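/- **Setting.** Fix integers $q,r\ge 1$ and write $[n]=\{1,\dots,n\}$. On the semi-infinite wedge space let $\alpha_m=\sum_{k\in\mathbb Z+1/2}\psi_{k-m}\psi_k^*$ ($m\neq 0$) and $\mathcal F_{r+1}=\sum_{k\in\mathbb Z+1/2}k^{r+1}{:}\psi_k\psi_k^*{:}$, and let $\langle\cdot\rangle$ be the vacuum expectation value. For positive integers $\mu_1,\dots,\mu_n$ with sum $|\mu|$ and $b\in\mathbb Z_{\ge0}$ put $$h^{\bullet}_{b}(\mu)=\Big\langle \frac{\alpha_q^{|\mu|/q}}{q^{|\mu|/q}(|\mu|/q)!}\,\frac{\mathcal F_{r+1}^b}{(r+1)^b}\prod_{i=1}^n\frac{\alpha_{-\mu_i}}{\mu_i}\Big\rangle$$ ($0$ if $q\nmid|\mu|$). The connected numbers $h^\circ_b(\mu)$ are defined by inclusion–exclusion: for every such $\mu$ with $n\ge1$, $$\sum_b h^\bullet_b(\mu)\frac{\beta^b}{b!}=\sum_{P}\prod_{B\in P}\Big(\sum_b h^\circ_b(\mu_B)\frac{\beta^b}{b!}\Big),$$ where $P$ runs over the set partitions of $[n]$ and $\mu_B=(\mu_i)_{i\in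 B}$. For $g\ge0$, $n\ge1$ the correlator is the formal power series $$H_{g,n}(x_1,\dots,x_n)=\sum_{\mu_1,\dots,\mu_n\ge1}\frac{h^\circ_b(\mu)}{b!}\,x_1^{\mu_1}\cdots x_n^{\mu_n},\qquad b=\frac{(2g-2+n)q+|\mu|}{qr},$$ the sum being over those $\mu$ for which $b$ is a nonnegative integer. Let $D_x=x\,\partial_x$, $\zeta(z)=e^{z/2}-e^{-z/2}$, $B_{g,n}=\frac1r\big(2g-2+n+\frac1q\sum_{i=1}^nD_{x_i}\big)$, and let the operators $Q^{(k)}_{d,\emptyset,m}$ be given by $$\sum_{d\ge0}Q^{(k)}_{d,\emptyset,m}z^{2d}=\frac{z}{\zeta(z)}\,\frac{\zeta(zD_{x_k})}{zD_{x_k}}\circ\Big|_{\xi_1=\dots=\xi_m=x_k}\circ\prod_{j=1}^m\frac{\zeta(zD_{\xi_j})}{z}.$$ **Modified correlators.** Put $\tilde H_{0,1}=H_{0,1}$ and $$\tilde H_{0,2}(x_1,x_2)=H_{0,2}(x_1,x_2)+\ln\Big(\frac{x_1-x_2}{x_1x_2}\Big),$$ except that a factor $\tilde H_{0,2}(\xi_a,\xi_b)$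 in two of the variables $\xi$ below is replaced by $H_{0,2}(\xi_a,\xi_b)$. The modified correlators are formal power series $\tilde H_{g,n}(x_1,\dots,x_n)$, for $g\ge0$, $n\ge1$, $2g-2+n>0$, satisfying for all such $(g,n)$ the resummed cut-and-join equation $$\frac{B_{g,n}}{r!}\tilde H_{g,n}(x_{[n]})=\sum_{\substack{m\ge1,\,d\ge0\\ m+2d=r+1}}\frac1{m!}\sum_{\substack{\ell\ge1\\ \{k\}\sqcup\bigsqcup_{j=1}^{\ell}K_j=[n]\\ \bigsqcup_{j=1}^{\ell}M_j=[m],\ M_j\ne\emptyset}}\frac1{\ell!}\sum_{\substack{g_1,\dots,g_\ell\ge0\\ g=\sum_jg_j+m-\ell+d}}Q^{(k)}_{d,\emptyset,m}\Big[\prod_{j=1}^{\ell}\tilde H_{g_j,|K_j|+|M_j|}(x_{K_j},\xi_{M_j})\Big],$$ an identity in the field of fractions of $\mathbb C[[x_1,\dots,x_n]]$; the sum is over ordered sequences $(K_j)$, $(M_j)$ of pairwise disjoint sets, where the $K_j$ may be empty. **Proposition.** Such a family $(\tilde H_{g,n})$ exists, and it is unique. For all $g\ge0$, $n\ge1$ with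 $2g-2+n>0$: * if $2g-2+n\ne r$, or if $n=1$, then $\tilde H_{g,n}=H_{g,n}$; * if $2g-2+n=r$ and $n\ge2$, then $$\tilde H_{g,n}=H_{g,n}+(-1)^{n+1}\,r!\,\frac{(2^{1-2g}-1)\,B_{2g}}{(2g)!},$$ where $B_{2g}$ is the Bernoulli number ($B_0=1$, $B_2=\tfrac16$, …). -/

import Mathlib

namespace SpinHurwitz

noncomputable section

/-! ### The semi-infinite wedge space (charge zero and all other charges)

A basis vector `v_S = s₁ ∧ s₂ ∧ …` of the semi-infinite wedge is given by a set
`S = {s₁ > s₂ > …}` of half-integers that differs from the set of negative half-integers by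
finitely many elements.  The half-integer `j + 1/2` is written as the integer `j`, and `S` is
recorded by the finite set `E ⊆ ℤ` of places where it differs from the vacuum `{j | j < 0}`. -/

/-- The place `j + 1/2` is occupied in the state with excitation set `E`. -/
def Occupied (E : Finset ℤ) (j : ℤ) : Prop := Xor (j ∈ E) (j < 0)

instance (E : Finset ℤ) (j : ℤ) : Decidable (Occupied E j) :=
  inferInstanceAs (Decidable (Xor (j ∈ E) (j < 0)))

/-- The semi-infinite wedge space, with basis vectors `v_S`. -/
abbrev Wedge : Type := Finset ℤ →₀ ℂ

/-- The occupied places `j` such that the place `j - m` is empty. -/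
def hops (m : ℤ) (E : Finset ℤ) : Finset ℤ :=
  (E ∪ E.image (· + m) ∪ Finset.Ico m 0).filter
    fun j => Occupied E j ∧ ¬ Occupied E (j - m)

theorem mem_hops (m : ℤ) (E : Finset ℤ) (j : ℤ) :
    j ∈ hops m E ↔ Occupied E j ∧ ¬ Occupied E (j - m) := by
  simp only [hops, Finset.mem_filter, Finset.mem_union, Finset.mem_image, Finset.mem_Ico,
    and_iff_right_iff_imp]
  rintro ⟨h1, h2⟩
  by_cases hj : j ∈ E
  · exact Or.inl (Or.inl hj)
  by_cases hm : j - m ∈ E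
  · exact Or.inl (Or.inr ⟨j - m, hm, by ring⟩)
  · right
    simp only [Occupied, Xor, hj, hm, false_and, false_or, not_false_eq_true,
      and_true] at h1 h2
    omega

/-- The operator `α_m = ∑_k ψ_{k-m} ψ_k^*` for `m ≠ 0`: one factor `k` of the wedge product is
replaced by `k - m`, and the factors are reordered decreasingly, with the sign of the number of
factors passed. -/
def alpha (m : ℤ) : Module.End ℂ Wedge :=
  Finsupp.linearCombination ℂ fun E => ∑ j ∈ hops m E,
    Finsupp.single (symmDiff E {j, j - m})
      ((-1 : ℂ) ^ ((Finset.Ioo (min j (j - m)) (max j (j - m))).filter (Occupied E)).card)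

/-- The completed-cycle operator `𝓕_p = ∑_k k^p :ψ_k ψ_k^*:`, the sum being over half-integers;
normal ordering turns its eigenvalue on `v_S` into
`∑_{k ∈ S, k > 0} k^p - ∑_{k ∉ S, k < 0} k^p`. -/
def completedCycle (p : ℕ) : Module.End ℂ Wedge :=
  Finsupp.linearCombination ℂ fun E => Finsupp.single E
    (∑ j ∈ E, if 0 ≤ j then ((j : ℂ) + 1 / 2) ^ p else - ((j : ℂ) + 1 / 2) ^ p)

/-- The vacuum expectation value of an operator. -/
def vev (T : Module.End ℂ Wedge) : ℂ := T (Finsupp.single ∅ 1) ∅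

/-! ### Spin orbifold Hurwitz numbers -/

/-- The disconnected number with `b` completed `(r+1)`-cycles,
`⟨ α_q^{|μ|/q} / (q^{|μ|/q} (|μ|/q)!) · (𝓕_{r+1}/(r+1))^b · ∏ α_{-μ_i}/μ_i ⟩`,
which is zero if `q` does not divide `|μ|`. -/
def hDisconnected (q r : ℕ) (μ : List ℕ) (b : ℕ) : ℂ :=
  if q ∣ μ.sum then
    vev (((q : ℂ) ^ (μ.sum / q) * ((μ.sum / q).factorial : ℂ))⁻¹ •
      (alpha (q : ℤ) ^ (μ.sum / q) *
        (((r : ℂ) + 1)⁻¹ • completedCycle (r + 1)) ^ b *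
        (μ.map fun k : ℕ => (k : ℂ)⁻¹ • alpha (-(k : ℤ))).prod))
  else 0

/-- `∑_b h^•_b(μ_I) β^b / b!`, where `μ_I` is the tuple of the `μ_i` with `i ∈ I`. -/
def disconnectedSeries (q r : ℕ) {n : ℕ} (μ : Fin n → ℕ) (I : Finset (Fin n)) :
    PowerSeries ℂ :=
  PowerSeries.mk fun b => hDisconnected q r ((I.sort (· ≤ ·)).map μ) b / (b.factorial : ℂ)

/-- Inclusion-exclusion: the connected quantities `c` attached to disconnected quantities `A` are
determined by `A I = ∑_P ∏_{B ∈ P} c B`, the sum being over all set partitions `P` of `I ≠ ∅`;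
here the term of the partition with a single block is solved for. -/
def connected {ι : Type} [DecidableEq ι] {R : Type} [CommRing R] (A : Finset ι → R)
    (I : Finset ι) : R :=
  A I - ∑ P ∈ ((Finset.univ : Finset (Finpartition I)).filter
    fun P => 1 < P.parts.card).attach, ∏ B ∈ P.1.parts.attach, connected A B.1
termination_by I.card
decreasing_by
  have hP := (Finset.mem_filter.1 P.2).2
  obtain ⟨C, hC, hne⟩ := Finset.exists_mem_ne hP B.1
  have hBI : B.1 ⊆ I := P.1.le B.2
  have hCI : C ⊆ I := P.1.le hC
  refine Finset.card_lt_card (Finset.ssubset_iff_subset_ne.2 ⟨hBI, fun hEq => ?_⟩)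
  have hd : Disjoint C B.1 := P.1.disjoint hC B.2 hne
  have hbot : C = ⊥ := by
    have := hd.mono_right (hCI.trans hEq.ge)
    simpa using this
  exact P.1.bot_notMem (hbot ▸ hC)

/-- The correlator `H_{g,n} = ∑_{μ_1,…,μ_n ≥ 1} (h°_{g;μ} / b!) x_1^{μ_1} ⋯ x_n^{μ_n}`, where
`b = ((2g - 2 + n) q + |μ|) / (q r)`; there is no term if `b` is not a nonnegative integer. -/
def correlator (q r g n : ℕ) : MvPowerSeries (Fin n) ℂ := fun μ =>
  let N : ℤ := (2 * (g : ℤ) - 2 + n) * q + ∑ i, (μ i : ℤ)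
  if (∀ i, 1 ≤ μ i) ∧ 0 ≤ N ∧ ((q : ℤ) * r) ∣ N then
    PowerSeries.coeff (N / ((q : ℤ) * r)).toNat
      (connected (disconnectedSeries q r μ) Finset.univ)
  else 0

/-! ### Functions with denominators and their derivations -/

/-- The algebra map `f ↦ f + ε D f` that encodes a derivation, with values in the dual numbers
of a localization. -/
def dualHom {R : Type} [CommRing R] [Algebra ℂ R] (S : Submonoid R) (D : Derivation ℂ R R) :
    R →ₐ[ℂ] TrivSqZeroExt (Localization S) (Localization S) where
  toFun f := (algebraMap R (Localization S) f, algebraMap R (Localization S) (D f))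
  map_one' := by ext <;> simp
  map_zero' := by ext <;> simp
  map_mul' a b := by
    ext
    · exact map_mul (algebraMap R (Localization S)) a b
    · change algebraMap R (Localization S) (D (a * b)) =
        algebraMap R (Localization S) a • algebraMap R (Localization S) (D b) +
          MulOpposite.op (algebraMap R (Localization S) b) • algebraMap R (Localization S) (D a)
      simp [mul_comm]
  map_add' a b := by
    ext
    · change algebraMap R (Localization S) (a + b) = _ + _
      simp
    · change algebraMap R (Localization S) (D (a + b)) = _ + _
      simp
  commutes' c := by
    ext
    · change algebraMap R (Localization S) (algebraMap ℂ R c) = algebraMap ℂ (Localization S) c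
      exact (IsScalarTower.algebraMap_apply ℂ R (Localization S) c).symm
    · change algebraMap R (Localization S) (D (algebraMap ℂ R c)) = 0
      simp

theorem isUnit_dualHom {R : Type} [CommRing R] [Algebra ℂ R] (S : Submonoid R)
    (D : Derivation ℂ R R) (s : S) : IsUnit (dualHom S D s) :=
  TrivSqZeroExt.isUnit_iff_isUnit_fst.2 (IsLocalization.map_units (Localization S) s)

/-- The extension of `dualHom` to the localization. -/
def dualLift {R : Type} [CommRing R] [Algebra ℂ R] (S : Submonoid R) (D : Derivation ℂ R R) :
    Localization S →ₐ[ℂ] TrivSqZeroExt (Localization S) (Localization S) :=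
  IsLocalization.liftAlgHom (M := S) (f := dualHom S D) (isUnit_dualHom S D)

theorem fst_dualLift {R : Type} [CommRing R] [Algebra ℂ R] (S : Submonoid R)
    (D : Derivation ℂ R R) (F : Localization S) : (dualLift S D F).fst = F := by
  have h : ((TrivSqZeroExt.fstHom ℂ (Localization S) (Localization S)).comp
      (dualLift S D)).toRingHom = RingHom.id _ := by
    refine IsLocalization.ringHom_ext S ?_
    ext f
    change (dualLift S D (algebraMap R _ f)).fst = algebraMap R _ f
    rw [dualLift, IsLocalization.liftAlgHom_apply, IsLocalization.lift_eq]
    rfl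
  exact congrArg (fun φ : Localization S →+* Localization S => φ F) h

/-- The extension of a derivation to a localization (by the quotient rule). -/
def locDerivation {R : Type} [CommRing R] [Algebra ℂ R] (S : Submonoid R)
    (D : Derivation ℂ R R) : Derivation ℂ (Localization S) (Localization S) :=
  Derivation.mk' ((((TrivSqZeroExt.sndHom (Localization S) (Localization S)).restrictScalars ℂ)).comp (dualLift S D).toLinearMap)
    (by
      intro F G
      change (dualLift S D (F * G)).snd = F • (dualLift S D G).snd + G • (dualLift S D F).snd
      rw [map_mul, TrivSqZeroExt.snd_mul, fst_dualLift, fst_dualLift]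
      simp [mul_comm])

theorem locDerivation_algebraMap {R : Type} [CommRing R] [Algebra ℂ R] (S : Submonoid R)
    (D : Derivation ℂ R R) (f : R) :
    locDerivation S D (algebraMap R (Localization S) f) = algebraMap R (Localization S) (D f) := by
  change (dualLift S D (algebraMap R _ f)).snd = _
  rw [dualLift, IsLocalization.liftAlgHom_apply, IsLocalization.lift_eq]
  rfl

/-- The derivation `D_v = v ∂/∂v` of formal power series, for a variable `v`. -/
def euler {σ : Type} (v : σ) : Derivation ℂ (MvPowerSeries σ ℂ) (MvPowerSeries σ ℂ) :=
  (MvPowerSeries.X v : MvPowerSeries σ ℂ) • MvPowerSeries.pderiv ℂ v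

/-- The field of fractions of `ℂ⟦x_1,…,x_n⟧`. -/
abbrev Frac (n : ℕ) : Type := FractionRing (MvPowerSeries (Fin n) ℂ)

/-- `D_{x_i}` on fractions of power series. -/
def eulerFrac {n : ℕ} (i : Fin n) : Derivation ℂ (Frac n) (Frac n) :=
  locDerivation (nonZeroDivisors (MvPowerSeries (Fin n) ℂ)) (euler i)

/-- Power series in the variables `x_1,…,x_n` (`Sum.inl`) and `ξ_1,…,ξ_m` (`Sum.inr`). -/
abbrev Series (n m : ℕ) : Type := MvPowerSeries (Fin n ⊕ Fin m) ℂ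

/-- The specialization `ξ_1 = ⋯ = ξ_m = x_k` of power series. -/
def diag {n m : ℕ} (k : Fin n) : Series n m →ₐ[ℂ] MvPowerSeries (Fin n) ℂ :=
  MvPowerSeries.rename (Sum.elim id fun _ => k)

/-- The power series that do not vanish identically on `ξ_1 = ⋯ = ξ_m = x_k`. -/
def denominators (n m : ℕ) (k : Fin n) : Submonoid (Series n m) :=
  (nonZeroDivisors (MvPowerSeries (Fin n) ℂ)).comap (diag (m := m) k)

/-- The ring of fractions of power series in `x_1,…,x_n,ξ_1,…,ξ_m` whose denominator does not
vanish identically on `ξ_1 = ⋯ = ξ_m = x_k`. -/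
abbrev Reg (n m : ℕ) (k : Fin n) : Type := Localization (denominators n m k)

/-- The specialization `F ↦ F|_{ξ_1 = ⋯ = ξ_m = x_k}`. -/
def specialize {n m : ℕ} (k : Fin n) : Reg n m k →+* Frac n :=
  IsLocalization.map (M := denominators n m k)
    (T := nonZeroDivisors (MvPowerSeries (Fin n) ℂ)) (Frac n)
    ((diag (m := m) k).toRingHom) (le_refl _)

/-- `D_{ξ_a}` on fractions of power series. -/
def eulerReg {n m : ℕ} (k : Fin n) (a : Fin m) : Derivation ℂ (Reg n m k) (Reg n m k) :=
  locDerivation (denominators n m k) (euler (Sum.inr a))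

/-- The variable `x_i` as an element of `Reg n m k`. -/
def xVar {n m : ℕ} (k i : Fin n) : Reg n m k :=
  algebraMap (Series n m) (Reg n m k) (MvPowerSeries.X (Sum.inl i))

/-- The variable `ξ_a` as an element of `Reg n m k`. -/
def xiVar {n m : ℕ} (k : Fin n) (a : Fin m) : Reg n m k :=
  algebraMap (Series n m) (Reg n m k) (MvPowerSeries.X (Sum.inr a))

/-- A formal expression `reg + ln arg`, with `arg` invertible. -/
structure LogFun (A : Type) where
  /-- the part without logarithm -/
  reg : A
  /-- the argument of the logarithm -/
  arg : A

/-- `D (reg + ln arg) = D reg + (D arg) / arg`. -/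
def LogFun.deriv {A : Type} [CommRing A] [Algebra ℂ A] (D : Derivation ℂ A A)
    (F : LogFun A) : A :=
  D F.reg + D F.arg * Ring.inverse F.arg

/-- The mixed derivative `(∏_{a ∈ M} D_{ξ_a}) F`, for `M ≠ ∅`. -/
def LogFun.mixedDeriv {n m : ℕ} (k : Fin n) (M : Finset (Fin m))
    (F : LogFun (Reg n m k)) : Reg n m k :=
  match M.sort (· ≤ ·) with
  | [] => F.reg
  | a :: l => l.foldr (fun b G => eulerReg k b G) (F.deriv (eulerReg k a))

/-! ### The operators `Q` -/

/-- `ζ(z) = e^{z/2} - e^{-z/2}`. -/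
def zeta : PowerSeries ℂ :=
  PowerSeries.rescale (1 / 2 : ℂ) (PowerSeries.exp ℂ) -
    PowerSeries.rescale (-1 / 2 : ℂ) (PowerSeries.exp ℂ)

/-- `ζ(z)/z`. -/
def zetaDivZ : PowerSeries ℂ := PowerSeries.mk fun i => PowerSeries.coeff (i + 1) zeta

/-- The operator `ζ(zD)/(zD)`, acting on power series in `z` with coefficients in `A`. -/
def zetaOp {A : Type} [CommRing A] [Algebra ℂ A] (D : Derivation ℂ A A)
    (F : PowerSeries A) : PowerSeries A :=
  PowerSeries.mk fun N => ∑ p ∈ Finset.HasAntidiagonal.antidiagonal N,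
    PowerSeries.coeff p.1 zetaDivZ • (D^[p.1]) (PowerSeries.coeff p.2 F)

/-- The operator `Q_{d;∅,m}^{(k)}`, given by
`∑_d Q_{d;∅,m}^{(k)} z^{2d}
  = z/ζ(z) · ζ(zD_{x_k})/(zD_{x_k}) ∘ |_{ξ_j = x_k} ∘ ∏_{j=1}^m ζ(zD_{ξ_j})/z`.
Writing `ζ(zD_{ξ_j})/z = ζ(zD_{ξ_j})/(zD_{ξ_j}) ∘ D_{ξ_j}`, the operator depends on the function
`F` that it is applied to through `G = D_{ξ_1} ⋯ D_{ξ_m} F` only, and `G` is the argument here. -/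
def Qop {n m : ℕ} (d : ℕ) (k : Fin n) (G : Reg n m k) : Frac n :=
  PowerSeries.coeff (2 * d)
    (PowerSeries.map (algebraMap ℂ (Frac n)) zetaDivZ⁻¹ *
      zetaOp (eulerFrac k)
        (PowerSeries.map (specialize k)
          ((List.finRange m).foldr (fun j F => zetaOp (eulerReg k j) F) (PowerSeries.C G))))

/-! ### The resummed cut-and-join equation -/

/-- The correlators without the logarithm of `H̃_{0,2}`: the given `Ht g n` if `2g - 2 + n > 0`,
and `H_{g,n}` otherwise. -/
def regularPart (q r : ℕ) (Ht : ℕ → (n : ℕ) → MvPowerSeries (Fin n) ℂ) (g n : ℕ) :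
    MvPowerSeries (Fin n) ℂ :=
  if 2 < 2 * g + n then Ht g n else correlator q r g n

/-- The factor `H̃_{g,|K|+|M|}(x_K, ξ_M)`.  If `g = 0`, `K = {i}` and `M = {a}`, it is
`H_{0,2}(x_i, ξ_a) + ln ((ξ_a - x_i)/(ξ_a x_i))`; the factor `H̃_{0,2}(ξ_a, ξ_b)` is, by
convention, `H_{0,2}(ξ_a, ξ_b)`. -/
def factor (q r : ℕ) (Ht : ℕ → (n : ℕ) → MvPowerSeries (Fin n) ℂ) {n m : ℕ} (k : Fin n)
    (g : ℕ) (K : Finset (Fin n)) (M : Finset (Fin m)) : LogFun (Reg n m k) where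
  reg := algebraMap (Series n m) (Reg n m k)
    (MvPowerSeries.rename
      (Fin.append (fun i => Sum.inl (K.orderEmbOfFin rfl i))
        (fun a => Sum.inr (M.orderEmbOfFin rfl a)))
      (regularPart q r Ht g (K.card + M.card)))
  arg := if g = 0 ∧ K.card = 1 ∧ M.card = 1 then
      ∏ i ∈ K, ∏ a ∈ M, (xiVar k a - xVar k i) * Ring.inverse (xiVar k a * xVar k i)
    else 1

open Classical in
/-- The sequences `(K_1,…,K_l)` of pairwise disjoint, possibly empty sets with union `s`. -/
def splittings {α : Type} [Fintype α] (s : Finset α) (l : ℕ) : Finset (Fin l → Finset α) :=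
  Finset.univ.filter fun K =>
    (∀ i j, i ≠ j → Disjoint (K i) (K j)) ∧ Finset.univ.biUnion K = s

open Classical in
/-- The right-hand side of the resummed cut-and-join equation.  Every `ξ_a` occurs in exactly one
factor of the product, so that the mixed derivative of the product by all the `ξ_a` is the product
of the mixed derivatives.  The conditions `M_j ≠ ∅` force `l ≤ m`, and
`g = ∑ g_j + m - l + d` then forces `g_j ≤ g`. -/
def resummedRHS (q r : ℕ) (Ht : ℕ → (n : ℕ) → MvPowerSeries (Fin n) ℂ) (g n : ℕ) : Frac n :=
  ∑ p ∈ (Finset.range (r + 2) ×ˢ Finset.range (r + 2)).filter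
      (fun p => 1 ≤ p.1 ∧ p.1 + 2 * p.2 = r + 1),
    ((p.1.factorial : ℂ)⁻¹) • ∑ k : Fin n, ∑ l ∈ Finset.range (p.1 + 1),
      ((l.factorial : ℂ)⁻¹) • ∑ K ∈ splittings (Finset.univ.erase k) l,
        ∑ M ∈ (splittings (Finset.univ : Finset (Fin p.1)) l).filter
            (fun M => ∀ j, (M j).Nonempty),
          ∑ γ ∈ (Finset.univ : Finset (Fin l → Fin (g + 1))).filter
              (fun γ => (∑ j, (γ j : ℕ)) + p.1 + p.2 = g + l),
            Qop p.2 k (∏ j, (factor q r Ht k (γ j) (K j) (M j)).mixedDeriv k (M j))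

/-- The operator `B_{g,n} = (1/r) (2g - 2 + n + (1/q) ∑_i D_{x_i})`. -/
def Bop (q r g n : ℕ) (f : MvPowerSeries (Fin n) ℂ) : MvPowerSeries (Fin n) ℂ :=
  (1 / (r : ℂ)) • ((2 * (g : ℂ) - 2 + n) • f + (1 / (q : ℂ)) • ∑ i, euler i f)

/-- The power series `Ht g n`, for `n ≥ 1` and `2g - 2 + n > 0`, satisfy the recursion that
defines the modified correlators `H̃_{g,n}`. -/
def IsModified (q r : ℕ) (Ht : ℕ → (n : ℕ) → MvPowerSeries (Fin n) ℂ) : Prop :=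
  ∀ g n : ℕ, 1 ≤ n → 2 < 2 * g + n →
    algebraMap (MvPowerSeries (Fin n) ℂ) (Frac n)
        ((1 / (r.factorial : ℂ)) • Bop q r g n (Ht g n)) =
      resummedRHS q r Ht g n

end

end SpinHurwitz

namespace SpinHurwitz

noncomputable section

open Finset.HasAntidiagonal (antidiagonal)
open PowerSeries (derivative)

/-! ### Fermions -/

section Fermions
variable {R : Type} [CommRing R]

/-! Write S(z) = ζ(z)/z. The argument compares two recursions: a cut-and-join equation for the
Hurwitz numbers, obtained in the wedge space, and the resummed equation evaluated on the
correlators. They differ by one constant, and that constant is the correction.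

Cut-and-join. Let E_{-a}(z) = ∑_k e^{z(k+a/2)} :ψ_{k+a} ψ_k^*:. The completed cycle is (r+1)! times
the coefficient of z^{r+1} in E_0(z). Moving E_0(z) to the right past the α_{-μ_i}/μ_i absorbs a
nonempty set I of parts and leaves E_{-M}(z) v_∅ with M = ∑_{i∈I} μ_i (`vertexOp_raise`,
`vertexOp_stateOn`). By the boson-fermion correspondence, ζ(z) E_{-M}(z) v_∅ is the coefficient of
w^M in exp(∑_k ζ(kz) α_{-k} w^k/k) v_∅; this is established as a recursion on particle-hole states
(`vertexOp_vacuum_recursion`). The result is `disconnectedNumber_cutAndJoin`. The connected numbers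
are a logarithm in a convolution ring of functions of multisets, and cancelling the disconnected
series gives `derivative_connectedFun`. A homogeneity argument determines which b can occur and
sorts the equation by genus (`coeff_genusJoin`).

The resummed side. The operators ζ(zD)/(zD) are diagonal on monomials and produce the same weights
S(ν_i z). The logarithm in the two-point function has D_ξ-derivative x_i/(ξ - x_i). After ξ = x_k a
term carries a product of x_i/(x_k - x_i) over a set T of indices; the terms are collected by I = T
∪ {k}. For a ≥ 1 the sum over k ∈ I of x_k^a ∏_{i ∈ I∖k} x_i/(x_k - x_i) is the sum of all monomials
of degree a in the x_i, i ∈ I, with every exponent positive (`sum_blockSeries_polar`). So the poles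
cancel, and I becomes the set of joined parts of the cut-and-join equation (`sum_mainTerm`).

The correction. The exponent a = 0 occurs only when all factors are logarithms, that is for I = [n],
m = n - 1, d = g. Then the sum over k is (-1)^{n-1} (`sum_prod_polar`). Since m ≥ 1 and m + 2d = r +
1, this happens exactly for n ≥ 2 and 2g - 2 + n = r, and the equation for H_{g,n} fails by
(-1)^{n-1} times the coefficient of z^{2g} in z/ζ(z). On constants B_{g,n} is then the identity, so
adding r! times the defect to H_{g,n} repairs the left-hand side. The right-hand side does not
notice, because every factor is differentiated in some ξ (`resummedRHS_congr`). This proves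
existence; `coeff_zetaDivZ_inv` brings in the Bernoulli numbers.

Uniqueness. The right-hand side for (g,n) involves correlators with smaller 2g + n, except for terms
in which one factor has the same 2g + n and all others are derivatives of H_{0,1}, which vanish at
the origin (`splitting_dichotomy`). Such terms raise the total degree, while B_{g,n} multiplies each
monomial by a nonzero number. Induction on 2g + n and then on the degree concludes
(`IsModified.unique`). -/

theorem occupied_symmDiff_singleton (E : Finset ℤ) (i j : ℤ) :
    Occupied (symmDiff E {j}) i ↔ Xor (i = j) (Occupied E i) := by
  simp only [Occupied, Xor, Finset.mem_symmDiff, Finset.mem_singleton]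
  tauto

/-- The sign of the number of occupied places above `i`. -/
def wedgeSign (R : Type) [CommRing R] (E : Finset ℤ) (i : ℤ) : R :=
  (-1) ^ ((E.filter (i < ·)).card + (Finset.Ioo i 0).card)

theorem wedgeSign_symmDiff (E : Finset ℤ) (i j : ℤ) :
    wedgeSign R (symmDiff E {j}) i = (if i < j then -1 else 1) * wedgeSign R E i := by
  have hf : (symmDiff E {j}).filter (i < ·) =
      if i < j then symmDiff (E.filter (i < ·)) {j} else E.filter (i < ·) := by
    split_ifs with h
    · ext k; simp only [Finset.mem_filter, Finset.mem_symmDiff, Finset.mem_singleton]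
      constructor
      · tauto
      · rintro (⟨⟨h1, h2⟩, h3⟩ | ⟨h1, h2⟩)
        · tauto
        · subst h1; tauto
    · ext k; simp only [Finset.mem_filter, Finset.mem_symmDiff, Finset.mem_singleton]
      constructor
      · rintro ⟨⟨h1, h2⟩ | ⟨h1, h2⟩, h3⟩
        · exact ⟨h1, h3⟩
        · subst h1; exact absurd h3 h
      · rintro ⟨h1, h2⟩
        exact ⟨Or.inl ⟨h1, fun h3 => h (h3 ▸ h2)⟩, h2⟩
  unfold wedgeSign
  rw [hf]
  split_ifs with h
  · by_cases hj : j ∈ E.filter (i < ·)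
    · have : symmDiff (E.filter (i < ·)) {j} = (E.filter (i < ·)).erase j := by
        ext k; simp only [Finset.mem_symmDiff, Finset.mem_singleton, Finset.mem_erase]
        constructor
        · rintro (h1 | ⟨h1, h2⟩)
          · tauto
          · subst h1; tauto
        · tauto
      rw [this, ← Finset.card_erase_add_one hj]
      ring
    · have : symmDiff (E.filter (i < ·)) {j} = insert j (E.filter (i < ·)) := by
        ext k; simp only [Finset.mem_symmDiff, Finset.mem_singleton, Finset.mem_insert]
        constructor
        · tauto
        · rintro (h1 | h1)
          · subst h1; tauto
          · exact Or.inl ⟨h1, fun h2 => hj (h2 ▸ h1)⟩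
      rw [this, Finset.card_insert_of_notMem hj]
      ring
  · ring

/-- The operator `ψ_i`. -/
def create (R : Type) [CommRing R] (i : ℤ) : Module.End R (Finset ℤ →₀ R) :=
  Finsupp.linearCombination R fun E =>
    if Occupied E i then 0 else Finsupp.single (symmDiff E {i}) (wedgeSign R E i)

/-- The operator `ψ_i^*`. -/
def annihilate (R : Type) [CommRing R] (i : ℤ) : Module.End R (Finset ℤ →₀ R) :=
  Finsupp.linearCombination R fun E =>
    if Occupied E i then Finsupp.single (symmDiff E {i}) (wedgeSign R E i) else 0

theorem create_single (i : ℤ) (E : Finset ℤ) (c : R) :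
    create R i (Finsupp.single E c) =
      if Occupied E i then 0 else Finsupp.single (symmDiff E {i}) (c * wedgeSign R E i) := by
  rw [create, Finsupp.linearCombination_single]; split_ifs <;> simp

theorem annihilate_single (i : ℤ) (E : Finset ℤ) (c : R) :
    annihilate R i (Finsupp.single E c) =
      if Occupied E i then Finsupp.single (symmDiff E {i}) (c * wedgeSign R E i) else 0 := by
  rw [annihilate, Finsupp.linearCombination_single]; split_ifs <;> simp

theorem symmDiff_symmDiff_comm (E : Finset ℤ) (i j : ℤ) :
    symmDiff (symmDiff E {i}) {j} = symmDiff (symmDiff E {j}) {i} := by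
  rw [symmDiff_assoc, symmDiff_comm ({i} : Finset ℤ) {j}, ← symmDiff_assoc]

/-- Flipping the larger of the two places changes the sign at the smaller one, and not conversely.
This asymmetry is the source of all the anticommutation relations below. -/
theorem wedgeSign_mul_anticomm (E : Finset ℤ) {i j : ℤ} (h : i ≠ j) :
    wedgeSign R E i * wedgeSign R (symmDiff E {i}) j =
      -(wedgeSign R E j * wedgeSign R (symmDiff E {j}) i) := by
  rw [wedgeSign_symmDiff, wedgeSign_symmDiff]
  rcases lt_or_gt_of_ne h with h | h
  · simp [h, h.not_gt]; ring
  · simp [h, h.not_gt]; ring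

theorem wedgeSign_mul_self (E : Finset ℤ) (i : ℤ) :
    wedgeSign R E i * wedgeSign R (symmDiff E {i}) i = 1 := by
  rw [wedgeSign_symmDiff]
  simp [wedgeSign, ← pow_add, ← two_mul]

theorem create_create (i j : ℤ) (v : Finset ℤ →₀ R) :
    create R i (create R j v) = -create R j (create R i v) := by
  induction v using Finsupp.induction_linear with
  | zero => simp
  | add f g hf hg => simp only [map_add, hf, hg, neg_add]
  | single E c =>
    by_cases hij : i = j
    · subst hij
      simp only [create_single]
      split_ifs with h
      · simp
      · rw [create_single, if_pos]
        · simp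
        · rw [occupied_symmDiff_singleton]; simp [Xor, h]
    · have hji : ¬ j = i := fun h => hij h.symm
      simp only [create_single]
      by_cases h1 : Occupied E i <;> by_cases h2 : Occupied E j <;>
        simp [h1, h2, create_single, occupied_symmDiff_singleton, Xor, hij, hji, -Finsupp.single_mul]
      rw [symmDiff_symmDiff_comm, ← Finsupp.single_neg, mul_assoc, mul_assoc,
        wedgeSign_mul_anticomm E hji, mul_neg]

theorem annihilate_annihilate (i j : ℤ) (v : Finset ℤ →₀ R) :
    annihilate R i (annihilate R j v) = -annihilate R j (annihilate R i v) := by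
  induction v using Finsupp.induction_linear with
  | zero => simp
  | add f g hf hg => simp only [map_add, hf, hg, neg_add]
  | single E c =>
    by_cases hij : i = j
    · subst hij
      simp only [annihilate_single]
      split_ifs with h
      · rw [annihilate_single, if_neg]
        · simp
        · rw [occupied_symmDiff_singleton]; simp [Xor, h]
      · simp
    · have hji : ¬ j = i := fun h => hij h.symm
      simp only [annihilate_single]
      by_cases h1 : Occupied E i <;> by_cases h2 : Occupied E j <;>
        simp [h1, h2, annihilate_single, occupied_symmDiff_singleton, Xor, hij, hji, -Finsupp.single_mul]
      rw [symmDiff_symmDiff_comm, ← Finsupp.single_neg, mul_assoc, mul_assoc,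
        wedgeSign_mul_anticomm E hji, mul_neg]

theorem annihilate_create (i j : ℤ) (v : Finset ℤ →₀ R) :
    annihilate R i (create R j v) = (if i = j then v else 0) - create R j (annihilate R i v) := by
  induction v using Finsupp.induction_linear with
  | zero => simp
  | add f g hf hg => simp only [map_add, hf, hg]; split_ifs <;> abel
  | single E c =>
    by_cases hij : i = j
    · subst hij
      have hs : symmDiff (symmDiff E {i}) {i} = E := by rw [symmDiff_assoc]; simp
      simp only [create_single, annihilate_single]
      by_cases h : Occupied E i <;>
        simp [h, create_single, annihilate_single, occupied_symmDiff_singleton, Xor, hs,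
          mul_assoc, wedgeSign_mul_self, -Finsupp.single_mul]
    · have hji : ¬ j = i := fun h => hij h.symm
      simp only [annihilate_single, create_single]
      by_cases h1 : Occupied E i <;> by_cases h2 : Occupied E j <;>
        simp [h1, h2, annihilate_single, create_single, occupied_symmDiff_singleton, Xor, hij, hji, -Finsupp.single_mul]
      rw [symmDiff_symmDiff_comm, ← Finsupp.single_neg, mul_assoc, mul_assoc,
        wedgeSign_mul_anticomm E hji, mul_neg]

/-- The operator `ψ_i ψ_j^*`. -/
def hop (R : Type) [CommRing R] (i j : ℤ) : Module.End R (Finset ℤ →₀ R) :=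
  create R i * annihilate R j

theorem hop_apply (i j : ℤ) (v : Finset ℤ →₀ R) :
    hop R i j v = create R i (annihilate R j v) := rfl

/-- The commutator of two matrix units. No central term appears because the products are not
normally ordered; the cocycle can only come from infinite sums of these identities. -/
theorem hop_hop (a b c d : ℤ) (v : Finset ℤ →₀ R) :
    hop R a b (hop R c d v) = hop R c d (hop R a b v) +
      (if b = c then hop R a d v else 0) - (if d = a then hop R c b v else 0) := by
  simp only [hop_apply]
  rw [annihilate_create b c, annihilate_create d a, map_sub, map_sub, create_create a c,
    annihilate_annihilate b d]
  by_cases h1 : b = c <;> by_cases h2 : d = a <;> simp [h1, h2] <;> abel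

theorem wedgeSign_mul_eq (E : Finset ℤ) {i j : ℤ} (hij : i ≠ j) (hj : Occupied E j)
    (hi : ¬ Occupied E i) :
    wedgeSign R E j * wedgeSign R (symmDiff E {j}) i =
      (-1) ^ ((Finset.Ioo (min j i) (max j i)).filter (Occupied E)).card := by
  -- The places above the larger of the two are counted twice and cancel, so the product of the
  -- signs counts the occupied places in the interval from `a` to `b`, with `b` included.
  have key : ∀ a b : ℤ, a < b → wedgeSign R E a * wedgeSign R E b =
      (-1) ^ ((Finset.Ioo a b).filter (Occupied E)).card * (if Occupied E b then -1 else 1) := by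
    intro a b hab
    have h1 : (E.filter (a < ·)).card = ((Finset.Ioc a b).filter (· ∈ E)).card +
        (E.filter (b < ·)).card := by
      rw [← Finset.card_union_of_disjoint]
      · congr 1; ext k
        simp only [Finset.mem_filter, Finset.mem_union, Finset.mem_Ioc]
        constructor
        · rintro ⟨h, h'⟩
          by_cases hk : k ≤ b
          · exact Or.inl ⟨⟨h', hk⟩, h⟩
          · exact Or.inr ⟨h, by omega⟩
        · rintro (⟨⟨h, h'⟩, h''⟩ | ⟨h, h'⟩)
          · exact ⟨h'', h⟩
          · exact ⟨h, by omega⟩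
      · rw [Finset.disjoint_left]; intro k
        simp only [Finset.mem_filter, Finset.mem_Ioc]; omega
    have h2 : (Finset.Ioo a 0).card = ((Finset.Ioc a b).filter (· < 0)).card +
        (Finset.Ioo b 0).card := by
      rw [← Finset.card_union_of_disjoint]
      · congr 1; ext k
        simp only [Finset.mem_filter, Finset.mem_union, Finset.mem_Ioc, Finset.mem_Ioo]
        omega
      · rw [Finset.disjoint_left]; intro k
        simp only [Finset.mem_filter, Finset.mem_Ioc, Finset.mem_Ioo]; omega
    have hprod : ∀ p : ℤ → Prop, ∀ _ : DecidablePred p, ∀ s : Finset ℤ,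
        (-1 : R) ^ (s.filter p).card = ∏ k ∈ s, if p k then -1 else 1 := by
      intro p _ s
      rw [Finset.prod_ite]; simp
    have h3 : (-1 : R) ^ ((Finset.Ioc a b).filter (· ∈ E)).card *
        (-1) ^ ((Finset.Ioc a b).filter (· < 0)).card =
        (-1) ^ ((Finset.Ioc a b).filter (Occupied E)).card := by
      rw [hprod, hprod, hprod, ← Finset.prod_mul_distrib]
      refine Finset.prod_congr rfl fun k _ => ?_
      by_cases hk : k ∈ E <;> by_cases hk' : k < 0 <;> simp [Occupied, Xor, hk, hk']
    have h4 : (-1 : R) ^ ((Finset.Ioc a b).filter (Occupied E)).card =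
        (-1) ^ ((Finset.Ioo a b).filter (Occupied E)).card *
          (if Occupied E b then -1 else 1) := by
      rw [hprod, hprod, ← Finset.Ioo_insert_right hab, Finset.prod_insert (by simp), mul_comm]
    rw [← h4, ← h3, wedgeSign, wedgeSign, h1, h2]
    have e : ∀ n : ℕ, (-1 : R) ^ n * (-1) ^ n = 1 := fun n => by
      rw [← pow_add, ← two_mul, pow_mul]; simp
    have e1 := e (E.filter (b < ·)).card
    have e2 := e (Finset.Ioo b 0).card
    simp only [pow_add]
    linear_combination (((-1 : R) ^ ((Finset.Ioc a b).filter (· ∈ E)).card *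
        (-1) ^ ((Finset.Ioc a b).filter (· < 0)).card)) *
        ((-1 : R) ^ (Finset.Ioo b 0).card * (-1) ^ (Finset.Ioo b 0).card * e1 + e2)
  rw [wedgeSign_symmDiff]
  rcases lt_or_gt_of_ne hij with h | h
  · rw [min_eq_right h.le, max_eq_left h.le, if_pos h]
    have := key i j h
    rw [if_pos hj] at this
    linear_combination -this
  · rw [min_eq_left h.le, max_eq_right h.le, if_neg h.not_gt]
    have := key j i h
    rw [if_neg hi] at this
    linear_combination this

end Fermions

/-! ### One-body operators -/

section OneBody
variable {R : Type} [CommRing R]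

/-- The operator `∑_j f(j) ψ_{j-m} ψ_j^*`, for `m ≠ 0`. -/
def oneBody (m : ℤ) (f : ℤ → R) : Module.End R (Finset ℤ →₀ R) :=
  Finsupp.linearCombination R fun E => ∑ j ∈ hops m E,
    Finsupp.single (symmDiff E {j, j - m})
      (f j * (-1) ^ ((Finset.Ioo (min j (j - m)) (max j (j - m))).filter (Occupied E)).card)

theorem alpha_eq_oneBody (m : ℤ) : alpha m = oneBody m (fun _ => (1 : ℂ)) := by
  simp [alpha, oneBody]

theorem hop_single {m : ℤ} (hm : m ≠ 0) (j : ℤ) (E : Finset ℤ) (c : R) :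
    hop R (j - m) j (Finsupp.single E c) = if j ∈ hops m E then
      Finsupp.single (symmDiff E {j, j - m})
        (c * (-1) ^ ((Finset.Ioo (min j (j - m)) (max j (j - m))).filter (Occupied E)).card)
      else 0 := by
  have hne : j - m ≠ j := by omega
  rw [hop_apply, annihilate_single]
  by_cases hj : Occupied E j
  · rw [if_pos hj, create_single]
    have ho := occupied_symmDiff_singleton E (j - m) j
    by_cases hi : Occupied E (j - m)
    · rw [if_pos (by rw [ho]; simp [Xor, hne, hi]), if_neg (by simp [mem_hops, hi])]
    · rw [if_neg (by rw [ho]; simp [Xor, hne, hi]), if_pos ((mem_hops _ _ _).2 ⟨hj, hi⟩), mul_assoc,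
        wedgeSign_mul_eq E hne hj hi]
      congr 1
      rw [symmDiff_assoc]
      congr 1
      ext k
      simp only [Finset.mem_symmDiff, Finset.mem_singleton, Finset.mem_insert]
      constructor
      · tauto
      · rintro (h | h)
        · exact Or.inl ⟨h, fun h' => hne (h'.symm.trans h)⟩
        · exact Or.inr ⟨h, fun h' => hne (h.symm.trans h')⟩
  · simp [mem_hops, hj]

theorem oneBody_single {m : ℤ} (hm : m ≠ 0) (f : ℤ → R) (E : Finset ℤ) (c : R) (s : Finset ℤ)
    (hs : hops m E ⊆ s) :
    oneBody m f (Finsupp.single E c) =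
      ∑ j ∈ s, f j • hop R (j - m) j (Finsupp.single E c) := by
  simp only [hop_single hm, smul_ite, smul_zero]
  rw [← Finset.sum_filter, Finset.filter_mem_eq_inter, Finset.inter_eq_right.2 hs, oneBody,
    Finsupp.linearCombination_single, Finset.smul_sum]
  refine Finset.sum_congr rfl fun j _ => ?_
  rw [Finsupp.smul_single, Finsupp.smul_single, smul_eq_mul, smul_eq_mul]
  congr 1; ring

/-- On a fixed vector only finitely many hops act nontrivially. The form "for every finite set
containing `s₀`" allows several infinite sums to be compared over one common index set. -/
theorem exists_oneBody_eq_sum {m : ℤ} (hm : m ≠ 0) (f : ℤ → R) (v : Finset ℤ →₀ R) :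
    ∃ s₀ : Finset ℤ, ∀ s, s₀ ⊆ s → oneBody m f v = ∑ j ∈ s, f j • hop R (j - m) j v := by
  induction v using Finsupp.induction_linear with
  | zero => exact ⟨∅, by simp⟩
  | add v w hv hw =>
    obtain ⟨s, hs⟩ := hv
    obtain ⟨t, ht⟩ := hw
    refine ⟨s ∪ t, fun u hu => ?_⟩
    rw [map_add, hs u (Finset.union_subset_left hu), ht u (Finset.union_subset_right hu),
      ← Finset.sum_add_distrib]
    simp
  | single E c => exact ⟨hops m E, fun s hs => oneBody_single hm f E c s hs⟩

theorem oneBody_hop {m : ℤ} (hm : m ≠ 0) (g : ℤ → R) (a c : ℤ) (v : Finset ℤ →₀ R) :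
    oneBody m g (hop R a c v) = hop R a c (oneBody m g v) + g a • hop R (a - m) c v -
      g (c + m) • hop R a (c + m) v := by
  obtain ⟨s, hs⟩ := exists_oneBody_eq_sum hm g (hop R a c v)
  obtain ⟨t, ht⟩ := exists_oneBody_eq_sum hm g v
  set u := s ∪ t ∪ {a, c + m} with hu
  have h1 : a ∈ u := by simp [hu]
  have h2 : c + m ∈ u := by simp [hu]
  rw [hs u (by rw [hu, Finset.union_assoc]; exact Finset.subset_union_left),
    ht u (fun x hx => by simp [hu, hx]), map_sum]
  simp only [hop_hop _ _ a c, smul_add, smul_sub, Finset.sum_add_distrib, Finset.sum_sub_distrib,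
    map_smul, smul_ite, smul_zero]
  congr 1
  · congr 1
    rw [Finset.sum_ite_eq' u a, if_pos h1]
  · have : ∀ j : ℤ, (c = j - m) ↔ (j = c + m) := fun j => by omega
    simp only [this]
    rw [Finset.sum_ite_eq' u (c + m), if_pos h2]

/-- The cocycle of the central extension is supported on m + n = 0, which is excluded here; the one
instance of it that is needed is `alpha_raise`. -/
theorem oneBody_oneBody {m n : ℤ} (hm : m ≠ 0) (hn : n ≠ 0) (hmn : m + n ≠ 0) (g f : ℤ → R)
    (v : Finset ℤ →₀ R) :
    oneBody m g (oneBody n f v) = oneBody n f (oneBody m g v) +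
      oneBody (m + n) (fun j => f j * g (j - n) - f (j - m) * g j) v := by
  obtain ⟨s₁, h₁⟩ := exists_oneBody_eq_sum hn f v
  obtain ⟨s₂, h₂⟩ := exists_oneBody_eq_sum hn f (oneBody m g v)
  obtain ⟨s₃, h₃⟩ := exists_oneBody_eq_sum hmn (fun j => f j * g (j - n)) v
  obtain ⟨s₄, h₄⟩ := exists_oneBody_eq_sum hmn (fun j => f (j - m) * g j) v
  have hsub : oneBody (m + n) (fun j => f j * g (j - n) - f (j - m) * g j) v =
      oneBody (m + n) (fun j => f j * g (j - n)) v -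
        oneBody (m + n) (fun j => f (j - m) * g j) v := by
    obtain ⟨s₅, h₅⟩ := exists_oneBody_eq_sum hmn (fun j => f j * g (j - n) - f (j - m) * g j) v
    rw [h₅ (s₃ ∪ s₄ ∪ s₅) Finset.subset_union_right, h₃ (s₃ ∪ s₄ ∪ s₅) (fun x hx => by simp [hx]),
      h₄ (s₃ ∪ s₄ ∪ s₅) (fun x hx => by simp [hx]), ← Finset.sum_sub_distrib]
    simp [sub_smul]
  -- In the last sum the index is shifted by `m`, so it is taken over the image of `u`; the shifted
  -- copy of `s₄` makes that image large enough.
  set u := s₁ ∪ s₂ ∪ s₃ ∪ s₄.image (· - m) with hu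
  rw [hsub, h₁ u (fun x hx => by simp [hu, hx]), h₂ u (fun x hx => by simp [hu, hx]),
    h₃ u (fun x hx => by simp [hu, hx]), h₄ (u.image (· + m))]
  · rw [map_sum, Finset.sum_image (by intro a _ b _ h; simpa using h), ← Finset.sum_sub_distrib,
      ← Finset.sum_add_distrib]
    refine Finset.sum_congr rfl fun j _ => ?_
    rw [map_smul, oneBody_hop hm]
    have e1 : j - n - m = j - (m + n) := by ring
    have e2 : j + m - (m + n) = j - n := by ring
    rw [e1, e2, add_sub_cancel_right, smul_sub, smul_add, mul_smul, mul_smul, add_sub_assoc]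
  · intro x hx
    exact Finset.mem_image.2 ⟨x - m, by simp [hu, hx], by ring⟩

/-- The diagonal operator `∑_j f(j) :ψ_j ψ_j^*:`. -/
def diagonal (f : ℤ → R) : Module.End R (Finset ℤ →₀ R) :=
  Finsupp.linearCombination R fun E => Finsupp.single E (∑ j ∈ E, if 0 ≤ j then f j else - f j)

theorem diagonal_single (f : ℤ → R) (E : Finset ℤ) (c : R) :
    diagonal f (Finsupp.single E c) =
      (∑ j ∈ E, if 0 ≤ j then f j else - f j) • Finsupp.single E c := by
  rw [diagonal, Finsupp.linearCombination_single, Finsupp.smul_single, Finsupp.smul_single,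
    smul_eq_mul, smul_eq_mul, mul_comm]

theorem sum_symmDiff_singleton (f : ℤ → R) (E : Finset ℤ) (i : ℤ) :
    (∑ j ∈ symmDiff E {i}, if 0 ≤ j then f j else - f j) =
      (∑ j ∈ E, if 0 ≤ j then f j else - f j) + if Occupied E i then - f i else f i := by
  by_cases hi : i ∈ E
  · have : symmDiff E {i} = E.erase i := by
      ext k; simp only [Finset.mem_symmDiff, Finset.mem_singleton, Finset.mem_erase]
      constructor
      · rintro (h1 | ⟨h1, h2⟩)
        · tauto
        · subst h1; tauto
      · tauto
    rw [this, ← Finset.sum_erase_add _ _ hi]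
    by_cases h0 : i < 0
    · simp [Occupied, Xor, hi, h0, h0.not_ge]
    · simp [Occupied, Xor, hi, h0, not_lt.1 h0, sub_eq_add_neg]
  · have : symmDiff E {i} = insert i E := by
      ext k; simp only [Finset.mem_symmDiff, Finset.mem_singleton, Finset.mem_insert]
      constructor
      · tauto
      · rintro (h1 | h1)
        · subst h1; tauto
        · exact Or.inl ⟨h1, fun h2 => hi (h2 ▸ h1)⟩
    rw [this, Finset.sum_insert hi, add_comm]
    by_cases h0 : i < 0
    · simp [Occupied, Xor, hi, h0, h0.not_ge]
    · simp [Occupied, Xor, hi, h0, not_lt.1 h0]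

theorem diagonal_create (f : ℤ → R) (i : ℤ) (v : Finset ℤ →₀ R) :
    diagonal f (create R i v) = create R i (diagonal f v) + f i • create R i v := by
  induction v using Finsupp.induction_linear with
  | zero => simp
  | add f g hf hg => simp only [map_add, hf, hg, smul_add]; abel
  | single E c =>
    rw [diagonal_single, map_smul, create_single]
    by_cases h : Occupied E i
    · simp [h]
    · rw [if_neg h, diagonal_single, sum_symmDiff_singleton, if_neg h, add_smul]

theorem diagonal_annihilate (f : ℤ → R) (i : ℤ) (v : Finset ℤ →₀ R) :
    diagonal f (annihilate R i v) = annihilate R i (diagonal f v) - f i • annihilate R i v := by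
  induction v using Finsupp.induction_linear with
  | zero => simp
  | add f g hf hg => simp only [map_add, hf, hg, smul_add]; abel
  | single E c =>
    rw [diagonal_single, map_smul, annihilate_single]
    by_cases h : Occupied E i
    · rw [if_pos h, diagonal_single, sum_symmDiff_singleton, if_pos h, add_smul, neg_smul,
        sub_eq_add_neg]
    · simp [h]

/-- Normal ordering changes the diagonal operator by a formal constant, which drops out of a
commutator, so no correction term appears. -/
theorem diagonal_oneBody {m : ℤ} (hm : m ≠ 0) (f g : ℤ → R) (v : Finset ℤ →₀ R) :
    diagonal f (oneBody m g v) = oneBody m g (diagonal f v) +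
      oneBody m (fun j => g j * (f (j - m) - f j)) v := by
  obtain ⟨s₁, h₁⟩ := exists_oneBody_eq_sum hm g v
  obtain ⟨s₂, h₂⟩ := exists_oneBody_eq_sum hm g (diagonal f v)
  obtain ⟨s₃, h₃⟩ := exists_oneBody_eq_sum hm (fun j => g j * (f (j - m) - f j)) v
  set u := s₁ ∪ s₂ ∪ s₃ with hu
  rw [h₁ u (fun x hx => by simp [hu, hx]), h₂ u (fun x hx => by simp [hu, hx]),
    h₃ u (fun x hx => by simp [hu, hx]), map_sum, ← Finset.sum_add_distrib]
  refine Finset.sum_congr rfl fun j _ => ?_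
  rw [map_smul, hop_apply, diagonal_create, diagonal_annihilate, map_sub, map_smul, hop_apply,
    mul_smul, ← smul_add, sub_smul]
  congr 1; abel

/-! ### The operators `E_{-a}` and the Heisenberg operators -/

/-- The operator `α_{-k}`. -/
def raise (R : Type) [CommRing R] (k : ℕ) : Module.End R (Finset ℤ →₀ R) :=
  oneBody (-(k : ℤ)) fun _ => 1

theorem raise_zero : raise R 0 = 0 := by
  refine Finsupp.lhom_ext fun E c => ?_
  have : hops 0 E = ∅ := by
    ext j; simp [mem_hops]
  simp [raise, oneBody, this]

theorem oneBody_smul (m : ℤ) (c : R) (f : ℤ → R) (v : Finset ℤ →₀ R) :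
    oneBody m (fun j => c * f j) v = c • oneBody m f v := by
  have : oneBody m (fun j => c * f j) = c • oneBody m f := by
    refine Finsupp.lhom_ext fun E d => ?_
    simp only [oneBody, LinearMap.smul_apply, Finsupp.linearCombination_single, Finset.smul_sum]
    refine Finset.sum_congr rfl fun j _ => ?_
    simp only [Finsupp.smul_single, smul_eq_mul]
    congr 1; ring
  rw [this, LinearMap.smul_apply]

theorem raise_raise (k l : ℕ) (v : Finset ℤ →₀ R) :
    raise R k (raise R l v) = raise R l (raise R k v) := by
  rcases Nat.eq_zero_or_pos k with rfl | hk
  · simp [raise_zero]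
  rcases Nat.eq_zero_or_pos l with rfl | hl
  · simp [raise_zero]
  rw [raise, raise, oneBody_oneBody (by omega) (by omega) (by omega)]
  simpa using oneBody_smul (-(k : ℤ) + -(l : ℤ)) (0 : R) (fun _ => 0) v

/-- The operator `E_{-a}(z) = ∑_k e^{z(k + a/2)} :ψ_{k+a} ψ_k^*:`, where `y = e^{z/2}`. -/
def vertexOp (y : Rˣ) (a : ℕ) : Module.End R (Finset ℤ →₀ R) :=
  if a = 0 then diagonal fun j => ((y ^ (2 * j + 1) : Rˣ) : R)
  else oneBody (-(a : ℤ)) fun j => ((y ^ (2 * j + 1 + a) : Rˣ) : R)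

/-- The quantum integer `y^k - y^{-k}`. -/
def qnum (y : Rˣ) (k : ℕ) : R := ((y ^ (k : ℤ) : Rˣ) : R) - ((y ^ (-(k : ℤ)) : Rˣ) : R)

/-- The commutator [E_{-a}(z), α_{-k}] = ζ(kz) E_{-a-k}(z). The difference of the exponentials at j
+ k and at j factors through their midpoint, which is the exponent in E_{-a-k} thanks to the
symmetric normalization k + a/2. No central term occurs since neither operator lowers the energy. -/
theorem vertexOp_raise (y : Rˣ) (a k : ℕ) (v : Finset ℤ →₀ R) :
    vertexOp y a (raise R k v) = raise R k (vertexOp y a v) + qnum y k • vertexOp y (a + k) v := by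
  rcases Nat.eq_zero_or_pos k with rfl | hk
  · simp [raise_zero, qnum]
  have hk0 : -(k : ℤ) ≠ 0 := by omega
  rw [vertexOp, vertexOp, if_neg (show ¬ a + k = 0 by omega), ← oneBody_smul]
  have hq : ∀ e : ℤ, qnum y k * ((y ^ (e + k) : Rˣ) : R) =
      ((y ^ (e + 2 * k) : Rˣ) : R) - ((y ^ e : Rˣ) : R) := fun e => by
    rw [qnum, sub_mul, ← Units.val_mul, ← Units.val_mul, ← zpow_add, ← zpow_add]
    congr 3 <;> ring_nf
  split_ifs with ha
  · subst ha
    rw [raise, diagonal_oneBody hk0]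
    have hf : (fun j : ℤ => (1 : R) * (((y ^ (2 * (j - -(k : ℤ)) + 1) : Rˣ) : R) -
        ((y ^ (2 * j + 1) : Rˣ) : R))) =
        fun j => qnum y k * ((y ^ (2 * j + 1 + ((0 + k : ℕ) : ℤ)) : Rˣ) : R) := by
      funext j
      rw [zero_add, hq, one_mul, show 2 * (j - -(k : ℤ)) + 1 = 2 * j + 1 + 2 * k by ring]
    rw [hf, zero_add]
  · have ha0 : -(a : ℤ) ≠ 0 := by omega
    rw [raise, oneBody_oneBody ha0 hk0 (by omega)]
    have hf : (fun j : ℤ => (1 : R) * ((y ^ (2 * (j - -(k : ℤ)) + 1 + a) : Rˣ) : R) -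
        1 * ((y ^ (2 * j + 1 + a) : Rˣ) : R)) =
        fun j => qnum y k * ((y ^ (2 * j + 1 + ((a + k : ℕ) : ℤ)) : Rˣ) : R) := by
      funext j
      rw [Nat.cast_add, ← add_assoc, hq, one_mul, one_mul,
        show 2 * (j - -(k : ℤ)) + 1 + a = 2 * j + 1 + a + 2 * k by ring]
    rw [hf, show -(a : ℤ) + -(k : ℤ) = -((a + k : ℕ) : ℤ) by push_cast; ring]

end OneBody

/-! ### Particle-hole states and the vector E_{-M}(z) v_∅ -/

section Vacuum
variable {R : Type} [CommRing R]

/-- The vacuum. -/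
def vacuum (R : Type) [CommRing R] : Finset ℤ →₀ R := Finsupp.single ∅ 1

/-- The state with one particle at `p + 1/2` and one hole at `-n - 1/2`. -/
def pairState (R : Type) [CommRing R] (p n : ℕ) : Finset ℤ →₀ R := hop R p (-1 - n) (vacuum R)

theorem oneBody_vacuum (a : ℕ) (f : ℤ → R) :
    oneBody (-((a + 1 : ℕ) : ℤ)) f (vacuum R) =
      ∑ x ∈ antidiagonal a, f (-1 - x.2) • pairState R x.1 x.2 := by
  rw [vacuum, oneBody_single (by omega) f ∅ 1 (Finset.Ico (-((a + 1 : ℕ) : ℤ)) 0)]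
  · refine (Finset.sum_nbij' (fun x : ℕ × ℕ => -1 - (x.2 : ℤ))
      (fun j => ((j + a + 1).toNat, (-1 - j).toNat)) ?_ ?_ ?_ ?_ ?_).symm
    · rintro ⟨p, n⟩ h
      simp only [Finset.HasAntidiagonal.mem_antidiagonal] at h
      simp only [Finset.mem_Ico]; omega
    · intro j h
      simp only [Finset.mem_Ico] at h
      simp only [Finset.HasAntidiagonal.mem_antidiagonal]; omega
    · rintro ⟨p, n⟩ h
      simp only [Finset.HasAntidiagonal.mem_antidiagonal] at h
      simp only [Prod.mk.injEq]; omega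
    · intro j h
      simp only [Finset.mem_Ico] at h
      push_cast at h ⊢; omega
    · rintro ⟨p, n⟩ h
      simp only [Finset.HasAntidiagonal.mem_antidiagonal] at h
      have : (-1 - (n : ℤ)) - -((a + 1 : ℕ) : ℤ) = p := by push_cast; omega
      rw [this]; rfl
  · intro j hj
    rw [mem_hops] at hj
    simp only [Occupied, Xor, Finset.notMem_empty, false_and, not_false_eq_true, and_true,
      false_or] at hj
    rw [Finset.mem_Ico]; omega

theorem vertexOp_vacuum (y : Rˣ) (a : ℕ) :
    vertexOp y (a + 1) (vacuum R) =
      ∑ x ∈ antidiagonal a, ((y ^ ((x.1 : ℤ) - x.2) : Rˣ) : R) • pairState R x.1 x.2 := by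
  rw [vertexOp, if_neg (by omega), oneBody_vacuum]
  refine Finset.sum_congr rfl fun x hx => ?_
  rw [Finset.HasAntidiagonal.mem_antidiagonal] at hx
  congr 3
  push_cast; omega

theorem raise_vacuum (a : ℕ) :
    raise R (a + 1) (vacuum R) = ∑ x ∈ antidiagonal a, pairState R x.1 x.2 := by
  rw [raise, oneBody_vacuum]; simp

/-- Raising the energy of a particle-hole pair either creates a second pair, or moves the particle
up, or moves the hole down; the last possibility carries a sign. -/
theorem raise_pairState (k p n : ℕ) :
    raise R (k + 1) (pairState R p n) =
      (∑ x ∈ antidiagonal k, hop R p (-1 - n) (pairState R x.1 x.2)) +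
        pairState R (p + (k + 1)) n - pairState R p (n + (k + 1)) := by
  rw [pairState, raise, oneBody_hop (by omega), ← raise, raise_vacuum, map_sum, one_smul, one_smul,
    pairState, pairState]
  congr 3
  push_cast; ring

theorem hop_pairState_swap_left (p n p' n' : ℕ) :
    hop R p (-1 - n) (pairState R p' n') = -hop R p' (-1 - n) (pairState R p n') := by
  simp only [pairState, hop_apply]
  rw [annihilate_create, annihilate_create, if_neg (by omega), if_neg (by omega), zero_sub,
    zero_sub, map_neg, map_neg, create_create]

theorem hop_pairState_swap_right (p n p' n' : ℕ) :
    hop R p (-1 - n) (pairState R p' n') = -hop R p (-1 - n') (pairState R p' n) := by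
  simp only [pairState, hop_apply]
  rw [annihilate_create, annihilate_create, if_neg (by omega), if_neg (by omega), zero_sub,
    zero_sub, map_neg, map_neg, annihilate_annihilate, map_neg, map_neg]

/-- The quadruples of natural numbers with sum `N`. -/
def quadruples (N : ℕ) : Finset (ℕ × ℕ × ℕ × ℕ) :=
  (Finset.range (N + 1) ×ˢ Finset.range (N + 1) ×ˢ Finset.range (N + 1) ×ˢ
    Finset.range (N + 1)).filter fun x => x.1 + x.2.1 + x.2.2.1 + x.2.2.2 = N

theorem mem_quadruples {N : ℕ} {x : ℕ × ℕ × ℕ × ℕ} :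
    x ∈ quadruples N ↔ x.1 + x.2.1 + x.2.2.1 + x.2.2.2 = N := by
  simp only [quadruples, Finset.mem_filter, Finset.mem_product, Finset.mem_range]; omega

theorem sum_quadruples {A : Type} [AddCommMonoid A] (N : ℕ) (F : ℕ → ℕ → ℕ → ℕ → A) :
    ∑ i ∈ antidiagonal N, ∑ x ∈ antidiagonal i.2, ∑ x' ∈ antidiagonal i.1,
      F x.1 x.2 x'.1 x'.2 = ∑ z ∈ quadruples N, F z.1 z.2.1 z.2.2.1 z.2.2.2 := by
  simp only [Finset.sum_sigma']
  refine Finset.sum_nbij' (fun u => (u.2.1.1, u.2.1.2, u.2.2.1, u.2.2.2))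
    (fun z => ⟨(z.2.2.1 + z.2.2.2, z.1 + z.2.1), ⟨(z.1, z.2.1), (z.2.2.1, z.2.2.2)⟩⟩) ?_ ?_ ?_ ?_ ?_
  · rintro ⟨⟨i, j⟩, ⟨p, n⟩, ⟨p', n'⟩⟩ h
    simp only [Finset.mem_sigma, Finset.HasAntidiagonal.mem_antidiagonal] at h
    simp only [mem_quadruples]; omega
  · rintro ⟨p, n, p', n'⟩ h
    simp only [mem_quadruples] at h
    simp only [Finset.mem_sigma, Finset.HasAntidiagonal.mem_antidiagonal, and_true, true_and]; omega
  · rintro ⟨⟨i, j⟩, ⟨p, n⟩, ⟨p', n'⟩⟩ h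
    simp only [Finset.mem_sigma, Finset.HasAntidiagonal.mem_antidiagonal] at h
    obtain ⟨_, rfl, rfl⟩ := h
    rfl
  · rintro ⟨p, n, p', n'⟩ _; rfl
  · rintro ⟨⟨i, j⟩, ⟨p, n⟩, ⟨p', n'⟩⟩ _; rfl

theorem sum_pairs_shift_left {A : Type} [AddCommMonoid A] (N : ℕ) (G : ℕ → ℕ → ℕ → A) :
    ∑ i ∈ antidiagonal N, ∑ x ∈ antidiagonal i.2, G i.1 x.1 x.2 =
      ∑ x ∈ antidiagonal (N + 1), ∑ i ∈ Finset.range x.1, G i (x.1 - 1 - i) x.2 := by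
  simp only [Finset.sum_sigma']
  refine Finset.sum_nbij' (fun u => ⟨(u.2.1 + u.1.1 + 1, u.2.2), u.1.1⟩)
    (fun z => ⟨(z.2, N - z.2), (z.1.1 - 1 - z.2, z.1.2)⟩) ?_ ?_ ?_ ?_ ?_
  · rintro ⟨⟨i, j⟩, ⟨p, n⟩⟩ h
    simp only [Finset.mem_sigma, Finset.HasAntidiagonal.mem_antidiagonal] at h
    simp only [Finset.mem_sigma, Finset.HasAntidiagonal.mem_antidiagonal, Finset.mem_range]; omega
  · rintro ⟨⟨p, n⟩, i⟩ h
    simp only [Finset.mem_sigma, Finset.HasAntidiagonal.mem_antidiagonal, Finset.mem_range] at h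
    simp only [Finset.mem_sigma, Finset.HasAntidiagonal.mem_antidiagonal, and_true, true_and]; omega
  · rintro ⟨⟨i, j⟩, ⟨p, n⟩⟩ h
    simp only [Finset.mem_sigma, Finset.HasAntidiagonal.mem_antidiagonal] at h
    obtain ⟨rfl, rfl⟩ := h
    simp only [Sigma.mk.injEq, Prod.mk.injEq, heq_eq_eq, and_true, true_and]; omega
  · rintro ⟨⟨p, n⟩, i⟩ h
    simp only [Finset.mem_sigma, Finset.HasAntidiagonal.mem_antidiagonal, Finset.mem_range] at h
    simp only [Sigma.mk.injEq, Prod.mk.injEq, heq_eq_eq, and_true, true_and]; omega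
  · rintro ⟨⟨i, j⟩, ⟨p, n⟩⟩ h
    simp only
    congr 1; omega

theorem sum_pairs_shift_right {A : Type} [AddCommMonoid A] (N : ℕ) (G : ℕ → ℕ → ℕ → A) :
    ∑ i ∈ antidiagonal N, ∑ x ∈ antidiagonal i.2, G i.1 x.1 x.2 =
      ∑ x ∈ antidiagonal (N + 1), ∑ i ∈ Finset.range x.2, G i x.1 (x.2 - 1 - i) := by
  have h : ∀ i : ℕ × ℕ, ∑ x ∈ antidiagonal i.2, G i.1 x.1 x.2 =
      ∑ x ∈ antidiagonal i.2, G i.1 x.2 x.1 := fun i =>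
    (Finset.Nat.sum_antidiagonal_swap (f := fun x => G i.1 x.1 x.2) (n := i.2)).symm
  simp only [h]
  rw [sum_pairs_shift_left N (fun i p n => G i n p)]
  exact Finset.Nat.sum_antidiagonal_swap (f := fun x => ∑ i ∈ Finset.range x.2, G i x.1 (x.2 - 1 - i))

/-- Each summand is y^e minus a power of y, and multiplication by y - y⁻¹ makes those powers
telescope. The next lemma is the mirror image, for holes instead of particles. -/
theorem qnum_one_mul_sum_left (y : Rˣ) (p : ℕ) (e : ℤ) :
    qnum y 1 * ∑ i ∈ Finset.range p, qnum y (i + 1) * ((y ^ (e - (i + 1)) : Rˣ) : R) =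
      p * qnum y 1 * ((y ^ e : Rˣ) : R) - ((y ^ (e - 1) : Rˣ) : R) +
        ((y ^ (e - 2 * p - 1) : Rˣ) : R) := by
  induction p with
  | zero => simp
  | succ p ih =>
    rw [Finset.sum_range_succ, mul_add, ih]
    have h1 : qnum y (p + 1) * ((y ^ (e - (p + 1)) : Rˣ) : R) =
        ((y ^ e : Rˣ) : R) - ((y ^ (e - 2 * p - 2) : Rˣ) : R) := by
      rw [qnum, sub_mul, ← Units.val_mul, ← Units.val_mul, ← zpow_add, ← zpow_add]
      congr 3 <;> push_cast <;> ring
    have h2 : qnum y 1 * ((y ^ (e - 2 * p - 2) : Rˣ) : R) =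
        ((y ^ (e - 2 * p - 1) : Rˣ) : R) - ((y ^ (e - 2 * (p + 1 : ℕ) - 1) : Rˣ) : R) := by
      rw [qnum, sub_mul, ← Units.val_mul, ← Units.val_mul, ← zpow_add, ← zpow_add]
      congr 3 <;> push_cast <;> ring
    rw [h1, mul_sub, h2]; push_cast; ring

theorem qnum_one_mul_sum_right (y : Rˣ) (n : ℕ) (e : ℤ) :
    qnum y 1 * ∑ i ∈ Finset.range n, qnum y (i + 1) * ((y ^ (e + (i + 1)) : Rˣ) : R) =
      ((y ^ (e + 2 * n + 1) : Rˣ) : R) - ((y ^ (e + 1) : Rˣ) : R) -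
        n * qnum y 1 * ((y ^ e : Rˣ) : R) := by
  induction n with
  | zero => simp
  | succ p ih =>
    rw [Finset.sum_range_succ, mul_add, ih]
    have h1 : qnum y (p + 1) * ((y ^ (e + (p + 1)) : Rˣ) : R) =
        ((y ^ (e + 2 * p + 2) : Rˣ) : R) - ((y ^ e : Rˣ) : R) := by
      rw [qnum, sub_mul, ← Units.val_mul, ← Units.val_mul, ← zpow_add, ← zpow_add]
      congr 3 <;> push_cast <;> ring
    have h2 : qnum y 1 * ((y ^ (e + 2 * p + 2) : Rˣ) : R) =
        ((y ^ (e + 2 * (p + 1 : ℕ) + 1) : Rˣ) : R) - ((y ^ (e + 2 * p + 1) : Rˣ) : R) := by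
      rw [qnum, sub_mul, ← Units.val_mul, ← Units.val_mul, ← zpow_add, ← zpow_add]
      congr 3 <;> push_cast <;> ring
    rw [h1, mul_sub, h2]; push_cast; ring

/-- A state with two pairs changes sign when its particles are exchanged and when its holes are
exchanged. The coefficient is a difference of two monomials in y, the first symmetric in the two
particles and the second symmetric in the two holes, so each is killed by antisymmetrization. This
is why E_{-M} v_∅ involves only single pairs although the bosonic polynomial creates many. -/
theorem sum_two_pairs_eq_zero [Algebra ℂ R] (y : Rˣ) (N : ℕ) :
    ∑ z ∈ quadruples N, (qnum y (z.2.2.1 + z.2.2.2 + 1) * ((y ^ ((z.1 : ℤ) - z.2.1) : Rˣ) : R)) •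
      hop R z.1 (-1 - z.2.1) (pairState R z.2.2.1 z.2.2.2) = 0 := by
  set κ : ℕ × ℕ × ℕ × ℕ → R := fun z =>
    qnum y (z.2.2.1 + z.2.2.2 + 1) * ((y ^ ((z.1 : ℤ) - z.2.1) : Rˣ) : R) with hκ
  set V : ℕ × ℕ × ℕ × ℕ → Finset ℤ →₀ R := fun z =>
    hop R z.1 (-1 - z.2.1) (pairState R z.2.2.1 z.2.2.2) with hV
  let a : ℕ × ℕ × ℕ × ℕ → ℕ × ℕ × ℕ × ℕ := fun z => (z.2.2.1, z.2.1, z.1, z.2.2.2)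
  let b : ℕ × ℕ × ℕ × ℕ → ℕ × ℕ × ℕ × ℕ := fun z => (z.1, z.2.2.2, z.2.2.1, z.2.1)
  have hVa : ∀ z, V (a z) = -V z := fun z => by
    rw [hV]; exact hop_pairState_swap_left _ _ _ _
  have hVb : ∀ z, V (b z) = -V z := fun z => by
    rw [hV]; exact hop_pairState_swap_right _ _ _ _
  have hsa : ∀ G : ℕ × ℕ × ℕ × ℕ → Finset ℤ →₀ R,
      ∑ z ∈ quadruples N, G (a z) = ∑ z ∈ quadruples N, G z := fun G =>
    Finset.sum_nbij' a a (fun z hz => by rw [mem_quadruples] at *; simp only [a]; omega)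
      (fun z hz => by rw [mem_quadruples] at *; simp only [a]; omega) (fun _ _ => rfl)
      (fun _ _ => rfl) (fun _ _ => rfl)
  have hsb : ∀ G : ℕ × ℕ × ℕ × ℕ → Finset ℤ →₀ R,
      ∑ z ∈ quadruples N, G (b z) = ∑ z ∈ quadruples N, G z := fun G =>
    Finset.sum_nbij' b b (fun z hz => by rw [mem_quadruples] at *; simp only [b]; omega)
      (fun z hz => by rw [mem_quadruples] at *; simp only [b]; omega) (fun _ _ => rfl)
      (fun _ _ => rfl) (fun _ _ => rfl)
  have hκ0 : ∀ z, κ z + κ (a (b z)) - κ (a z) - κ (b z) = 0 := by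
    rintro ⟨p, n, p', n'⟩
    have e : ∀ (k : ℕ) (c : ℤ), qnum y (k + 1) * ((y ^ c : Rˣ) : R) =
        ((y ^ (k + 1 + c) : Rˣ) : R) - ((y ^ (-k - 1 + c) : Rˣ) : R) := by
      intro k c
      rw [qnum, sub_mul, ← Units.val_mul, ← Units.val_mul, ← zpow_add, ← zpow_add]
      congr 3; push_cast; ring
    simp only [hκ, a, b, e]
    push_cast
    ring_nf
  set X := ∑ z ∈ quadruples N, κ z • V z with hX
  have h1 : ∑ z ∈ quadruples N, κ (a z) • V z = -X := by
    rw [hX, ← hsa (fun z => κ z • V z), ← Finset.sum_neg_distrib]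
    refine Finset.sum_congr rfl fun z _ => ?_
    rw [hVa, smul_neg, neg_neg]
  have h2 : ∑ z ∈ quadruples N, κ (b z) • V z = -X := by
    rw [hX, ← hsb (fun z => κ z • V z), ← Finset.sum_neg_distrib]
    refine Finset.sum_congr rfl fun z _ => ?_
    rw [hVb, smul_neg, neg_neg]
  have h3 : ∑ z ∈ quadruples N, κ (a (b z)) • V z = X := by
    rw [hX, ← hsa (fun z => κ z • V z), ← hsb (fun z => κ (a z) • V (a z))]
    refine Finset.sum_congr rfl fun z _ => ?_
    rw [hVa, hVb, neg_neg]
  have h4 : ∑ z ∈ quadruples N, (κ z + κ (a (b z)) - κ (a z) - κ (b z)) • V z = 0 :=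
    Finset.sum_eq_zero fun z _ => by rw [hκ0, zero_smul]
  simp only [sub_smul, add_smul, Finset.sum_sub_distrib, Finset.sum_add_distrib, h1, h2, h3] at h4
  -- The four signed rearrangements all equal X, and 4 is invertible over ℂ.
  have h5 : (4 : R) • X = 0 := by rw [← h4, ← hX]; module
  have h6 : (algebraMap ℂ R (1 / 4)) * 4 = 1 := by
    rw [← map_ofNat (algebraMap ℂ R) 4, ← map_mul]; norm_num
  rw [← one_smul R X, ← h6, mul_smul, h5, smul_zero]

/-- The recursion that identifies `ζ(z) E_{-M}(z) v_∅` with a polynomial in the `α_{-k}`. -/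
theorem vertexOp_vacuum_recursion [Algebra ℂ R] (y : Rˣ) (N : ℕ) :
    ((N + 1 : ℕ) : R) • qnum y 1 • vertexOp y (N + 2) (vacuum R) + qnum y 1 • vertexOp y (N + 2) (vacuum R) =
      (∑ i ∈ antidiagonal N, qnum y (i.1 + 1) • raise R (i.1 + 1)
        (qnum y 1 • vertexOp y (i.2 + 1) (vacuum R))) +
        qnum y (N + 2) • raise R (N + 2) (vacuum R) := by
  -- The contributions with two pairs add up to zero, so only the moves of the particle and of the
  -- hole of an existing pair survive.
  have hmain : ∑ i ∈ antidiagonal N, qnum y (i.1 + 1) • raise R (i.1 + 1)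
        (vertexOp y (i.2 + 1) (vacuum R)) =
      (∑ i ∈ antidiagonal N, ∑ x ∈ antidiagonal i.2,
        (qnum y (i.1 + 1) * ((y ^ ((x.1 : ℤ) - x.2) : Rˣ) : R)) • pairState R (x.1 + (i.1 + 1)) x.2) -
      ∑ i ∈ antidiagonal N, ∑ x ∈ antidiagonal i.2,
        (qnum y (i.1 + 1) * ((y ^ ((x.1 : ℤ) - x.2) : Rˣ) : R)) • pairState R x.1 (x.2 + (i.1 + 1)) := by
    have h0 := sum_quadruples N fun p n p' n' =>
      (qnum y (p' + n' + 1) * ((y ^ ((p : ℤ) - n) : Rˣ) : R)) • hop R p (-1 - n) (pairState R p' n')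
    rw [sum_two_pairs_eq_zero] at h0
    rw [← add_zero (_ - _), ← h0, ← Finset.sum_sub_distrib, ← Finset.sum_add_distrib]
    refine Finset.sum_congr rfl fun i _ => ?_
    rw [vertexOp_vacuum, map_sum, Finset.smul_sum, ← Finset.sum_sub_distrib,
      ← Finset.sum_add_distrib]
    refine Finset.sum_congr rfl fun x _ => ?_
    rw [map_smul, raise_pairState, smul_smul, add_sub_assoc, smul_add, smul_sub, Finset.smul_sum,
      add_comm]
    congr 1
    refine Finset.sum_congr rfl fun x' hx' => ?_
    rw [Finset.HasAntidiagonal.mem_antidiagonal] at hx'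
    rw [hx']
  have h1 := sum_pairs_shift_left N fun i p n =>
    (qnum y (i + 1) * ((y ^ ((p : ℤ) - n) : Rˣ) : R)) • pairState R (p + (i + 1)) n
  have h2 := sum_pairs_shift_right N fun i p n =>
    (qnum y (i + 1) * ((y ^ ((p : ℤ) - n) : Rˣ) : R)) • pairState R p (n + (i + 1))
  have h3 : ∑ i ∈ antidiagonal N, qnum y (i.1 + 1) • raise R (i.1 + 1)
        (qnum y 1 • vertexOp y (i.2 + 1) (vacuum R)) = qnum y 1 •
      ∑ i ∈ antidiagonal N, qnum y (i.1 + 1) • raise R (i.1 + 1)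
        (vertexOp y (i.2 + 1) (vacuum R)) := by
    rw [Finset.smul_sum]
    refine Finset.sum_congr rfl fun i _ => ?_
    rw [map_smul, smul_comm]
  rw [h3, hmain, h1, h2, vertexOp_vacuum, raise_vacuum, ← Finset.sum_sub_distrib, Finset.smul_sum,
    Finset.smul_sum, Finset.smul_sum, Finset.smul_sum, ← Finset.sum_add_distrib,
    ← Finset.sum_add_distrib]
  refine Finset.sum_congr rfl fun x hx => ?_
  rw [Finset.HasAntidiagonal.mem_antidiagonal] at hx
  obtain ⟨p, n⟩ := x
  simp only at hx ⊢
  -- The pair (p, n) arises by moving a particle up by i + 1 from p - 1 - i, and likewise for a hole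
  -- in `e2`. The two resulting geometric sums telescope after multiplication by y - y⁻¹.
  have e1 : ∑ i ∈ Finset.range p, (qnum y (i + 1) * ((y ^ (((p - 1 - i : ℕ) : ℤ) - n) : Rˣ) : R)) •
      pairState R (p - 1 - i + (i + 1)) n =
      (∑ i ∈ Finset.range p, qnum y (i + 1) * ((y ^ ((p : ℤ) - n - (i + 1)) : Rˣ) : R)) •
        pairState R p n := by
    rw [Finset.sum_smul]
    refine Finset.sum_congr rfl fun i hi => ?_
    rw [Finset.mem_range] at hi
    congr 4 <;> omega
  have e2 : ∑ i ∈ Finset.range n, (qnum y (i + 1) * ((y ^ ((p : ℤ) - (n - 1 - i : ℕ)) : Rˣ) : R)) •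
      pairState R p (n - 1 - i + (i + 1)) =
      (∑ i ∈ Finset.range n, qnum y (i + 1) * ((y ^ ((p : ℤ) - n + (i + 1)) : Rˣ) : R)) •
        pairState R p n := by
    rw [Finset.sum_smul]
    refine Finset.sum_congr rfl fun i hi => ?_
    rw [Finset.mem_range] at hi
    congr 4 <;> omega
  rw [e1, e2, ← sub_smul, smul_smul, smul_smul, smul_smul, smul_smul, ← add_smul, ← add_smul, mul_sub,
    qnum_one_mul_sum_left, qnum_one_mul_sum_right]
  congr 1
  have e3 : qnum y (N + 2) = ((y ^ ((p : ℤ) - n + 2 * n + 1) : Rˣ) : R) -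
      ((y ^ ((p : ℤ) - n - 2 * p - 1) : Rˣ) : R) := by
    rw [qnum]; congr 3 <;> omega
  have e4 : qnum y 1 * ((y ^ ((p : ℤ) - n) : Rˣ) : R) = ((y ^ ((p : ℤ) - n + 1) : Rˣ) : R) -
      ((y ^ ((p : ℤ) - n - 1) : Rˣ) : R) := by
    rw [qnum, sub_mul, ← Units.val_mul, ← Units.val_mul, ← zpow_add, ← zpow_add]
    congr 3 <;> push_cast <;> ring
  have e5 : ((N + 1 : ℕ) : R) = p + n := by rw [← hx]; push_cast; ring
  rw [e3, e5]
  linear_combination e4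

end Vacuum

/-! ### States built from multisets of parts -/

section States
variable {R : Type} [CommRing R] [Algebra ℂ R]

/-- The operator `α_{-k} / k`. -/
def insertPart (k : ℕ) (v : Finset ℤ →₀ R) : Finset ℤ →₀ R :=
  algebraMap ℂ R (k : ℂ)⁻¹ • raise R k v

/-- The operators α_{-k} commute with each other, so a state depends on the multiset of parts only.
-/
instance : LeftCommutative (insertPart (R := R)) :=
  ⟨fun k l v => by
    simp only [insertPart, map_smul]
    rw [raise_raise, smul_comm]⟩

/-- The state `∏_{k ∈ s} (α_{-k} / k) v`. -/
def stateOn (s : Multiset ℕ) (v : Finset ℤ →₀ R) : Finset ℤ →₀ R := s.foldr insertPart v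

theorem stateOn_zero (v : Finset ℤ →₀ R) : stateOn 0 v = v := rfl

theorem stateOn_cons (k : ℕ) (s : Multiset ℕ) (v : Finset ℤ →₀ R) :
    stateOn (k ::ₘ s) v = insertPart k (stateOn s v) := Multiset.foldr_cons _ _ _ _

theorem stateOn_smul (s : Multiset ℕ) (c : R) (v : Finset ℤ →₀ R) :
    stateOn s (c • v) = c • stateOn s v := by
  induction s using Multiset.induction with
  | empty => rfl
  | cons k s ih => rw [stateOn_cons, stateOn_cons, ih, insertPart, map_smul, smul_comm]; rfl

theorem stateOn_sum {ι : Type} (s : Multiset ℕ) (t : Finset ι) (v : ι → Finset ℤ →₀ R) :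
    stateOn s (∑ i ∈ t, v i) = ∑ i ∈ t, stateOn s (v i) := by
  induction s using Multiset.induction with
  | empty => rfl
  | cons k s ih =>
    rw [stateOn_cons, ih, insertPart, map_sum, Finset.smul_sum]
    simp only [stateOn_cons, insertPart]

theorem stateOn_raise (k : ℕ) (s : Multiset ℕ) (v : Finset ℤ →₀ R) :
    stateOn s (raise R k v) = (k : R) • stateOn (k ::ₘ s) v := by
  have h : stateOn s (raise R k v) = raise R k (stateOn s v) := by
    induction s using Multiset.induction with
    | empty => rfl
    | cons l s ih => rw [stateOn_cons, stateOn_cons, ih, insertPart, insertPart, map_smul, raise_raise]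
  rw [h, stateOn_cons, insertPart, smul_smul]
  rcases Nat.eq_zero_or_pos k with rfl | hk
  · simp [raise_zero]
  · rw [← map_natCast (algebraMap ℂ R), ← map_mul, mul_inv_cancel₀ (Nat.cast_ne_zero.2 hk.ne'), map_one,
      one_smul]

/-- While E_{-a} moves to the right, each part k is either passed, or absorbed into the index at the
price ζ(kz)/k. The antidiagonal lists these choices with the correct multiplicities for repeated
parts. -/
theorem vertexOp_stateOn (y : Rˣ) (a : ℕ) (s : Multiset ℕ) (v : Finset ℤ →₀ R) :
    vertexOp y a (stateOn s v) = (s.antidiagonal.map fun p =>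
      (p.1.map fun k : ℕ => algebraMap ℂ R (k : ℂ)⁻¹ * qnum y k).prod •
        stateOn p.2 (vertexOp y (a + p.1.sum) v)).sum := by
  induction s using Multiset.induction generalizing a with
  | empty => simp [stateOn_zero]
  | cons k s ih =>
    have hadd : ∀ m : Multiset (Multiset ℕ × Multiset ℕ), ∀ f : Multiset ℕ × Multiset ℕ →
        Finset ℤ →₀ R, insertPart k (m.map f).sum = (m.map fun p => insertPart k (f p)).sum := by
      intro m f
      induction m using Multiset.induction with
      | empty => simp [insertPart]
      | cons p m ihm =>
        rw [Multiset.map_cons, Multiset.sum_cons, Multiset.map_cons, Multiset.sum_cons, ← ihm]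
        simp only [insertPart, map_add, smul_add]
    rw [stateOn_cons, insertPart, map_smul, vertexOp_raise, smul_add, ← insertPart, ih, ih, hadd,
      Multiset.antidiagonal_cons, Multiset.map_add, Multiset.sum_add, Multiset.map_map,
      Multiset.map_map]
    congr 1
    · congr 1
      refine Multiset.map_congr rfl fun p _ => ?_
      simp only [Function.comp_apply, Prod.map_fst, Prod.map_snd, id_eq, stateOn_cons]
      rw [insertPart, map_smul, smul_comm]; rfl
    · rw [smul_smul, Multiset.smul_sum, Multiset.map_map]
      congr 1
      refine Multiset.map_congr rfl fun p _ => ?_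
      simp only [Function.comp_apply, Prod.map_fst, Prod.map_snd, id_eq, Multiset.map_cons,
        Multiset.prod_cons, Multiset.sum_cons, smul_smul, add_assoc]

/-- `ζ(z) E_{-M}(z) v_∅`, with the value `v_∅` for `M = 0`. -/
def vertexState (y : Rˣ) (M : ℕ) : Finset ℤ →₀ R :=
  if M = 0 then vacuum R else qnum y 1 • vertexOp y M (vacuum R)

/-- This is the recursion for the coefficients in w of exp(∑_k ζ(kz) α_{-k} w^k/k) applied to the
vacuum, obtained by applying w d/dw. The value chosen for M = 0 absorbs the boundary term of
`vertexOp_vacuum_recursion`. -/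
theorem vertexState_recursion (y : Rˣ) (M : ℕ) (hM : M ≠ 0) :
    (M : R) • vertexState y M = ∑ p ∈ antidiagonal M,
      qnum y p.1 • raise R p.1 (vertexState y p.2) := by
  obtain _ | _ | N := M
  · exact absurd rfl hM
  · have h1 := vertexOp_vacuum y 0
    have h2 := raise_vacuum (R := R) 0
    simp only [zero_add, Finset.Nat.antidiagonal_zero, Finset.sum_singleton] at h1 h2
    rw [Finset.Nat.sum_antidiagonal_succ]
    simp [raise_zero, vertexState, h1, h2]
  · have h := vertexOp_vacuum_recursion y N
    rw [Finset.Nat.sum_antidiagonal_succ, Finset.Nat.sum_antidiagonal_succ']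
    simp only [raise_zero, LinearMap.zero_apply, smul_zero, zero_add]
    rw [vertexState, if_neg (by omega), vertexState, if_pos rfl, Nat.cast_succ, add_smul, one_smul,
      h, add_comm]
    rfl

end States

/-! ### Weighted sums over inserted parts -/

section Insertions
variable {R : Type} [CommRing R]

/-- `∑ ω_{k_1} ⋯ ω_{k_l} A(k_1, …, k_l, u)` over the `k_1, …, k_l` with sum `M`. -/
def insertions (w : ℕ → R) (A : Multiset ℕ → R) : ℕ → ℕ → Multiset ℕ → R
  | 0, M, u => if M = 0 then A u else 0
  | l + 1, M, u => ∑ p ∈ antidiagonal M, w p.1 * insertions w A l p.2 (p.1 ::ₘ u)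

theorem sum_antidiagonal_comm {A : Type} [AddCommMonoid A] (M : ℕ) (F : ℕ → ℕ → ℕ → A) :
    ∑ p ∈ antidiagonal M, ∑ r ∈ antidiagonal p.2, F p.1 r.1 r.2 =
      ∑ p ∈ antidiagonal M, ∑ r ∈ antidiagonal p.2, F r.1 p.1 r.2 := by
  simp only [Finset.sum_sigma']
  refine Finset.sum_nbij' (fun u => ⟨(u.2.1, u.1.1 + u.2.2), (u.1.1, u.2.2)⟩)
    (fun u => ⟨(u.2.1, u.1.1 + u.2.2), (u.1.1, u.2.2)⟩) ?_ ?_ ?_ ?_ ?_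
  · rintro ⟨⟨i, j⟩, ⟨p, n⟩⟩ h
    simp only [Finset.mem_sigma, Finset.HasAntidiagonal.mem_antidiagonal, and_true] at h ⊢; omega
  · rintro ⟨⟨i, j⟩, ⟨p, n⟩⟩ h
    simp only [Finset.mem_sigma, Finset.HasAntidiagonal.mem_antidiagonal, and_true] at h ⊢; omega
  · rintro ⟨⟨i, j⟩, ⟨p, n⟩⟩ h
    simp only [Finset.mem_sigma, Finset.HasAntidiagonal.mem_antidiagonal] at h
    obtain ⟨_, rfl⟩ := h; rfl
  · rintro ⟨⟨i, j⟩, ⟨p, n⟩⟩ h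
    simp only [Finset.mem_sigma, Finset.HasAntidiagonal.mem_antidiagonal] at h
    obtain ⟨_, rfl⟩ := h; rfl
  · rintro ⟨⟨i, j⟩, ⟨p, n⟩⟩ _; rfl

/-- On the summation range M = k_1 + ⋯ + k_{l+1}, and by symmetry each k_i contributes the same
amount. -/
theorem mul_insertions_succ (w : ℕ → R) (A : Multiset ℕ → R) (l M : ℕ) (u : Multiset ℕ) :
    (M : R) * insertions w A (l + 1) M u = (l + 1 : ℕ) *
      ∑ p ∈ antidiagonal M, (p.1 : R) * w p.1 * insertions w A l p.2 (p.1 ::ₘ u) := by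
  induction l generalizing M u with
  | zero =>
    rw [insertions, Finset.mul_sum, zero_add, Nat.cast_one, one_mul]
    refine Finset.sum_congr rfl fun p hp => ?_
    rw [Finset.HasAntidiagonal.mem_antidiagonal] at hp
    rw [insertions]
    split_ifs with h
    · rw [← hp, h, add_zero, mul_assoc]
    · simp
  | succ l ih =>
    have h1 : (M : R) * insertions w A (l + 1 + 1) M u =
        (∑ p ∈ antidiagonal M, (p.1 : R) * w p.1 * insertions w A (l + 1) p.2 (p.1 ::ₘ u)) +
        ∑ p ∈ antidiagonal M, w p.1 * ((p.2 : R) * insertions w A (l + 1) p.2 (p.1 ::ₘ u)) := by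
      rw [insertions, Finset.mul_sum, ← Finset.sum_add_distrib]
      refine Finset.sum_congr rfl fun p hp => ?_
      rw [Finset.HasAntidiagonal.mem_antidiagonal] at hp
      rw [← hp]; push_cast; ring
    have h2 : ∑ p ∈ antidiagonal M, w p.1 * ((p.2 : R) * insertions w A (l + 1) p.2 (p.1 ::ₘ u)) =
        (l + 1 : ℕ) * ∑ p ∈ antidiagonal M, ∑ r ∈ antidiagonal p.2,
          (r.1 : R) * w p.1 * w r.1 * insertions w A l r.2 (r.1 ::ₘ p.1 ::ₘ u) := by
      rw [Finset.mul_sum]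
      refine Finset.sum_congr rfl fun p _ => ?_
      rw [ih, Finset.mul_sum, Finset.mul_sum, Finset.mul_sum]
      refine Finset.sum_congr rfl fun r _ => ?_
      ring
    rw [h1, h2, sum_antidiagonal_comm M fun a b c =>
      (b : R) * w a * w b * insertions w A l c (b ::ₘ a ::ₘ u)]
    have h3 : ∑ p ∈ antidiagonal M, ∑ r ∈ antidiagonal p.2,
          (p.1 : R) * w r.1 * w p.1 * insertions w A l r.2 (p.1 ::ₘ r.1 ::ₘ u) =
        ∑ p ∈ antidiagonal M, (p.1 : R) * w p.1 * insertions w A (l + 1) p.2 (p.1 ::ₘ u) := by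
      refine Finset.sum_congr rfl fun p _ => ?_
      rw [insertions, Finset.mul_sum]
      refine Finset.sum_congr rfl fun r _ => ?_
      rw [Multiset.cons_swap]; ring
    rw [h3]; push_cast; ring

theorem insertions_smul (c : R) (w : ℕ → R) (A : Multiset ℕ → R) (l M : ℕ) (u : Multiset ℕ) :
    insertions (fun k => c * w k) A l M u = c ^ l * insertions w A l M u := by
  induction l generalizing M u with
  | zero => simp [insertions]
  | succ l ih =>
    rw [insertions, insertions, Finset.mul_sum]
    refine Finset.sum_congr rfl fun p _ => ?_
    rw [ih]; ring

/-- The solution of the recursion for the exponential of the insertion operator. -/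
theorem eq_sum_insertions [Algebra ℂ R] (w : ℕ → R) (A : Multiset ℕ → R)
    (F : ℕ → Multiset ℕ → R) (h0 : ∀ u, F 0 u = A u)
    (hF : ∀ M : ℕ, M ≠ 0 → ∀ u, (M : R) * F M u =
      ∑ p ∈ antidiagonal M, (p.1 : R) * w p.1 * F p.2 (p.1 ::ₘ u)) (hw : w 0 = 0)
    (M B : ℕ) (hB : M ≤ B) (u : Multiset ℕ) :
    F M u = ∑ l ∈ Finset.range (B + 1),
      algebraMap ℂ R (l.factorial : ℂ)⁻¹ * insertions w A l M u := by
  induction M using Nat.strong_induction_on generalizing B u with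
  | _ M ih =>
  rcases Nat.eq_zero_or_pos M with rfl | hM
  · rw [h0, Finset.sum_range_succ', Finset.sum_eq_zero]
    · simp [insertions]
    · intro l _
      simp [insertions, hw]
  -- Any bound at least M is admissible: more than M insertions would require a part 0, whose weight
  -- is zero. Removing one part lowers the bound by one.
  · obtain ⟨B, rfl⟩ : ∃ B', B = B' + 1 := ⟨B - 1, by omega⟩
    have hu : IsUnit (M : R) := by
      rw [← map_natCast (algebraMap ℂ R)]
      exact (IsUnit.mk0 _ (Nat.cast_ne_zero.2 hM.ne')).map _
    apply hu.mul_left_cancel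
    rw [hF M hM.ne', Finset.sum_range_succ', mul_add]
    have h1 : (M : R) * (algebraMap ℂ R ((0).factorial : ℂ)⁻¹ * insertions w A 0 M u) = 0 := by
      simp [insertions, hM.ne']
    rw [h1, add_zero, Finset.mul_sum]
    have h2 : ∀ l, (M : R) * (algebraMap ℂ R ((l + 1).factorial : ℂ)⁻¹ *
        insertions w A (l + 1) M u) = ∑ p ∈ antidiagonal M, (p.1 : R) * w p.1 *
          (algebraMap ℂ R (l.factorial : ℂ)⁻¹ * insertions w A l p.2 (p.1 ::ₘ u)) := by
      intro l
      have h3 : algebraMap ℂ R ((l + 1).factorial : ℂ)⁻¹ * ((l + 1 : ℕ) : R) =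
          algebraMap ℂ R (l.factorial : ℂ)⁻¹ := by
        rw [← map_natCast (algebraMap ℂ R), ← map_mul, Nat.factorial_succ, Nat.cast_mul, mul_inv,
          mul_right_comm, inv_mul_cancel₀ (Nat.cast_ne_zero.2 l.succ_ne_zero), one_mul]
      rw [mul_left_comm, mul_insertions_succ, ← mul_assoc, h3, Finset.mul_sum]
      refine Finset.sum_congr rfl fun p _ => ?_
      ring
    simp only [h2]
    rw [Finset.sum_comm]
    refine Finset.sum_congr rfl fun p hp => ?_
    rw [Finset.HasAntidiagonal.mem_antidiagonal] at hp
    rw [← Finset.mul_sum]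
    rcases Nat.eq_zero_or_pos p.1 with h | h
    · simp [h]
    · rw [ih p.2 (by omega) B (by omega)]

end Insertions

/-! ### Functionals on states and extension of scalars -/

section Functionals
variable {R : Type} [CommRing R] [Algebra ℂ R]

/-- The functional on states with the values `ℓ` on the basis vectors. -/
def stateFun (ℓ : Finset ℤ → ℂ) : (Finset ℤ →₀ R) →ₗ[R] R :=
  Finsupp.linearCombination R fun E => algebraMap ℂ R (ℓ E)

/-- The functional that produces Hurwitz numbers depends on the energy of the state through |μ|/q,
hence a family `ℓ`. Along the recursion a part moves from M into `u`, and M + `u.sum` does not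
change. -/
theorem stateFun_vertexState (ℓ : ℕ → Finset ℤ → ℂ) (y : Rˣ) (M B : ℕ) (hB : M ≤ B)
    (u : Multiset ℕ) :
    stateFun (ℓ (M + u.sum)) (stateOn u (vertexState y M)) =
      ∑ l ∈ Finset.range (B + 1), algebraMap ℂ R (l.factorial : ℂ)⁻¹ *
        insertions (qnum y) (fun s => stateFun (ℓ s.sum) (stateOn s (vacuum R))) l M u := by
  refine eq_sum_insertions (qnum y) _
    (fun M u => stateFun (ℓ (M + u.sum)) (stateOn u (vertexState y M))) ?_ ?_ ?_ M B hB u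
  · intro u; simp [vertexState]
  · intro M hM u
    rw [← smul_eq_mul, ← map_smul, ← stateOn_smul, vertexState_recursion y M hM, stateOn_sum,
      map_sum]
    refine Finset.sum_congr rfl fun p hp => ?_
    rw [Finset.HasAntidiagonal.mem_antidiagonal] at hp
    rw [stateOn_smul, stateOn_raise, map_smul, map_smul, smul_eq_mul, smul_eq_mul,
      Multiset.sum_cons, ← hp]
    have : p.2 + (p.1 + u.sum) = p.1 + p.2 + u.sum := by ring
    rw [this]; ring
  · simp [qnum]

/-- Extension of scalars for states. -/
def baseChange (R : Type) [CommRing R] [Algebra ℂ R] :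
    (Finset ℤ →₀ ℂ) →ₗ[ℂ] (Finset ℤ →₀ R) :=
  Finsupp.mapRange.linearMap (Algebra.linearMap ℂ R)

theorem baseChange_single (E : Finset ℤ) (c : ℂ) :
    baseChange R (Finsupp.single E c) = Finsupp.single E (algebraMap ℂ R c) := by
  simp [baseChange]

theorem baseChange_raise (k : ℕ) (v : Finset ℤ →₀ ℂ) :
    baseChange R (raise ℂ k v) = raise R k (baseChange R v) := by
  induction v using Finsupp.induction_linear with
  | zero => simp
  | add f g hf hg => simp only [map_add, hf, hg]
  | single E c =>
    rw [baseChange_single, raise, raise, oneBody, oneBody, Finsupp.linearCombination_single,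
      Finsupp.linearCombination_single, Finset.smul_sum, Finset.smul_sum, map_sum]
    refine Finset.sum_congr rfl fun j _ => ?_
    rw [Finsupp.smul_single, Finsupp.smul_single, baseChange_single]
    congr 1
    simp

theorem baseChange_stateOn (s : Multiset ℕ) (v : Finset ℤ →₀ ℂ) :
    baseChange R (stateOn s v) = stateOn s (baseChange R v) := by
  induction s using Multiset.induction with
  | empty => rfl
  | cons k s ih =>
    rw [stateOn_cons, stateOn_cons, ← ih, insertPart, insertPart, map_smul, baseChange_raise]
    ext E
    simp [Algebra.smul_def]

theorem baseChange_vacuum : baseChange R (vacuum ℂ) = vacuum R := by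
  rw [vacuum, baseChange_single, map_one]; rfl

theorem stateFun_baseChange (ℓ : Finset ℤ → ℂ) (v : Finset ℤ →₀ ℂ) :
    stateFun ℓ (baseChange R v) = algebraMap ℂ R (stateFun ℓ v) := by
  induction v using Finsupp.induction_linear with
  | zero => simp
  | add f g hf hg => simp only [map_add, hf, hg]
  | single E c => rw [baseChange_single]; simp [stateFun]

theorem coeff_stateFun_diagonal (ℓ : Finset ℤ → ℂ) (f : ℤ → PowerSeries ℂ) (p : ℕ)
    (v : Finset ℤ →₀ ℂ) :
    PowerSeries.coeff p (stateFun ℓ (diagonal f (baseChange (PowerSeries ℂ) v))) =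
      stateFun ℓ (diagonal (fun j => PowerSeries.coeff p (f j)) v) := by
  induction v using Finsupp.induction_linear with
  | zero => simp
  | add f g hf hg => simp only [map_add, hf, hg]
  | single E c =>
    rw [baseChange_single, diagonal_single, diagonal_single,
      (stateFun (R := PowerSeries ℂ) ℓ).map_smul, (stateFun (R := ℂ) ℓ).map_smul]
    simp only [stateFun, Finsupp.linearCombination_single, smul_eq_mul, ← map_mul]
    have h : ∀ (x : PowerSeries ℂ) (d : ℂ), PowerSeries.coeff p
        (x * algebraMap ℂ (PowerSeries ℂ) d) = PowerSeries.coeff p x * d := fun x d => by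
      rw [← PowerSeries.C_eq_algebraMap, PowerSeries.coeff_mul_C]
    rw [h, map_sum]
    congr 1
    refine Finset.sum_congr rfl fun j _ => ?_
    split_ifs <;> simp

end Functionals

/-! ### Cut-and-join for the disconnected numbers -/

section Moments

/-- The functional `v ↦ ⟨α_q^{e/q} / (q^{e/q} (e/q)!) (𝓕_{r+1}/(r+1))^b v⟩` on states of energy `e`. -/
def hurwitzFun (q r b e : ℕ) (E : Finset ℤ) : ℂ :=
  if q ∣ e then
    vev (((q : ℂ) ^ (e / q) * ((e / q).factorial : ℂ))⁻¹ •
      (alpha (q : ℤ) ^ (e / q) * (((r : ℂ) + 1)⁻¹ • completedCycle (r + 1)) ^ b *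
        Finsupp.linearCombination ℂ fun _ => Finsupp.single E 1))
  else 0

/-- The disconnected numbers, as a function of the multiset of the `μ_i`. -/
def disconnectedNumber (q r b : ℕ) (s : Multiset ℕ) : ℂ :=
  stateFun (hurwitzFun q r b s.sum) (stateOn s (vacuum ℂ))

theorem stateFun_hurwitzFun (q r b e : ℕ) (v : Finset ℤ →₀ ℂ) :
    stateFun (hurwitzFun q r b e) v = if q ∣ e then
      (((q : ℂ) ^ (e / q) * ((e / q).factorial : ℂ))⁻¹ •
      (alpha (q : ℤ) ^ (e / q) * (((r : ℂ) + 1)⁻¹ • completedCycle (r + 1)) ^ b) : Module.End ℂ Wedge) v ∅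
    else 0 := by
  induction v using Finsupp.induction_linear with
  | zero => simp
  | add f g hf hg => rw [map_add, hf, hg]; split_ifs <;> simp
  | single E c =>
    rw [stateFun, Finsupp.linearCombination_single, hurwitzFun]
    split_ifs with h
    · simp only [vev, LinearMap.smul_apply, Module.End.mul_apply, Finsupp.linearCombination_single,
        one_smul]
      rw [← mul_one c, ← smul_eq_mul c 1, ← Finsupp.smul_single]
      simp only [map_smul, Finsupp.smul_apply, smul_eq_mul, Algebra.algebraMap_self, RingHom.id_apply]
      ring
    · simp

theorem hDisconnected_eq (q r b : ℕ) (μ : List ℕ) :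
    hDisconnected q r μ b = disconnectedNumber q r b (μ : Multiset ℕ) := by
  have h : (μ.map fun k : ℕ => (k : ℂ)⁻¹ • alpha (-(k : ℤ))).prod (Finsupp.single ∅ 1) =
      stateOn (μ : Multiset ℕ) (vacuum ℂ) := by
    induction μ with
    | nil => rfl
    | cons k μ ih =>
      rw [List.map_cons, List.prod_cons, Module.End.mul_apply, ih, ← Multiset.cons_coe,
        stateOn_cons, insertPart, LinearMap.smul_apply, alpha_eq_oneBody]
      rfl
  rw [disconnectedNumber, stateFun_hurwitzFun, hDisconnected, Multiset.sum_coe]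
  simp only [vev, LinearMap.smul_apply, Module.End.mul_apply, h]

theorem completedCycle_eq_diagonal (p : ℕ) :
    completedCycle p = diagonal fun j => ((j : ℂ) + 1 / 2) ^ p := rfl

theorem disconnectedNumber_succ (q r b : ℕ) (s : Multiset ℕ) :
    disconnectedNumber q r (b + 1) s = ((r : ℂ) + 1)⁻¹ * stateFun (hurwitzFun q r b s.sum)
      (diagonal (fun j => ((j : ℂ) + 1 / 2) ^ (r + 1)) (stateOn s (vacuum ℂ))) := by
  rw [disconnectedNumber, stateFun_hurwitzFun, stateFun_hurwitzFun]
  split_ifs with h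
  · simp only [pow_succ (_ • completedCycle (r + 1)) b, ← completedCycle_eq_diagonal,
      LinearMap.smul_apply, Module.End.mul_apply, map_smul, Finsupp.smul_apply, smul_eq_mul]
    ring
  · simp

/-- The power series `e^{z/2}`. -/
def expHalf : (PowerSeries ℂ)ˣ where
  val := PowerSeries.rescale (1 / 2 : ℂ) (PowerSeries.exp ℂ)
  inv := PowerSeries.rescale (-(1 / 2) : ℂ) (PowerSeries.exp ℂ)
  val_inv := by rw [PowerSeries.exp_mul_exp_eq_exp_add]; simp
  inv_val := by rw [PowerSeries.exp_mul_exp_eq_exp_add]; simp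

theorem expHalf_zpow (k : ℤ) :
    ((expHalf ^ k : (PowerSeries ℂ)ˣ) : PowerSeries ℂ) =
      PowerSeries.rescale ((k : ℂ) / 2) (PowerSeries.exp ℂ) := by
  induction k using Int.induction_on with
  | zero => simp
  | succ k ih =>
    rw [zpow_add_one, Units.val_mul, ih]
    change _ * PowerSeries.rescale (1 / 2 : ℂ) (PowerSeries.exp ℂ) = _
    rw [PowerSeries.exp_mul_exp_eq_exp_add]
    congr 2; push_cast; ring
  | pred k ih =>
    rw [zpow_sub_one, Units.val_mul, ih]
    change _ * PowerSeries.rescale (-(1 / 2) : ℂ) (PowerSeries.exp ℂ) = _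
    rw [PowerSeries.exp_mul_exp_eq_exp_add]
    congr 2; push_cast; ring

theorem coeff_rescale_exp (a : ℂ) (p : ℕ) :
    PowerSeries.coeff p (PowerSeries.rescale a (PowerSeries.exp ℂ)) = a ^ p / p.factorial := by
  rw [PowerSeries.coeff_rescale, PowerSeries.coeff_exp]
  simp [div_eq_mul_inv]

theorem zeta_eq_X_mul : zeta = PowerSeries.X * zetaDivZ := by
  ext n
  cases n with
  | zero => rw [zeta, map_sub, coeff_rescale_exp, coeff_rescale_exp, PowerSeries.coeff_zero_X_mul]; simp
  | succ n => rw [PowerSeries.coeff_succ_X_mul, zetaDivZ, PowerSeries.coeff_mk]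

theorem qnum_expHalf (k : ℕ) :
    qnum expHalf k = PowerSeries.X * ((k : PowerSeries ℂ) * PowerSeries.rescale (k : ℂ) zetaDivZ) := by
  have h : qnum expHalf k = PowerSeries.rescale (k : ℂ) zeta := by
    rw [qnum, expHalf_zpow, expHalf_zpow, zeta, map_sub, PowerSeries.rescale_rescale,
      PowerSeries.rescale_rescale]
    congr 3 <;> push_cast <;> ring
  rw [h, zeta_eq_X_mul, map_mul, PowerSeries.rescale_X, ← map_natCast (PowerSeries.C (R := ℂ))]
  ring

theorem zetaDivZ_mul_inv : zetaDivZ * zetaDivZ⁻¹ = 1 := by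
  refine PowerSeries.mul_inv_cancel _ ?_
  rw [← PowerSeries.coeff_zero_eq_constantCoeff_apply, zetaDivZ, PowerSeries.coeff_mk, zeta, map_sub,
    coeff_rescale_exp, coeff_rescale_exp]
  norm_num

/-- The cut-and-join equation for the disconnected numbers. -/
theorem disconnectedNumber_cutAndJoin (q r b : ℕ) (s : Multiset ℕ) (hs : ∀ k ∈ s, 1 ≤ k) (B : ℕ)
    (hB : s.sum ≤ B) :
    disconnectedNumber q r (b + 1) s = r.factorial * ((s.antidiagonal.filter fun p => p.1 ≠ 0).map
      fun p => ∑ l ∈ Finset.range (B + 1), (l.factorial : ℂ)⁻¹ *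
        PowerSeries.coeff (r + 2) (PowerSeries.X ^ (p.1.card + l) * (zetaDivZ⁻¹ *
          ((p.1.map fun k : ℕ => PowerSeries.rescale (k : ℂ) zetaDivZ).prod *
          insertions (fun k : ℕ => (k : PowerSeries ℂ) * PowerSeries.rescale (k : ℂ) zetaDivZ)
            (fun s => PowerSeries.C (disconnectedNumber q r b s)) l p.1.sum p.2)))).sum := by
  set L : (Finset ℤ →₀ PowerSeries ℂ) →ₗ[PowerSeries ℂ] PowerSeries ℂ :=
    stateFun (hurwitzFun q r b s.sum) with hL
  -- The power k^{r+1} is (r+1)! times the coefficient of z^{r+1} in e^{kz}; the normalization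
  -- 1/(r+1) of the completed cycle leaves r!.
  have h1 : disconnectedNumber q r (b + 1) s = r.factorial * PowerSeries.coeff (r + 1)
      (L (vertexOp expHalf 0 (stateOn s (vacuum _)))) := by
    rw [disconnectedNumber_succ, vertexOp, if_pos rfl, ← baseChange_vacuum (R := PowerSeries ℂ),
      ← baseChange_stateOn,
      hL, coeff_stateFun_diagonal]
    have h : (fun j : ℤ => ((j : ℂ) + 1 / 2) ^ (r + 1)) = fun j : ℤ =>
        ((r + 1).factorial : ℂ) * PowerSeries.coeff (r + 1)
          ((expHalf ^ (2 * j + 1) : (PowerSeries ℂ)ˣ) : PowerSeries ℂ) := by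
      funext j
      rw [expHalf_zpow, coeff_rescale_exp, mul_div_cancel₀ _ (Nat.cast_ne_zero.2 (Nat.factorial_ne_zero _))]
      congr 1; push_cast; ring
    have h' : ∀ (c : ℂ) (f : ℤ → ℂ) v, diagonal (fun j => c * f j) v = c • diagonal f v := by
      intro c f v
      induction v using Finsupp.induction_linear with
      | zero => simp
      | add f g hf hg => simp only [map_add, hf, hg, smul_add]
      | single E d =>
        rw [diagonal_single, diagonal_single, smul_smul, Finset.mul_sum]
        congr 1
        refine Finset.sum_congr rfl fun j _ => ?_
        split_ifs <;> simp
    rw [h, h', map_smul, smul_eq_mul, ← mul_assoc, Nat.factorial_succ]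
    congr 1
    push_cast
    rw [← mul_assoc, inv_mul_cancel₀ (by exact_mod_cast r.succ_ne_zero), one_mul]
  -- A factor ζ(z) = z S(z) is supplied here in order to use `vertexState`, which contains it; this
  -- moves the coefficient from r + 1 to r + 2 and leaves 1/S(z).
  have h2 : ∀ x : PowerSeries ℂ, PowerSeries.coeff (r + 1) x =
      PowerSeries.coeff (r + 2) (zetaDivZ⁻¹ * (qnum expHalf 1 * x)) := by
    intro x
    have : zetaDivZ⁻¹ * (qnum expHalf 1 * x) = PowerSeries.X * x := by
      rw [qnum_expHalf]
      simp only [Nat.cast_one, PowerSeries.rescale_one, RingHom.id_apply, one_mul]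
      linear_combination (PowerSeries.X * x) * zetaDivZ_mul_inv
    rw [this, PowerSeries.coeff_succ_X_mul]
  have h3 : qnum expHalf 1 * L (vertexOp expHalf 0 (stateOn s (vacuum _))) =
      ((s.antidiagonal.filter fun p => p.1 ≠ 0).map fun p => ∑ l ∈ Finset.range (B + 1),
        PowerSeries.C ((l.factorial : ℂ)⁻¹) * (PowerSeries.X ^ (p.1.card + l) *
          ((p.1.map fun k : ℕ => PowerSeries.rescale (k : ℂ) zetaDivZ).prod *
          insertions (fun k : ℕ => (k : PowerSeries ℂ) * PowerSeries.rescale (k : ℂ) zetaDivZ)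
            (fun s => PowerSeries.C (disconnectedNumber q r b s)) l p.1.sum p.2))).sum := by
    rw [vertexOp_stateOn]
    conv_lhs => rw [← Multiset.filter_add_not (fun p : Multiset ℕ × Multiset ℕ => p.1 ≠ 0)
      s.antidiagonal, Multiset.map_add, Multiset.sum_add]
    -- If no part is absorbed, E_0 reaches the vacuum and annihilates it.
    have h4 : ((s.antidiagonal.filter fun p => ¬ p.1 ≠ 0).map fun p : Multiset ℕ × Multiset ℕ =>
        (p.1.map fun k : ℕ => algebraMap ℂ (PowerSeries ℂ) (k : ℂ)⁻¹ * qnum expHalf k).prod •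
        stateOn p.2 (vertexOp expHalf (0 + p.1.sum) (vacuum (PowerSeries ℂ)))).sum = 0 := by
      refine Multiset.sum_eq_zero fun x hx => ?_
      obtain ⟨p, hp, rfl⟩ := Multiset.mem_map.1 hx
      rw [Multiset.mem_filter, not_not] at hp
      have : vertexOp expHalf 0 (vacuum (PowerSeries ℂ)) = 0 := by
        simp [vertexOp, vacuum, diagonal_single]
      rw [hp.2, Multiset.sum_zero, zero_add, this]
      have h0 := stateOn_smul p.2 (0 : PowerSeries ℂ) (0 : Finset ℤ →₀ PowerSeries ℂ)
      rw [zero_smul, zero_smul] at h0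
      rw [h0, smul_zero]
    rw [h4, add_zero, ← smul_eq_mul, ← map_smul, Multiset.smul_sum, map_multiset_sum,
      Multiset.map_map, Multiset.map_map]
    congr 1
    refine Multiset.map_congr rfl fun p hp => ?_
    rw [Multiset.mem_filter, Multiset.mem_antidiagonal] at hp
    have hp1 : ∀ k ∈ p.1, 1 ≤ k := fun k hk => hs k (by rw [← hp.1]; exact Multiset.mem_add.2 (Or.inl hk))
    have hsum : s.sum = p.1.sum + p.2.sum := by rw [← hp.1, Multiset.sum_add]
    have hpos : p.1.sum ≠ 0 := by
      obtain ⟨k, hk⟩ := Multiset.exists_mem_of_ne_zero hp.2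
      have := Multiset.single_le_sum (fun _ _ => Nat.zero_le _) k hk
      have := hp1 k hk
      omega
    have h5 : qnum expHalf 1 • vertexOp expHalf (0 + p.1.sum) (vacuum (PowerSeries ℂ)) =
        vertexState expHalf p.1.sum := by
      rw [vertexState, if_neg hpos, zero_add]
    have h6 : (p.1.map fun k : ℕ => algebraMap ℂ (PowerSeries ℂ) (k : ℂ)⁻¹ * qnum expHalf k).prod =
        PowerSeries.X ^ p.1.card * (p.1.map fun k : ℕ => PowerSeries.rescale (k : ℂ) zetaDivZ).prod := by
      rw [← Multiset.prod_replicate, ← Multiset.map_const', ← Multiset.prod_map_mul]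
      congr 1
      refine Multiset.map_congr rfl fun k hk => ?_
      have hk0 : (k : ℂ) ≠ 0 := Nat.cast_ne_zero.2 (by have := hp1 k hk; omega)
      rw [qnum_expHalf, ← map_natCast (algebraMap ℂ (PowerSeries ℂ)), mul_left_comm, ← mul_assoc _ _ (PowerSeries.rescale _ _),
        ← map_mul, inv_mul_cancel₀ hk0, map_one, one_mul]
    simp only [Function.comp_apply]
    rw [smul_comm, ← stateOn_smul, h5, map_smul, hL, hsum,
      stateFun_vertexState (hurwitzFun q r b) expHalf p.1.sum B (by omega) p.2, h6, smul_eq_mul,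
      Finset.mul_sum]
    refine Finset.sum_congr rfl fun l _ => ?_
    have h7 : (fun t : Multiset ℕ => stateFun (hurwitzFun q r b t.sum) (stateOn t (vacuum (PowerSeries ℂ)))) =
        fun t => PowerSeries.C (disconnectedNumber q r b t) := by
      funext t
      rw [← baseChange_vacuum (R := PowerSeries ℂ), ← baseChange_stateOn, stateFun_baseChange]; rfl
    have h8 : qnum expHalf = fun k : ℕ => PowerSeries.X *
        ((k : PowerSeries ℂ) * PowerSeries.rescale (k : ℂ) zetaDivZ) := funext qnum_expHalf
    rw [h7, h8, insertions_smul, pow_add, PowerSeries.C_eq_algebraMap]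
    ring
  rw [h1, h2, h3, ← smul_eq_mul (zetaDivZ⁻¹), Multiset.smul_sum, map_multiset_sum, Multiset.map_map,
    Multiset.map_map]
  congr 2
  refine Multiset.map_congr rfl fun p _ => ?_
  simp only [Function.comp_apply, smul_eq_mul]
  rw [Finset.mul_sum, map_sum]
  refine Finset.sum_congr rfl fun l _ => ?_
  rw [← PowerSeries.coeff_C_mul]
  congr 1; ring

end Moments

/-! ### Functions of finite sets, with the convolution product -/

/-- Functions of finite subsets of `ι`, with `(f * g)(S) = ∑_{T ⊆ S} f(T) g(S ∖ T)`. -/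
structure SetFun (ι R : Type) : Type where
  /-- A function of finite sets as an element of `SetFun ι R`. -/
  of ::
  /-- The values. -/
  toFun : Finset ι → R

instance {ι R : Type} : CoeFun (SetFun ι R) fun _ => Finset ι → R := ⟨SetFun.toFun⟩

namespace SetFun

theorem of_apply {ι R : Type} (f : Finset ι → R) (S : Finset ι) : of f S = f S := rfl

variable {ι R : Type} [DecidableEq ι] [CommRing R]

theorem toFun_injective : Function.Injective (toFun : SetFun ι R → Finset ι → R) :=
  fun ⟨_⟩ ⟨_⟩ h => congrArg of h

instance : Zero (SetFun ι R) := ⟨of fun _ => 0⟩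
instance : Add (SetFun ι R) := ⟨fun f g => of fun S => f S + g S⟩
instance : Neg (SetFun ι R) := ⟨fun f => of fun S => -f S⟩
instance : Sub (SetFun ι R) := ⟨fun f g => of fun S => f S - g S⟩
instance : SMul ℕ (SetFun ι R) := ⟨fun c f => of fun S => c • f S⟩
instance : SMul ℤ (SetFun ι R) := ⟨fun c f => of fun S => c • f S⟩

instance : AddCommGroup (SetFun ι R) :=
  toFun_injective.addCommGroup _ rfl (fun _ _ => rfl) (fun _ => rfl) (fun _ _ => rfl)
    (fun _ _ => rfl) (fun _ _ => rfl)

instance : Mul (SetFun ι R) := ⟨fun f g => of fun S => ∑ T ∈ S.powerset, f T * g (S \ T)⟩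

instance : One (SetFun ι R) := ⟨of fun S => if S = ∅ then 1 else 0⟩

@[ext] theorem ext {f g : SetFun ι R} (h : ∀ S, f S = g S) : f = g := toFun_injective (funext h)

theorem mul_apply (f g : SetFun ι R) (S : Finset ι) :
    (f * g) S = ∑ T ∈ S.powerset, f T * g (S \ T) := rfl

theorem one_apply (S : Finset ι) : (1 : SetFun ι R) S = if S = ∅ then 1 else 0 := rfl

theorem add_apply (f g : SetFun ι R) (S : Finset ι) : (f + g) S = f S + g S := rfl

theorem zero_apply (S : Finset ι) : (0 : SetFun ι R) S = 0 := rfl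

theorem sum_powerset_compl {A : Type} [AddCommMonoid A] (S : Finset ι) (F : Finset ι → Finset ι → A) :
    ∑ T ∈ S.powerset, F T (S \ T) = ∑ T ∈ S.powerset, F (S \ T) T :=
  Finset.sum_nbij' (S \ ·) (S \ ·) (by simp) (by simp)
    (fun T hT => by simpa using Finset.mem_powerset.1 hT)
    (fun T hT => by simpa using Finset.mem_powerset.1 hT)
    (fun T hT => by simp [Finset.mem_powerset.1 hT])

theorem sum_powerset_assoc {A : Type} [AddCommMonoid A] (S : Finset ι)
    (F : Finset ι → Finset ι → Finset ι → A) :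
    ∑ T ∈ S.powerset, ∑ U ∈ T.powerset, F U (T \ U) (S \ T) =
      ∑ U ∈ S.powerset, ∑ V ∈ (S \ U).powerset, F U V ((S \ U) \ V) := by
  simp only [Finset.sum_sigma']
  refine Finset.sum_nbij' (fun x => ⟨x.2, x.1 \ x.2⟩) (fun x => ⟨x.1 ∪ x.2, x.1⟩) ?_ ?_ ?_ ?_ ?_
  · rintro ⟨T, U⟩ h
    simp only [Finset.mem_sigma, Finset.mem_powerset] at h ⊢
    exact ⟨h.2.trans h.1, Finset.sdiff_subset_sdiff h.1 le_rfl⟩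
  · rintro ⟨U, V⟩ h
    simp only [Finset.mem_sigma, Finset.mem_powerset] at h ⊢
    exact ⟨Finset.union_subset h.1 (h.2.trans Finset.sdiff_subset), Finset.subset_union_left⟩
  · rintro ⟨T, U⟩ h
    simp only [Finset.mem_sigma, Finset.mem_powerset] at h
    simp [Finset.union_sdiff_of_subset h.2]
  · rintro ⟨U, V⟩ h
    simp only [Finset.mem_sigma, Finset.mem_powerset] at h
    have : Disjoint V U := (Finset.disjoint_sdiff.mono_right h.2).symm
    simp [Finset.union_sdiff_left, this.sdiff_eq_left]
  · rintro ⟨T, U⟩ h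
    simp only [Finset.mem_sigma, Finset.mem_powerset] at h
    congr 1
    ext x
    simp only [Finset.mem_sdiff]
    have := @h.2 x
    tauto

theorem mul_comm' (f g : SetFun ι R) : f * g = g * f := by
  ext S
  rw [mul_apply, mul_apply, sum_powerset_compl S fun T U => f T * g U]
  exact Finset.sum_congr rfl fun T _ => mul_comm _ _

theorem mul_assoc' (f g h : SetFun ι R) : f * g * h = f * (g * h) := by
  ext S
  rw [mul_apply, mul_apply]
  simp only [mul_apply, Finset.sum_mul, Finset.mul_sum]
  rw [sum_powerset_assoc S fun U V W => f U * g V * h W]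
  refine Finset.sum_congr rfl fun U _ => Finset.sum_congr rfl fun V _ => mul_assoc _ _ _

theorem one_mul' (f : SetFun ι R) : 1 * f = f := by
  ext S
  rw [mul_apply, Finset.sum_eq_single ∅]
  · simp [one_apply]
  · intro T _ hT; simp [one_apply, hT]
  · simp

instance : CommRing (SetFun ι R) :=
  { (inferInstance : AddCommGroup (SetFun ι R)), (inferInstance : Mul (SetFun ι R)),
    (inferInstance : One (SetFun ι R)) with
    left_distrib := fun f g h => by
      ext S
      simp only [add_apply, mul_apply, mul_add, Finset.sum_add_distrib]
    right_distrib := fun f g h => by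
      ext S
      simp only [add_apply, mul_apply, add_mul, Finset.sum_add_distrib]
    zero_mul := fun f => by
      ext S
      simp [zero_apply, mul_apply]
    mul_zero := fun f => by
      ext S
      simp [zero_apply, mul_apply]
    mul_assoc := mul_assoc'
    one_mul := one_mul'
    mul_one := fun f => by rw [mul_comm', one_mul']
    mul_comm := mul_comm'
    zsmul := fun n f => n • f
    nsmul := fun n f => n • f }

theorem sum_apply {α : Type} (s : Finset α) (f : α → SetFun ι R) (S : Finset ι) :
    (∑ i ∈ s, f i) S = ∑ i ∈ s, f i S := by
  classical
  induction s using Finset.induction_on with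
  | empty => rfl
  | insert a s ha ih => rw [Finset.sum_insert ha, Finset.sum_insert ha, add_apply, ih]

/-- The scalars, supported on `∅`. -/
def scalar : R →+* SetFun ι R where
  toFun c := of fun S => if S = ∅ then c else 0
  map_one' := rfl
  map_mul' a b := by
    ext S
    change _ = ∑ T ∈ S.powerset, (if T = ∅ then a else 0) * (if S \ T = ∅ then b else 0)
    rw [Finset.sum_eq_single ∅]
    · by_cases h : S = ∅ <;> simp [h]
    · intro T _ hT; simp [hT]
    · simp
  map_zero' := by ext S; simp [zero_apply]
  map_add' a b := by
    ext S
    change _ = (if S = ∅ then a else 0) + (if S = ∅ then b else 0)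
    by_cases h : S = ∅ <;> simp [h]

theorem scalar_apply (c : R) (S : Finset ι) :
    (scalar c : SetFun ι R) S = if S = ∅ then c else 0 := rfl

theorem scalar_mul_apply (c : R) (f : SetFun ι R) (S : Finset ι) :
    (scalar c * f : SetFun ι R) S = c * f S := by
  rw [mul_apply, Finset.sum_eq_single ∅]
  · simp [scalar_apply]
  · intro T _ hT; simp [scalar_apply, hT]
  · simp

/-- Change of the coefficients. -/
def map {R' : Type} [CommRing R'] (φ : R →+* R') : SetFun ι R →+* SetFun ι R' where
  toFun f := of fun S => φ (f S)
  map_one' := by ext S; rw [one_apply]; by_cases h : S = ∅ <;> simp [h, one_apply]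
  map_mul' f g := by
    ext S
    change _ = ∑ T ∈ S.powerset, φ (f T) * φ (g (S \ T))
    simp [mul_apply, map_sum]
  map_zero' := by ext S; simp [zero_apply]
  map_add' f g := by
    ext S
    change _ = φ (f S) + φ (g S)
    simp [add_apply]

theorem map_apply {R' : Type} [CommRing R'] (φ : R →+* R') (f : SetFun ι R) (S : Finset ι) :
    map φ f S = φ (f S) := rfl

end SetFun

/-! ### Ordered splittings and exponential generating series -/

section Splittings
variable {α R : Type} [DecidableEq α] [CommRing R]

theorem mem_splittings [Fintype α] {s : Finset α} {l : ℕ} {K : Fin l → Finset α} :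
    K ∈ splittings s l ↔
      (∀ i j, i ≠ j → Disjoint (K i) (K j)) ∧ ∀ x, x ∈ s ↔ ∃ j, x ∈ K j := by
  classical
  simp only [splittings, Finset.mem_filter, Finset.mem_univ, true_and, Finset.ext_iff,
    Finset.mem_biUnion]
  constructor
  · rintro ⟨h1, h2⟩; exact ⟨h1, fun x => (h2 x).symm⟩
  · rintro ⟨h1, h2⟩; exact ⟨h1, fun x => (h2 x).symm⟩

theorem sum_splittings_succ [Fintype α] {A : Type} [AddCommMonoid A] (s : Finset α) (l : ℕ)
    (F : Finset α → (Fin l → Finset α) → A) :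
    ∑ K ∈ splittings s (l + 1), F (K 0) (Fin.tail K) =
      ∑ T ∈ s.powerset, ∑ K ∈ splittings (s \ T) l, F T K := by
  rw [Finset.sum_sigma']
  refine Finset.sum_nbij' (fun K => ⟨K 0, Fin.tail K⟩) (fun x => Fin.cons x.1 x.2) ?_ ?_ ?_ ?_ ?_
  · intro K hK
    rw [mem_splittings] at hK
    simp only [Finset.mem_sigma, Finset.mem_powerset, mem_splittings]
    refine ⟨fun x hx => (hK.2 x).2 ⟨0, hx⟩, fun i j hij => hK.1 _ _ (by simpa using hij), fun x => ?_⟩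
    rw [Finset.mem_sdiff, hK.2]
    constructor
    · rintro ⟨⟨j, hj⟩, h0⟩
      obtain ⟨j, rfl⟩ := Fin.exists_succ_eq.2 (show j ≠ 0 from fun h => h0 (h ▸ hj))
      exact ⟨j, hj⟩
    · rintro ⟨j, hj⟩
      exact ⟨⟨j.succ, hj⟩, Finset.disjoint_left.1 (hK.1 _ _ (Fin.succ_ne_zero j)) hj⟩
  · rintro ⟨T, K⟩ h
    simp only [Finset.mem_sigma, Finset.mem_powerset, mem_splittings] at h
    obtain ⟨hT, hd, hu⟩ := h
    have hTK : ∀ j, Disjoint T (K j) := fun j => by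
      rw [Finset.disjoint_right]
      intro x hx
      exact (Finset.mem_sdiff.1 ((hu x).2 ⟨j, hx⟩)).2
    rw [mem_splittings]
    refine ⟨fun i j => ?_, fun x => ?_⟩
    · refine Fin.cases ?_ (fun i => ?_) i <;> refine Fin.cases ?_ (fun j => ?_) j
      · simp
      · intro _; simpa using hTK j
      · intro _; simpa using (hTK i).symm
      · intro h; simpa using hd i j (by simpa using h)
    · rw [Fin.exists_fin_succ]
      simp only [Fin.cons_zero, Fin.cons_succ]
      rw [← hu, Finset.mem_sdiff]
      have := @hT x
      tauto
  · intro K _; exact Fin.cons_self_tail K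
  · rintro ⟨T, K⟩ _; simp [Fin.tail_cons]
  · intro K _; rfl

theorem SetFun.prod_apply [Fintype α] (l : ℕ) (f : Fin l → SetFun α R) (S : Finset α) :
    (∏ j, f j) S = ∑ K ∈ splittings S l, ∏ j, f j (K j) := by
  induction l generalizing S with
  | zero =>
    by_cases h : S = ∅
    · have : splittings S 0 = Finset.univ := by
        ext K
        simp only [mem_splittings, h, Finset.mem_univ, iff_true]
        exact ⟨fun i => i.elim0, fun x => by simp⟩
      rw [this]
      simp [SetFun.one_apply, h]
    · have : splittings S 0 = ∅ := by
        ext K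
        simp only [mem_splittings, Finset.notMem_empty, iff_false, not_and, not_forall]
        intro _
        obtain ⟨x, hx⟩ := Finset.nonempty_iff_ne_empty.2 h
        exact ⟨x, by simp [hx]⟩
      rw [this]
      simp [SetFun.one_apply, h]
  | succ l ih =>
    rw [Fin.prod_univ_succ, SetFun.mul_apply]
    simp only [Fin.prod_univ_succ, ih, Finset.mul_sum]
    exact (sum_splittings_succ S l fun T K => f 0 T * ∏ j, f j.succ (K j)).symm

/-- The set functions `S ↦ |S|! p_{|S|}` of the exponential generating series `∑ p_i t^i`. -/
def cardFun (α : Type) {R : Type} [CommRing R] (p : PowerSeries R) : SetFun α R :=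
  .of fun S => (S.card.factorial : R) * PowerSeries.coeff S.card p

theorem cardFun_mul (p p' : PowerSeries R) : cardFun α (p * p') = cardFun α p * cardFun α p' := by
  ext S
  rw [SetFun.mul_apply]
  simp only [cardFun]
  rw [Finset.sum_congr rfl (g := fun T : Finset α => (fun i => (i.factorial : R) *
    PowerSeries.coeff i p * (((S.card - i).factorial : R) * PowerSeries.coeff (S.card - i) p')) T.card)
    (fun T hT => by rw [Finset.card_sdiff_of_subset (Finset.mem_powerset.1 hT)]),
    Finset.sum_powerset_apply_card (fun i => (i.factorial : R) *
      PowerSeries.coeff i p * (((S.card - i).factorial : R) * PowerSeries.coeff (S.card - i) p')),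
    PowerSeries.coeff_mul,
    Finset.Nat.sum_antidiagonal_eq_sum_range_succ fun i j =>
      PowerSeries.coeff i p * PowerSeries.coeff j p', Finset.mul_sum]
  refine Finset.sum_congr rfl fun i hi => ?_
  have := Nat.choose_mul_factorial_mul_factorial (Nat.lt_succ_iff.1 (Finset.mem_range.1 hi))
  rw [← this, nsmul_eq_mul]
  push_cast; ring

theorem cardFun_prod (l : ℕ) (p : Fin l → PowerSeries R) :
    cardFun α (∏ j, p j) = ∏ j, cardFun α (p j) := by
  induction l with
  | zero =>
    ext S
    simp only [cardFun, Finset.univ_eq_empty, Finset.prod_empty, SetFun.one_apply,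
      PowerSeries.coeff_one, Finset.card_eq_zero]
    by_cases h : S = ∅ <;> simp [h]
  | succ l ih => rw [Fin.prod_univ_succ, Fin.prod_univ_succ, cardFun_mul, ih]

/-- The exponential formula for labelled sets: a weight that depends only on the cardinalities of
the blocks turns a sum over ordered splittings into one coefficient of a product of generating
series. -/
theorem sum_splittings_card [Fintype α] (S : Finset α) (l : ℕ) (p : Fin l → PowerSeries R) :
    ∑ M ∈ splittings S l, ∏ j, ((M j).card.factorial : R) * PowerSeries.coeff (M j).card (p j) =
      (S.card.factorial : R) * PowerSeries.coeff S.card (∏ j, p j) := by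
  have := congrArg (fun f : SetFun α R => f S) (cardFun_prod (α := α) l p)
  rw [SetFun.prod_apply] at this
  exact this.symm

/-- Splitting a set into b ordered singletons amounts to ordering it, whence b!. -/
theorem SetFun.pow_apply_singletons (Λ : SetFun α R) (hΛ : ∀ S, S.card ≠ 1 → Λ S = 0) (b : ℕ)
    (S : Finset α) :
    (Λ ^ b) S = if S.card = b then (b.factorial : R) * ∏ i ∈ S, Λ {i} else 0 := by
  induction b generalizing S with
  | zero =>
    rw [pow_zero, SetFun.one_apply]
    by_cases h : S = ∅ <;> simp [h]
  | succ b ih =>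
    rw [pow_succ', SetFun.mul_apply]
    have h1 : ∑ T ∈ S.powerset, Λ T * (Λ ^ b) (S \ T) =
        ∑ i ∈ S, Λ {i} * (Λ ^ b) (S \ {i}) := by
      symm
      refine Finset.sum_bij_ne_zero (fun i _ _ => {i}) ?_ ?_ ?_ ?_
      · intro i hi _; simpa using hi
      · intro i _ _ j _ _ h; simpa using h
      · intro T hT h0
        have hc : T.card = 1 := by
          by_contra hc
          exact h0 (by rw [hΛ T hc, zero_mul])
        obtain ⟨i, rfl⟩ := Finset.card_eq_one.1 hc
        exact ⟨i, by simpa using hT, h0, rfl⟩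
      · intro i _ _; rfl
    rw [h1]
    have h2 : ∀ i ∈ S, Λ {i} * (Λ ^ b) (S \ {i}) =
        if S.card = b + 1 then (b.factorial : R) * ∏ i ∈ S, Λ {i} else 0 := by
      intro i hi
      rw [ih, Finset.sdiff_singleton_eq_erase, Finset.card_erase_of_mem hi,
        ← Finset.mul_prod_erase S (fun i => Λ {i}) hi]
      have : 0 < S.card := Finset.card_pos.2 ⟨i, hi⟩
      by_cases h : S.card = b + 1
      · rw [if_pos h, if_pos (by omega)]; ring
      · rw [if_neg h, if_neg (by omega), mul_zero]
    rw [Finset.sum_congr rfl h2, Finset.sum_const, nsmul_eq_mul]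
    split_ifs with h
    · rw [h, Nat.factorial_succ]; push_cast; ring
    · simp

end Splittings

/-! ### Inclusion-exclusion -/

section Connected
variable {ι R : Type} [DecidableEq ι] [CommRing R]

theorem sum_finpartition_connected (A : Finset ι → R) (hA : A ∅ = 1) (I : Finset ι) :
    ∑ P : Finpartition I, ∏ B ∈ P.parts, connected A B = A I := by
  rcases I.eq_empty_or_nonempty with rfl | hI
  · have h : ∀ P : Finpartition (∅ : Finset ι), P.parts = ∅ := fun P =>
      Finset.eq_empty_of_forall_notMem fun B hB =>
        P.bot_notMem (by rwa [show B = ⊥ from Finset.subset_empty.1 (P.le hB)] at hB)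
    rw [hA, Finset.sum_eq_single (⊥ : Finpartition (∅ : Finset ι))]
    · simp [h]
    · intro P _ hP; exact absurd (Finpartition.ext ((h P).trans (h _).symm)) hP
    · simp
  · have h1 : ∑ P : Finpartition I, ∏ B ∈ P.parts, connected A B =
        (∑ P ∈ Finset.univ.filter (fun P : Finpartition I => 1 < P.parts.card),
          ∏ B ∈ P.parts, connected A B) + connected A I := by
      rw [← Finset.sum_filter_add_sum_filter_not Finset.univ
        (fun P : Finpartition I => 1 < P.parts.card)]
      congr 1
      rw [Finset.sum_eq_single (Finpartition.indiscrete hI.ne_empty)]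
      · simp
      · intro P hP hne
        rw [Finset.mem_filter, not_lt] at hP
        exfalso
        apply hne
        have h0 : P.parts.Nonempty := P.parts_nonempty hI.ne_empty
        obtain ⟨B, hB⟩ := Finset.card_eq_one.1 (le_antisymm hP.2 (Finset.card_pos.2 h0))
        have hBI : B = I := by
          have := P.sup_parts
          rw [hB] at this
          simpa using this
        ext1
        rw [hB, hBI]; simp
      · intro h
        exact absurd (Finset.mem_filter.2 ⟨Finset.mem_univ _, by simp⟩) h
    rw [h1, connected, Finset.sum_attach (Finset.univ.filter (fun P : Finpartition I => 1 < P.parts.card))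
      (fun P => ∏ B ∈ P.parts.attach, connected A B.1)]
    have h2 : ∀ P : Finpartition I, ∏ B ∈ P.parts.attach, connected A B.1 =
        ∏ B ∈ P.parts, connected A B := fun P => Finset.prod_attach P.parts (connected A)
    simp only [h2]
    ring

theorem sum_finpartition_eq (f : Finset ι → R) (I : Finset ι) (a : ι) (ha : a ∈ I) :
    ∑ P : Finpartition I, ∏ B ∈ P.parts, f B =
      ∑ T ∈ I.powerset.filter (a ∈ ·), f T *
        ∑ P : Finpartition (I \ T), ∏ B ∈ P.parts, f B := by
  simp only [Finset.mul_sum]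
  rw [Finset.sum_sigma']
  symm
  have hne : ∀ T ∈ I.powerset.filter (a ∈ ·), T ≠ ⊥ := fun T hT => by
    rw [Finset.mem_filter] at hT
    exact Finset.ne_empty_of_mem hT.2
  have hsub : ∀ T ∈ I.powerset.filter (a ∈ ·), T ⊆ I := fun T hT => by
    rw [Finset.mem_filter, Finset.mem_powerset] at hT
    exact hT.1
  refine Finset.sum_bij (fun x hx => x.2.extend (hne x.1 (Finset.mem_sigma.1 hx).1)
    (Finset.sdiff_disjoint) (Finset.sdiff_union_of_subset (hsub x.1 (Finset.mem_sigma.1 hx).1)))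
    (fun _ _ => Finset.mem_univ _) ?_ ?_ ?_
  · rintro ⟨T, P⟩ hx ⟨T', P'⟩ hx' h
    have hp := congrArg Finpartition.parts h
    simp only [Finpartition.extend_parts] at hp
    have hmem : ∀ (U : Finset ι) (P : Finpartition (I \ U)), a ∈ U → ∀ B ∈ P.parts, a ∉ B := by
      intro U P haU B hB haB
      exact (Finset.mem_sdiff.1 (P.le hB haB)).2 haU
    have haT : a ∈ T := (Finset.mem_filter.1 (Finset.mem_sigma.1 hx).1).2
    have haT' : a ∈ T' := (Finset.mem_filter.1 (Finset.mem_sigma.1 hx').1).2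
    have hTT : T = T' := by
      have : T ∈ insert T' P'.parts := hp ▸ Finset.mem_insert_self _ _
      rcases Finset.mem_insert.1 this with h | h
      · exact h
      · exact absurd haT (hmem T' P' haT' T h)
    subst hTT
    congr 1
    ext1
    have h1 : T ∉ P.parts := fun h => hmem T P haT T h haT
    have h2 : T ∉ P'.parts := fun h => hmem T P' haT T h haT
    rw [← Finset.erase_insert h1, hp, Finset.erase_insert h2]
  · intro Q _
    obtain ⟨T, hT, haT⟩ := Q.exists_mem ha
    have hTI : T ∈ I.powerset.filter (a ∈ ·) :=
      Finset.mem_filter.2 ⟨Finset.mem_powerset.2 (Q.le hT), haT⟩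
    refine ⟨⟨T, ⟨Q.parts.erase T, ?_, ?_, ?_⟩⟩, Finset.mem_sigma.2 ⟨hTI, Finset.mem_univ _⟩, ?_⟩
    · exact Q.supIndep.subset (Finset.erase_subset _ _)
    · ext x
      simp only [Finset.mem_sup, id, Finset.mem_erase, Finset.mem_sdiff]
      constructor
      · rintro ⟨B, ⟨hB, hBQ⟩, hx⟩
        exact ⟨Q.le hBQ hx, fun hxT => Finset.disjoint_left.1 (Q.disjoint hBQ hT hB) hx hxT⟩
      · rintro ⟨hx, hxT⟩
        obtain ⟨B, hB, hxB⟩ := Q.exists_mem hx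
        exact ⟨B, ⟨fun h => hxT (h ▸ hxB), hB⟩, hxB⟩
    · exact fun h => Q.bot_notMem (Finset.mem_of_mem_erase h)
    · ext1
      simp [Finset.insert_erase hT]
  · rintro ⟨T, P⟩ hx
    have haT : a ∈ T := (Finset.mem_filter.1 (Finset.mem_sigma.1 hx).1).2
    rw [Finpartition.extend_parts, Finset.prod_insert]
    intro h
    exact (Finset.mem_sdiff.1 (P.le h haT)).2 haT

theorem connected_recursion (A : Finset ι → R) (hA : A ∅ = 1) (I : Finset ι) (a : ι) (ha : a ∈ I) :
    A I = ∑ T ∈ I.powerset.filter (a ∈ ·), connected A T * A (I \ T) := by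
  rw [← sum_finpartition_connected A hA I, sum_finpartition_eq _ I a ha]
  simp only [sum_finpartition_connected A hA]

/-- The recursion over the block of a marked element is triangular: the term T = I is c(I) A(∅) =
c(I), and all other blocks are smaller. Inclusion-exclusion can thus be verified without handling
set partitions. -/
theorem connected_unique (A : Finset ι → R) (hA : A ∅ = 1) (c : Finset ι → R)
    (hc : ∀ I, ∀ a ∈ I, A I = ∑ T ∈ I.powerset.filter (a ∈ ·), c T * A (I \ T))
    (I : Finset ι) (hI : I.Nonempty) : connected A I = c I := by
  induction I using Finset.strongInduction with
  | H I ih =>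
  obtain ⟨a, ha⟩ := hI
  have h1 := connected_recursion A hA I a ha
  have h2 := hc I a ha
  have hmem : I ∈ I.powerset.filter (a ∈ ·) := by simp [ha]
  rw [← Finset.add_sum_erase _ _ hmem, Finset.sdiff_self] at h1 h2
  have h3 : ∑ T ∈ (I.powerset.filter (a ∈ ·)).erase I, connected A T * A (I \ T) =
      ∑ T ∈ (I.powerset.filter (a ∈ ·)).erase I, c T * A (I \ T) := by
    refine Finset.sum_congr rfl fun T hT => ?_
    rw [Finset.mem_erase, Finset.mem_filter, Finset.mem_powerset] at hT
    rw [ih T (Finset.ssubset_iff_subset_ne.2 ⟨hT.2.1, hT.1⟩) ⟨a, hT.2.2⟩]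
  change A I = connected A I * A ∅ + _ at h1
  change A I = c I * A ∅ + _ at h2
  rw [hA, mul_one] at h1 h2
  rw [h3] at h1
  exact add_right_cancel (h1.symm.trans h2)

end Connected

/-! ### Exponentials of power series -/

section ExpSeries
variable {R : Type} [CommRing R] [Algebra ℂ R]

theorem smul_cancel_of_cast_ne_zero {n : ℕ} (hn : n ≠ 0) {x y : R}
    (h : (n : R) * x = (n : R) * y) : x = y := by
  have h1 : (n : ℂ) ≠ 0 := Nat.cast_ne_zero.2 hn
  have h2 : ∀ z : R, (n : R) * z = (n : ℂ) • z := fun z => by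
    rw [Algebra.smul_def, map_natCast]
  rw [h2, h2] at h
  exact smul_right_injective R h1 h

theorem ode_unique {f g h : PowerSeries R} (hf : derivative R f = g * f)
    (hh : derivative R h = g * h)
    (h0 : PowerSeries.constantCoeff f = PowerSeries.constantCoeff h) : f = h := by
  ext n
  induction n using Nat.strong_induction_on with
  | _ n ih =>
  cases n with
  | zero => simpa using h0
  | succ n =>
    have h1 := congrArg (PowerSeries.coeff n) hf
    have h2 := congrArg (PowerSeries.coeff n) hh
    rw [PowerSeries.coeff_derivative, PowerSeries.coeff_mul] at h1 h2
    have h3 : ∑ p ∈ antidiagonal n, PowerSeries.coeff p.1 g * PowerSeries.coeff p.2 f =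
        ∑ p ∈ antidiagonal n, PowerSeries.coeff p.1 g * PowerSeries.coeff p.2 h := by
      refine Finset.sum_congr rfl fun p hp => ?_
      rw [ih p.2 (Nat.lt_succ_of_le (Finset.HasAntidiagonal.antidiagonal.snd_le hp))]
    rw [h3, ← h2] at h1
    refine smul_cancel_of_cast_ne_zero (Nat.succ_ne_zero n) ?_
    push_cast
    rw [mul_comm, h1, mul_comm]

/-- The exponential `∑_ℓ Φ^ℓ / ℓ!` of a power series without constant term. -/
def expSeries (Φ : PowerSeries R) : PowerSeries R :=
  PowerSeries.mk fun l => ∑ j ∈ Finset.range (l + 1),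
    (j.factorial : ℂ)⁻¹ • PowerSeries.coeff l (Φ ^ j)

theorem coeff_pow_eq_zero {Φ : PowerSeries R} (h0 : PowerSeries.constantCoeff Φ = 0) {l j : ℕ}
    (h : l < j) : PowerSeries.coeff l (Φ ^ j) = 0 :=
  PowerSeries.X_pow_dvd_iff.1 (pow_dvd_pow_of_dvd (PowerSeries.X_dvd_iff.2 h0) j) l h

theorem coeff_expSeries {Φ : PowerSeries R} (h0 : PowerSeries.constantCoeff Φ = 0) {l N : ℕ}
    (h : l ≤ N) : PowerSeries.coeff l (expSeries Φ) =
      ∑ j ∈ Finset.range (N + 1), (j.factorial : ℂ)⁻¹ • PowerSeries.coeff l (Φ ^ j) := by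
  rw [expSeries, PowerSeries.coeff_mk]
  refine Finset.sum_subset (Finset.range_mono (by omega)) fun j _ hj => ?_
  rw [coeff_pow_eq_zero h0 (by simpa using hj), smul_zero]

theorem constantCoeff_expSeries (Φ : PowerSeries R) :
    PowerSeries.constantCoeff (expSeries Φ) = 1 := by
  rw [← PowerSeries.coeff_zero_eq_constantCoeff_apply, expSeries, PowerSeries.coeff_mk]
  simp

theorem derivative_expSeries {Φ : PowerSeries R} (h0 : PowerSeries.constantCoeff Φ = 0) :
    derivative R (expSeries Φ) = derivative R Φ * expSeries Φ := by
  ext l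
  have h1 : PowerSeries.coeff l (derivative R Φ * expSeries Φ) =
      ∑ j ∈ Finset.range (l + 1), (j.factorial : ℂ)⁻¹ •
        PowerSeries.coeff l (derivative R Φ * Φ ^ j) := by
    simp only [PowerSeries.coeff_mul, Finset.smul_sum]
    rw [Finset.sum_comm]
    refine Finset.sum_congr rfl fun p hp => ?_
    rw [coeff_expSeries h0 (Finset.HasAntidiagonal.antidiagonal.snd_le hp), Finset.mul_sum]
    exact Finset.sum_congr rfl fun j _ => mul_smul_comm _ _ _
  rw [h1, PowerSeries.coeff_derivative, coeff_expSeries h0 le_rfl, Finset.sum_mul,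
    Finset.sum_range_succ']
  simp only [pow_zero, PowerSeries.coeff_one, Nat.succ_ne_zero, if_false, smul_zero, zero_mul,
    add_zero]
  refine Finset.sum_congr rfl fun j _ => ?_
  have h2 := PowerSeries.coeff_derivative (Φ ^ (j + 1)) l
  rw [Derivation.leibniz_pow, Nat.add_sub_cancel] at h2
  rw [smul_mul_assoc, ← h2, map_nsmul, Nat.factorial_succ, smul_eq_mul, mul_comm (Φ ^ j),
    ← Nat.cast_smul_eq_nsmul ℂ, smul_smul]
  congr 1
  have : (j : ℂ) + 1 ≠ 0 := by exact_mod_cast Nat.succ_ne_zero j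
  push_cast
  field_simp

/-- The linear differential equation f' = Φ' f determines f up to its constant term. Identities
between exponentials are derived from this instead of from rearranging sums. -/
theorem eq_expSeries {Φ f : PowerSeries R} (h0 : PowerSeries.constantCoeff Φ = 0)
    (hf : derivative R f = derivative R Φ * f) :
    f = PowerSeries.C (PowerSeries.constantCoeff f) * expSeries Φ := by
  refine ode_unique hf ?_ ?_
  · rw [Derivation.leibniz, derivative_expSeries h0]
    simp only [smul_eq_mul, PowerSeries.derivative_C, mul_zero, add_zero]
    ring
  · simp [constantCoeff_expSeries]

theorem expSeries_add {Φ Ψ : PowerSeries R} (h0 : PowerSeries.constantCoeff Φ = 0)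
    (h1 : PowerSeries.constantCoeff Ψ = 0) :
    expSeries (Φ + Ψ) = expSeries Φ * expSeries Ψ := by
  have h2 : PowerSeries.constantCoeff (Φ + Ψ) = 0 := by simp [h0, h1]
  have := eq_expSeries (f := expSeries Φ * expSeries Ψ) h2 (by
    rw [Derivation.leibniz, derivative_expSeries h0, derivative_expSeries h1, map_add]
    simp only [smul_eq_mul]
    ring)
  rw [this]
  simp [constantCoeff_expSeries]

theorem map_expSeries {R' : Type} [CommRing R'] [Algebra ℂ R'] (φ : R →+* R')
    (Φ : PowerSeries R) : PowerSeries.map φ (expSeries Φ) = expSeries (PowerSeries.map φ Φ) := by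
  ext l
  simp only [PowerSeries.coeff_map, expSeries, PowerSeries.coeff_mk, map_sum, ← map_pow]
  exact Finset.sum_congr rfl fun j _ => map_inv_natCast_smul φ ℂ ℂ _ _

theorem rescale_expSeries (a : R) (Φ : PowerSeries R) :
    PowerSeries.rescale a (expSeries Φ) = expSeries (PowerSeries.rescale a Φ) := by
  ext l
  simp only [PowerSeries.coeff_rescale, expSeries, PowerSeries.coeff_mk, Finset.mul_sum,
    ← map_pow, mul_smul_comm]

/-- The flow `f ↦ ∑_l t^l D^l f / l!` of a derivation. -/
def flow (D : Derivation ℂ R R) (f : R) : PowerSeries R :=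
  PowerSeries.mk fun l => (l.factorial : ℂ)⁻¹ • D^[l] f

theorem derivative_flow (D : Derivation ℂ R R) (f : R) :
    derivative R (flow D f) = flow D (D f) := by
  ext l
  rw [PowerSeries.coeff_derivative, flow, flow, PowerSeries.coeff_mk, PowerSeries.coeff_mk,
    smul_mul_assoc, mul_comm, ← Nat.cast_succ, ← nsmul_eq_mul, ← Nat.cast_smul_eq_nsmul ℂ,
    smul_smul, Function.iterate_succ_apply, Nat.factorial_succ]
  congr 1
  have : (l : ℂ) + 1 ≠ 0 := by exact_mod_cast Nat.succ_ne_zero l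
  push_cast
  field_simp

theorem flow_add (D : Derivation ℂ R R) (f g : R) : flow D (f + g) = flow D f + flow D g := by
  ext l
  simp only [flow, PowerSeries.coeff_mk, map_add]
  rw [← smul_add]
  congr 1
  induction l generalizing f g with
  | zero => rfl
  | succ l ih => simp only [Function.iterate_succ_apply, map_add, ih]

/-- A derivation exponentiates to a ring homomorphism. Differentiating in t turns the coefficient of
t^{l+1} on both sides into coefficients of t^l of the products (Df) g and f (Dg), so induction on l
applies. -/
theorem flow_mul (D : Derivation ℂ R R) (f g : R) : flow D (f * g) = flow D f * flow D g := by
  ext l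
  induction l generalizing f g with
  | zero => simp [flow]
  | succ l ih =>
    have h1 := PowerSeries.coeff_derivative (flow D (f * g)) l
    have h2 := PowerSeries.coeff_derivative (flow D f * flow D g) l
    rw [derivative_flow, Derivation.leibniz, flow_add, map_add, smul_eq_mul, smul_eq_mul, ih,
      ih, ← derivative_flow, ← derivative_flow, ← map_add] at h1
    rw [Derivation.leibniz, smul_eq_mul, smul_eq_mul, h1] at h2
    refine smul_cancel_of_cast_ne_zero (Nat.succ_ne_zero l) ?_
    rw [mul_comm, mul_comm _ (PowerSeries.coeff (l + 1) (flow D f * flow D g))]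
    exact_mod_cast h2

/-- If Z behaves like e^F under D, then its flow is e^{flow F} = Z e^{flow F - F}. Only the
logarithmic derivative of Z is used, so no exponential in the coefficient ring is needed. -/
theorem flow_eq_exp_mul (D : Derivation ℂ R R) (F Z : R) (h : D Z = D F * Z) :
    flow D Z = PowerSeries.C Z * expSeries (flow D F - PowerSeries.C F) := by
  have h0 : ∀ f, PowerSeries.constantCoeff (flow D f) = f := fun f => by
    rw [← PowerSeries.coeff_zero_eq_constantCoeff_apply, flow, PowerSeries.coeff_mk]
    simp
  have := eq_expSeries (Φ := flow D F - PowerSeries.C F) (f := flow D Z) (by simp [h0])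
    (by rw [derivative_flow, h, flow_mul, map_sub, derivative_flow]; simp)
  rwa [h0] at this

end ExpSeries

/-! ### Functions of multisets, with the convolution product -/

/-- Functions of multisets of natural numbers, with
`(f * g)(s) = ∑ f(t) g(u)` over the pairs `(t, u)` in the antidiagonal of `s`. -/
structure MultiFun (R : Type) : Type where
  /-- A function of multisets as an element of `MultiFun R`. -/
  of ::
  /-- The values. -/
  toFun : Multiset ℕ → R

instance {R : Type} : CoeFun (MultiFun R) fun _ => Multiset ℕ → R := ⟨MultiFun.toFun⟩

namespace MultiFun

theorem of_apply {R : Type} (f : Multiset ℕ → R) (s : Multiset ℕ) : of f s = f s := rfl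

variable {R : Type} [CommRing R]

theorem toFun_injective : Function.Injective (toFun : MultiFun R → Multiset ℕ → R) :=
  fun ⟨_⟩ ⟨_⟩ h => congrArg of h

instance : Zero (MultiFun R) := ⟨of fun _ => 0⟩
instance : Add (MultiFun R) := ⟨fun f g => of fun s => f s + g s⟩
instance : Neg (MultiFun R) := ⟨fun f => of fun s => -f s⟩
instance : Sub (MultiFun R) := ⟨fun f g => of fun s => f s - g s⟩
instance : SMul ℕ (MultiFun R) := ⟨fun c f => of fun s => c • f s⟩
instance : SMul ℤ (MultiFun R) := ⟨fun c f => of fun s => c • f s⟩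

instance : AddCommGroup (MultiFun R) :=
  toFun_injective.addCommGroup _ rfl (fun _ _ => rfl) (fun _ => rfl) (fun _ _ => rfl)
    (fun _ _ => rfl) (fun _ _ => rfl)

instance : Mul (MultiFun R) :=
  ⟨fun f g => of fun s => (s.antidiagonal.map fun p => f p.1 * g p.2).sum⟩

instance : One (MultiFun R) := ⟨of fun s => if s = 0 then 1 else 0⟩

theorem ext {f g : MultiFun R} (h : ∀ s, f s = g s) : f = g := toFun_injective (funext h)

theorem mul_apply (f g : MultiFun R) (s : Multiset ℕ) :
    (f * g) s = (s.antidiagonal.map fun p => f p.1 * g p.2).sum := rfl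

theorem one_apply (s : Multiset ℕ) : (1 : MultiFun R) s = if s = 0 then 1 else 0 := rfl

theorem add_apply (f g : MultiFun R) (s : Multiset ℕ) : (f + g) s = f s + g s := rfl

theorem sub_apply (f g : MultiFun R) (s : Multiset ℕ) : (f - g) s = f s - g s := rfl

theorem zero_apply (s : Multiset ℕ) : (0 : MultiFun R) s = 0 := rfl

/-- The function `s ↦ f(k, s)` with one more part `k`. -/
def shift (k : ℕ) (f : MultiFun R) : MultiFun R := of fun s => f (k ::ₘ s)

theorem shift_apply (k : ℕ) (f : MultiFun R) (s : Multiset ℕ) : shift k f s = f (k ::ₘ s) := rfl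

theorem mul_zero_apply (f g : MultiFun R) : (f * g) 0 = f 0 * g 0 := by simp [mul_apply]

theorem mul_cons_apply (k : ℕ) (f g : MultiFun R) (s : Multiset ℕ) :
    (f * g) (k ::ₘ s) = (shift k f * g) s + (f * shift k g) s := by
  simp only [mul_apply, Multiset.antidiagonal_cons, Multiset.map_add, Multiset.sum_add,
    Multiset.map_map]
  rw [add_comm]
  rfl

theorem mul_comm' (f g : MultiFun R) : f * g = g * f := by
  refine ext fun s => ?_
  induction s using Multiset.induction generalizing f g with
  | empty => rw [mul_zero_apply, mul_zero_apply, mul_comm]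
  | cons k s ih => rw [mul_cons_apply, mul_cons_apply, ih, ih f, add_comm]

theorem left_distrib' (f g h : MultiFun R) : f * (g + h) = f * g + f * h := by
  refine ext fun s => ?_
  simp only [add_apply, mul_apply, mul_add, Multiset.sum_map_add]

theorem right_distrib' (f g h : MultiFun R) : (f + g) * h = f * h + g * h := by
  rw [mul_comm', left_distrib', mul_comm' h, mul_comm' h]

theorem shift_mul (k : ℕ) (f g : MultiFun R) :
    shift k (f * g) = shift k f * g + f * shift k g :=
  ext fun s => mul_cons_apply k f g s

theorem mul_assoc' (f g h : MultiFun R) : f * g * h = f * (g * h) := by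
  refine ext fun s => ?_
  induction s using Multiset.induction generalizing f g h with
  | empty => simp only [mul_zero_apply, mul_assoc]
  | cons k s ih =>
    simp only [mul_cons_apply, shift_mul, right_distrib', left_distrib', add_apply, ih, add_assoc]

theorem one_mul' (f : MultiFun R) : 1 * f = f := by
  refine ext fun s => ?_
  induction s using Multiset.induction generalizing f with
  | empty => simp [mul_zero_apply, one_apply]
  | cons k s ih =>
    rw [mul_cons_apply, ih, mul_apply]
    have : ∀ t, shift k (1 : MultiFun R) t = 0 := fun t => by simp [shift_apply, one_apply]
    simp [this, shift_apply]

instance : CommRing (MultiFun R) :=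
  { (inferInstance : AddCommGroup (MultiFun R)), (inferInstance : Mul (MultiFun R)),
    (inferInstance : One (MultiFun R)) with
    left_distrib := left_distrib'
    right_distrib := right_distrib'
    zero_mul := fun f => by
      refine ext fun s => ?_
      simp [zero_apply, mul_apply]
    mul_zero := fun f => by
      refine ext fun s => ?_
      simp [zero_apply, mul_apply]
    mul_assoc := mul_assoc'
    one_mul := one_mul'
    mul_one := fun f => by rw [mul_comm', one_mul']
    mul_comm := mul_comm'
    zsmul := fun n f => n • f
    nsmul := fun n f => n • f }

instance [Algebra ℂ R] : Module ℂ (MultiFun R) :=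
  { smul := fun c f => of fun s => c • f s
    one_smul := fun f => ext fun s => one_smul ℂ (f s)
    mul_smul := fun a b f => ext fun s => mul_smul a b (f s)
    smul_zero := fun a => ext fun _ => smul_zero a
    zero_smul := fun f => ext fun s => zero_smul ℂ (f s)
    smul_add := fun a f g => ext fun s => smul_add a (f s) (g s)
    add_smul := fun a b f => ext fun s => add_smul a b (f s) }

theorem smul_apply [Algebra ℂ R] (c : ℂ) (f : MultiFun R)
    (s : Multiset ℕ) : (c • f) s = c • f s := rfl

instance [Algebra ℂ R] : Algebra ℂ (MultiFun R) :=
  Algebra.ofModule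
    (fun c f g => ext fun s => by
      simp only [smul_apply, mul_apply, smul_mul_assoc, Multiset.smul_sum, Multiset.map_map,
        Function.comp_def])
    (fun c f g => ext fun s => by
      simp only [smul_apply, mul_apply, mul_smul_comm, Multiset.smul_sum, Multiset.map_map,
        Function.comp_def])

/-- Multiplication by the number of parts. -/
def num (f : MultiFun R) : MultiFun R := of fun s => (s.card : R) * f s

theorem num_apply (f : MultiFun R) (s : Multiset ℕ) : num f s = (s.card : R) * f s := rfl

theorem num_mul (f g : MultiFun R) : num (f * g) = num f * g + f * num g := by
  refine ext fun s => ?_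
  rw [add_apply, num_apply, mul_apply, mul_apply, mul_apply, ← Multiset.sum_map_add,
    ← Multiset.sum_map_mul_left]
  refine congrArg Multiset.sum (Multiset.map_congr rfl fun p hp => ?_)
  rw [← Multiset.mem_antidiagonal.1 hp, Multiset.card_add, num_apply, num_apply]
  push_cast; ring

theorem num_sub (f g : MultiFun R) : num (f - g) = num f - num g :=
  ext fun _ => mul_sub _ _ _

theorem num_shift (k : ℕ) (f : MultiFun R) : shift k (num f) = num (shift k f) + shift k f := by
  refine ext fun s => ?_
  rw [add_apply, num_apply, shift_apply, num_apply, Multiset.card_cons, shift_apply]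
  push_cast; ring

/-- The left-hand side multiplies the value at s by |s| + k, whereas the right-hand side involves E
at smaller multisets only, since G vanishes at the empty one. The factor |s| + k is zero only in the
case covered by `h0`. -/
theorem eq_zero_of_num_eq [Algebra ℂ R] {E G : MultiFun R} (k : ℕ) (hG : G 0 = 0)
    (h : num E + k • E = G * E) (h0 : k = 0 → E 0 = 0) : E = 0 := by
  refine ext fun s => ?_
  induction hn : s.card using Nat.strong_induction_on generalizing s with
  | _ n ih =>
  by_cases hk : s.card + k = 0
  · have hs : s = 0 := Multiset.card_eq_zero.1 (by omega)
    rw [hs]; exact h0 (by omega)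
  · have h1 := congrArg (fun f : MultiFun R => f s) h
    have h2 : (G * E) s = 0 := by
      rw [mul_apply]
      refine Multiset.sum_eq_zero fun x hx => ?_
      obtain ⟨p, hp, rfl⟩ := Multiset.mem_map.1 hx
      rw [Multiset.mem_antidiagonal] at hp
      by_cases h3 : p.1 = 0
      · rw [h3, hG, zero_mul]
      · have : 0 < p.1.card := Multiset.card_pos.2 h3
        have hc := congrArg Multiset.card hp
        rw [Multiset.card_add] at hc
        rw [ih p.2.card (by omega) p.2 rfl, zero_apply, mul_zero]
    have h4 : (num E + k • E) s = (num E) s + k • E s := rfl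
    refine smul_cancel_of_cast_ne_zero hk ?_
    rw [h2, h4, num_apply, nsmul_eq_mul] at h1
    rw [zero_apply, mul_zero, ← h1]
    push_cast; ring

/-- The logarithm `F` of `Z`, with `N F * Z = N Z` for the number operator `N`. -/
def log [Algebra ℂ R] (Z : MultiFun R) (s : Multiset ℕ) : R :=
  Z s - (s.card : ℂ)⁻¹ • ((s.antidiagonal.filter fun p => p.2 ≠ 0).attach.map fun p =>
    (p.1.1.card : R) * log Z p.1.1 * Z p.1.2).sum
termination_by s.card
decreasing_by
  obtain ⟨h1, h2⟩ := Multiset.mem_filter.1 p.2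
  have := congrArg Multiset.card (Multiset.mem_antidiagonal.1 h1)
  rw [Multiset.card_add] at this
  have : 0 < p.1.2.card := Multiset.card_pos.2 h2
  omega

/-- The logarithm as an element of the convolution ring. -/
def logFun [Algebra ℂ R] (Z : MultiFun R) : MultiFun R := of fun s => if s = 0 then 0 else log Z s

theorem logFun_apply [Algebra ℂ R] (Z : MultiFun R) (s : Multiset ℕ) :
    logFun Z s = if s = 0 then 0 else log Z s := rfl

theorem logFun_zero [Algebra ℂ R] (Z : MultiFun R) : logFun Z 0 = 0 := by
  rw [logFun_apply, if_pos rfl]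

theorem antidiagonal_filter_snd (s : Multiset ℕ) :
    s.antidiagonal.filter (fun p => p.2 = 0) = {(s, 0)} := by
  induction s using Multiset.induction with
  | empty => rfl
  | cons a s ih =>
    rw [Multiset.antidiagonal_cons, Multiset.filter_add, Multiset.filter_map, Multiset.filter_map]
    have h1 : s.antidiagonal.filter ((fun p => p.2 = 0) ∘ Prod.map id (Multiset.cons a)) = 0 := by
      refine Multiset.filter_eq_nil.2 fun p _ => ?_
      simp
    have h2 : s.antidiagonal.filter ((fun p => p.2 = 0) ∘ Prod.map (Multiset.cons a) id) =
        {(s, 0)} := by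
      rw [← ih]; rfl
    rw [h1, h2]
    simp

theorem num_logFun_mul [Algebra ℂ R] (Z : MultiFun R) (hZ : Z 0 = 1) :
    num (logFun Z) * Z = num Z := by
  refine ext fun s => ?_
  by_cases hs : s = 0
  · rw [hs, mul_zero_apply]; simp [num_apply]
  · rw [mul_apply, ← Multiset.filter_add_not (fun p => p.2 = 0) s.antidiagonal,
      antidiagonal_filter_snd, Multiset.map_add, Multiset.sum_add, Multiset.map_singleton,
      Multiset.sum_singleton, hZ, mul_one, num_apply, logFun_apply, if_neg hs, log]
    dsimp only
    rw [Multiset.attach_map_val' _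
      (fun p : Multiset ℕ × Multiset ℕ => (p.1.card : R) * log Z p.1 * Z p.2)]
    have h1 : ((s.antidiagonal.filter fun p => ¬ p.2 = 0).map fun p =>
        num (logFun Z) p.1 * Z p.2).sum =
        ((s.antidiagonal.filter fun p => p.2 ≠ 0).map fun p =>
          (p.1.card : R) * log Z p.1 * Z p.2).sum := by
      refine congrArg Multiset.sum (Multiset.map_congr rfl fun p _ => ?_)
      rw [num_apply, logFun_apply]
      split_ifs with h
      · rw [h]; simp
      · rfl
    have hc : (s.card : ℂ) ≠ 0 := Nat.cast_ne_zero.2 fun h => hs (Multiset.card_eq_zero.1 h)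
    rw [h1, mul_sub, mul_smul_comm, ← nsmul_eq_mul, ← nsmul_eq_mul,
      ← Nat.cast_smul_eq_nsmul ℂ s.card (Multiset.sum _), smul_smul, inv_mul_cancel₀ hc, one_smul,
      nsmul_eq_mul, sub_add_cancel, num_apply]

/-- Applying δ to (N F) Z = N Z shows that the defect X = δZ - (δF) Z satisfies N X + k X = (N F) X,
hence vanishes. The integer k measures by how much δ changes the number of parts: 1 for insertion of
a part, 0 for the derivative in β. -/
theorem derivation_eq_log_mul [Algebra ℂ R] (Z F : MultiFun R) (hZ : Z 0 = 1) (hF : F 0 = 0)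
    (h : num F * Z = num Z)
    (δ : MultiFun R → MultiFun R) (hmul : ∀ f g, δ (f * g) = δ f * g + f * δ g) (k : ℕ)
    (hnum : ∀ f, δ (num f) = num (δ f) + k • δ f)
    (h0 : k = 0 → δ Z 0 = δ F 0) : δ Z = δ F * Z := by
  rw [← sub_eq_zero]
  refine eq_zero_of_num_eq k (G := num F) (by rw [num_apply, hF, mul_zero]) ?_ ?_
  · have h1 := congrArg δ h
    rw [hmul, hnum, hnum] at h1
    rw [num_sub, num_mul, smul_sub, ← h, eq_sub_of_add_eq h1.symm]
    simp only [nsmul_eq_mul]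
    ring
  · intro hk
    rw [sub_apply, mul_zero_apply, hZ, mul_one, h0 hk, sub_self]

theorem shift_eq_logFun_mul [Algebra ℂ R] (Z : MultiFun R) (hZ : Z 0 = 1) (k : ℕ) :
    shift k Z = shift k (logFun Z) * Z :=
  derivation_eq_log_mul Z _ hZ (logFun_zero Z) (num_logFun_mul Z hZ) (shift k) (shift_mul k) 1
    (fun f => by rw [num_shift, one_smul]) (fun h => absurd h one_ne_zero)

/-- Change of the coefficients. -/
def map {R' : Type} [CommRing R'] (φ : R →+* R') : MultiFun R →+* MultiFun R' where
  toFun f := of fun s => φ (f s)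
  map_one' := ext fun s => by rw [of_apply, one_apply]; by_cases h : s = 0 <;> simp [h, one_apply]
  map_mul' f g := ext fun s => by
    rw [of_apply, mul_apply, mul_apply, map_multiset_sum, Multiset.map_map]
    refine congrArg Multiset.sum (Multiset.map_congr rfl fun p _ => ?_)
    exact map_mul φ _ _
  map_zero' := ext fun _ => map_zero φ
  map_add' _ _ := ext fun _ => map_add φ _ _

theorem map_apply {R' : Type} [CommRing R'] (φ : R →+* R') (f : MultiFun R) (s : Multiset ℕ) :
    map φ f s = φ (f s) := rfl

theorem map_num {R' : Type} [CommRing R'] (φ : R →+* R') (f : MultiFun R) :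
    map φ (num f) = num (map φ f) :=
  ext fun s => by rw [map_apply, num_apply, num_apply, map_mul, map_natCast, map_apply]

end MultiFun

namespace SetFun
variable {ι R : Type} [DecidableEq ι] [CommRing R]

instance [Algebra ℂ R] : Module ℂ (SetFun ι R) :=
  { smul := fun c f => .of fun S => c • f S
    one_smul := fun f => ext fun s => one_smul ℂ (f s)
    mul_smul := fun a b f => ext fun s => mul_smul a b (f s)
    smul_zero := fun a => ext fun _ => smul_zero a
    zero_smul := fun f => ext fun s => zero_smul ℂ (f s)
    smul_add := fun a f g => ext fun s => smul_add a (f s) (g s)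
    add_smul := fun a b f => ext fun s => add_smul a b (f s) }

theorem smul_apply [Algebra ℂ R] (c : ℂ) (f : SetFun ι R) (S : Finset ι) :
    (c • f) S = c • f S := rfl

instance [Algebra ℂ R] : Algebra ℂ (SetFun ι R) :=
  Algebra.ofModule
    (fun c f g => ext fun S => by
      simp only [smul_apply, mul_apply, smul_mul_assoc, Finset.smul_sum])
    (fun c f g => ext fun S => by
      simp only [smul_apply, mul_apply, mul_smul_comm, Finset.smul_sum])

end SetFun

/-! ### From functions of multisets to functions of finite sets -/

section Parts
variable {n : ℕ}

/-- The multiset of the `ν i` with `i ∈ S`. -/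
def parts (ν : Fin n → ℕ) (S : Finset (Fin n)) : Multiset ℕ := S.val.map ν

theorem parts_empty (ν : Fin n → ℕ) : parts ν ∅ = 0 := rfl

theorem parts_insert (ν : Fin n → ℕ) {a : Fin n} {S : Finset (Fin n)} (h : a ∉ S) :
    parts ν (insert a S) = ν a ::ₘ parts ν S := by
  rw [parts, Finset.insert_val_of_notMem h, Multiset.map_cons, parts]

theorem card_parts (ν : Fin n → ℕ) (S : Finset (Fin n)) : (parts ν S).card = S.card := by
  simp [parts]

theorem sum_parts (ν : Fin n → ℕ) (S : Finset (Fin n)) : (parts ν S).sum = ∑ i ∈ S, ν i := rfl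

theorem parts_eq_zero (ν : Fin n → ℕ) {S : Finset (Fin n)} : parts ν S = 0 ↔ S = ∅ := by
  rw [← Multiset.card_eq_zero, card_parts, Finset.card_eq_zero]

/-- The antidiagonal of a multiset distinguishes equal parts, so it corresponds to the subsets of
the labelled parts. This makes the passage from multisets to finite sets a ring homomorphism. -/
theorem sum_antidiagonal_parts {A : Type} [AddCommMonoid A] (ν : Fin n → ℕ)
    (S : Finset (Fin n)) (F : Multiset ℕ × Multiset ℕ → A) :
    ((parts ν S).antidiagonal.map F).sum =
      ∑ T ∈ S.powerset, F (parts ν T, parts ν (S \ T)) := by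
  induction S using Finset.induction_on generalizing F with
  | empty => simp [parts_empty]
  | insert a S ha ih =>
    rw [parts_insert ν ha, Multiset.antidiagonal_cons, Multiset.map_add, Multiset.sum_add,
      Multiset.map_map, Multiset.map_map, ih, ih, Finset.sum_powerset_insert ha]
    congr 1
    · refine Finset.sum_congr rfl fun T hT => ?_
      have haT : a ∉ T := fun h => ha (Finset.mem_powerset.1 hT h)
      rw [Finset.insert_sdiff_of_notMem _ haT,
        parts_insert ν (fun h => ha (Finset.mem_sdiff.1 h).1)]
      rfl
    · refine Finset.sum_congr rfl fun T hT => ?_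
      have haT : a ∉ T := fun h => ha (Finset.mem_powerset.1 hT h)
      rw [Finset.insert_sdiff_insert, Finset.sdiff_insert_of_notMem ha, parts_insert ν haT]
      rfl

/-- Evaluation of functions of multisets at the multisets of the `ν i` with `i ∈ S`. -/
def evalParts {R : Type} [CommRing R] (ν : Fin n → ℕ) : MultiFun R →+* SetFun (Fin n) R where
  toFun f := .of fun S => f (parts ν S)
  map_one' := by
    ext S
    rw [SetFun.of_apply, MultiFun.one_apply, SetFun.one_apply]
    simp only [parts_eq_zero]
  map_mul' f g := by
    ext S
    rw [SetFun.of_apply, MultiFun.mul_apply, sum_antidiagonal_parts]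
    rfl
  map_zero' := rfl
  map_add' _ _ := rfl

theorem evalParts_apply {R : Type} [CommRing R] (ν : Fin n → ℕ) (f : MultiFun R)
    (S : Finset (Fin n)) : evalParts ν f S = f (parts ν S) := rfl

end Parts

/-! ### Connected numbers as a logarithm -/

/-- The generating series `∑_b h^•_b β^b / b!` of the disconnected numbers. -/
def disconnectedFun (q r : ℕ) : MultiFun (PowerSeries ℂ) := .of fun s =>
  PowerSeries.mk fun b => disconnectedNumber q r b s / (b.factorial : ℂ)

/-- The generating series `∑_b h^∘_b β^b / b!` of the connected numbers. -/
def connectedFun (q r : ℕ) : MultiFun (PowerSeries ℂ) := MultiFun.logFun (disconnectedFun q r)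

theorem coeff_disconnectedFun (q r b : ℕ) (s : Multiset ℕ) :
    PowerSeries.coeff b (disconnectedFun q r s) =
      disconnectedNumber q r b s / (b.factorial : ℂ) := by
  rw [disconnectedFun, MultiFun.of_apply, PowerSeries.coeff_mk]

theorem disconnectedSeries_eq (q r : ℕ) {n : ℕ} (ν : Fin n → ℕ) (I : Finset (Fin n)) :
    disconnectedSeries q r ν I = disconnectedFun q r (parts ν I) := by
  ext b
  rw [disconnectedSeries, coeff_disconnectedFun, PowerSeries.coeff_mk, parts, hDisconnected_eq]
  congr 2
  rw [← Multiset.map_coe, Finset.sort_eq]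

theorem disconnectedFun_zero (q r : ℕ) : disconnectedFun q r 0 = 1 := by
  ext b
  rw [coeff_disconnectedFun, PowerSeries.coeff_one]
  cases b with
  | zero =>
    have := hDisconnected_eq q r 0 []
    rw [Multiset.coe_nil] at this
    rw [← this]
    simp [hDisconnected, vev]
  | succ b =>
    rw [disconnectedNumber_cutAndJoin q r b 0 (by simp) 0 (by simp)]
    simp [Multiset.filter_singleton]

/-- Inserting the marked part ν_a into Z = e^F gives (∂F) Z, which is the recursion over the block
containing a. By `connected_unique` the logarithm then computes the inclusion-exclusion. -/
theorem connected_disconnectedSeries (q r : ℕ) {n : ℕ} (ν : Fin n → ℕ) (I : Finset (Fin n))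
    (hI : I.Nonempty) :
    connected (disconnectedSeries q r ν) I = connectedFun q r (parts ν I) := by
  refine connected_unique _ ?_ (fun I => connectedFun q r (parts ν I)) ?_ I hI
  · rw [disconnectedSeries_eq, parts_empty, disconnectedFun_zero]
  · intro I a ha
    simp only [disconnectedSeries_eq]
    have h1 := congrArg (fun f : MultiFun (PowerSeries ℂ) => f (parts ν (I.erase a)))
      (MultiFun.shift_eq_logFun_mul (disconnectedFun q r) (disconnectedFun_zero q r) (ν a))
    rw [MultiFun.shift_apply, ← parts_insert ν (Finset.notMem_erase a I), Finset.insert_erase ha,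
      MultiFun.mul_apply, sum_antidiagonal_parts] at h1
    rw [h1]
    refine Finset.sum_nbij' (fun T => insert a T) (fun T => T.erase a) ?_ ?_ ?_ ?_ ?_
    · intro T hT
      rw [Finset.mem_powerset] at hT
      simp only [Finset.mem_filter, Finset.mem_powerset, Finset.mem_insert_self, and_true]
      exact Finset.insert_subset ha (hT.trans (Finset.erase_subset _ _))
    · intro T hT
      rw [Finset.mem_filter, Finset.mem_powerset] at hT
      exact Finset.mem_powerset.2 (Finset.erase_subset_erase a hT.1)
    · intro T hT
      exact Finset.erase_insert fun h => Finset.notMem_erase a I (Finset.mem_powerset.1 hT h)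
    · intro T hT
      exact Finset.insert_erase (Finset.mem_filter.1 hT).2
    · intro T hT
      have haT : a ∉ T := fun h => Finset.notMem_erase a I (Finset.mem_powerset.1 hT h)
      rw [MultiFun.shift_apply, parts_insert ν haT, connectedFun]
      congr 3
      dsimp only
      congr 1
      ext x
      simp only [Finset.mem_sdiff, Finset.mem_erase, Finset.mem_insert]
      tauto

/-! ### Weighted insertions of parts -/

section Insertion
variable {R : Type} [CommRing R]

/-- `∑_k ω_k w^k x_k`, for a sequence of power series in `w`. -/
def weightedSum (ω : ℕ → R) : (ℕ → PowerSeries R) →+ PowerSeries R where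
  toFun x := PowerSeries.mk fun M => ∑ p ∈ antidiagonal M, ω p.1 * PowerSeries.coeff p.2 (x p.1)
  map_zero' := by ext M; simp
  map_add' x y := by
    ext M
    simp only [PowerSeries.coeff_mk, Pi.add_apply, map_add, mul_add, Finset.sum_add_distrib]

theorem coeff_weightedSum (ω : ℕ → R) (x : ℕ → PowerSeries R) (M : ℕ) :
    PowerSeries.coeff M (weightedSum ω x) =
      ∑ p ∈ antidiagonal M, ω p.1 * PowerSeries.coeff p.2 (x p.1) := by
  exact PowerSeries.coeff_mk M fun M => ∑ p ∈ antidiagonal M, ω p.1 * PowerSeries.coeff p.2 (x p.1)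

theorem coeff_weightedSum_of_le (ω : ℕ → R) (x : ℕ → PowerSeries R) {M N : ℕ} (h : M ≤ N) :
    PowerSeries.coeff M (weightedSum ω x) = PowerSeries.coeff M
      (∑ k ∈ Finset.range (N + 1), PowerSeries.X ^ k * (PowerSeries.C (ω k) * x k)) := by
  rw [coeff_weightedSum, map_sum,
    Finset.Nat.sum_antidiagonal_eq_sum_range_succ fun i j => ω i * PowerSeries.coeff j (x i)]
  simp only [PowerSeries.coeff_X_pow_mul', PowerSeries.coeff_C_mul]
  rw [← Finset.sum_subset (Finset.range_mono (Nat.succ_le_succ h))]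
  · exact Finset.sum_congr rfl fun k hk =>
      (if_pos (Nat.lt_succ_iff.1 (Finset.mem_range.1 hk))).symm
  · intro k _ hk
    exact if_neg (by simpa using hk)

theorem weightedSum_mul (ω : ℕ → R) (x : ℕ → PowerSeries R) (y : PowerSeries R) :
    weightedSum ω (fun k => x k * y) = weightedSum ω x * y := by
  ext M
  rw [coeff_weightedSum_of_le ω _ le_rfl, PowerSeries.coeff_mul]
  have h1 : ∀ p ∈ antidiagonal M, PowerSeries.coeff p.1 (weightedSum ω x) * PowerSeries.coeff p.2 y =
      PowerSeries.coeff p.1 (∑ k ∈ Finset.range (M + 1),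
        PowerSeries.X ^ k * (PowerSeries.C (ω k) * x k)) * PowerSeries.coeff p.2 y := fun p hp => by
    rw [coeff_weightedSum_of_le ω x (Finset.HasAntidiagonal.antidiagonal.fst_le hp)]
  rw [Finset.sum_congr rfl h1, ← PowerSeries.coeff_mul, Finset.sum_mul]
  simp only [mul_assoc]

variable [Algebra ℂ R]

/-- The derivation `∑_k ω_k w^k ∂_k`, where `∂_k` is the shift by the part `k`. -/
def insertDer (ω : ℕ → R) : Derivation ℂ (MultiFun (PowerSeries R)) (MultiFun (PowerSeries R)) :=
  Derivation.mk'
    { toFun := fun f => .of fun s => weightedSum ω fun k => f (k ::ₘ s)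
      map_add' := fun f g => MultiFun.ext fun s =>
        map_add (weightedSum ω) (fun k => f (k ::ₘ s)) (fun k => g (k ::ₘ s))
      map_smul' := fun c f => MultiFun.ext fun s => by
        ext M
        change PowerSeries.coeff M (weightedSum ω fun k => c • f (k ::ₘ s)) =
          PowerSeries.coeff M (c • (weightedSum ω fun k => f (k ::ₘ s)))
        rw [PowerSeries.coeff_smul, coeff_weightedSum, coeff_weightedSum, Finset.smul_sum]
        simp only [PowerSeries.coeff_smul, mul_smul_comm] }
    fun f g => MultiFun.ext fun s => by
      have key : ∀ f g : MultiFun (PowerSeries R),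
          ((MultiFun.of (fun s => weightedSum ω fun k => f (k ::ₘ s)) * g :
            MultiFun (PowerSeries R)) s) =
          weightedSum ω fun k => (MultiFun.shift k f * g) s := by
        intro f g
        have h : ∀ m : Multiset (Multiset ℕ × Multiset ℕ),
            (m.map fun p => (weightedSum ω fun k => f (k ::ₘ p.1)) * g p.2).sum =
            weightedSum ω fun k => (m.map fun p => MultiFun.shift k f p.1 * g p.2).sum := by
          intro m
          induction m using Multiset.induction with
          | empty => exact (map_zero (weightedSum ω)).symm
          | cons p m ih =>
            simp only [Multiset.map_cons, Multiset.sum_cons, ih]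
            rw [← weightedSum_mul]
            exact (map_add (weightedSum ω) _ _).symm
        exact h _
      change (weightedSum ω fun k => (f * g) (k ::ₘ s)) =
        (f * MultiFun.of (fun s => weightedSum ω fun k => g (k ::ₘ s)) +
        g * MultiFun.of (fun s => weightedSum ω fun k => f (k ::ₘ s)) :
          MultiFun (PowerSeries R)) s
      rw [MultiFun.add_apply, mul_comm f (MultiFun.of fun s => weightedSum ω fun k => g (k ::ₘ s)),
        mul_comm g (MultiFun.of fun s => weightedSum ω fun k => f (k ::ₘ s)), key, key, ← map_add]
      congr 1
      funext k
      rw [MultiFun.mul_cons_apply, mul_comm f, add_comm]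
      rfl

theorem insertDer_apply (ω : ℕ → R) (f : MultiFun (PowerSeries R)) (s : Multiset ℕ) :
    insertDer ω f s = weightedSum ω fun k => f (k ::ₘ s) := rfl

theorem insertDer_eq_log_mul (ω : ℕ → R) (Z F : MultiFun (PowerSeries R)) (hZ : Z 0 = 1)
    (hF : F 0 = 0) (h : MultiFun.num F * Z = MultiFun.num Z) :
    insertDer ω Z = insertDer ω F * Z := by
  refine MultiFun.derivation_eq_log_mul Z F hZ hF h (insertDer ω) (fun f g => ?_) 1 (fun f => ?_)
    (fun h => absurd h one_ne_zero)
  · rw [Derivation.leibniz, smul_eq_mul, smul_eq_mul, mul_comm g, add_comm]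
  · refine MultiFun.ext fun s => ?_
    rw [MultiFun.add_apply, one_smul, MultiFun.num_apply, insertDer_apply, insertDer_apply]
    have : ∀ k, MultiFun.num f (k ::ₘ s) = f (k ::ₘ s) * ((s.card : PowerSeries R) + 1) := by
      intro k
      rw [MultiFun.num_apply, Multiset.card_cons]
      push_cast; ring
    simp only [this]
    rw [weightedSum_mul]; ring

theorem coeff_iterate_insertDer (ω : ℕ → R) (A : Multiset ℕ → R) (l M : ℕ) (u : Multiset ℕ) :
    PowerSeries.coeff M ((insertDer ω)^[l] (MultiFun.of fun s => PowerSeries.C (A s)) u) =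
      insertions ω A l M u := by
  induction l generalizing M u with
  | zero =>
    rw [Function.iterate_zero, id_eq, MultiFun.of_apply, PowerSeries.coeff_C, insertions]
  | succ l ih =>
    rw [Function.iterate_succ_apply', insertDer_apply, coeff_weightedSum, insertions]
    simp only [ih]

end Insertion

/-! ### The connected cut-and-join equation -/

section Exponent
variable {R : Type} [CommRing R] [Algebra ℂ R] {n : ℕ}

/-- The set functions `K ↦ ∑_{s ≥ 1} t^s θ^{s-1} / s! ∑_λ ∏ ω_{λ_i} w^{λ_i} c(λ, ν_K)`, the inner
sum being over sequences `λ` of length `s`. -/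
def insertionSeries (ω : ℕ → R) (θ : R) (c : Multiset ℕ → R) (ν : Fin n → ℕ) :
    PowerSeries (SetFun (Fin n) (PowerSeries R)) :=
  PowerSeries.mk fun s => if s = 0 then 0 else SetFun.of fun K => PowerSeries.mk fun a =>
    θ ^ (s - 1) * ((s.factorial : ℂ)⁻¹ • insertions ω c s a (parts ν K))

theorem coeff_insertionSeries (ω : ℕ → R) (θ : R) (c : Multiset ℕ → R) (ν : Fin n → ℕ)
    {s : ℕ} (hs : s ≠ 0) (a : ℕ) (K : Finset (Fin n)) :
    PowerSeries.coeff a ((PowerSeries.coeff s (insertionSeries ω θ c ν)) K) =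
      θ ^ (s - 1) * ((s.factorial : ℂ)⁻¹ • insertions ω c s a (parts ν K)) := by
  rw [insertionSeries, PowerSeries.coeff_mk, if_neg hs, SetFun.of_apply, PowerSeries.coeff_mk]

theorem constantCoeff_insertionSeries (ω : ℕ → R) (θ : R) (c : Multiset ℕ → R) (ν : Fin n → ℕ) :
    PowerSeries.constantCoeff (insertionSeries ω θ c ν) = 0 := by
  rw [← PowerSeries.coeff_zero_eq_constantCoeff_apply, insertionSeries, PowerSeries.coeff_mk,
    if_pos rfl]

/-- Inserting l parts into the disconnected series distributes them over connected components. The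
components that receive inserted parts, together with the old parts on them, form the exponential;
the remaining parts stay in a disconnected factor. This is `flow_eq_exp_mul` for the insertion
derivation. -/
theorem insertions_eq_exp (ω : ℕ → R) (Z F : MultiFun R) (hZ : Z 0 = 1) (hF : F 0 = 0)
    (h : MultiFun.num F * Z = MultiFun.num Z) (ν : Fin n → ℕ) (l M : ℕ) (J : Finset (Fin n)) :
    (l.factorial : ℂ)⁻¹ • insertions ω Z l M (parts ν J) =
      ∑ V ∈ J.powerset, PowerSeries.coeff M
        ((PowerSeries.coeff l (expSeries (insertionSeries ω 1 F ν))) V) * Z (parts ν (J \ V)) := by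
  set C' : R →+* PowerSeries R := PowerSeries.C
  have h1 := flow_eq_exp_mul (insertDer ω) (MultiFun.map C' F) (MultiFun.map C' Z)
    (insertDer_eq_log_mul ω _ _ (by rw [MultiFun.map_apply, hZ, map_one])
      (by rw [MultiFun.map_apply, hF, map_zero])
      (by rw [← MultiFun.map_num, ← map_mul, h, MultiFun.map_num]))
  have h2 : PowerSeries.map (evalParts ν) (flow (insertDer ω) (MultiFun.map C' F) -
      PowerSeries.C (MultiFun.map C' F)) = insertionSeries ω 1 F ν := by
    refine PowerSeries.ext fun s => ?_
    rw [PowerSeries.coeff_map, map_sub, flow, PowerSeries.coeff_mk, PowerSeries.coeff_C]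
    by_cases hs : s = 0
    · subst hs
      rw [PowerSeries.coeff_zero_eq_constantCoeff_apply, constantCoeff_insertionSeries]
      simp
    · rw [if_neg hs, sub_zero]
      refine SetFun.ext fun K => PowerSeries.ext fun a => ?_
      rw [coeff_insertionSeries _ _ _ _ hs, one_pow, one_mul, evalParts_apply,
        MultiFun.smul_apply, PowerSeries.coeff_smul]
      exact congrArg _ (coeff_iterate_insertDer ω F s a (parts ν K))
  have h3 := congrArg (fun f => PowerSeries.coeff M
    ((PowerSeries.coeff l (PowerSeries.map (evalParts ν) f)) J)) h1
  rw [map_mul, map_expSeries, h2, PowerSeries.map_C, PowerSeries.coeff_C_mul, mul_comm,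
    SetFun.mul_apply, map_sum, PowerSeries.coeff_map, flow, PowerSeries.coeff_mk, evalParts_apply,
    MultiFun.smul_apply, PowerSeries.coeff_smul] at h3
  rw [← coeff_iterate_insertDer ω Z l M (parts ν J)]
  refine h3.trans (Finset.sum_congr rfl fun V _ => ?_)
  rw [evalParts_apply, MultiFun.map_apply]
  exact PowerSeries.coeff_mul_C _ _ _

end Exponent

/-- The weight `k S(kz)` of an inserted part `k`, where `S(z) = ζ(z)/z`. -/
def partWeight (k : ℕ) : PowerSeries ℂ := (k : PowerSeries ℂ) * PowerSeries.rescale (k : ℂ) zetaDivZ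

/-- The series `z^{|I| + l} S(z)⁻¹ ∏_{i ∈ I} S(ν_i z)`. -/
def joinWeight {n : ℕ} (ν : Fin n → ℕ) (I : Finset (Fin n)) (l : ℕ) : PowerSeries ℂ :=
  PowerSeries.X ^ (I.card + l) *
    (zetaDivZ⁻¹ * ∏ i ∈ I, PowerSeries.rescale (ν i : ℂ) zetaDivZ)

/-- The coefficient of `z^e` in `W f`, for `f` with a further variable. -/
def coeffMul (e : ℕ) (W : PowerSeries ℂ) :
    PowerSeries (PowerSeries ℂ) →ₗ[ℂ] PowerSeries ℂ where
  toFun f := PowerSeries.mk fun b => PowerSeries.coeff e (W * PowerSeries.coeff b f)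
  map_add' f g := by ext b; simp [mul_add]
  map_smul' c f := by ext b; simp [mul_smul_comm]

theorem coeff_coeffMul (e : ℕ) (W : PowerSeries ℂ) (f : PowerSeries (PowerSeries ℂ)) (b : ℕ) :
    PowerSeries.coeff b (coeffMul e W f) = PowerSeries.coeff e (W * PowerSeries.coeff b f) :=
  PowerSeries.coeff_mk b fun b => PowerSeries.coeff e (W * PowerSeries.coeff b f)

theorem coeffMul_mul_map_C (e : ℕ) (W : PowerSeries ℂ) (f : PowerSeries (PowerSeries ℂ))
    (a : PowerSeries ℂ) :
    coeffMul e W (f * PowerSeries.map PowerSeries.C a) = coeffMul e W f * a := by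
  ext b
  rw [coeff_coeffMul, PowerSeries.coeff_mul b, PowerSeries.coeff_mul b, Finset.mul_sum, map_sum]
  refine Finset.sum_congr rfl fun p _ => ?_
  rw [PowerSeries.coeff_map, ← mul_assoc, PowerSeries.coeff_mul_C, coeff_coeffMul]

/-- The right-hand side of the connected cut-and-join equation. -/
def cutJoin (r : ℕ) {n : ℕ} (Y : PowerSeries (SetFun (Fin n) (PowerSeries (PowerSeries (PowerSeries ℂ)))))
    (ν : Fin n → ℕ) (U : Finset (Fin n)) : PowerSeries ℂ :=
  ∑ I ∈ U.powerset, if I = ∅ then 0 else ∑ l ∈ Finset.range (r + 3),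
    coeffMul (r + 2) (joinWeight ν I l)
      (PowerSeries.coeff (∑ i ∈ I, ν i) ((PowerSeries.coeff l Y) (U \ I)))

theorem coeff_insertions (A : MultiFun (PowerSeries ℂ)) (b l M : ℕ) (u : Multiset ℕ) :
    PowerSeries.coeff b (insertions (fun k => PowerSeries.C (partWeight k))
      (MultiFun.map (PowerSeries.map PowerSeries.C) A) l M u) =
    insertions partWeight (fun s => PowerSeries.C (PowerSeries.coeff b (A s))) l M u := by
  induction l generalizing M u with
  | zero =>
    simp only [insertions]
    split_ifs with h
    · rw [MultiFun.map_apply, PowerSeries.coeff_map]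
    · simp
  | succ l ih =>
    simp only [insertions, map_sum, PowerSeries.coeff_C_mul, ih]

theorem insertions_mul_left {R : Type} [CommRing R] (c : R) (w : ℕ → R) (A : Multiset ℕ → R) (l M : ℕ)
    (u : Multiset ℕ) :
    insertions w (fun s => c * A s) l M u = c * insertions w A l M u := by
  induction l generalizing M u with
  | zero => simp [insertions]
  | succ l ih =>
    rw [insertions, insertions, Finset.mul_sum]
    refine Finset.sum_congr rfl fun p _ => ?_
    rw [ih]; ring

theorem derivative_disconnectedFun (q r : ℕ) {n : ℕ} (ν : Fin n → ℕ) (hν : ∀ i, 1 ≤ ν i)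
    (S : Finset (Fin n)) :
    derivative ℂ (disconnectedFun q r (parts ν S)) =
      (r.factorial : ℂ) • ∑ I ∈ S.powerset, if I = ∅ then 0 else ∑ l ∈ Finset.range (r + 3),
        coeffMul (r + 2) (joinWeight ν I l) ((l.factorial : ℂ)⁻¹ •
          insertions (fun k => PowerSeries.C (partWeight k))
            (MultiFun.map (PowerSeries.map PowerSeries.C) (disconnectedFun q r)) l (∑ i ∈ I, ν i)
            (parts ν (S \ I))) := by
  ext b
  have hs : ∀ k ∈ parts ν S, 1 ≤ k := fun k hk => by
    obtain ⟨i, _, rfl⟩ := Multiset.mem_map.1 hk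
    exact hν i
  have hfilter : ∀ (m : Multiset (Multiset ℕ × Multiset ℕ)) (F : Multiset ℕ × Multiset ℕ → ℂ),
      ((m.filter fun p => p.1 ≠ 0).map F).sum = (m.map fun p => if p.1 = 0 then 0 else F p).sum := by
    intro m F
    induction m using Multiset.induction with
    | empty => simp
    | cons p m ih =>
      by_cases h : p.1 = 0
      · rw [Multiset.filter_cons_of_neg _ (by simpa using h), ih]; simp [h]
      · rw [Multiset.filter_cons_of_pos (p := fun p : Multiset ℕ × Multiset ℕ => p.1 ≠ 0) _ h,
          Multiset.map_cons, Multiset.sum_cons, ih, Multiset.map_cons, Multiset.sum_cons, if_neg h]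
  have hb : PowerSeries.coeff b (derivative ℂ (disconnectedFun q r (parts ν S))) =
      (b.factorial : ℂ)⁻¹ * disconnectedNumber q r (b + 1) (parts ν S) := by
    rw [PowerSeries.coeff_derivative, coeff_disconnectedFun, Nat.factorial_succ]
    have h1 : (b : ℂ) + 1 ≠ 0 := by exact_mod_cast Nat.succ_ne_zero b
    push_cast
    field_simp
  rw [hb, disconnectedNumber_cutAndJoin q r b _ hs ((parts ν S).sum + r + 2) (by omega),
    hfilter, sum_antidiagonal_parts, PowerSeries.coeff_smul, map_sum, smul_eq_mul, mul_left_comm,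
    Finset.mul_sum]
  congr 1
  refine Finset.sum_congr rfl fun I _ => ?_
  simp only [parts_eq_zero]
  split_ifs with hI
  · simp
  rw [map_sum, Finset.mul_sum]
  symm
  -- The weight is divisible by z^l and the coefficient of z^{r+2} is taken, so the terms with l > r
  -- + 2 vanish. This replaces a bound depending on the parts by a uniform one.
  refine (Finset.sum_subset (Finset.range_mono (by omega)) fun l _ hl => ?_).trans
    (Finset.sum_congr rfl fun l _ => ?_)
  · rw [Finset.mem_range, not_lt] at hl
    rw [coeff_coeffMul, joinWeight, mul_assoc, PowerSeries.coeff_X_pow_mul', if_neg (by omega)]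
  · rw [map_smul, PowerSeries.coeff_smul, coeff_coeffMul, coeff_insertions, smul_eq_mul,
      mul_left_comm, card_parts, sum_parts]
    congr 1
    have h1 : (fun s => PowerSeries.C (PowerSeries.coeff b (disconnectedFun q r s))) =
        fun s => (PowerSeries.C (b.factorial : ℂ)⁻¹) * PowerSeries.C (disconnectedNumber q r b s) := by
      funext s
      rw [coeff_disconnectedFun, ← map_mul, div_eq_inv_mul]
    rw [h1, insertions_mul_left, joinWeight, mul_left_comm, PowerSeries.coeff_C_mul]
    congr 2
    have h2 : ((parts ν I).map fun k : ℕ => PowerSeries.rescale (k : ℂ) zetaDivZ).prod =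
        ∏ i ∈ I, PowerSeries.rescale (ν i : ℂ) zetaDivZ := by
      rw [parts, Multiset.map_map]; rfl
    rw [h2]
    simp only [mul_assoc]
    rfl

theorem mapDerivative_eq_mul (Z F : MultiFun (PowerSeries ℂ)) (hZ : Z 0 = 1) (hF : F 0 = 0)
    (h : MultiFun.num F * Z = MultiFun.num Z) (s : Multiset ℕ) :
    derivative ℂ (Z s) = (s.antidiagonal.map fun p => derivative ℂ (F p.1) * Z p.2).sum := by
  have h1 := MultiFun.derivation_eq_log_mul Z F hZ hF h
    (fun f => .of fun s => derivative ℂ (f s)) (fun f g => MultiFun.ext fun s => ?_) 0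
    (fun f => MultiFun.ext fun s => ?_) (fun _ => ?_)
  · exact congrArg (fun f : MultiFun (PowerSeries ℂ) => f s) h1
  · rw [MultiFun.of_apply, MultiFun.add_apply, MultiFun.mul_apply, MultiFun.mul_apply,
      MultiFun.mul_apply, map_multiset_sum, Multiset.map_map, ← Multiset.sum_map_add]
    refine congrArg Multiset.sum (Multiset.map_congr rfl fun p _ => ?_)
    rw [Function.comp, Derivation.leibniz, smul_eq_mul, smul_eq_mul, MultiFun.of_apply,
      MultiFun.of_apply, mul_comm (g p.2), add_comm]
  · rw [zero_smul, add_zero, MultiFun.of_apply, MultiFun.num_apply, MultiFun.num_apply,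
      MultiFun.of_apply, Derivation.leibniz, Derivation.map_natCast, smul_zero, add_zero,
      smul_eq_mul]
  · change derivative ℂ (Z 0) = derivative ℂ (F 0)
    rw [hZ, hF, Derivation.map_one_eq_zero, map_zero]

/-- With Z = e^F, the derivative in β is (∂F) Z on one hand and, by the disconnected equation and
`insertions_eq_exp`, r! times the right-hand side below convolved with Z on the other. Since Z is 1
on the empty multiset, it can be cancelled by induction on the set. -/
theorem derivative_connectedFun (q r : ℕ) {n : ℕ} (ν : Fin n → ℕ) (hν : ∀ i, 1 ≤ ν i)
    (S : Finset (Fin n)) :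
    derivative ℂ (connectedFun q r (parts ν S)) = (r.factorial : ℂ) •
      cutJoin r (expSeries (insertionSeries (fun k => PowerSeries.C (partWeight k)) 1
        (MultiFun.map (PowerSeries.map PowerSeries.C) (connectedFun q r)) ν)) ν S := by
  set Y := expSeries (insertionSeries (fun k => PowerSeries.C (partWeight k)) 1
        (MultiFun.map (PowerSeries.map PowerSeries.C) (connectedFun q r)) ν) with hY
  have hZ := disconnectedFun_zero q r
  have hnum := MultiFun.num_logFun_mul _ hZ
  have h1 : ∀ S, derivative ℂ (disconnectedFun q r (parts ν S)) =
      ∑ U ∈ S.powerset, derivative ℂ (connectedFun q r (parts ν U)) *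
        disconnectedFun q r (parts ν (S \ U)) := fun S => by
    rw [mapDerivative_eq_mul _ _ hZ (MultiFun.logFun_zero _) hnum, sum_antidiagonal_parts]
    rfl
  have h2 : ∀ S, derivative ℂ (disconnectedFun q r (parts ν S)) =
      ∑ U ∈ S.powerset, (r.factorial : ℂ) • cutJoin r Y ν U *
        disconnectedFun q r (parts ν (S \ U)) := fun S => by
    rw [derivative_disconnectedFun q r ν hν]
    simp only [smul_mul_assoc, ← Finset.smul_sum]
    congr 1
    simp only [cutJoin, Finset.sum_mul]
    have h3 := SetFun.sum_powerset_assoc S fun I V W => if I = ∅ then 0 else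
      ∑ l ∈ Finset.range (r + 3), coeffMul (r + 2) (joinWeight ν I l)
        (PowerSeries.coeff (∑ i ∈ I, ν i) ((PowerSeries.coeff l Y) V)) *
          disconnectedFun q r (parts ν W)
    simp only [ite_mul, zero_mul, Finset.sum_mul]
    refine Eq.trans ?_ h3.symm
    refine Finset.sum_congr rfl fun I _ => ?_
    split_ifs with hI
    · simp
    rw [Finset.sum_comm]
    refine Finset.sum_congr rfl fun l _ => ?_
    rw [insertions_eq_exp _ _ (MultiFun.map (PowerSeries.map PowerSeries.C) (connectedFun q r))
      (by rw [MultiFun.map_apply, hZ, map_one])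
      (by rw [MultiFun.map_apply, connectedFun, MultiFun.logFun_zero, map_zero])
      (by rw [← MultiFun.map_num, ← map_mul, connectedFun, hnum, MultiFun.map_num]), map_sum]
    refine Finset.sum_congr rfl fun V _ => ?_
    rw [MultiFun.map_apply, coeffMul_mul_map_C]
  induction S using Finset.strongInduction with
  | H S ih =>
  have h4 := (h1 S).symm.trans (h2 S)
  rw [← Finset.add_sum_erase _ _ (Finset.mem_powerset_self S),
    ← Finset.add_sum_erase S.powerset _ (Finset.mem_powerset_self S), Finset.sdiff_self,
    parts_empty, hZ, mul_one, mul_one] at h4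
  have h5 : ∀ U ∈ S.powerset.erase S, derivative ℂ (connectedFun q r (parts ν U)) *
      disconnectedFun q r (parts ν (S \ U)) = (r.factorial : ℂ) • cutJoin r Y ν U *
        disconnectedFun q r (parts ν (S \ U)) := fun U hU => by
    rw [Finset.mem_erase, Finset.mem_powerset] at hU
    rw [ih U (Finset.ssubset_iff_subset_ne.2 ⟨hU.2, hU.1⟩)]
  rw [Finset.sum_congr rfl h5] at h4
  exact add_right_cancel h4

/-! ### The numbers without completed cycles -/

section Lowering

theorem hop_self_single (i : ℤ) (E : Finset ℤ) (c : ℂ) :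
    hop ℂ i i (Finsupp.single E c) = if Occupied E i then Finsupp.single E c else 0 := by
  have ho := occupied_symmDiff_singleton E i i
  rw [hop_apply, annihilate_single]
  by_cases h : Occupied E i
  · rw [if_pos h, if_pos h, create_single, if_neg (by rw [ho]; simp [Xor, h]),
      symmDiff_symmDiff_cancel_right]
    have := wedgeSign_mul_self (R := ℂ) E i
    congr 1
    linear_combination c * this
  · simp [h]

theorem exists_occupied_iff (E : Finset ℤ) : ∃ L : ℕ, ∀ j : ℤ,
    ((L : ℤ) ≤ j → ¬ Occupied E j) ∧ (j < -(L : ℤ) → Occupied E j) := by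
  refine ⟨∑ k ∈ E, (k.natAbs + 1), fun j => ?_⟩
  have h : ∀ k ∈ E, k.natAbs + 1 ≤ ∑ k ∈ E, (k.natAbs + 1) := fun k hk =>
    Finset.single_le_sum (f := fun k : ℤ => k.natAbs + 1) (fun _ _ => Nat.zero_le _) hk
  constructor
  · intro hj
    have : j ∉ E := fun hE => by have := h j hE; omega
    simp only [Occupied, Xor, this, false_and, false_or, not_and, not_not]
    omega
  · intro hj
    have : j ∉ E := fun hE => by have := h j hE; omega
    simp only [Occupied, Xor, this, false_and, false_or, not_false_eq_true, and_true]
    omega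

/-- Far below everything is occupied and far above nothing is, so the shifted and unshifted counts
over a long window differ by q, whatever the state. This is the central term of the Heisenberg
algebra. -/
theorem sum_occupied_sub (E : Finset ℤ) (q L : ℕ)
    (hL : ∀ j : ℤ, ((L : ℤ) ≤ j → ¬ Occupied E j) ∧ (j < -(L : ℤ) → Occupied E j)) :
    ∑ j ∈ Finset.Ico (-((L + q : ℕ) : ℤ)) (L + q : ℕ),
      ((if Occupied E j then (1 : ℂ) else 0) - if Occupied E (j + q) then 1 else 0) = q := by
  rw [Finset.sum_sub_distrib]
  have h1 : ∑ j ∈ Finset.Ico (-((L + q : ℕ) : ℤ)) (L + q : ℕ),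
      (if Occupied E (j + q) then (1 : ℂ) else 0) =
      ∑ j ∈ Finset.Ico (-(L : ℤ)) (L + q : ℕ), if Occupied E j then (1 : ℂ) else 0 := by
    have h2 : ∑ j ∈ Finset.Ico (-((L + q : ℕ) : ℤ)) (L + q : ℕ),
        (if Occupied E (j + q) then (1 : ℂ) else 0) =
        ∑ j ∈ Finset.Ico (-(L : ℤ)) (L + q + q : ℕ), if Occupied E j then (1 : ℂ) else 0 := by
      refine Finset.sum_nbij' (· + (q : ℤ)) (· - (q : ℤ)) ?_ ?_ ?_ ?_ ?_
      · intro j hj; simp only [Finset.mem_Ico] at hj ⊢; push_cast at hj ⊢; omega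
      · intro j hj; simp only [Finset.mem_Ico] at hj ⊢; push_cast at hj ⊢; omega
      · intro j _; simp
      · intro j _; simp
      · intro j _; rfl
    rw [h2]
    symm
    refine Finset.sum_subset (Finset.Ico_subset_Ico_right (by push_cast; omega)) ?_
    intro j _ hj
    refine if_neg ((hL j).1 ?_)
    simp only [Finset.mem_Ico] at *
    push_cast at *
    omega
  have h3 : Finset.Ico (-((L + q : ℕ) : ℤ)) (L + q : ℕ) =
      Finset.Ico (-((L + q : ℕ) : ℤ)) (-(L : ℤ)) ∪ Finset.Ico (-(L : ℤ)) (L + q : ℕ) := by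
    ext j; simp only [Finset.mem_Ico, Finset.mem_union]; push_cast; omega
  rw [h1, h3, Finset.sum_union, add_sub_cancel_right, Finset.sum_congr rfl (g := fun _ => (1 : ℂ))]
  · simp
  · intro j hj
    exact if_pos ((hL j).2 (Finset.mem_Ico.1 hj).2)
  · rw [Finset.disjoint_left]
    intro j; simp only [Finset.mem_Ico]; omega

/-- For k ≠ q the commutator is again a one-body operator, with coefficient function 0. For k = q it
is a sum of differences of occupation numbers, which is evaluated on basis vectors. -/
theorem alpha_raise (q k : ℕ) (hq : 1 ≤ q) (hk : 1 ≤ k) (v : Wedge) :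
    alpha q (raise ℂ k v) = raise ℂ k (alpha q v) + (if k = q then (q : ℂ) else 0) • v := by
  rw [alpha_eq_oneBody, raise]
  by_cases hkq : k = q
  · subst hkq
    rw [if_pos rfl]
    induction v using Finsupp.induction_linear with
    | zero => simp
    | add v w hv hw =>
      simp only [map_add, hv, hw, smul_add]
      abel
    | single E c =>
      obtain ⟨s, hs⟩ := exists_oneBody_eq_sum (show (-(k : ℤ)) ≠ 0 by omega) (fun _ => (1 : ℂ))
        (Finsupp.single E c)
      obtain ⟨t, ht⟩ := exists_oneBody_eq_sum (show (-(k : ℤ)) ≠ 0 by omega) (fun _ => (1 : ℂ))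
        (oneBody (k : ℤ) (fun _ => (1 : ℂ)) (Finsupp.single E c))
      obtain ⟨L₀, hL₀⟩ := exists_occupied_iff E
      -- L is chosen so large that the window contains all hops that act, and that the occupation is
      -- already constant outside [-L, L).
      set L := L₀ + ∑ j ∈ s ∪ t, (j.natAbs + 1) with hL
      have hL' : ∀ j : ℤ, ((L : ℤ) ≤ j → ¬ Occupied E j) ∧ (j < -(L : ℤ) → Occupied E j) := fun j =>
        ⟨fun h => (hL₀ j).1 (by omega), fun h => (hL₀ j).2 (by omega)⟩
      have hst : s ∪ t ⊆ Finset.Ico (-((L + k : ℕ) : ℤ)) (L + k : ℕ) := fun j hj => by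
        have := Finset.single_le_sum (f := fun k : ℤ => k.natAbs + 1) (fun _ _ => Nat.zero_le _) hj
        rw [Finset.mem_Ico]; push_cast; omega
      rw [hs _ (Finset.union_subset_left hst), ht _ (Finset.union_subset_right hst)]
      simp only [one_smul, sub_neg_eq_add, map_sum]
      simp only [oneBody_hop (show (k : ℤ) ≠ 0 by omega), one_smul, add_sub_cancel_right]
      simp only [add_sub_assoc, Finset.sum_add_distrib]
      congr 1
      have h := sum_occupied_sub E k L hL'
      rw [← h, Finset.sum_smul]
      refine Finset.sum_congr rfl fun j _ => ?_
      rw [hop_self_single, hop_self_single, sub_smul]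
      split_ifs <;> simp
  · rw [if_neg hkq, zero_smul, oneBody_oneBody (by omega) (by omega) (by omega)]
    congr 1
    simp only [mul_one, sub_self]
    obtain ⟨s, hs⟩ := exists_oneBody_eq_sum (show (q : ℤ) + -(k : ℤ) ≠ 0 by omega)
      (fun _ => (0 : ℂ)) v
    rw [hs s le_rfl]
    simp

theorem alpha_vacuum (q : ℕ) (hq : 1 ≤ q) : alpha q (vacuum ℂ) = 0 := by
  have h : hops (q : ℤ) ∅ = ∅ := by
    refine Finset.eq_empty_of_forall_notMem fun j hj => ?_
    rw [mem_hops] at hj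
    simp only [Occupied, Xor, Finset.notMem_empty, false_and, not_false_eq_true, and_true,
      false_or] at hj
    omega
  rw [alpha, vacuum, Finsupp.linearCombination_single, h]
  simp

theorem stateOn_eq_zero (s : Multiset ℕ) (h : 0 ∈ s) (v : Wedge) : stateOn s v = 0 := by
  obtain ⟨t, rfl⟩ := Multiset.exists_cons_of_mem h
  rw [stateOn_cons, insertPart]
  simp

theorem alpha_stateOn (q : ℕ) (hq : 1 ≤ q) (s : Multiset ℕ) (hs : 0 ∉ s) :
    alpha q (stateOn s (vacuum ℂ)) = (s.count q : ℂ) • stateOn (s.erase q) (vacuum ℂ) := by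
  induction s using Multiset.induction with
  | empty => simp [stateOn_zero, alpha_vacuum q hq]
  | cons k s ih =>
    rw [Multiset.mem_cons, not_or] at hs
    have hk : 1 ≤ k := Nat.one_le_iff_ne_zero.2 (Ne.symm hs.1)
    have hk0 : (k : ℂ) ≠ 0 := Nat.cast_ne_zero.2 (by omega)
    have hr : ∀ v : Wedge, raise ℂ k v = (k : ℂ) • insertPart k v := fun v => by
      rw [insertPart, smul_smul]; simp [hk0]
    have hcomm : alpha q (insertPart k (stateOn s (vacuum ℂ))) =
        insertPart k (alpha q (stateOn s (vacuum ℂ))) +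
          (if k = q then (1 : ℂ) else 0) • stateOn s (vacuum ℂ) := by
      rw [insertPart, map_smul, alpha_raise q k hq hk, smul_add, insertPart, smul_smul]
      congr 2
      split_ifs with h
      · subst h; simp [hk0]
      · simp
    rw [stateOn_cons, hcomm, ih hs.2]
    have hins : ∀ (c : ℂ) (v : Wedge), insertPart k (c • v) = c • insertPart k v := fun c v => by
      rw [insertPart, insertPart, map_smul, smul_comm]
    rw [hins, ← stateOn_cons]
    by_cases h : k = q
    · subst h
      rw [if_pos rfl, Multiset.erase_cons_head, Multiset.count_cons_self]
      by_cases hm : k ∈ s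
      · rw [Multiset.cons_erase hm, ← add_smul]; push_cast; rfl
      · rw [Multiset.count_eq_zero_of_notMem hm]; simp
    · rw [if_neg h, zero_smul, add_zero, Multiset.erase_cons_tail _ h,
        Multiset.count_cons_of_ne (Ne.symm h)]

theorem alpha_pow_stateOn (q : ℕ) (hq : 1 ≤ q) (d : ℕ) (s : Multiset ℕ) (hs : 0 ∉ s) :
    (alpha q ^ d) (stateOn s (vacuum ℂ)) =
      ((s.count q).descFactorial d : ℂ) • stateOn (s - Multiset.replicate d q) (vacuum ℂ) := by
  induction d with
  | zero => simp
  | succ d ih =>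
    rw [pow_succ', Module.End.mul_apply, ih, map_smul, alpha_stateOn q hq _
      (fun h => hs (Multiset.mem_of_le (Multiset.sub_le_self _ _) h)), smul_smul,
      Nat.descFactorial_succ, Multiset.count_sub, Multiset.count_replicate_self]
    congr 1
    · push_cast; ring
    · rw [← Multiset.sub_singleton, ← Multiset.sub_add_eq_sub_sub, Multiset.replicate_succ,
        ← Multiset.singleton_add, add_comm]

/-- Without completed cycles each α_q must contract with a part equal to q. The number of
contractions, a factorial, cancels against the normalization and leaves 1/q for each part. -/
theorem disconnectedNumber_zero (q r : ℕ) (hq : 1 ≤ q) (s : Multiset ℕ) :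
    disconnectedNumber q r 0 s = if ∀ k ∈ s, k = q then ((q : ℂ)⁻¹) ^ s.card else 0 := by
  by_cases h0 : 0 ∈ s
  · rw [disconnectedNumber, stateOn_eq_zero s h0, map_zero, if_neg]
    intro h
    have := h 0 h0
    omega
  have hrep : (∀ k ∈ s, k = q) → s = Multiset.replicate s.card q := Multiset.eq_replicate_card.2
  rw [disconnectedNumber, stateFun_hurwitzFun]
  by_cases hdvd : q ∣ s.sum
  · rw [if_pos hdvd, pow_zero, mul_one, LinearMap.smul_apply, Finsupp.smul_apply,
      alpha_pow_stateOn q hq _ s h0]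
    split_ifs with h
    · have hs := hrep h
      have hsum : s.sum / q = s.card := by
        rw [hs, Multiset.sum_replicate, smul_eq_mul, Multiset.card_replicate,
          Nat.mul_div_cancel _ (by omega)]
      have hc : s.count q = s.card := by
        rw [hs, Multiset.count_replicate_self, Multiset.card_replicate]
      rw [hsum, hc, Nat.descFactorial_self, ← hs, tsub_self, stateOn_zero, vacuum]
      have h1 : (s.card.factorial : ℂ) ≠ 0 := Nat.cast_ne_zero.2 (Nat.factorial_ne_zero _)
      simp only [Finsupp.smul_apply, Finsupp.single_eq_same, smul_eq_mul, mul_one]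
      rw [mul_inv, mul_assoc, inv_mul_cancel₀ h1, mul_one, inv_pow]
    -- Otherwise the parts equal to q would already have total size |μ|, and the positive remaining
    -- parts would have sum zero.
    · have hlt : s.count q < s.sum / q := by
        by_contra hle
        rw [not_lt, Multiset.le_count_iff_replicate_le] at hle
        obtain ⟨t, ht⟩ := Multiset.le_iff_exists_add.1 hle
        have hsum := congrArg Multiset.sum ht
        rw [Multiset.sum_add, Multiset.sum_replicate, smul_eq_mul, Nat.div_mul_cancel hdvd] at hsum
        have ht0 : t.sum = 0 := by omega
        apply h
        intro k hk
        rw [ht, Multiset.mem_add] at hk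
        rcases hk with hk | hk
        · exact Multiset.eq_of_mem_replicate hk
        · have hk0 : k = 0 := Multiset.sum_eq_zero_iff.1 ht0 k hk
          exact absurd (by rw [ht, ← hk0]; exact Multiset.mem_add.2 (Or.inr hk)) h0
      rw [Nat.descFactorial_of_lt hlt]
      simp
  · rw [if_neg hdvd, if_neg]
    intro h
    rw [hrep h, Multiset.sum_replicate, smul_eq_mul] at hdvd
    exact hdvd (Dvd.intro_left _ rfl)

end Lowering

theorem MultiFun.eq_zero_of_mul_eq_zero {R : Type} [CommRing R] {f Z : MultiFun R} (hZ : Z 0 = 1)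
    (h : f * Z = 0) : f = 0 := by
  refine MultiFun.ext fun s => ?_
  induction hn : s.card using Nat.strong_induction_on generalizing s with
  | _ n ih =>
  have h1 := congrArg (fun f : MultiFun R => f s) h
  simp only [MultiFun.mul_apply, MultiFun.zero_apply] at h1
  rw [← Multiset.filter_add_not (fun p => p.2 = 0) s.antidiagonal, antidiagonal_filter_snd,
    Multiset.map_add, Multiset.sum_add, Multiset.map_singleton, Multiset.sum_singleton, hZ,
    mul_one, Multiset.sum_eq_zero, add_zero] at h1
  · exact h1
  · intro x hx
    obtain ⟨p, hp, rfl⟩ := Multiset.mem_map.1 hx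
    obtain ⟨hp1, hp2⟩ := Multiset.mem_filter.1 hp
    have hc := congrArg Multiset.card (Multiset.mem_antidiagonal.1 hp1)
    rw [Multiset.card_add] at hc
    have : 0 < p.2.card := Multiset.card_pos.2 hp2
    rw [ih p.1.card (by omega) p.1 rfl, MultiFun.zero_apply, zero_mul]

/-- At β = 0 the disconnected series is the exponential of a function supported at the single
multiset {q}, where it is 1/q. This is the starting point for the support of the connected numbers.
-/
theorem constantCoeff_connectedFun (q r : ℕ) (hq : 1 ≤ q) (s : Multiset ℕ)
    (h : PowerSeries.constantCoeff (connectedFun q r s) ≠ 0) : s = {q} := by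
  induction s using Multiset.induction with
  | empty => exact absurd (by rw [connectedFun, MultiFun.logFun_zero, map_zero]) h
  | cons k s _ =>
    have hZ := disconnectedFun_zero q r
    have h1 := congrArg (MultiFun.map (PowerSeries.constantCoeff (R := ℂ)))
      (MultiFun.shift_eq_logFun_mul _ hZ k)
    set Z0 := MultiFun.map (PowerSeries.constantCoeff (R := ℂ)) (disconnectedFun q r) with hZ0
    have hZ0s : ∀ s, Z0 s = if ∀ k ∈ s, k = q then ((q : ℂ)⁻¹) ^ s.card else 0 := fun s => by
      rw [hZ0, MultiFun.map_apply, ← PowerSeries.coeff_zero_eq_constantCoeff_apply,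
        coeff_disconnectedFun, disconnectedNumber_zero q r hq]
      simp
    -- Adding a part k multiplies the value at β = 0 by 1/q or by 0, independently of the other
    -- parts; so the logarithmic derivative is a constant supported on the empty multiset.
    have h2 : MultiFun.map (PowerSeries.constantCoeff (R := ℂ))
        (MultiFun.shift k (disconnectedFun q r)) =
        (MultiFun.of fun s => if s = 0 then (if k = q then (q : ℂ)⁻¹ else 0) else 0) * Z0 := by
      have h3 : MultiFun.map (PowerSeries.constantCoeff (R := ℂ))
        (MultiFun.shift k (disconnectedFun q r)) = (if k = q then (q : ℂ)⁻¹ else 0) • Z0 := by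
        refine MultiFun.ext fun s => ?_
        rw [MultiFun.smul_apply, smul_eq_mul]
        change Z0 (k ::ₘ s) = _
        rw [hZ0s, hZ0s]
        simp only [Multiset.mem_cons, forall_eq_or_imp, Multiset.card_cons]
        by_cases hk : k = q
        · simp only [hk, true_and, if_true]
          split_ifs
          · rw [pow_succ']
          · simp
        · simp [hk]
      have h4 : (MultiFun.of fun s => if s = 0 then (if k = q then (q : ℂ)⁻¹ else 0) else 0 :
          MultiFun ℂ) = (if k = q then (q : ℂ)⁻¹ else 0) • 1 := by
        refine MultiFun.ext fun s => ?_
        rw [MultiFun.smul_apply, MultiFun.one_apply, MultiFun.of_apply]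
        split_ifs <;> simp
      rw [h3, h4, smul_mul_assoc, one_mul]
    rw [h2, map_mul, ← sub_eq_zero, ← sub_mul] at h1
    have h5 := congrArg (fun f : MultiFun ℂ => f s)
      (MultiFun.eq_zero_of_mul_eq_zero (by rw [hZ0s]; simp) h1)
    simp only [MultiFun.sub_apply, MultiFun.of_apply, MultiFun.zero_apply] at h5
    rw [sub_eq_zero] at h5
    change PowerSeries.constantCoeff (connectedFun q r (k ::ₘ s)) ≠ 0 at h
    have h6 : PowerSeries.constantCoeff (connectedFun q r (k ::ₘ s)) =
      if s = 0 then (if k = q then (q : ℂ)⁻¹ else 0) else 0 := h5.symm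
    rw [h6] at h
    by_cases hs : s = 0
    · by_cases hk : k = q
      · rw [hs, hk]; rfl
      · simp [hk] at h
    · simp [hs] at h

/-! ### Naturality and homogeneity of the exponential of the insertion series -/

section Natural
variable {R R' : Type} [CommRing R] [CommRing R'] [Algebra ℂ R] [Algebra ℂ R'] {n : ℕ}

/-- The coefficient of `t^l w^a` in the exponential of the insertion series at the set `J`. -/
def insertionExp (ω : ℕ → R) (θ : R) (c : Multiset ℕ → R) (ν : Fin n → ℕ) (l : ℕ)
    (J : Finset (Fin n)) (a : ℕ) : R :=
  PowerSeries.coeff a ((PowerSeries.coeff l (expSeries (insertionSeries ω θ c ν))) J)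

theorem map_insertions (φ : R →+* R') (ω : ℕ → R) (c : Multiset ℕ → R) (l M : ℕ)
    (u : Multiset ℕ) :
    φ (insertions ω c l M u) = insertions (fun k => φ (ω k)) (fun s => φ (c s)) l M u := by
  induction l generalizing M u with
  | zero =>
    simp only [insertions]
    split_ifs <;> simp
  | succ l ih => simp only [insertions, map_sum, map_mul, ih]

theorem map_insertionSeries (φ : R →+* R') (ω : ℕ → R) (θ : R) (c : Multiset ℕ → R)
    (ν : Fin n → ℕ) :
    PowerSeries.map (SetFun.map (PowerSeries.map φ)) (insertionSeries ω θ c ν) =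
      insertionSeries (fun k => φ (ω k)) (φ θ) (fun s => φ (c s)) ν := by
  refine PowerSeries.ext fun s => ?_
  rw [PowerSeries.coeff_map]
  by_cases hs : s = 0
  · rw [hs, PowerSeries.coeff_zero_eq_constantCoeff_apply,
      PowerSeries.coeff_zero_eq_constantCoeff_apply, constantCoeff_insertionSeries,
      constantCoeff_insertionSeries, map_zero]
  · refine SetFun.ext fun K => PowerSeries.ext fun a => ?_
    rw [SetFun.map_apply, PowerSeries.coeff_map, coeff_insertionSeries _ _ _ _ hs,
      coeff_insertionSeries _ _ _ _ hs, map_mul, map_pow, map_inv_natCast_smul φ ℂ ℂ,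
      map_insertions]

theorem map_insertionExp (φ : R →+* R') (ω : ℕ → R) (θ : R) (c : Multiset ℕ → R)
    (ν : Fin n → ℕ) (l : ℕ) (J : Finset (Fin n)) (a : ℕ) :
    φ (insertionExp ω θ c ν l J a) =
      insertionExp (fun k => φ (ω k)) (φ θ) (fun s => φ (c s)) ν l J a := by
  rw [insertionExp, insertionExp, ← map_insertionSeries, ← map_expSeries, PowerSeries.coeff_map,
    SetFun.map_apply, PowerSeries.coeff_map]

/-- Inserting l parts of total size a always produces an argument of length l + |u| and size a + ∑u,
so the whole sum scales by one power of y. A part 0 would leave the range of `hc`, but its weight is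
zero. -/
theorem pow_mul_insertions {ω : ℕ → R} (hω : ω 0 = 0) {y : R} {q : ℕ} {c₁ c₂ : Multiset ℕ → R}
    (hc : ∀ s, s ≠ 0 → (∀ k ∈ s, 1 ≤ k) →
      y ^ (2 * q) * c₁ s = y ^ (s.card * q + s.sum) * c₂ s)
    (l a : ℕ) (u : Multiset ℕ) (hu : ∀ k ∈ u, 1 ≤ k) (h : l ≠ 0 ∨ u ≠ 0) :
    y ^ (2 * q) * insertions ω c₁ l a u =
      y ^ ((l + u.card) * q + a + u.sum) * insertions ω c₂ l a u := by
  induction l generalizing a u with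
  | zero =>
    simp only [insertions]
    split_ifs with ha
    · rw [hc u (h.resolve_left (by simp)) hu, ha]
      congr 2; ring
    · simp
  | succ l ih =>
    rw [insertions, insertions, Finset.mul_sum, Finset.mul_sum]
    refine Finset.sum_congr rfl fun p hp => ?_
    rw [Finset.HasAntidiagonal.mem_antidiagonal] at hp
    rcases Nat.eq_zero_or_pos p.1 with h0 | h0
    · rw [h0, hω]; simp
    · rw [mul_left_comm, ih p.2 (p.1 ::ₘ u) (by
        intro k hk
        rcases Multiset.mem_cons.1 hk with rfl | hk
        · exact h0
        · exact hu k hk) (Or.inr (Multiset.cons_ne_zero)), mul_left_comm, Multiset.card_cons,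
        Multiset.sum_cons, ← hp]
      congr 2; ring

/-- The rescaling of set functions with weights `y^{|K| q + ∑_K ν}`, and of `w` by `y`. -/
def gradeHom (y : R) (q : ℕ) (ν : Fin n → ℕ) :
    SetFun (Fin n) (PowerSeries R) →+* SetFun (Fin n) (PowerSeries R) where
  toFun f := .of fun K =>
    PowerSeries.C (y ^ (K.card * q + ∑ i ∈ K, ν i)) * PowerSeries.rescale y (f K)
  map_one' := by
    refine SetFun.ext fun K => ?_
    rw [SetFun.of_apply, SetFun.one_apply]
    split_ifs with h
    · rw [h]; simp
    · simp
  map_mul' f g := by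
    refine SetFun.ext fun K => ?_
    rw [SetFun.of_apply, SetFun.mul_apply, SetFun.mul_apply, map_sum, Finset.mul_sum]
    refine Finset.sum_congr rfl fun T hT => ?_
    rw [Finset.mem_powerset] at hT
    rw [SetFun.of_apply, SetFun.of_apply, ← Finset.sum_sdiff hT, map_mul,
      ← Finset.card_sdiff_add_card_eq_card hT, mul_mul_mul_comm, ← map_mul, ← map_mul, ← pow_add]
    congr 3
    ring
  map_zero' := by
    refine SetFun.ext fun K => ?_
    rw [SetFun.of_apply, SetFun.zero_apply, map_zero, mul_zero]
  map_add' f g := by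
    refine SetFun.ext fun K => ?_
    rw [SetFun.of_apply, SetFun.add_apply, SetFun.add_apply, map_add, mul_add]

theorem coeff_gradeHom (y : R) (q : ℕ) (ν : Fin n → ℕ) (f : SetFun (Fin n) (PowerSeries R))
    (K : Finset (Fin n)) (a : ℕ) : PowerSeries.coeff a (gradeHom y q ν f K) =
      y ^ (K.card * q + ∑ i ∈ K, ν i + a) * PowerSeries.coeff a (f K) := by
  change PowerSeries.coeff a (PowerSeries.C _ * PowerSeries.rescale y (f K)) = _
  rw [PowerSeries.coeff_C_mul, PowerSeries.coeff_rescale, ← mul_assoc, ← pow_add]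

/-- For one component with s inserted parts the scaling law produces the factor (y^{2q})^{s-1}: a
component attached along s parts adds s - 1 to the genus. The remaining powers of y are ring
homomorphisms, a rescaling of t on one side and `gradeHom` on the other, so the identity passes to
the exponentials. -/
theorem pow_mul_insertionExp [IsDomain R] {ω : ℕ → R} (hω : ω 0 = 0) {y : R} (hy : y ≠ 0) {q : ℕ}
    {c₁ c₂ : Multiset ℕ → R}
    (hc : ∀ s, s ≠ 0 → (∀ k ∈ s, 1 ≤ k) →
      y ^ (2 * q) * c₁ s = y ^ (s.card * q + s.sum) * c₂ s)
    (ν : Fin n → ℕ) (hν : ∀ i, 1 ≤ ν i) (l : ℕ) (J : Finset (Fin n)) (a : ℕ) :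
    y ^ (l * q) * insertionExp ω 1 c₁ ν l J a =
      y ^ (J.card * q + ∑ i ∈ J, ν i + a) * insertionExp ω (y ^ (2 * q)) c₂ ν l J a := by
  have h1 : PowerSeries.rescale (SetFun.scalar (PowerSeries.C (y ^ q)))
      (insertionSeries ω 1 c₁ ν) =
      PowerSeries.map (gradeHom y q ν) (insertionSeries ω (y ^ (2 * q)) c₂ ν) := by
    refine PowerSeries.ext fun s => ?_
    rw [PowerSeries.coeff_rescale, PowerSeries.coeff_map]
    by_cases hs : s = 0
    · rw [hs, PowerSeries.coeff_zero_eq_constantCoeff_apply,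
        PowerSeries.coeff_zero_eq_constantCoeff_apply, constantCoeff_insertionSeries,
        constantCoeff_insertionSeries, map_zero, mul_zero]
    · refine SetFun.ext fun K => PowerSeries.ext fun a => ?_
      rw [← map_pow, ← map_pow, SetFun.scalar_mul_apply, PowerSeries.coeff_C_mul, coeff_gradeHom,
        coeff_insertionSeries _ _ _ _ hs, coeff_insertionSeries _ _ _ _ hs, one_pow, one_mul,
        mul_smul_comm, mul_smul_comm, mul_smul_comm]
      congr 1
      have h2 := pow_mul_insertions hω hc s a (parts ν K) (fun k hk => by
        obtain ⟨i, _, rfl⟩ := Multiset.mem_map.1 hk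
        exact hν i) (Or.inl hs)
      refine mul_left_cancel₀ (pow_ne_zero (2 * q) hy) ?_
      rw [mul_left_comm, h2, card_parts, sum_parts]
      obtain ⟨s, rfl⟩ := Nat.exists_eq_succ_of_ne_zero hs
      simp only [← mul_assoc, ← pow_add, ← pow_mul]
      congr 2
      simp only [Nat.succ_sub_one, Nat.succ_eq_add_one]
      ring
  have h2 := congrArg (fun f => PowerSeries.coeff a ((PowerSeries.coeff l (expSeries f)) J)) h1
  rw [← rescale_expSeries, ← map_expSeries, PowerSeries.coeff_rescale, PowerSeries.coeff_map,
    coeff_gradeHom, ← map_pow, ← map_pow, SetFun.scalar_mul_apply, PowerSeries.coeff_C_mul,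
    ← pow_mul, mul_comm q l] at h2
  exact h2

end Natural

/-! ### Parity -/

theorem coeff_eq_zero_of_even {f : PowerSeries ℂ} (h : PowerSeries.rescale (-1 : ℂ) f = f) {j : ℕ}
    (hj : ¬ Even j) : PowerSeries.coeff j f = 0 := by
  have h1 := congrArg (PowerSeries.coeff j) h
  rw [PowerSeries.coeff_rescale, (Nat.not_even_iff_odd.1 hj).neg_one_pow] at h1
  linear_combination (-1 / 2 : ℂ) * h1

theorem rescale_neg_zetaDivZ : PowerSeries.rescale (-1 : ℂ) zetaDivZ = zetaDivZ := by
  ext j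
  rw [PowerSeries.coeff_rescale, zetaDivZ, PowerSeries.coeff_mk, zeta, map_sub,
    PowerSeries.coeff_rescale, PowerSeries.coeff_rescale]
  have : (-1 / 2 : ℂ) = -1 * (1 / 2) := by ring
  rw [this, mul_pow]
  rcases Nat.even_or_odd j with h | h
  · rw [h.neg_one_pow, one_mul]
  · rw [h.neg_one_pow, h.add_one.neg_one_pow]; ring

theorem rescale_neg_rescale_zetaDivZ (a : ℂ) :
    PowerSeries.rescale (-1 : ℂ) (PowerSeries.rescale a zetaDivZ) =
      PowerSeries.rescale a zetaDivZ := by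
  rw [PowerSeries.rescale_rescale, mul_comm, ← PowerSeries.rescale_rescale, rescale_neg_zetaDivZ]

theorem rescale_neg_inv_zetaDivZ : PowerSeries.rescale (-1 : ℂ) zetaDivZ⁻¹ = zetaDivZ⁻¹ := by
  have h := congrArg (PowerSeries.rescale (-1 : ℂ)) zetaDivZ_mul_inv
  rw [map_mul, rescale_neg_zetaDivZ, map_one] at h
  have h0 : zetaDivZ ≠ 0 := fun h0 => by
    have := zetaDivZ_mul_inv
    rw [h0, zero_mul] at this
    exact zero_ne_one this
  exact mul_left_cancel₀ h0 (h.trans zetaDivZ_mul_inv.symm)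

theorem rescale_neg_partWeight (k : ℕ) :
    PowerSeries.rescale (-1 : ℂ) (partWeight k) = partWeight k := by
  rw [partWeight, map_mul, map_natCast, rescale_neg_rescale_zetaDivZ]

/-- The weights of inserted parts as constant series in a further variable. -/
def liftedWeight (k : ℕ) : PowerSeries (PowerSeries ℂ) := PowerSeries.C (partWeight k)

theorem liftedWeight_zero : liftedWeight 0 = 0 := by
  rw [liftedWeight, partWeight, Nat.cast_zero, zero_mul, map_zero]

/-- A function of multisets with values in power series, with coefficients lifted to `ℂ⟦z⟧`. -/
def liftedFun (c : Multiset ℕ → PowerSeries ℂ) (s : Multiset ℕ) : PowerSeries (PowerSeries ℂ) :=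
  PowerSeries.map PowerSeries.C (c s)

theorem rescale_neg_coeff_insertionExp {n : ℕ} (θ : PowerSeries (PowerSeries ℂ))
    (hθ : PowerSeries.map (PowerSeries.rescale (-1 : ℂ)) θ = θ) (c : Multiset ℕ → PowerSeries ℂ)
    (ν : Fin n → ℕ) (l : ℕ) (J : Finset (Fin n)) (a b : ℕ) :
    PowerSeries.rescale (-1 : ℂ)
      (PowerSeries.coeff b (insertionExp liftedWeight θ (liftedFun c) ν l J a)) =
      PowerSeries.coeff b (insertionExp liftedWeight θ (liftedFun c) ν l J a) := by
  rw [← PowerSeries.coeff_map, map_insertionExp, hθ]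
  congr 2
  · funext k
    rw [liftedWeight, PowerSeries.map_C, rescale_neg_partWeight]
  · funext s
    ext b e
    simp only [liftedFun, PowerSeries.coeff_map, PowerSeries.coeff_rescale, PowerSeries.coeff_C]
    split_ifs with h
    · simp [h]
    · simp

/-! ### The cut-and-join equation by genus -/

/-- The series `S(z)⁻¹ ∏_{i ∈ I} S(ν_i z)`. -/
def joinFactor {n : ℕ} (ν : Fin n → ℕ) (I : Finset (Fin n)) : PowerSeries ℂ :=
  zetaDivZ⁻¹ * ∏ i ∈ I, PowerSeries.rescale (ν i : ℂ) zetaDivZ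

theorem rescale_neg_joinFactor {n : ℕ} (ν : Fin n → ℕ) (I : Finset (Fin n)) :
    PowerSeries.rescale (-1 : ℂ) (joinFactor ν I) = joinFactor ν I := by
  rw [joinFactor, map_mul, map_prod, rescale_neg_inv_zetaDivZ]
  simp only [rescale_neg_rescale_zetaDivZ]

/-- The right-hand side of the cut-and-join equation by genus, as a series in `u`. -/
def genusJoin (r : ℕ) {n : ℕ} (C : Multiset ℕ → PowerSeries ℂ) (ν : Fin n → ℕ)
    (U : Finset (Fin n)) : PowerSeries ℂ :=
  ∑ I ∈ U.powerset, if I = ∅ then 0 else ∑ l ∈ Finset.range (r + 3), ∑ d ∈ Finset.range (r + 3),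
    if I.card + l + 2 * d = r + 2 then
      PowerSeries.X ^ d * coeffMul (2 * d) (joinFactor ν I)
        (insertionExp liftedWeight PowerSeries.X (liftedFun C) ν l (U \ I) (∑ i ∈ I, ν i))
    else 0

theorem coeffMul_X_pow_mul (e k : ℕ) (W : PowerSeries ℂ) (f : PowerSeries (PowerSeries ℂ)) :
    coeffMul e W (PowerSeries.X ^ k * f) = PowerSeries.X ^ k * coeffMul e W f := by
  have := coeffMul_mul_map_C e W f (PowerSeries.X ^ k)
  rw [map_pow, PowerSeries.map_X] at this
  rw [mul_comm, this, mul_comm]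

theorem coeffMul_expand (e p : ℕ) (hp : p ≠ 0) (W : PowerSeries ℂ)
    (f : PowerSeries (PowerSeries ℂ)) :
    coeffMul e W (PowerSeries.expand p hp f) = PowerSeries.expand p hp (coeffMul e W f) := by
  ext b
  rw [coeff_coeffMul, PowerSeries.coeff_expand, PowerSeries.coeff_expand]
  split_ifs
  · rw [coeff_coeffMul]
  · simp

theorem coeffMul_X_pow_shift (e k : ℕ) (W : PowerSeries ℂ) (f : PowerSeries (PowerSeries ℂ)) :
    coeffMul e (PowerSeries.X ^ k * W) f = if k ≤ e then coeffMul (e - k) W f else 0 := by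
  ext b
  rw [coeff_coeffMul, mul_assoc, PowerSeries.coeff_X_pow_mul']
  split_ifs
  · rw [coeff_coeffMul]
  · simp

/-- S is even, and so is every weight built from it. Hence only even powers 2d of z contribute, in
agreement with the operators Q_d. -/
theorem coeffMul_eq_zero_of_odd {n : ℕ} (c : Multiset ℕ → PowerSeries ℂ) (ν : Fin n → ℕ)
    (I J : Finset (Fin n)) (l a : ℕ) {j : ℕ} (hj : ¬ Even j) :
    coeffMul j (joinFactor ν I) (insertionExp liftedWeight 1 (liftedFun c) ν l J a) = 0 := by
  ext b
  rw [coeff_coeffMul, map_zero]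
  refine coeff_eq_zero_of_even ?_ hj
  rw [map_mul, rescale_neg_joinFactor, rescale_neg_coeff_insertionExp 1 (map_one _)]

/-- The substitution `y ↦ y^p` as a ring homomorphism. -/
def expandHom {R : Type} [CommRing R] (p : ℕ) (hp : p ≠ 0) : PowerSeries R →+* PowerSeries R where
  toFun := PowerSeries.expand p hp
  map_one' := map_one _
  map_mul' := map_mul _
  map_zero' := map_zero _
  map_add' := map_add _

theorem expandHom_apply {R : Type} [CommRing R] (p : ℕ) (hp : p ≠ 0) (f : PowerSeries R) :
    expandHom p hp f = PowerSeries.expand p hp f := rfl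

section Homogeneity
variable {q r : ℕ} (hqr : q * r ≠ 0) (h2q : 2 * q ≠ 0)

/-- The variable β of `c` and the genus variable u of `C` are both made powers of one variable y,
namely y^{qr} and y^{2q}. The relation q r b + 2q = (n + 2g) q + |ν| then becomes an equality of
exponents, with no division. -/
theorem pow_mul_expand_insertionExp {c C : Multiset ℕ → PowerSeries ℂ}
    (hc : ∀ s, s ≠ 0 → (∀ k ∈ s, 1 ≤ k) →
      PowerSeries.X ^ (2 * q) * PowerSeries.expand (q * r) hqr (c s) =
        PowerSeries.X ^ (s.card * q + s.sum) * PowerSeries.expand (2 * q) h2q (C s))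
    {n : ℕ} (ν : Fin n → ℕ) (hν : ∀ i, 1 ≤ ν i) (l : ℕ) (J : Finset (Fin n)) (a : ℕ) :
    PowerSeries.X ^ (l * q) * PowerSeries.expand (q * r) hqr
        (insertionExp liftedWeight 1 (liftedFun c) ν l J a) =
      PowerSeries.X ^ (J.card * q + ∑ i ∈ J, ν i + a) * PowerSeries.expand (2 * q) h2q
        (insertionExp liftedWeight PowerSeries.X (liftedFun C) ν l J a) := by
  have h1 := map_insertionExp (expandHom (R := PowerSeries ℂ) (q * r) hqr)
    liftedWeight 1 (liftedFun c) ν l J a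
  have h2 := map_insertionExp (expandHom (R := PowerSeries ℂ) (2 * q) h2q)
    liftedWeight PowerSeries.X (liftedFun C) ν l J a
  have hw : ∀ (p : ℕ) (hp : p ≠ 0), (fun k => expandHom p hp (liftedWeight k)) = liftedWeight :=
    fun p hp => funext fun k => by rw [liftedWeight, expandHom_apply, PowerSeries.expand_C]
  have hX : expandHom (2 * q) h2q (PowerSeries.X : PowerSeries (PowerSeries ℂ)) =
      PowerSeries.X ^ (2 * q) := by rw [expandHom_apply, PowerSeries.expand_X]
  rw [hw, map_one] at h1
  rw [hw, hX] at h2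
  rw [← expandHom_apply, ← expandHom_apply, h1, h2]
  refine pow_mul_insertionExp liftedWeight_zero PowerSeries.X_ne_zero (fun s hs hk => ?_) ν hν l J a
  have h4 := congrArg (PowerSeries.map (PowerSeries.C (R := ℂ))) (hc s hs hk)
  rw [map_mul, map_mul, PowerSeries.map_expand, PowerSeries.map_expand, map_pow, map_pow,
    PowerSeries.map_X] at h4
  exact h4

theorem pow_mul_expand_cutJoin {c C : Multiset ℕ → PowerSeries ℂ}
    (hc : ∀ s, s ≠ 0 → (∀ k ∈ s, 1 ≤ k) →
      PowerSeries.X ^ (2 * q) * PowerSeries.expand (q * r) hqr (c s) =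
        PowerSeries.X ^ (s.card * q + s.sum) * PowerSeries.expand (2 * q) h2q (C s))
    {n : ℕ} (ν : Fin n → ℕ) (hν : ∀ i, 1 ≤ ν i) (U : Finset (Fin n)) :
    PowerSeries.X ^ ((r + 2) * q) * PowerSeries.expand (q * r) hqr
        (cutJoin r (expSeries (insertionSeries liftedWeight 1 (liftedFun c) ν)) ν U) =
      PowerSeries.X ^ (U.card * q + ∑ i ∈ U, ν i) *
        PowerSeries.expand (2 * q) h2q (genusJoin r C ν U) := by
  rw [cutJoin, genusJoin, map_sum, map_sum, Finset.mul_sum, Finset.mul_sum]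
  refine Finset.sum_congr rfl fun I hI => ?_
  rw [Finset.mem_powerset] at hI
  split_ifs with hI0
  · simp
  rw [map_sum, map_sum, Finset.mul_sum, Finset.mul_sum]
  refine Finset.sum_congr rfl fun l _ => ?_
  change _ * PowerSeries.expand (q * r) hqr (coeffMul (r + 2)
    (PowerSeries.X ^ (I.card + l) * joinFactor ν I)
    (insertionExp liftedWeight 1 (liftedFun c) ν l (U \ I) (∑ i ∈ I, ν i))) = _
  rw [coeffMul_X_pow_shift]
  by_cases hle : I.card + l ≤ r + 2
  · rw [if_pos hle]
    -- With |I| + l + 2d = r + 2, the part l q of the exponent (r + 2) q is used by the exponential,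
    -- and the part 2 d q becomes the factor u^d; the rest is the weight of the parts in I.
    by_cases hev : Even (r + 2 - (I.card + l))
    · obtain ⟨d, hd⟩ := hev
      rw [Finset.sum_eq_single d]
      · rw [if_pos (by omega), show r + 2 - (I.card + l) = 2 * d by omega,
          show (r + 2) * q = (I.card + 2 * d) * q + l * q by
            rw [← add_mul]; congr 1; omega,
          pow_add, mul_assoc, ← coeffMul_expand, ← coeffMul_X_pow_mul,
          pow_mul_expand_insertionExp hqr h2q hc ν hν, coeffMul_X_pow_mul, ← mul_assoc, ← pow_add,
          map_mul, map_pow, PowerSeries.expand_X, coeffMul_expand, ← mul_assoc, ← pow_mul,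
          ← pow_add]
        congr 2
        have h1 := Finset.card_sdiff_add_card_eq_card hI
        have h2 := Finset.sum_sdiff (f := ν) hI
        rw [← h1, ← h2]
        ring
      · intro d' _ hd'
        exact if_neg (by omega)
      · intro h
        exfalso; apply h
        rw [Finset.mem_range]; omega
    · rw [coeffMul_eq_zero_of_odd c ν I _ l _ hev, map_zero, mul_zero,
        Finset.sum_eq_zero fun d _ => if_neg fun h => hev ⟨d, by omega⟩, map_zero, mul_zero]
  · rw [if_neg hle, map_zero, mul_zero, Finset.sum_eq_zero fun d _ => if_neg (by omega), map_zero,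
      mul_zero]

/-- The numbers of genus `g` among the coefficients of `c`. -/
def genusFun (q r : ℕ) (c : Multiset ℕ → PowerSeries ℂ) (s : Multiset ℕ) : PowerSeries ℂ :=
  PowerSeries.mk fun g => if 2 * q ≤ s.card * q + s.sum + 2 * q * g ∧
      q * r ∣ s.card * q + s.sum + 2 * q * g - 2 * q then
    PowerSeries.coeff ((s.card * q + s.sum + 2 * q * g - 2 * q) / (q * r)) (c s) else 0

theorem pow_mul_expand_genusFun (c : Multiset ℕ → PowerSeries ℂ) (s : Multiset ℕ)
    (h : ∀ b, PowerSeries.coeff b (c s) ≠ 0 →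
      ∃ g, 2 * q + q * r * b = s.card * q + s.sum + 2 * q * g) :
    PowerSeries.X ^ (2 * q) * PowerSeries.expand (q * r) hqr (c s) =
      PowerSeries.X ^ (s.card * q + s.sum) *
        PowerSeries.expand (2 * q) h2q (genusFun q r c s) := by
  ext M
  rw [PowerSeries.coeff_X_pow_mul', PowerSeries.coeff_X_pow_mul', PowerSeries.coeff_expand,
    PowerSeries.coeff_expand]
  by_cases hR : s.card * q + s.sum ≤ M ∧ 2 * q ∣ M - (s.card * q + s.sum)
  · obtain ⟨h1, g, hg⟩ := hR
    have hM : M = s.card * q + s.sum + 2 * q * g := by omega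
    rw [if_pos h1, if_pos (show 2 * q ∣ M - (s.card * q + s.sum) from ⟨g, hg⟩), hg, Nat.mul_div_cancel_left _ (Nat.pos_of_ne_zero h2q),
      genusFun, PowerSeries.coeff_mk, ← hM]
    by_cases hA : 2 * q ≤ M ∧ q * r ∣ M - 2 * q
    · rw [if_pos hA, if_pos hA.1, if_pos hA.2]
    · rw [if_neg hA]
      split_ifs with h3 h4
      · exact absurd ⟨h3, h4⟩ hA
      · rfl
      · rfl
  · have hz : (if s.card * q + s.sum ≤ M then if 2 * q ∣ M - (s.card * q + s.sum) then
        PowerSeries.coeff ((M - (s.card * q + s.sum)) / (2 * q)) (genusFun q r c s) else 0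
        else 0) = 0 := by
      split_ifs <;> first | rfl | (exfalso; tauto)
    rw [hz]
    split_ifs with h1 h2
    · obtain ⟨b, hb⟩ := h2
      rw [hb, Nat.mul_div_cancel_left _ (Nat.pos_of_ne_zero hqr)]
      by_contra h0
      obtain ⟨g, hg⟩ := h b h0
      refine hR ⟨?_, g, ?_⟩ <;> omega
    · rfl
    · rfl

end Homogeneity

/-! ### Truncation -/

/-- All constructions are natural in the coefficient ring, so it suffices to compare modulo the
ideal generated by β^b. -/
theorem coeff_insertionExp_congr {c c' : Multiset ℕ → PowerSeries ℂ} {b : ℕ}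
    (h : ∀ s, ∀ b' < b, PowerSeries.coeff b' (c s) = PowerSeries.coeff b' (c' s)) {n : ℕ}
    (ν : Fin n → ℕ) (l : ℕ) (J : Finset (Fin n)) (a b' : ℕ) (hb' : b' < b) :
    PowerSeries.coeff b' (insertionExp liftedWeight 1 (liftedFun c) ν l J a) =
      PowerSeries.coeff b' (insertionExp liftedWeight 1 (liftedFun c') ν l J a) := by
  set φ := Ideal.Quotient.mk (Ideal.span {(PowerSeries.X : PowerSeries (PowerSeries ℂ)) ^ b})
  have hφ : ∀ f g : PowerSeries (PowerSeries ℂ), φ f = φ g ↔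
      ∀ b' < b, PowerSeries.coeff b' f = PowerSeries.coeff b' g := fun f g => by
    rw [Ideal.Quotient.mk_eq_mk_iff_sub_mem, Ideal.mem_span_singleton, PowerSeries.X_pow_dvd_iff]
    simp only [map_sub, sub_eq_zero]
  have h1 : (fun s => φ (liftedFun c s)) = fun s => φ (liftedFun c' s) := by
    funext s
    rw [hφ]
    intro b' hb'
    rw [liftedFun, liftedFun, PowerSeries.coeff_map, PowerSeries.coeff_map, h s b' hb']
  refine (hφ _ _).1 ?_ b' hb'
  rw [map_insertionExp, map_insertionExp, h1]

theorem coeff_cutJoin_congr (r : ℕ) {c c' : Multiset ℕ → PowerSeries ℂ} {b : ℕ}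
    (h : ∀ s, ∀ b' < b, PowerSeries.coeff b' (c s) = PowerSeries.coeff b' (c' s)) {n : ℕ}
    (ν : Fin n → ℕ) (U : Finset (Fin n)) (b' : ℕ) (hb' : b' < b) :
    PowerSeries.coeff b'
        (cutJoin r (expSeries (insertionSeries liftedWeight 1 (liftedFun c) ν)) ν U) =
      PowerSeries.coeff b'
        (cutJoin r (expSeries (insertionSeries liftedWeight 1 (liftedFun c') ν)) ν U) := by
  rw [cutJoin, cutJoin, map_sum, map_sum]
  refine Finset.sum_congr rfl fun I _ => ?_
  split_ifs
  · rfl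
  rw [map_sum, map_sum]
  refine Finset.sum_congr rfl fun l _ => ?_
  rw [coeff_coeffMul, coeff_coeffMul]
  have := coeff_insertionExp_congr h ν l (U \ I) (∑ i ∈ I, ν i) b' hb'
  rw [insertionExp, insertionExp] at this
  rw [this]

theorem exists_parts (s : Multiset ℕ) : ∃ ν : Fin s.card → ℕ, parts ν Finset.univ = s := by
  obtain ⟨l, rfl⟩ := Quot.exists_rep s
  refine ⟨l.get, ?_⟩
  change (Finset.univ : Finset (Fin l.length)).val.map l.get = _
  rw [Fin.univ_val_map]
  exact congrArg _ (List.ofFn_get l)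

/-- Riemann-Hurwitz, with an integral genus g ≥ 0, by induction on b. The coefficient of β^{b+1} is
determined by the coefficients up to β^b through the cut-and-join equation, which preserves the
grading; for b = 0 only the part q remains, with g = 0. -/
theorem coeff_connectedFun_support (q r : ℕ) (hq : 1 ≤ q) (hr : 1 ≤ r) (b : ℕ) (s : Multiset ℕ)
    (hs : ∀ k ∈ s, 1 ≤ k) (h : PowerSeries.coeff b (connectedFun q r s) ≠ 0) :
    ∃ g, 2 * q + q * r * b = s.card * q + s.sum + 2 * q * g := by
  induction b using Nat.strong_induction_on generalizing s with
  | _ b ih =>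
  cases b with
  | zero =>
    rw [PowerSeries.coeff_zero_eq_constantCoeff_apply] at h
    refine ⟨0, ?_⟩
    rw [constantCoeff_connectedFun q r hq s h]
    simp; ring
  | succ b =>
    have hqr : q * r ≠ 0 := by positivity
    have h2q : 2 * q ≠ 0 := by positivity
    obtain ⟨ν, hν⟩ := exists_parts s
    have hν1 : ∀ i, 1 ≤ ν i := fun i => hs _ (by
      rw [← hν]; exact Multiset.mem_map_of_mem ν (Finset.mem_univ i))
    -- The support is known only up to β^b, so the homogeneity argument is applied to the truncated
    -- series; by `coeff_cutJoin_congr` this does not affect the coefficient in question.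
    set c' : Multiset ℕ → PowerSeries ℂ := fun s =>
      PowerSeries.mk fun b' => if b' < b + 1 then
        PowerSeries.coeff b' (connectedFun q r s) else 0 with hc'
    have h1 := congrArg (PowerSeries.coeff b) (derivative_connectedFun q r ν hν1 Finset.univ)
    have h2 := coeff_cutJoin_congr r (c := connectedFun q r) (c' := c') (b := b + 1)
      (fun s b' hb' => by rw [hc', PowerSeries.coeff_mk, if_pos hb']) ν Finset.univ b (by omega)
    rw [PowerSeries.coeff_derivative, hν, PowerSeries.coeff_smul] at h1
    have h3 : PowerSeries.coeff b
        (cutJoin r (expSeries (insertionSeries liftedWeight 1 (liftedFun c') ν)) ν Finset.univ) ≠ 0 := by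
      intro h0
      rw [h0] at h2
      have h4 : (b : ℂ) + 1 ≠ 0 := by exact_mod_cast Nat.succ_ne_zero b
      refine mul_ne_zero h h4 (h1.trans ?_)
      exact (congrArg ((r.factorial : ℂ) • ·) h2).trans (smul_zero _)
    -- This exponent equals 2q + q r (b + 1), the one belonging to b + 1.
    have h4 := congrArg (PowerSeries.coeff ((r + 2) * q + q * r * b))
      (pow_mul_expand_cutJoin hqr h2q (c := c') (C := genusFun q r c') (fun s _ hs1 => by
        refine pow_mul_expand_genusFun hqr h2q c' s fun b' hb' => ?_
        rw [hc', PowerSeries.coeff_mk] at hb'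
        by_cases hlt : b' < b + 1
        · rw [if_pos hlt] at hb'
          exact ih b' hlt s hs1 hb'
        · exact absurd (if_neg hlt) hb') ν hν1 Finset.univ)
    rw [PowerSeries.coeff_X_pow_mul', if_pos (by omega), Nat.add_sub_cancel_left,
      PowerSeries.coeff_expand_mul, PowerSeries.coeff_X_pow_mul', PowerSeries.coeff_expand] at h4
    have h5 : (Finset.univ : Finset (Fin s.card)).card * q + ∑ i, ν i = s.card * q + s.sum := by
      rw [Finset.card_univ, Fintype.card_fin, ← sum_parts, hν]
    rw [h5] at h4
    split_ifs at h4 with h6 h7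
    · obtain ⟨g, hg⟩ := h7
      refine ⟨g, ?_⟩
      rw [← hg, Nat.add_sub_cancel' h6]
      ring
    · exact absurd h4 h3
    · exact absurd h4 h3

theorem pow_mul_expand_connectedFun {q r : ℕ} (hq : 1 ≤ q) (hr : 1 ≤ r) (hqr : q * r ≠ 0)
    (h2q : 2 * q ≠ 0) (s : Multiset ℕ) (hs : ∀ k ∈ s, 1 ≤ k) :
    PowerSeries.X ^ (2 * q) * PowerSeries.expand (q * r) hqr (connectedFun q r s) =
      PowerSeries.X ^ (s.card * q + s.sum) *
        PowerSeries.expand (2 * q) h2q (genusFun q r (connectedFun q r) s) :=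
  pow_mul_expand_genusFun hqr h2q _ s fun b hb => coeff_connectedFun_support q r hq hr b s hs hb

/-- The generating series over the genus of the connected numbers. -/
def genusNumbers (q r : ℕ) (s : Multiset ℕ) : PowerSeries ℂ := genusFun q r (connectedFun q r) s

/-- The derivative in β multiplies the number by b, here expressed through g and ν. Where this
quotient is not a nonnegative integer the genus number is zero. -/
theorem coeff_genusJoin (q r : ℕ) (hq : 1 ≤ q) (hr : 1 ≤ r) {n : ℕ} (ν : Fin n → ℕ)
    (hν : ∀ i, 1 ≤ ν i) (g : ℕ) :
    (r.factorial : ℂ) * PowerSeries.coeff g (genusJoin r (genusNumbers q r) ν Finset.univ) =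
      (((2 * g + n : ℕ) : ℂ) * q + ((∑ i, ν i : ℕ) : ℂ) - 2 * q) / (q * r) *
        PowerSeries.coeff g (genusNumbers q r (parts ν Finset.univ)) := by
  have hqr : q * r ≠ 0 := by positivity
  have h2q : 2 * q ≠ 0 := by positivity
  set E := n * q + ∑ i, ν i with hE
  have hE' : (parts ν Finset.univ).card * q + (parts ν Finset.univ).sum = E := by
    rw [card_parts, sum_parts, Finset.card_univ, Fintype.card_fin]
  have h1 := congrArg (PowerSeries.coeff (E + 2 * q * g))
    (pow_mul_expand_cutJoin hqr h2q (c := connectedFun q r) (C := genusNumbers q r)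
      (fun s _ hs1 => pow_mul_expand_connectedFun hq hr hqr h2q s hs1) ν hν Finset.univ)
  rw [PowerSeries.coeff_X_pow_mul', PowerSeries.coeff_X_pow_mul', PowerSeries.coeff_expand,
    Finset.card_univ, Fintype.card_fin, if_pos (show n * q + ∑ i, ν i ≤ E + 2 * q * g by omega),
    ← hE, Nat.add_sub_cancel_left, PowerSeries.coeff_expand_mul] at h1
  have hG : PowerSeries.coeff g (genusNumbers q r (parts ν Finset.univ)) =
      if 2 * q ≤ E + 2 * q * g ∧ q * r ∣ E + 2 * q * g - 2 * q then
        PowerSeries.coeff ((E + 2 * q * g - 2 * q) / (q * r))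
          (connectedFun q r (parts ν Finset.univ)) else 0 := by
    rw [genusNumbers, genusFun, PowerSeries.coeff_mk, hE']
  have hq0 : (q : ℂ) ≠ 0 := Nat.cast_ne_zero.2 (by omega)
  have hr0 : (r : ℂ) ≠ 0 := Nat.cast_ne_zero.2 (by omega)
  have hb : ∀ b : ℕ, E + 2 * q * g = 2 * q + q * r * b →
      (((2 * g + n : ℕ) : ℂ) * q + ((∑ i, ν i : ℕ) : ℂ) - 2 * q) / (q * r) = b := fun b hb => by
    have h2 : ((E + 2 * q * g : ℕ) : ℂ) = ((2 * q + q * r * b : ℕ) : ℂ) := by rw [hb]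
    rw [hE] at h2
    push_cast at h2 ⊢
    field_simp
    linear_combination h2
  rw [← h1]
  by_cases hc : (r + 2) * q ≤ E + 2 * q * g ∧ q * r ∣ E + 2 * q * g - (r + 2) * q
  · obtain ⟨hle, b, hbe⟩ := hc
    have hM : E + 2 * q * g = 2 * q + q * r * (b + 1) := by
      rw [← Nat.sub_add_cancel hle, hbe]; ring
    rw [if_pos hle, if_pos ⟨b, hbe⟩, hbe, Nat.mul_div_cancel_left _ (Nat.pos_of_ne_zero hqr),
      hb _ hM, hG, if_pos ⟨by omega, b + 1, by omega⟩, hM, Nat.add_sub_cancel_left,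
      Nat.mul_div_cancel_left _ (Nat.pos_of_ne_zero hqr)]
    have h2 := congrArg (PowerSeries.coeff b) (derivative_connectedFun q r ν hν Finset.univ)
    rw [PowerSeries.coeff_derivative, PowerSeries.coeff_smul, smul_eq_mul] at h2
    refine Eq.trans h2.symm ?_
    push_cast; ring
  · have h0 : (if (r + 2) * q ≤ E + 2 * q * g then if q * r ∣ E + 2 * q * g - (r + 2) * q then
        PowerSeries.coeff ((E + 2 * q * g - (r + 2) * q) / (q * r))
          (cutJoin r (expSeries (insertionSeries liftedWeight 1 (liftedFun (connectedFun q r)) ν))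
            ν Finset.univ) else 0 else 0) = 0 := by
      split_ifs with h3 h4
      · exact absurd ⟨h3, h4⟩ hc
      · rfl
      · rfl
    rw [h0, mul_zero, hG]
    split_ifs with h3
    · obtain ⟨h4, b, hbe⟩ := h3
      have hM : E + 2 * q * g = 2 * q + q * r * b := by omega
      cases b with
      -- For b = 0 the number itself need not vanish, but its factor b does, in accordance with the
      -- absent coefficient of the derivative.
      | zero => rw [hb _ hM, Nat.cast_zero, zero_mul]
      | succ b =>
        exfalso
        apply hc
        have : q * r * (b + 1) = q * r * b + q * r := by ring
        have : (r + 2) * q = q * r + 2 * q := by ring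
        refine ⟨?_, b, ?_⟩ <;> omega
    · rw [mul_zero]

/-! ### The operators `ζ(zD)/(zD)` -/

section ZetaOp
variable {A : Type} [CommRing A] [Algebra ℂ A]

theorem iterate_derivation_sum {ι : Type} (D : Derivation ℂ A A) (p : ℕ) (s : Finset ι)
    (f : ι → A) : (D^[p]) (∑ r ∈ s, f r) = ∑ r ∈ s, (D^[p]) (f r) := by
  induction s using Finset.cons_induction with
  | empty => exact iterate_map_zero D p
  | cons a s ha ih => rw [Finset.sum_cons, iterate_map_add, ih, Finset.sum_cons]

theorem iterate_derivation_smul (D : Derivation ℂ A A) (p : ℕ) (c : ℂ) (a : A) :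
    (D^[p]) (c • a) = c • (D^[p]) a :=
  (Function.Semiconj.iterate_right (f := fun x : A => c • x) (fun x => (D.map_smul c x).symm)
    p a).symm

/-- The operator `ζ(zD)/(zD)` as a linear map. -/
def zetaEnd (D : Derivation ℂ A A) : Module.End ℂ (PowerSeries A) where
  toFun := zetaOp D
  map_add' F G := by
    ext N
    simp only [zetaOp, PowerSeries.coeff_mk, map_add, iterate_map_add, smul_add,
      Finset.sum_add_distrib]
  map_smul' c F := by
    ext N
    simp only [zetaOp, PowerSeries.coeff_mk, PowerSeries.coeff_smul, Finset.smul_sum,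
      RingHom.id_apply]
    refine Finset.sum_congr rfl fun p _ => ?_
    rw [smul_comm, iterate_derivation_smul]

theorem zetaEnd_apply (D : Derivation ℂ A A) (F : PowerSeries A) : zetaEnd D F = zetaOp D F := rfl

theorem coeff_zetaEnd (D : Derivation ℂ A A) (F : PowerSeries A) (N : ℕ) :
    PowerSeries.coeff N (zetaEnd D F) = ∑ p ∈ antidiagonal N,
      PowerSeries.coeff p.1 zetaDivZ • (D^[p.1]) (PowerSeries.coeff p.2 F) := by
  rw [zetaEnd_apply, zetaOp, PowerSeries.coeff_mk]

/-- The series whose coefficients are killed by `D`. -/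
def Kills (D : Derivation ℂ A A) (F : PowerSeries A) : Prop := ∀ N, D (PowerSeries.coeff N F) = 0

theorem iterate_derivation_mul {D : Derivation ℂ A A} {a : A} (h : D a = 0) (b : A) (p : ℕ) :
    (D^[p]) (a * b) = a * (D^[p]) b := by
  induction p with
  | zero => rfl
  | succ p ih => rw [Function.iterate_succ_apply', ih, Function.iterate_succ_apply', D.leibniz, h]
                 simp

theorem zetaEnd_mul {D : Derivation ℂ A A} {G : PowerSeries A} (h : Kills D G)
    (F : PowerSeries A) : zetaEnd D (G * F) = G * zetaEnd D F := by
  ext N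
  rw [coeff_zetaEnd, PowerSeries.coeff_mul]
  have h1 : ∀ p : ℕ × ℕ, PowerSeries.coeff p.1 zetaDivZ • (D^[p.1]) (PowerSeries.coeff p.2 (G * F)) =
      ∑ r ∈ antidiagonal p.2, PowerSeries.coeff p.1 zetaDivZ •
        (PowerSeries.coeff r.1 G * (D^[p.1]) (PowerSeries.coeff r.2 F)) := fun p => by
    rw [PowerSeries.coeff_mul, ← Finset.smul_sum]
    congr 1
    rw [iterate_derivation_sum]
    exact Finset.sum_congr rfl fun r _ => iterate_derivation_mul (h _) _ _
  rw [Finset.sum_congr rfl fun p _ => h1 p,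
    sum_antidiagonal_comm N fun i j k => PowerSeries.coeff i zetaDivZ •
        (PowerSeries.coeff j G * (D^[i]) (PowerSeries.coeff k F))]
  refine Finset.sum_congr rfl fun p _ => ?_
  rw [coeff_zetaEnd, Finset.mul_sum]
  exact Finset.sum_congr rfl fun r _ => (mul_smul_comm _ _ _).symm

theorem constantCoeff_zetaDivZ : PowerSeries.coeff 0 zetaDivZ = 1 := by
  rw [zetaDivZ, PowerSeries.coeff_mk, zeta, map_sub, PowerSeries.coeff_rescale,
    PowerSeries.coeff_rescale, PowerSeries.coeff_exp]
  norm_num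

theorem kills_one (D : Derivation ℂ A A) : Kills D 1 := fun N => by
  rw [PowerSeries.coeff_one]; split_ifs <;> simp

theorem zetaEnd_one (D : Derivation ℂ A A) : zetaEnd D 1 = 1 := by
  ext N
  rw [coeff_zetaEnd, Finset.sum_eq_single (0, N)]
  · simp [constantCoeff_zetaDivZ]
  · rintro ⟨i, j⟩ h hne
    rcases i with _ | i
    · rw [Finset.HasAntidiagonal.mem_antidiagonal] at h
      exact absurd (by simp at h; simp [h]) hne
    · rw [Function.iterate_succ_apply, kills_one, iterate_map_zero, smul_zero]
  · intro h; exact absurd (by rw [Finset.HasAntidiagonal.mem_antidiagonal]; simp) h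

theorem zetaEnd_of_kills {D : Derivation ℂ A A} {G : PowerSeries A} (h : Kills D G) :
    zetaEnd D G = G := by
  have := zetaEnd_mul h 1
  rwa [zetaEnd_one, mul_one] at this

theorem Kills.mul {D : Derivation ℂ A A} {F G : PowerSeries A} (hF : Kills D F) (hG : Kills D G) :
    Kills D (F * G) := fun N => by
  rw [PowerSeries.coeff_mul, map_sum]
  exact Finset.sum_eq_zero fun p _ => by rw [D.leibniz, hF, hG]; simp

theorem Kills.prod {ι : Type} {D : Derivation ℂ A A} (s : Finset ι) {F : ι → PowerSeries A}
    (h : ∀ i ∈ s, Kills D (F i)) : Kills D (∏ i ∈ s, F i) := by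
  classical
  exact Finset.prod_induction F (Kills D) (fun _ _ => Kills.mul) (kills_one D) h

theorem iterate_derivation_comm {D D' : Derivation ℂ A A} (h : ∀ a, D (D' a) = D' (D a)) (i : ℕ)
    (a : A) : D ((D'^[i]) a) = (D'^[i]) (D a) := by
  induction i generalizing a with
  | zero => rfl
  | succ i ih => rw [Function.iterate_succ_apply, ih, h, Function.iterate_succ_apply]

theorem Kills.zetaEnd {D D' : Derivation ℂ A A} (h : ∀ a, D (D' a) = D' (D a)) {F : PowerSeries A}
    (hF : Kills D F) : Kills D (zetaEnd D' F) := fun N => by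
  rw [coeff_zetaEnd, map_sum]
  refine Finset.sum_eq_zero fun p _ => ?_
  rw [D.map_smul, iterate_derivation_comm h, hF, iterate_map_zero, smul_zero]

/-- If `D` kills all the series but at most one, then `ζ(zD)/(zD)` acts factorwise. -/
theorem zetaEnd_prod {ι : Type} {D : Derivation ℂ A A} (s : Finset ι) {F : ι → PowerSeries A}
    (h : ∀ i ∈ s, ∀ j ∈ s, i ≠ j → Kills D (F i) ∨ Kills D (F j)) :
    zetaEnd D (∏ i ∈ s, F i) = ∏ i ∈ s, zetaEnd D (F i) := by
  classical
  by_cases hall : ∀ i ∈ s, Kills D (F i)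
  · rw [zetaEnd_of_kills (Kills.prod s hall)]
    exact Finset.prod_congr rfl fun i hi => (zetaEnd_of_kills (hall i hi)).symm
  · push Not at hall
    obtain ⟨i, hi, hk⟩ := hall
    have hrest : ∀ j ∈ s.erase i, Kills D (F j) := fun j hj =>
      (h i hi j (Finset.mem_of_mem_erase hj) (Finset.ne_of_mem_erase hj).symm).resolve_left hk
    rw [← Finset.prod_erase_mul s F hi, ← Finset.prod_erase_mul s _ hi,
      zetaEnd_mul (Kills.prod _ hrest)]
    congr 1
    exact Finset.prod_congr rfl fun j hj => (zetaEnd_of_kills (hrest j hj)).symm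

theorem map_zetaEnd {B : Type} [CommRing B] [Algebra ℂ B] (φ : A →+* B)
    (hφ : ∀ (c : ℂ) (a : A), φ (c • a) = c • φ a) {D : Derivation ℂ A A} {D' : Derivation ℂ B B}
    (h : ∀ a, φ (D a) = D' (φ a)) (F : PowerSeries A) :
    PowerSeries.map φ (zetaEnd D F) = zetaEnd D' (PowerSeries.map φ F) := by
  ext N
  rw [PowerSeries.coeff_map, coeff_zetaEnd, coeff_zetaEnd, map_sum]
  refine Finset.sum_congr rfl fun p _ => ?_
  rw [hφ, PowerSeries.coeff_map]
  congr 1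
  exact (Function.Semiconj.iterate_right (f := φ) h p.1) _

theorem commute_zetaEnd {D D' : Derivation ℂ A A} (h : ∀ a, D (D' a) = D' (D a)) :
    Commute (zetaEnd D) (zetaEnd D') := by
  have key : ∀ (D D' : Derivation ℂ A A) (F : PowerSeries A) (N : ℕ),
      PowerSeries.coeff N (zetaEnd D (zetaEnd D' F)) = ∑ p ∈ antidiagonal N,
        ∑ s ∈ antidiagonal p.2, PowerSeries.coeff p.1 zetaDivZ • PowerSeries.coeff s.1 zetaDivZ •
          (D^[p.1]) ((D'^[s.1]) (PowerSeries.coeff s.2 F)) := fun D D' F N => by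
    rw [coeff_zetaEnd]
    refine Finset.sum_congr rfl fun p _ => ?_
    rw [← Finset.smul_sum, coeff_zetaEnd]
    congr 1
    rw [iterate_derivation_sum]
    exact Finset.sum_congr rfl fun s _ => iterate_derivation_smul _ _ _ _
  refine LinearMap.ext fun F => PowerSeries.ext fun N => ?_
  change PowerSeries.coeff N (zetaEnd D (zetaEnd D' F)) =
    PowerSeries.coeff N (zetaEnd D' (zetaEnd D F))
  rw [key, key, sum_antidiagonal_comm N fun i j k => PowerSeries.coeff i zetaDivZ •
    PowerSeries.coeff j zetaDivZ • (D^[i]) ((D'^[j]) (PowerSeries.coeff k F))]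
  refine Finset.sum_congr rfl fun p _ => Finset.sum_congr rfl fun s _ => ?_
  rw [smul_comm]
  congr 2
  have : ∀ (i : ℕ) (a : A), (D^[i]) ((D'^[p.1]) a) = (D'^[p.1]) ((D^[i]) a) := fun i => by
    induction i with
    | zero => exact fun a => rfl
    | succ i ih => intro a; rw [Function.iterate_succ_apply, iterate_derivation_comm h, ih,
                    Function.iterate_succ_apply]
  exact this _ _

/-- The composition of the operators `ζ(zD_i)/(zD_i)` for `i ∈ I`. -/
def zetaEnds {ι : Type} (D : ι → Derivation ℂ A A) (h : ∀ i j a, D i (D j a) = D j (D i a))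
    (I : Finset ι) : Module.End ℂ (PowerSeries A) :=
  I.noncommProd (fun i => zetaEnd (D i)) fun i _ j _ _ => commute_zetaEnd (h i j)

theorem zetaEnds_insert {ι : Type} [DecidableEq ι] (D : ι → Derivation ℂ A A)
    (h : ∀ i j a, D i (D j a) = D j (D i a)) {I : Finset ι} {i : ι} (hi : i ∉ I)
    (F : PowerSeries A) :
    zetaEnds D h (insert i I) F = zetaEnd (D i) (zetaEnds D h I F) := by
  exact congrArg (fun E : Module.End ℂ (PowerSeries A) => E F)
    (Finset.noncommProd_insert_of_notMem I i (fun i => zetaEnd (D i))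
      (fun i _ j _ _ => commute_zetaEnd (h i j)) hi)

theorem zetaEnds_empty {ι : Type} (D : ι → Derivation ℂ A A)
    (h : ∀ i j a, D i (D j a) = D j (D i a)) (F : PowerSeries A) : zetaEnds D h ∅ F = F := by
  exact congrArg (fun E : Module.End ℂ (PowerSeries A) => E F)
    (Finset.noncommProd_empty (fun i => zetaEnd (D i)) (fun i _ j _ _ => commute_zetaEnd (h i j)))

theorem zetaEnds_one {ι : Type} (D : ι → Derivation ℂ A A)
    (h : ∀ i j a, D i (D j a) = D j (D i a)) (I : Finset ι) : zetaEnds D h I 1 = 1 := by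
  classical
  induction I using Finset.induction_on with
  | empty => exact zetaEnds_empty _ _ _
  | insert i I hi ih => rw [zetaEnds_insert _ _ hi, ih, zetaEnd_one]

/-- The operators act on a product of series that each depend on one variable, times a series
that depends on none of them. -/
theorem zetaEnds_prod_mul {ι : Type} [DecidableEq ι] (D : ι → Derivation ℂ A A)
    (h : ∀ i j a, D i (D j a) = D j (D i a)) (I : Finset ι) (F : ι → PowerSeries A)
    (E : PowerSeries A) (hF : ∀ i ∈ I, ∀ j ∈ I, i ≠ j → Kills (D i) (F j))
    (hE : ∀ i ∈ I, Kills (D i) E) :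
    zetaEnds D h I ((∏ i ∈ I, F i) * E) = (∏ i ∈ I, zetaEnd (D i) (F i)) * E := by
  induction I using Finset.induction_on with
  | empty => simp [zetaEnds_empty]
  | insert i I hi ih =>
    have hk : ∀ j ∈ I, Kills (D i) (zetaEnd (D j) (F j)) := fun j hj =>
      (hF i (Finset.mem_insert_self _ _) j (Finset.mem_insert_of_mem hj)
        (fun e => hi (e ▸ hj))).zetaEnd (h i j)
    have hs : zetaEnds D h I (F i * ((∏ j ∈ I, F j) * E)) =
        F i * zetaEnds D h I ((∏ j ∈ I, F j) * E) := by
      have : ∀ K ⊆ I, ∀ G, zetaEnds D h K (F i * G) = F i * zetaEnds D h K G := by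
        intro K hK G
        induction K using Finset.induction_on with
        | empty => simp [zetaEnds_empty]
        | insert a K ha ihK =>
          have haI : a ∈ I := hK (Finset.mem_insert_self _ _)
          rw [zetaEnds_insert _ _ ha, zetaEnds_insert _ _ ha,
            ihK fun x hx => hK (Finset.mem_insert_of_mem hx), zetaEnd_mul
              (hF a (Finset.mem_insert_of_mem haI) i (Finset.mem_insert_self _ _)
                fun e => hi (e ▸ haI))]
      exact this I (le_refl _) _
    rw [zetaEnds_insert _ _ hi, Finset.prod_insert hi, mul_assoc, hs,
      ih (fun a ha b hb => hF a (Finset.mem_insert_of_mem ha) b (Finset.mem_insert_of_mem hb))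
        (fun a ha => hE a (Finset.mem_insert_of_mem ha)),
      mul_comm (F i), zetaEnd_mul ((Kills.prod I hk).mul (hE i (Finset.mem_insert_self _ _))),
      Finset.prod_insert hi]
    ring

end ZetaOp

/-! ### Commuting derivations of localizations -/

section Localization
variable {R : Type} [CommRing R] [Algebra ℂ R] (S : Submonoid R)

theorem derivation_localization_ext {D D' : Derivation ℂ (Localization S) (Localization S)}
    (h : ∀ f, D (algebraMap R _ f) = D' (algebraMap R _ f)) : D = D' := by
  refine Derivation.ext fun x => ?_
  obtain ⟨⟨f, s⟩, hfs⟩ := IsLocalization.surj S x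
  have h1 : (D - D') (x * algebraMap R _ s) = 0 := by
    rw [hfs, Derivation.sub_apply, h, sub_self]
  rw [Derivation.leibniz, Derivation.sub_apply (algebraMap R _ _), h, sub_self, smul_zero,
    zero_add, smul_eq_mul] at h1
  have h2 := (IsLocalization.map_units (Localization S) s).mul_right_eq_zero.1 h1
  exact sub_eq_zero.1 h2

theorem locDerivation_comm {D D' : Derivation ℂ R R} (h : ∀ f, D (D' f) = D' (D f))
    (x : Localization S) :
    locDerivation S D (locDerivation S D' x) = locDerivation S D' (locDerivation S D x) := by
  have : ⁅locDerivation S D, locDerivation S D'⁆ = 0 := by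
    refine derivation_localization_ext S fun f => ?_
    rw [Derivation.commutator_apply]
    simp [locDerivation_algebraMap, h]
  have h2 := congrArg (fun E => E x) this
  rw [Derivation.commutator_apply] at h2
  exact sub_eq_zero.1 h2

end Localization

theorem coeff_X_mul {σ : Type} (v : σ) (f : MvPowerSeries σ ℂ) (μ : σ →₀ ℕ) [Decidable
    (Finsupp.single v 1 ≤ μ)] :
    MvPowerSeries.coeff μ (MvPowerSeries.X v * f) =
      if Finsupp.single v 1 ≤ μ then MvPowerSeries.coeff (μ - Finsupp.single v 1) f else 0 := by
  classical
  rw [MvPowerSeries.X, MvPowerSeries.coeff_monomial_mul, one_mul]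
  congr

theorem coeff_euler {σ : Type} (v : σ) (f : MvPowerSeries σ ℂ) (μ : σ →₀ ℕ) :
    MvPowerSeries.coeff μ (euler v f) = (μ v : ℂ) * MvPowerSeries.coeff μ f := by
  classical
  rw [euler, Derivation.smul_apply, smul_eq_mul, coeff_X_mul]
  split_ifs with h
  · have h1 := Finsupp.single_le_iff.1 h
    rw [MvPowerSeries.coeff_pderiv, tsub_add_cancel_of_le h, mul_comm, Finsupp.tsub_apply,
      Finsupp.single_eq_same, Nat.cast_sub h1]
    simp
  · rw [Finsupp.single_le_iff] at h
    rw [show μ v = 0 by omega]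
    simp

theorem euler_comm {σ : Type} (v w : σ) (f : MvPowerSeries σ ℂ) :
    euler v (euler w f) = euler w (euler v f) := by
  ext μ
  simp only [coeff_euler]
  ring

theorem coeff_iterate_euler {σ : Type} (v : σ) (p : ℕ) (f : MvPowerSeries σ ℂ) (μ : σ →₀ ℕ) :
    MvPowerSeries.coeff μ (((euler v)^[p]) f) = (μ v : ℂ) ^ p * MvPowerSeries.coeff μ f := by
  induction p with
  | zero => simp
  | succ p ih => rw [Function.iterate_succ_apply', coeff_euler, ih, pow_succ]; ring

theorem eulerFrac_algebraMap {n : ℕ} (i : Fin n) (f : MvPowerSeries (Fin n) ℂ) :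
    eulerFrac i (algebraMap _ (Frac n) f) = algebraMap _ (Frac n) (euler i f) :=
  locDerivation_algebraMap _ _ _

theorem eulerFrac_comm {n : ℕ} (i j : Fin n) (f : Frac n) :
    eulerFrac i (eulerFrac j f) = eulerFrac j (eulerFrac i f) :=
  locDerivation_comm _ (euler_comm _ _) f

theorem eulerReg_algebraMap {n m : ℕ} (k : Fin n) (a : Fin m) (f : Series n m) :
    eulerReg k a (algebraMap _ (Reg n m k) f) = algebraMap _ (Reg n m k) (euler (Sum.inr a) f) :=
  locDerivation_algebraMap _ _ _

theorem eulerReg_comm {n m : ℕ} (k : Fin n) (a b : Fin m) (f : Reg n m k) :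
    eulerReg k a (eulerReg k b f) = eulerReg k b (eulerReg k a f) :=
  locDerivation_comm _ (euler_comm _ _) f

/-- The coefficient of `x^μ` of a series in `z` whose coefficients are series in `x`. -/
def coeffAt {σ : Type} (μ : σ →₀ ℕ) (F : PowerSeries (MvPowerSeries σ ℂ)) : PowerSeries ℂ :=
  PowerSeries.mk fun N => MvPowerSeries.coeff μ (PowerSeries.coeff N F)

theorem coeff_coeffAt {σ : Type} (μ : σ →₀ ℕ) (F : PowerSeries (MvPowerSeries σ ℂ)) (N : ℕ) :
    PowerSeries.coeff N (coeffAt μ F) = MvPowerSeries.coeff μ (PowerSeries.coeff N F) :=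
  PowerSeries.coeff_mk _ _

/-- D_v is diagonal on monomials, with the exponent of v as eigenvalue. This is how the weights
S(ν_i z) of the cut-and-join equation arise from the operators Q. -/
theorem coeffAt_zetaEnd {σ : Type} (v : σ) (F : PowerSeries (MvPowerSeries σ ℂ)) (μ : σ →₀ ℕ) :
    coeffAt μ (zetaEnd (euler v) F) =
      PowerSeries.rescale (μ v : ℂ) zetaDivZ * coeffAt μ F := by
  ext N
  rw [coeff_coeffAt, coeff_zetaEnd, map_sum, PowerSeries.coeff_mul]
  refine Finset.sum_congr rfl fun p _ => ?_
  rw [MvPowerSeries.coeff_smul, coeff_iterate_euler, PowerSeries.coeff_rescale, coeff_coeffAt]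
  ring

theorem coeffAt_zetaEnds {n : ℕ} (I : Finset (Fin n))
    (F : PowerSeries (MvPowerSeries (Fin n) ℂ)) (μ : Fin n →₀ ℕ) :
    coeffAt μ (zetaEnds (euler (σ := Fin n)) euler_comm I F) =
      (∏ i ∈ I, PowerSeries.rescale (μ i : ℂ) zetaDivZ) * coeffAt μ F := by
  induction I using Finset.induction_on with
  | empty => simp [zetaEnds_empty]
  | insert i I hi ih => rw [zetaEnds_insert _ _ hi, coeffAt_zetaEnd, ih, Finset.prod_insert hi,
      mul_assoc]

theorem zetaEnds_eulerFrac_map {n : ℕ} (I : Finset (Fin n))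
    (F : PowerSeries (MvPowerSeries (Fin n) ℂ)) :
    zetaEnds (eulerFrac (n := n)) eulerFrac_comm I (PowerSeries.map (algebraMap _ (Frac n)) F) =
      PowerSeries.map (algebraMap _ (Frac n)) (zetaEnds (euler (σ := Fin n)) euler_comm I F) := by
  induction I using Finset.induction_on with
  | empty => simp [zetaEnds_empty]
  | insert i I hi ih =>
    rw [zetaEnds_insert _ _ hi, zetaEnds_insert _ _ hi, ih]
    refine (map_zetaEnd _ (fun c a => ?_) (fun a => (eulerFrac_algebraMap i a).symm) _).symm
    exact map_smul (IsScalarTower.toAlgHom ℂ (MvPowerSeries (Fin n) ℂ) (Frac n)) c a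

/-! ### Series in several variables that depend on the sum of their exponents -/

section Block
variable {n : ℕ}

/-- The function `x_i / (x_k - x_i)`. -/
def polar (k i : Fin n) : Frac n :=
  algebraMap (MvPowerSeries (Fin n) ℂ) (Frac n) (MvPowerSeries.X i) /
    (algebraMap (MvPowerSeries (Fin n) ℂ) (Frac n) (MvPowerSeries.X k) -
      algebraMap (MvPowerSeries (Fin n) ℂ) (Frac n) (MvPowerSeries.X i))

theorem X_sub_X_ne_zero {σ : Type} {k i : σ} (h : k ≠ i) :
    (MvPowerSeries.X k - MvPowerSeries.X i : MvPowerSeries σ ℂ) ≠ 0 := by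
  classical
  intro h0
  have := congrArg (MvPowerSeries.coeff (Finsupp.single k 1)) h0
  rw [map_sub, MvPowerSeries.coeff_X, MvPowerSeries.coeff_X, if_pos rfl, if_neg, map_zero] at this
  · norm_num at this
  · intro h1
    exact h (Finsupp.single_left_injective one_ne_zero h1)

theorem algebraMap_X_sub_ne_zero {k i : Fin n} (h : k ≠ i) :
    algebraMap (MvPowerSeries (Fin n) ℂ) (Frac n) (MvPowerSeries.X k) -
      algebraMap (MvPowerSeries (Fin n) ℂ) (Frac n) (MvPowerSeries.X i) ≠ 0 := by
  rw [← map_sub, Ne, FaithfulSMul.algebraMap_eq_zero_iff]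
  exact X_sub_X_ne_zero h

theorem polar_mul_add (k a b : Fin n) (hka : k ≠ a) (hkb : k ≠ b) (hab : a ≠ b) :
    polar a b * polar k a + polar b a * polar k b = polar k a * polar k b := by
  have h1 := algebraMap_X_sub_ne_zero hka
  have h2 := algebraMap_X_sub_ne_zero hkb
  have h3 := algebraMap_X_sub_ne_zero hab
  have h4 := algebraMap_X_sub_ne_zero hab.symm
  simp only [polar]
  field_simp
  ring

theorem polar_add_polar {a b : Fin n} (hab : a ≠ b) : polar a b + polar b a = -1 := by
  have h3 := algebraMap_X_sub_ne_zero hab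
  have h4 := algebraMap_X_sub_ne_zero hab.symm
  simp only [polar]
  field_simp
  ring

/-- Solution of the recursion `S_{a,b,I} = x_b/(x_a - x_b) S_{a,I} + x_a/(x_b - x_a) S_{b,I}`. -/
theorem eq_sum_polar (S : Finset (Fin n) → Frac n) (U : Finset (Fin n))
    (hS : ∀ I ⊆ U, ∀ a ∈ U, ∀ b ∈ U, a ∉ I → b ∉ I → a ≠ b → S (insert a (insert b I)) =
      polar a b * S (insert a I) + polar b a * S (insert b I))
    (I : Finset (Fin n)) (hI : I.Nonempty) (hIU : I ⊆ U) :
    S I = ∑ k ∈ I, S {k} * ∏ i ∈ I.erase k, polar k i := by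
  induction I using Finset.strongInduction with
  | H I ih =>
    obtain ⟨a, ha⟩ := hI
    by_cases h1 : I = {a}
    · rw [h1]; simp
    obtain ⟨b, hb, hba⟩ : ∃ b ∈ I, b ≠ a := by
      by_contra! h
      exact h1 (Finset.eq_singleton_iff_unique_mem.2 ⟨ha, h⟩)
    set I' := (I.erase a).erase b with hI'
    have haI' : a ∉ I' := by simp [hI']
    have hbI' : b ∉ I' := by simp [hI']
    have hI'I : I' ⊆ I := (Finset.erase_subset _ _).trans (Finset.erase_subset _ _)
    have hIe : I = insert a (insert b I') := by
      rw [hI', Finset.insert_erase (Finset.mem_erase.2 ⟨hba, hb⟩), Finset.insert_erase ha]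
    have hab : a ∉ insert b I' := by simp [hba.symm, haI']
    have e1 := ih (insert a I') (by
      refine ⟨Finset.insert_subset ha hI'I, fun h => ?_⟩
      have := h hb
      simp [hba, hbI'] at this) ⟨a, by simp⟩
        (Finset.insert_subset (hIU ha) (hI'I.trans hIU))
    have e2 := ih (insert b I') (by
      refine ⟨Finset.insert_subset hb hI'I, fun h => ?_⟩
      have := h ha
      simp [hba.symm, haI'] at this) ⟨b, by simp⟩
        (Finset.insert_subset (hIU hb) (hI'I.trans hIU))
    have e0 := hS I' (hI'I.trans hIU) a (hIU ha) b (hIU hb) haI' hbI' hba.symm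
    rw [Finset.sum_insert haI', Finset.erase_insert haI'] at e1
    rw [Finset.sum_insert hbI', Finset.erase_insert hbI'] at e2
    have hbaI : b ∉ insert a I' := by simp [hba, hbI']
    rw [hIe, e0, Finset.sum_insert hab, Finset.sum_insert hbI', Finset.erase_insert hab,
      Finset.insert_comm a b, Finset.erase_insert hbaI, Finset.prod_insert hbI',
      Finset.prod_insert haI', e1, e2]
    -- For k other than a and b, the two smaller products recombine by the partial fraction identity
    -- `polar_mul_add`.
    have e3 : ∑ k ∈ I', S {k} * ∏ i ∈ (insert b (insert a I')).erase k, polar k i =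
        polar a b * (∑ k ∈ I', S {k} * ∏ i ∈ (insert a I').erase k, polar k i) +
        polar b a * ∑ k ∈ I', S {k} * ∏ i ∈ (insert b I').erase k, polar k i := by
      rw [Finset.mul_sum, Finset.mul_sum, ← Finset.sum_add_distrib]
      refine Finset.sum_congr rfl fun k hk => ?_
      have hka : k ≠ a := fun e => haI' (e ▸ hk)
      have hkb : k ≠ b := fun e => hbI' (e ▸ hk)
      rw [Finset.erase_insert_of_ne hkb.symm, Finset.erase_insert_of_ne hka.symm,
        Finset.erase_insert_of_ne hkb.symm, Finset.prod_insert, Finset.prod_insert,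
        Finset.prod_insert]
      · linear_combination (-(S {k} * ∏ i ∈ I'.erase k, polar k i)) *
          polar_mul_add k a b hka hkb hba.symm
      · exact fun h => hbI' (Finset.mem_of_mem_erase h)
      · exact fun h => haI' (Finset.mem_of_mem_erase h)
      · intro h
        rcases Finset.mem_insert.1 h with h | h
        · exact hba h
        · exact hbI' (Finset.mem_of_mem_erase h)
    rw [e3]
    ring

/-- The sum of the products of the polar functions. -/
theorem sum_prod_polar (I : Finset (Fin n)) (hI : I.Nonempty) :
    ∑ k ∈ I, ∏ i ∈ I.erase k, polar k i = (-1) ^ (I.card - 1) := by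
  have := eq_sum_polar (fun I => (-1 : Frac n) ^ (I.card - 1)) Finset.univ
    (fun I _ a _ b _ ha hb hab => by
      rw [Finset.card_insert_of_notMem (by simp [hab, ha]), Finset.card_insert_of_notMem hb,
        Finset.card_insert_of_notMem ha]
      simp only [Nat.add_sub_cancel]
      rw [← add_mul, polar_add_polar hab, pow_succ]
      ring) I hI (Finset.subset_univ _)
  simpa using this.symm

open Classical in
/-- The series in the variables with index in `J ∪ I`, all with positive exponents, whose
coefficients depend on the sum of the exponents with index in `I`. -/
def blockSeries (J : Finset (Fin n)) (F : ℕ → (Fin n → ℕ) → ℂ) (I : Finset (Fin n)) :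
    MvPowerSeries (Fin n) ℂ :=
  fun ν => if ∀ i, 1 ≤ ν i ↔ i ∈ J ∪ I then F (∑ i ∈ I, ν i) ν else 0

open Classical in
theorem coeff_blockSeries (J : Finset (Fin n)) (F : ℕ → (Fin n → ℕ) → ℂ) (I : Finset (Fin n))
    (ν : Fin n →₀ ℕ) : MvPowerSeries.coeff ν (blockSeries J F I) =
      if ∀ i, 1 ≤ ν i ↔ i ∈ J ∪ I then F (∑ i ∈ I, ν i) ν else 0 := rfl

open Classical in
theorem coeff_X_mul_blockSeries {J : Finset (Fin n)} {F : ℕ → (Fin n → ℕ) → ℂ}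
    (hF : ∀ a ν ν', (∀ j ∈ J, ν j = ν' j) → F a ν = F a ν') (I : Finset (Fin n)) {c : Fin n}
    (hc : c ∉ J) (ν : Fin n →₀ ℕ) :
    MvPowerSeries.coeff ν (MvPowerSeries.X c * blockSeries J F I) =
      if 1 ≤ ν c ∧ ∀ i, 1 ≤ ν i - (if i = c then 1 else 0) ↔ i ∈ J ∪ I then
        F (∑ i ∈ I, (ν i - (if i = c then 1 else 0))) ν else 0 := by
  have h1 : ∀ i, (ν - Finsupp.single c 1 : Fin n →₀ ℕ) i = ν i - (if i = c then 1 else 0) :=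
    fun i => by
      rw [Finsupp.tsub_apply, Finsupp.single_apply]
      simp only [eq_comm]
  rw [coeff_X_mul, coeff_blockSeries]
  simp only [h1]
  rw [hF _ _ ν fun j hj => by
    rw [h1, if_neg (ne_of_mem_of_not_mem hj hc), Nat.sub_zero]]
  simp only [Finsupp.single_le_iff]
  split_ifs <;> tauto

/-- The coefficients depend on ν_a + ν_b only, so multiplication by x_a and by x_b give the same
result, except at the boundary where one of the two exponents would drop to zero. The boundary terms
are the series for blocks that contain only one of a, b. -/
theorem X_sub_mul_blockSeries {J : Finset (Fin n)} {F : ℕ → (Fin n → ℕ) → ℂ}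
    (hF : ∀ a ν ν', (∀ j ∈ J, ν j = ν' j) → F a ν = F a ν') {I : Finset (Fin n)} {a b : Fin n}
    (haI : a ∉ I) (hbI : b ∉ I) (hab : a ≠ b) (haJ : a ∉ J) (hbJ : b ∉ J) :
    (MvPowerSeries.X a - MvPowerSeries.X b) * blockSeries J F (insert a (insert b I)) =
      MvPowerSeries.X b * blockSeries J F (insert a I) -
        MvPowerSeries.X a * blockSeries J F (insert b I) := by
  classical
  ext ν
  rw [sub_mul, map_sub, map_sub]
  by_cases hP : ∀ i, i ≠ a → i ≠ b → (1 ≤ ν i ↔ i ∈ J ∪ I)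
  · have hc : ∀ (c : Fin n) (T : Finset (Fin n)), c = a ∨ c = b → T ⊆ {a, b} →
        MvPowerSeries.coeff ν (MvPowerSeries.X c * blockSeries J F (T ∪ I)) =
          if 1 ≤ ν c ∧ (1 ≤ ν a - (if a = c then 1 else 0) ↔ a ∈ T) ∧
              (1 ≤ ν b - (if b = c then 1 else 0) ↔ b ∈ T) then
            F (∑ i ∈ T, (ν i - (if i = c then 1 else 0)) + ∑ i ∈ I, ν i) ν else 0 := by
      intro c T hc hT
      have hcJ : c ∉ J := by rcases hc with rfl | rfl <;> assumption
      have hcI : c ∉ I := by rcases hc with rfl | rfl <;> assumption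
      have hTI : Disjoint T I := by
        rw [Finset.disjoint_left]
        intro x hx hxI
        have := hT hx
        simp only [Finset.mem_insert, Finset.mem_singleton] at this
        rcases this with rfl | rfl <;> contradiction
      rw [coeff_X_mul_blockSeries hF _ hcJ, Finset.sum_union hTI]
      have e1 : ∑ i ∈ I, (ν i - (if i = c then 1 else 0)) = ∑ i ∈ I, ν i :=
        Finset.sum_congr rfl fun i hi => by
          rw [if_neg (ne_of_mem_of_not_mem hi hcI), Nat.sub_zero]
      rw [e1]
      refine if_congr (and_congr_right fun _ => ⟨fun h => ⟨?_, ?_⟩, fun h i => ?_⟩) rfl rfl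
      · rw [h a]; simp [haJ, haI]
      · rw [h b]; simp [hbJ, hbI]
      · by_cases hia : i = a
        · subst hia; rw [h.1]; simp [haJ, haI]
        by_cases hib : i = b
        · subst hib; rw [h.2]; simp [hbJ, hbI]
        rw [if_neg (by rcases hc with rfl | rfl <;> assumption), Nat.sub_zero, hP i hia hib]
        have : i ∉ T := fun h => by
          have := hT h
          simp [hia, hib] at this
        simp [this]
    have r1 : insert a (insert b I) = {a, b} ∪ I := by ext; simp
    have r2 : insert a I = {a} ∪ I := rfl
    have r3 : insert b I = {b} ∪ I := rfl
    rw [r1, r2, r3, hc a _ (Or.inl rfl) (le_refl _), hc b _ (Or.inr rfl) (le_refl _),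
      hc b {a} (Or.inr rfl) (by simp), hc a {b} (Or.inl rfl) (by simp)]
    simp only [Finset.sum_pair hab, if_true, if_neg hab, if_neg hab.symm, Finset.sum_singleton,
      Finset.mem_insert, Finset.mem_singleton, hab, hab.symm, true_or, or_true, iff_true, iff_false,
      Nat.sub_zero, if_false]
    rcases Nat.lt_or_ge (ν a) 1 with h1 | h1 <;> rcases Nat.lt_or_ge (ν b) 1 with h2 | h2
    · rw [if_neg (by omega), if_neg (by omega), if_neg (by omega), if_neg (by omega)]
    · rw [if_neg (by omega), if_neg (by omega), if_neg (by omega), if_neg (by omega)]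
    · rw [if_neg (by omega), if_neg (by omega), if_neg (by omega), if_neg (by omega)]
    · have e1 : ν a - 1 + ν b = ν a + ν b - 1 := by omega
      have e2 : ν a + (ν b - 1) = ν a + ν b - 1 := by omega
      rw [e1, e2]
      rcases Nat.lt_or_ge (ν a) 2 with h3 | h3 <;> rcases Nat.lt_or_ge (ν b) 2 with h4 | h4
      · have h5 : ν a = 1 := by omega
        have h6 : ν b = 1 := by omega
        simp [h5, h6]
      · have h5 : ν a = 1 := by omega
        rw [if_neg (by omega), if_pos (by omega), if_neg (by omega), if_pos (by omega), h5,
          show 1 + ν b - 1 = ν b by omega]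
      · have h5 : ν b = 1 := by omega
        rw [if_pos (by omega), if_neg (by omega), if_pos (by omega), if_neg (by omega), h5,
          show ν a + 1 - 1 = ν a by omega]
      · rw [if_pos (by omega), if_pos (by omega), if_neg (by omega), if_neg (by omega)]
        ring
  · have hc : ∀ (c : Fin n) (T : Finset (Fin n)), c = a ∨ c = b → T ⊆ {a, b} →
        MvPowerSeries.coeff ν (MvPowerSeries.X c * blockSeries J F (T ∪ I)) = 0 := by
      intro c T hc hT
      have hcJ : c ∉ J := by rcases hc with rfl | rfl <;> assumption
      rw [coeff_X_mul_blockSeries hF _ hcJ, if_neg]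
      rintro ⟨-, h⟩
      refine hP fun i hia hib => ?_
      have h1 := h i
      rw [if_neg (by rcases hc with rfl | rfl <;> assumption), Nat.sub_zero] at h1
      rw [h1]
      have : i ∉ T := fun h => by
        have := hT h
        simp [hia, hib] at this
      simp [this]
    have r1 : insert a (insert b I) = {a, b} ∪ I := by ext; simp
    have r2 : insert a I = {a} ∪ I := rfl
    have r3 : insert b I = {b} ∪ I := rfl
    rw [r1, r2, r3, hc a _ (Or.inl rfl) (le_refl _), hc b _ (Or.inr rfl) (le_refl _),
      hc b {a} (Or.inr rfl) (by simp), hc a {b} (Or.inl rfl) (by simp)]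

/-- The cancellation of the poles. Lagrange interpolation at the x_k spreads a power of one variable
over all variables of the block with positive exponents; only the recursion `X_sub_mul_blockSeries`
enters. -/
theorem sum_blockSeries_polar {J : Finset (Fin n)} {F : ℕ → (Fin n → ℕ) → ℂ}
    (hF : ∀ a ν ν', (∀ j ∈ J, ν j = ν' j) → F a ν = F a ν') {I : Finset (Fin n)} (hI : I.Nonempty)
    (hIJ : Disjoint I J) :
    ∑ k ∈ I, algebraMap _ (Frac n) (blockSeries J F {k}) * ∏ i ∈ I.erase k, polar k i =
      algebraMap _ (Frac n) (blockSeries J F I) := by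
  refine (eq_sum_polar (fun I => algebraMap _ (Frac n) (blockSeries J F I)) I
    (fun I' _ a ha b hb haI hbI hab => ?_) I hI (le_refl _)).symm
  have h0 := algebraMap_X_sub_ne_zero hab
  have h1 := algebraMap_X_sub_ne_zero hab.symm
  have := congrArg (algebraMap _ (Frac n)) (X_sub_mul_blockSeries hF haI hbI hab
    (Finset.disjoint_left.1 hIJ ha) (Finset.disjoint_left.1 hIJ hb))
  rw [map_mul, map_sub, map_sub, map_mul, map_mul] at this
  rw [← mul_right_inj' h0, this]
  simp only [polar]
  field_simp
  ring

end Block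

/-! ### Regular factors -/

section Append
variable {n : ℕ}

/-- The exponents `ν_i`, `i ∈ K`, followed by the exponents `lam`. -/
def tuple (ν : Fin n →₀ ℕ) (K : Finset (Fin n)) {s : ℕ} (lam : Fin s → ℕ) :
    Fin (K.card + s) →₀ ℕ :=
  Finsupp.equivFunOnFinite.symm (Fin.append (fun i => ν (K.orderEmbOfFin rfl i)) lam)

/-- The variables `x_i`, `i ∈ K`, followed by `s` times the variable `x_k`. -/
def collapse (k : Fin n) (K : Finset (Fin n)) (s : ℕ) : Fin (K.card + s) → Fin n :=
  Fin.append (K.orderEmbOfFin rfl) fun _ => k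

theorem mapDomain_apply_sum {α β : Type} [Fintype α] [DecidableEq β] (f : α → β) (κ : α →₀ ℕ)
    (b : β) : Finsupp.mapDomain f κ b = ∑ a, if f a = b then κ a else 0 := by
  rw [Finsupp.mapDomain, Finsupp.sum_fintype _ _ (by simp), Finsupp.finsetSum_apply]
  exact Finset.sum_congr rfl fun a _ => Finsupp.single_apply

theorem mapDomain_collapse (k : Fin n) {K : Finset (Fin n)} (hk : k ∉ K) {s : ℕ}
    (κ : Fin (K.card + s) →₀ ℕ) (ν : Fin n →₀ ℕ) :
    Finsupp.mapDomain (collapse k K s) κ = ν ↔ (∀ i, i ∉ K → i ≠ k → ν i = 0) ∧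
      (∀ i, κ (Fin.castAdd s i) = ν (K.orderEmbOfFin rfl i)) ∧
      ∑ b, κ (Fin.natAdd K.card b) = ν k := by
  have hmem : ∀ a i, i ∉ K → K.orderEmbOfFin rfl a ≠ i := fun a i hi e =>
    hi (e ▸ K.orderEmbOfFin_mem rfl a)
  have h0 : ∀ i, Finsupp.mapDomain (collapse k K s) κ i =
      (∑ a, if K.orderEmbOfFin rfl a = i then κ (Fin.castAdd s a) else 0) +
        ∑ b, if k = i then κ (Fin.natAdd K.card b) else 0 := fun i => by
    rw [mapDomain_apply_sum, Fin.sum_univ_add]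
    simp [collapse]
  have h1 : ∀ a, Finsupp.mapDomain (collapse k K s) κ (K.orderEmbOfFin rfl a) =
      κ (Fin.castAdd s a) := fun a => by
    have hne : k ≠ K.orderEmbOfFin rfl a := (hmem a k hk).symm
    rw [h0, Finset.sum_eq_single a]
    · simp [hne]
    · intro b _ hb
      rw [if_neg (fun e => hb ((K.orderEmbOfFin rfl).injective e))]
    · simp
  have h2 : Finsupp.mapDomain (collapse k K s) κ k = ∑ b, κ (Fin.natAdd K.card b) := by
    rw [h0, Finset.sum_eq_zero]
    · simp
    · intro a _
      rw [if_neg (hmem a k hk)]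
  have h3 : ∀ i, i ∉ K → i ≠ k → Finsupp.mapDomain (collapse k K s) κ i = 0 := fun i hi hik => by
    rw [h0, Finset.sum_eq_zero fun a _ => if_neg (hmem a i hi),
      Finset.sum_eq_zero fun b _ => if_neg hik.symm, add_zero]
  constructor
  · rintro rfl
    exact ⟨h3, fun i => (h1 i).symm, h2.symm⟩
  · rintro ⟨e1, e2, e3⟩
    ext i
    by_cases hik : i = k
    · rw [hik, h2, e3]
    by_cases hiK : i ∈ K
    · obtain ⟨a, rfl⟩ : i ∈ Set.range (K.orderEmbOfFin rfl) := by
        rw [Finset.range_orderEmbOfFin]; exact hiK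
      rw [h1, e2]
    · rw [h3 i hiK hik, e1 i hiK hik]

open Classical in
theorem coeff_rename_collapse (k : Fin n) {K : Finset (Fin n)} (hk : k ∉ K) {s : ℕ}
    (Y : MvPowerSeries (Fin (K.card + s)) ℂ) (ν : Fin n →₀ ℕ) :
    MvPowerSeries.coeff ν (MvPowerSeries.rename (collapse k K s) Y) =
      if ∀ i, i ∉ K → i ≠ k → ν i = 0 then
        ∑ lam ∈ Finset.Nat.antidiagonalTuple s (ν k), MvPowerSeries.coeff (tuple ν K lam) Y
      else 0 := by
  rw [MvPowerSeries.coeff_rename]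
  split_ifs with h
  · refine Finset.sum_nbij' (fun κ b => κ (Fin.natAdd K.card b)) (fun lam => tuple ν K lam)
      ?_ ?_ ?_ ?_ ?_
    · intro κ hκ
      rw [Set.Finite.mem_toFinset, Set.mem_preimage, Set.mem_singleton_iff,
        mapDomain_collapse k hk] at hκ
      exact Finset.Nat.mem_antidiagonalTuple.2 hκ.2.2
    · intro lam hlam
      rw [Finset.Nat.mem_antidiagonalTuple] at hlam
      rw [Set.Finite.mem_toFinset, Set.mem_preimage, Set.mem_singleton_iff,
        mapDomain_collapse k hk]
      exact ⟨h, fun i => by simp [tuple], by simpa [tuple] using hlam⟩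
    · intro κ hκ
      rw [Set.Finite.mem_toFinset, Set.mem_preimage, Set.mem_singleton_iff,
        mapDomain_collapse k hk] at hκ
      ext i
      refine Fin.addCases (fun i => ?_) (fun i => ?_) i
      · simp [tuple, hκ.2.1]
      · simp [tuple]
    · intro lam _
      ext b
      simp [tuple]
    · intro κ hκ
      rw [Set.Finite.mem_toFinset, Set.mem_preimage, Set.mem_singleton_iff,
        mapDomain_collapse k hk] at hκ
      congr 1
      congr 1
      ext i
      refine Fin.addCases (fun i => ?_) (fun i => ?_) i
      · simp [tuple, hκ.2.1]
      · simp [tuple]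
  · refine Finset.sum_eq_zero fun κ hκ => absurd ?_ h
    rw [Set.Finite.mem_toFinset, Set.mem_preimage, Set.mem_singleton_iff,
      mapDomain_collapse k hk] at hκ
    exact hκ.1

/-- The series `∏_b ζ(zD_{ξ_b})/z H(x_K, ξ_1, …, ξ_s)` at `ξ_1 = ⋯ = ξ_s = x_k`. -/
def regSeries (k : Fin n) (K : Finset (Fin n)) (s : ℕ)
    (H : MvPowerSeries (Fin (K.card + s)) ℂ) : PowerSeries (MvPowerSeries (Fin n) ℂ) :=
  PowerSeries.mk fun N => MvPowerSeries.rename (collapse k K s) (fun κ =>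
    PowerSeries.coeff N (∏ b : Fin s, partWeight (κ (Fin.natAdd K.card b))) *
      MvPowerSeries.coeff κ H : MvPowerSeries (Fin (K.card + s)) ℂ)

end Append

/-! ### Factors with their own variables ξ, and their specialization -/

section Factors
variable {n m : ℕ}

/-- The renaming of the variables of a factor. -/
def factorVars (K : Finset (Fin n)) (M : Finset (Fin m)) :
    Fin (K.card + M.card) → Fin n ⊕ Fin m :=
  Fin.append (fun i => Sum.inl (K.orderEmbOfFin rfl i)) fun a => Sum.inr (M.orderEmbOfFin rfl a)

theorem factorVars_injective (K : Finset (Fin n)) (M : Finset (Fin m)) :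
    Function.Injective (factorVars K M) := by
  intro i j
  refine Fin.addCases (fun i => ?_) (fun i => ?_) i <;>
    refine Fin.addCases (fun j => ?_) (fun j => ?_) j <;> simp [factorVars]

theorem coeff_foldr_euler (L : List (Fin m)) (f : Series n m) (η : Fin n ⊕ Fin m →₀ ℕ) :
    MvPowerSeries.coeff η (L.foldr (fun a G => euler (Sum.inr a) G) f) =
      (L.map fun a => (η (Sum.inr a) : ℂ)).prod * MvPowerSeries.coeff η f := by
  induction L with
  | nil => simp
  | cons a L ih => rw [List.foldr_cons, coeff_euler, ih, List.map_cons, List.prod_cons, mul_assoc]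

theorem coeffAt_foldr_zetaEnd (L : List (Fin m)) (F : PowerSeries (Series n m))
    (η : Fin n ⊕ Fin m →₀ ℕ) :
    coeffAt η (L.foldr (fun a G => zetaEnd (euler (Sum.inr a)) G) F) =
      (L.map fun a => PowerSeries.rescale (η (Sum.inr a) : ℂ) zetaDivZ).prod * coeffAt η F := by
  induction L with
  | nil => simp
  | cons a L ih =>
    rw [List.foldr_cons, coeffAt_zetaEnd, ih, List.map_cons, List.prod_cons, mul_assoc]

theorem prod_orderEmbOfFin {α β : Type} [LinearOrder α] [CommMonoid β] (M : Finset α)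
    (f : α → β) : ∏ a ∈ M, f a = ∏ b : Fin M.card, f (M.orderEmbOfFin rfl b) := by
  conv_lhs => rw [← Finset.map_orderEmbOfFin_univ M rfl]
  rw [Finset.prod_map]
  rfl

theorem prod_map_sort {β : Type} [CommMonoid β] (M : Finset (Fin m)) (f : Fin m → β) :
    ((M.sort (· ≤ ·)).map f).prod = ∏ b : Fin M.card, f (M.orderEmbOfFin rfl b) := by
  rw [← List.prod_toFinset f (M.sort_nodup _), M.sort_toFinset, prod_orderEmbOfFin]

theorem rescale_zero_zetaDivZ : PowerSeries.rescale (0 : ℂ) zetaDivZ = 1 := by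
  rw [PowerSeries.rescale_zero]
  have : PowerSeries.constantCoeff zetaDivZ = 1 := by
    rw [← PowerSeries.coeff_zero_eq_constantCoeff_apply, constantCoeff_zetaDivZ]
  simp [this]

theorem euler_rename_factorVars (K : Finset (Fin n)) {M : Finset (Fin m)} {a : Fin m} (ha : a ∉ M)
    (H : MvPowerSeries (Fin (K.card + M.card)) ℂ) :
    euler (Sum.inr a) (MvPowerSeries.rename (factorVars K M) H) = 0 := by
  ext η
  rw [coeff_euler, map_zero]
  by_cases hη : η ∈ Set.range (Finsupp.mapDomain (factorVars K M))
  · obtain ⟨κ, rfl⟩ := hη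
    rw [Finsupp.mapDomain_of_notMem_range, Nat.cast_zero, zero_mul]
    rintro ⟨i, hi⟩
    revert hi
    refine Fin.addCases (fun i => ?_) (fun i => ?_) i
    · simp [factorVars]
    · simp only [factorVars, Fin.append_right, Sum.inr.injEq]
      rintro rfl
      exact ha (M.orderEmbOfFin_mem rfl i)
  · rw [MvPowerSeries.coeff_rename_eq_zero _ _ hη, mul_zero]

theorem rename_congr {σ τ : Type} {f g : σ → τ} [Filter.TendstoCofinite f]
    [Filter.TendstoCofinite g] (h : f = g) (Y : MvPowerSeries σ ℂ) :
    MvPowerSeries.rename f Y = MvPowerSeries.rename g Y := by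
  subst h; rfl

/-- The operators are evaluated on monomials before the variables are identified: each ξ with
exponent κ contributes κ S(κz), and a ξ not occurring in the factor contributes S(0) = 1. Collapsing
the variables then sums over the exponents of the ξ. -/
theorem map_diag_foldr (k : Fin n) (K : Finset (Fin n)) (M : Finset (Fin m))
    (H : MvPowerSeries (Fin (K.card + M.card)) ℂ) :
    PowerSeries.map (diag (m := m) k).toRingHom
        ((List.finRange m).foldr (fun a G => zetaEnd (euler (Sum.inr a)) G)
          (PowerSeries.C ((M.sort (· ≤ ·)).foldr (fun a G => euler (Sum.inr a) G)
            (MvPowerSeries.rename (factorVars K M) H)))) =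
      regSeries k K M.card H := by
  ext1 N
  rw [PowerSeries.coeff_map, regSeries, PowerSeries.coeff_mk]
  set Y : MvPowerSeries (Fin (K.card + M.card)) ℂ := fun κ =>
    PowerSeries.coeff N (∏ b : Fin M.card, partWeight (κ (Fin.natAdd K.card b))) *
      MvPowerSeries.coeff κ H with hY
  have hcomp : collapse k K M.card = (Sum.elim id fun _ => k) ∘ factorVars K M := by
    funext i
    refine Fin.addCases (fun i => ?_) (fun i => ?_) i <;> simp [collapse, factorVars]
  have hren : MvPowerSeries.rename (collapse k K M.card) Y =
      diag k (MvPowerSeries.rename (factorVars K M) Y) := by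
    rw [diag, MvPowerSeries.rename_rename]
    exact rename_congr hcomp Y
  rw [hren]
  change diag k _ = _
  congr 1
  ext η
  rw [← coeff_coeffAt, coeffAt_foldr_zetaEnd, ← Fin.prod_univ_def]
  have hC : ∀ f : Series n m, coeffAt η (PowerSeries.C f) =
      PowerSeries.C (MvPowerSeries.coeff η f) := fun f => by
    ext N
    rw [coeff_coeffAt, PowerSeries.coeff_C, PowerSeries.coeff_C]
    split_ifs <;> simp
  rw [hC, coeff_foldr_euler, prod_map_sort, PowerSeries.coeff_mul_C]
  by_cases hη : η ∈ Set.range (Finsupp.mapDomain (factorVars K M))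
  · obtain ⟨κ, rfl⟩ := hη
    set e : Fin (K.card + M.card) ↪ Fin n ⊕ Fin m := ⟨factorVars K M, factorVars_injective K M⟩
    have hκ : Finsupp.mapDomain (factorVars K M) κ = Finsupp.embDomain e κ :=
      (Finsupp.embDomain_eq_mapDomain e κ).symm
    have h1 : ∀ Z : MvPowerSeries (Fin (K.card + M.card)) ℂ,
        MvPowerSeries.coeff (Finsupp.embDomain e κ) (MvPowerSeries.rename (factorVars K M) Z) =
          MvPowerSeries.coeff κ Z := fun Z => MvPowerSeries.coeff_embDomain_rename e Z κ
    have h2 : ∀ b, Finsupp.embDomain e κ (Sum.inr (M.orderEmbOfFin rfl b)) =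
        κ (Fin.natAdd K.card b) := fun b => by
      rw [← Finsupp.embDomain_apply_self e κ (Fin.natAdd K.card b)]
      congr 1
      simp [e, factorVars]
    have h3 : ∀ a ∉ M, Finsupp.embDomain e κ (Sum.inr a) = 0 := fun a ha => by
      refine Finsupp.embDomain_of_notMem_range _ _ _ ?_
      rintro ⟨i, hi⟩
      revert hi
      refine Fin.addCases (fun i => ?_) (fun i => ?_) i
      · simp [e, factorVars]
      · simp only [e, factorVars, Function.Embedding.coeFn_mk, Fin.append_right, Sum.inr.injEq]
        rintro rfl
        exact ha (M.orderEmbOfFin_mem rfl i)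
    rw [hκ, h1, h1]
    change _ = PowerSeries.coeff N (∏ b : Fin M.card, partWeight (κ (Fin.natAdd K.card b))) *
      MvPowerSeries.coeff κ H
    have h4 : ∏ a : Fin m, PowerSeries.rescale (Finsupp.embDomain e κ (Sum.inr a) : ℂ) zetaDivZ =
        ∏ b : Fin M.card, PowerSeries.rescale (κ (Fin.natAdd K.card b) : ℂ) zetaDivZ := by
      rw [← Finset.prod_subset (Finset.subset_univ M) fun a _ ha => by
        rw [h3 a ha, Nat.cast_zero, rescale_zero_zetaDivZ]]
      rw [prod_orderEmbOfFin M fun a =>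
        PowerSeries.rescale (Finsupp.embDomain e κ (Sum.inr a) : ℂ) zetaDivZ]
      exact Finset.prod_congr rfl fun b _ => by rw [h2]
    have h5 : ∏ b : Fin M.card, partWeight (κ (Fin.natAdd K.card b)) =
        PowerSeries.C (∏ b : Fin M.card, (κ (Fin.natAdd K.card b) : ℂ)) *
          ∏ b : Fin M.card, PowerSeries.rescale (κ (Fin.natAdd K.card b) : ℂ) zetaDivZ := by
      rw [map_prod, ← Finset.prod_mul_distrib]
      exact Finset.prod_congr rfl fun b _ => by rw [partWeight, map_natCast]
    rw [h4, h5, PowerSeries.coeff_C_mul]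
    simp only [h2]
    ring
  · rw [MvPowerSeries.coeff_rename_eq_zero _ _ hη, MvPowerSeries.coeff_rename_eq_zero _ _ hη,
      mul_zero, mul_zero]

end Factors

/-! ### Specialization of the factors -/

section Specialize
variable {n m : ℕ} (k : Fin n)

theorem specialize_algebraMap (f : Series n m) :
    specialize k (algebraMap _ (Reg n m k) f) = algebraMap _ (Frac n) (diag k f) :=
  IsLocalization.map_eq (M := denominators n m k)
    (T := nonZeroDivisors (MvPowerSeries (Fin n) ℂ)) (le_refl _) f

theorem algebraMap_complex_smul {R : Type} [CommRing R] [Algebra ℂ R] (S : Submonoid R) (c : ℂ)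
    (f : R) : algebraMap R (Localization S) (c • f) = c • algebraMap R (Localization S) f :=
  map_smul (IsScalarTower.toAlgHom ℂ R (Localization S)) c f

theorem specialize_smul (c : ℂ) (F : Reg n m k) : specialize k (c • F) = c • specialize k F := by
  have h1 : c • F = algebraMap _ (Reg n m k) (algebraMap ℂ (Series n m) c) * F := by
    rw [← IsScalarTower.algebraMap_apply, Algebra.smul_def]
  rw [h1, map_mul, specialize_algebraMap, AlgHom.commutes, ← IsScalarTower.algebraMap_apply,
    ← Algebra.smul_def]

/-- The composition of the operators `ζ(zD_{ξ_a})/(zD_{ξ_a})` for `a` in a list. -/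
def xiOps (L : List (Fin m)) (G : Reg n m k) : PowerSeries (Reg n m k) :=
  L.foldr (fun a F => zetaEnd (eulerReg k a) F) (PowerSeries.C G)

theorem xiOps_cons (a : Fin m) (L : List (Fin m)) (G : Reg n m k) :
    xiOps k (a :: L) G = zetaEnd (eulerReg k a) (xiOps k L G) := rfl

theorem xiOps_add (L : List (Fin m)) (G G' : Reg n m k) :
    xiOps k L (G + G') = xiOps k L G + xiOps k L G' := by
  induction L with
  | nil => exact map_add _ _ _
  | cons a L ih => rw [xiOps_cons, ih, map_add, xiOps_cons, xiOps_cons]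

theorem xiOps_sub (L : List (Fin m)) (G G' : Reg n m k) :
    xiOps k L (G - G') = xiOps k L G - xiOps k L G' := by
  rw [eq_sub_iff_add_eq, ← xiOps_add, sub_add_cancel]

theorem kills_C {A : Type} [CommRing A] [Algebra ℂ A] {D : Derivation ℂ A A} {a : A}
    (h : D a = 0) : Kills D (PowerSeries.C a) := fun N => by
  rw [PowerSeries.coeff_C]; split_ifs <;> simp [h]

theorem kills_xiOps (L : List (Fin m)) {b : Fin m} {G : Reg n m k} (h : eulerReg k b G = 0) :
    Kills (eulerReg k b) (xiOps k L G) := by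
  induction L with
  | nil => exact kills_C h
  | cons a L ih => exact ih.zetaEnd (eulerReg_comm k b a)

theorem xiOps_prod {l : ℕ} (L : List (Fin m)) (G : Fin l → Reg n m k)
    (h : ∀ a i j, i ≠ j → eulerReg k a (G i) = 0 ∨ eulerReg k a (G j) = 0) :
    xiOps k L (∏ j, G j) = ∏ j, xiOps k L (G j) := by
  induction L with
  | nil => exact map_prod _ _ _
  | cons a L ih =>
    rw [xiOps_cons, ih, zetaEnd_prod]
    · rfl
    · exact fun i _ j _ hij => (h a i j hij).imp (kills_xiOps k L) (kills_xiOps k L)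

theorem xiOps_single (L : List (Fin m)) (hL : L.Nodup) {a : Fin m} {G : Reg n m k}
    (h : ∀ b, b ≠ a → eulerReg k b G = 0) :
    xiOps k L G = if a ∈ L then zetaEnd (eulerReg k a) (PowerSeries.C G) else PowerSeries.C G := by
  induction L with
  | nil => rfl
  | cons b L ih =>
    rw [List.nodup_cons] at hL
    rw [xiOps_cons, ih hL.2]
    by_cases hab : a = b
    · subst hab
      rw [if_neg hL.1, if_pos (by simp)]
    · have hk := kills_C (h b (Ne.symm hab))
      simp only [List.mem_cons, hab, false_or]
      split_ifs
      · exact zetaEnd_of_kills (hk.zetaEnd (eulerReg_comm k b a))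
      · exact zetaEnd_of_kills hk

theorem foldr_eulerReg (L : List (Fin m)) (f : Series n m) :
    L.foldr (fun a G => eulerReg k a G) (algebraMap _ (Reg n m k) f) =
      algebraMap _ (Reg n m k) (L.foldr (fun a G => euler (Sum.inr a) G) f) := by
  induction L with
  | nil => rfl
  | cons a L ih => rw [List.foldr_cons, ih, eulerReg_algebraMap, List.foldr_cons]

theorem xiOps_algebraMap (L : List (Fin m)) (f : Series n m) :
    xiOps k L (algebraMap _ (Reg n m k) f) = PowerSeries.map (algebraMap _ (Reg n m k))
      (L.foldr (fun a F => zetaEnd (euler (Sum.inr a)) F) (PowerSeries.C f)) := by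
  induction L with
  | nil => exact (PowerSeries.map_C _ _).symm
  | cons a L ih =>
    rw [xiOps_cons, ih, List.foldr_cons]
    exact (map_zetaEnd _ (algebraMap_complex_smul _)
      (fun f => (eulerReg_algebraMap k a f).symm) _).symm

/-- The mixed derivative of the regular part of a factor. -/
def mixedEuler (M : Finset (Fin m)) (f : Series n m) : Series n m :=
  (M.sort (· ≤ ·)).foldr (fun a G => euler (Sum.inr a) G) f

theorem foldr_euler_comm (L : List (Fin m)) (a : Fin m) (f : Series n m) :
    L.foldr (fun a G => euler (Sum.inr a) G) (euler (Sum.inr a) f) =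
      euler (Sum.inr a) (L.foldr (fun a G => euler (Sum.inr a) G) f) := by
  induction L with
  | nil => rfl
  | cons b L ih => rw [List.foldr_cons, ih, euler_comm, List.foldr_cons]

theorem mixedDeriv_of_arg_one {M : Finset (Fin m)} (hM : M.Nonempty) (f : Series n m) :
    (LogFun.mk (algebraMap _ (Reg n m k) f) 1).mixedDeriv k M =
      algebraMap _ (Reg n m k) (mixedEuler M f) := by
  have hlen : (M.sort (· ≤ ·)) ≠ [] := by
    intro h
    have := M.sort_toFinset (· ≤ ·)
    rw [h] at this
    exact hM.ne_empty (by simpa using this.symm)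
  rw [LogFun.mixedDeriv, mixedEuler]
  cases hs : M.sort (· ≤ ·) with
  | nil => exact absurd hs hlen
  | cons a l =>
    simp only [LogFun.deriv]
    rw [Derivation.map_one_eq_zero, zero_mul, add_zero, eulerReg_algebraMap, foldr_eulerReg,
      foldr_euler_comm, List.foldr_cons]

theorem euler_mixedEuler_rename (K : Finset (Fin n)) {M : Finset (Fin m)} {a : Fin m} (ha : a ∉ M)
    (H : MvPowerSeries (Fin (K.card + M.card)) ℂ) :
    euler (Sum.inr a) (mixedEuler M (MvPowerSeries.rename (factorVars K M) H)) = 0 := by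
  rw [mixedEuler, ← foldr_euler_comm, euler_rename_factorVars K ha]
  exact List.foldr_fixed' (fun a => map_zero _) _

/-- Because M is not empty, at least one derivative acts on the constant. This is why the correction
of the correlators is invisible on the right-hand side. -/
theorem mixedEuler_rename_C (K : Finset (Fin n)) {M : Finset (Fin m)} (hM : M.Nonempty) (c : ℂ) :
    mixedEuler M (MvPowerSeries.rename (factorVars K M)
      (MvPowerSeries.C c : MvPowerSeries (Fin (K.card + M.card)) ℂ)) = 0 := by
  classical
  ext η
  rw [mixedEuler, coeff_foldr_euler, prod_map_sort, MvPowerSeries.rename_C, MvPowerSeries.coeff_C,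
    map_zero]
  split_ifs with h
  · haveI : NeZero M.card := ⟨hM.card_ne_zero⟩
    rw [Finset.prod_eq_zero (Finset.mem_univ (0 : Fin M.card)), zero_mul]
    simp [h]
  · exact mul_zero _

theorem mixedEuler_add (M : Finset (Fin m)) (f g : Series n m) :
    mixedEuler M (f + g) = mixedEuler M f + mixedEuler M g := by
  ext η
  simp only [mixedEuler, coeff_foldr_euler, map_add, mul_add]

/-! #### The logarithm -/

/-- The function `x_i / (ξ_a - x_i)`. -/
def polarReg (a : Fin m) (i : Fin n) : Reg n m k :=
  xVar k i * Ring.inverse (xiVar k a - xVar k i)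

theorem algebraMap_X_ne_zero (i : Fin n) : (MvPowerSeries.X i : MvPowerSeries (Fin n) ℂ) ≠ 0 := by
  classical
  intro h0
  have := congrArg (MvPowerSeries.coeff (Finsupp.single i 1)) h0
  rw [MvPowerSeries.coeff_X, if_pos rfl, map_zero] at this
  exact one_ne_zero this

theorem isUnit_algebraMap_reg {f : Series n m} (h : diag k f ≠ 0) :
    IsUnit (algebraMap _ (Reg n m k) f) :=
  IsLocalization.map_units (Reg n m k) (⟨f, mem_nonZeroDivisors_of_ne_zero h⟩ : denominators n m k)

theorem isUnit_xiVar_sub (a : Fin m) {i : Fin n} (hi : k ≠ i) :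
    IsUnit (xiVar k a - xVar (m := m) k i) := by
  rw [xiVar, xVar, ← map_sub]
  refine isUnit_algebraMap_reg k ?_
  rw [map_sub, diag, MvPowerSeries.rename_X, MvPowerSeries.rename_X]
  exact X_sub_X_ne_zero hi

theorem isUnit_xiVar_mul (a : Fin m) (i : Fin n) : IsUnit (xiVar k a * xVar (m := m) k i) := by
  rw [xiVar, xVar, ← map_mul]
  refine isUnit_algebraMap_reg k ?_
  rw [map_mul, diag, MvPowerSeries.rename_X, MvPowerSeries.rename_X]
  exact mul_ne_zero (algebraMap_X_ne_zero _) (algebraMap_X_ne_zero _)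

theorem euler_X_self {σ : Type} (v : σ) :
    euler v (MvPowerSeries.X v : MvPowerSeries σ ℂ) = MvPowerSeries.X v := by
  rw [euler, Derivation.smul_apply, MvPowerSeries.pderiv_X_self, smul_eq_mul, mul_one]

theorem euler_X_of_ne {σ : Type} {v w : σ} (h : w ≠ v) :
    euler v (MvPowerSeries.X w : MvPowerSeries σ ℂ) = 0 := by
  rw [euler, Derivation.smul_apply, MvPowerSeries.pderiv_X_of_ne h, smul_zero]

theorem eulerReg_xiVar_self (a : Fin m) : eulerReg k a (xiVar k a) = xiVar k a := by
  rw [xiVar, eulerReg_algebraMap, euler_X_self]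

theorem eulerReg_xiVar_of_ne {a b : Fin m} (h : b ≠ a) : eulerReg k b (xiVar k a) = 0 := by
  rw [xiVar, eulerReg_algebraMap, euler_X_of_ne (fun e => h (Sum.inr_injective e).symm), map_zero]

theorem eulerReg_xVar (a : Fin m) (i : Fin n) : eulerReg k a (xVar k i) = 0 := by
  rw [xVar, eulerReg_algebraMap, euler_X_of_ne (by simp), map_zero]

theorem derivation_inverse {A : Type} [CommRing A] [Algebra ℂ A] (D : Derivation ℂ A A) {u : A}
    (hu : IsUnit u) : D (Ring.inverse u) = -(Ring.inverse u * Ring.inverse u * D u) := by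
  have h1 := Ring.inverse_mul_cancel u hu
  have h2 : D (Ring.inverse u * u) = 0 := by rw [h1, Derivation.map_one_eq_zero]
  rw [D.leibniz, smul_eq_mul, smul_eq_mul] at h2
  linear_combination Ring.inverse u * h2 - D (Ring.inverse u) * h1

/-- D_ξ ln((ξ - x)/(ξ x)) = ξ/(ξ - x) - 1 = x/(ξ - x). -/
theorem log_deriv (a : Fin m) {i : Fin n} (hi : k ≠ i) :
    eulerReg k a ((xiVar k a - xVar k i) * Ring.inverse (xiVar k a * xVar k i)) *
      Ring.inverse ((xiVar k a - xVar k i) * Ring.inverse (xiVar k a * xVar k i)) =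
      polarReg k a i := by
  set u := xiVar k a - xVar (m := m) k i with hu
  set v := xiVar k a * xVar (m := m) k i with hv
  have hu' := isUnit_xiVar_sub k a hi
  have hv' := isUnit_xiVar_mul k a i
  have h1 := Ring.inverse_mul_cancel u hu'
  have h2 := Ring.inverse_mul_cancel v hv'
  have hw : IsUnit (u * Ring.inverse v) := hu'.mul hv'.ringInverse
  have h3 := Ring.inverse_mul_cancel _ hw
  have e1 : eulerReg k a u = xiVar k a := by
    rw [hu, map_sub, eulerReg_xiVar_self, eulerReg_xVar, sub_zero]
  have e2 : eulerReg k a v = v := by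
    rw [hv, Derivation.leibniz, eulerReg_xiVar_self, eulerReg_xVar, smul_zero, zero_add,
      smul_eq_mul, mul_comm]
  have e3 : eulerReg k a (u * Ring.inverse v) = xVar k i * Ring.inverse v := by
    rw [Derivation.leibniz, derivation_inverse _ hv', e1, e2, smul_eq_mul, smul_eq_mul]
    linear_combination (-u * Ring.inverse v) * h2 - Ring.inverse v * hu
  rw [e3, polarReg, ← hu]
  linear_combination (xVar k i * Ring.inverse u) * h3 -
    xVar k i * Ring.inverse v * Ring.inverse (u * Ring.inverse v) * h1

theorem eulerReg_polarReg_self (a : Fin m) {i : Fin n} (hi : k ≠ i) :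
    eulerReg k a (polarReg k a i) = -(polarReg k a i * (1 + polarReg k a i)) := by
  have hu' := isUnit_xiVar_sub (m := m) k a hi
  have h1 := Ring.inverse_mul_cancel _ hu'
  rw [polarReg, Derivation.leibniz, derivation_inverse _ hu', map_sub, eulerReg_xiVar_self,
    eulerReg_xVar, smul_zero, add_zero, sub_zero, smul_eq_mul]
  linear_combination -(xVar k i * Ring.inverse (xiVar k a - xVar k i)) * h1

theorem eulerReg_polarReg_of_ne {a b : Fin m} (hb : b ≠ a) {i : Fin n} (hi : k ≠ i) :
    eulerReg k b (polarReg k a i) = 0 := by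
  rw [polarReg, Derivation.leibniz, derivation_inverse _ (isUnit_xiVar_sub k a hi), map_sub,
    eulerReg_xiVar_of_ne k hb, eulerReg_xVar]
  simp

theorem specialize_polarReg (a : Fin m) {i : Fin n} (hi : k ≠ i) :
    specialize k (polarReg k a i) = polar k i := by
  rw [polar, eq_div_iff (algebraMap_X_sub_ne_zero hi)]
  have h1 : specialize k (xiVar k a - xVar (m := m) k i) =
      algebraMap (MvPowerSeries (Fin n) ℂ) (Frac n) (MvPowerSeries.X k) - algebraMap (MvPowerSeries (Fin n) ℂ) (Frac n) (MvPowerSeries.X i) := by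
    rw [map_sub, xiVar, xVar, specialize_algebraMap, specialize_algebraMap, diag,
      MvPowerSeries.rename_X, MvPowerSeries.rename_X]
    rfl
  rw [← h1, ← map_mul, polarReg, mul_assoc, Ring.inverse_mul_cancel _ (isUnit_xiVar_sub k a hi),
    mul_one, xVar, specialize_algebraMap, diag, MvPowerSeries.rename_X]
  rfl

theorem eulerFrac_polar {i : Fin n} (hi : k ≠ i) :
    eulerFrac i (polar k i) = polar k i * (1 + polar k i) := by
  have h0 := algebraMap_X_sub_ne_zero hi
  have h1 : polar k i * (algebraMap (MvPowerSeries (Fin n) ℂ) (Frac n) (MvPowerSeries.X k) -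
      algebraMap (MvPowerSeries (Fin n) ℂ) (Frac n) (MvPowerSeries.X i)) = algebraMap (MvPowerSeries (Fin n) ℂ) (Frac n) (MvPowerSeries.X i) := by
    rw [polar, div_mul_cancel₀ _ h0]
  have h2 := congrArg (eulerFrac i) h1
  rw [Derivation.leibniz, map_sub, eulerFrac_algebraMap, eulerFrac_algebraMap, euler_X_self,
    euler_X_of_ne hi, map_zero, smul_eq_mul, smul_eq_mul] at h2
  refine mul_right_cancel₀ h0 ?_
  linear_combination h2 - (1 + polar k i) * h1

theorem eulerFrac_polar_of_ne {i j : Fin n} (hj : j ≠ i) (hjk : j ≠ k) (hi : k ≠ i) :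
    eulerFrac j (polar k i) = 0 := by
  have h0 := algebraMap_X_sub_ne_zero hi
  have h1 : polar k i * (algebraMap (MvPowerSeries (Fin n) ℂ) (Frac n) (MvPowerSeries.X k) -
      algebraMap (MvPowerSeries (Fin n) ℂ) (Frac n) (MvPowerSeries.X i)) = algebraMap (MvPowerSeries (Fin n) ℂ) (Frac n) (MvPowerSeries.X i) := by
    rw [polar, div_mul_cancel₀ _ h0]
  have h2 := congrArg (eulerFrac j) h1
  rw [Derivation.leibniz, map_sub, eulerFrac_algebraMap, eulerFrac_algebraMap,
    euler_X_of_ne hj.symm, euler_X_of_ne hjk.symm, map_zero, sub_zero, smul_zero, zero_add,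
    smul_eq_mul] at h2
  exact (mul_eq_zero.1 h2).resolve_left h0

/-- The function x/(ξ - x) depends on the ratio of ξ and x only, so D_ξ acts as -D_x. Both iterates
are the same polynomial in the function itself, up to sign, which allows the comparison after ξ =
x_k. -/
theorem specialize_iterate_polarReg (a : Fin m) {i : Fin n} (hi : k ≠ i) (p : ℕ) :
    specialize k (((eulerReg k a)^[p]) (polarReg k a i)) =
      (-1 : Frac n) ^ p * ((eulerFrac i)^[p]) (polar k i) := by
  have key : ∃ P : Polynomial ℂ,
      ((eulerReg k a)^[p]) (polarReg k a i) = Polynomial.aeval (polarReg k a i) P ∧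
      ((eulerFrac i)^[p]) (polar k i) = (-1 : Frac n) ^ p * Polynomial.aeval (polar k i) P := by
    induction p with
    | zero => exact ⟨Polynomial.X, by simp, by simp⟩
    | succ p ih =>
      obtain ⟨P, h1, h2⟩ := ih
      refine ⟨-(Polynomial.derivative P * (Polynomial.X * (1 + Polynomial.X))), ?_, ?_⟩
      · rw [Function.iterate_succ_apply', h1, Derivation.map_aeval, eulerReg_polarReg_self k a hi]
        simp only [map_neg, map_mul, map_add, map_one, Polynomial.aeval_X, smul_eq_mul]
        ring
      · have h3 : eulerFrac i ((-1 : Frac n) ^ p) = 0 := by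
          rcases neg_one_pow_eq_or (Frac n) p with h | h <;> rw [h] <;> simp
        rw [Function.iterate_succ_apply', h2, Derivation.leibniz, Derivation.map_aeval,
          eulerFrac_polar k hi, h3]
        simp [pow_succ]
  obtain ⟨P, h1, h2⟩ := key
  rw [h1, h2, ← mul_assoc, ← mul_pow, neg_one_mul, neg_neg, one_pow, one_mul,
    ← specialize_polarReg (m := m) k a hi, Polynomial.aeval_eq_sum_range,
    Polynomial.aeval_eq_sum_range, map_sum]
  exact Finset.sum_congr rfl fun j _ => by rw [specialize_smul, map_pow]

theorem coeff_zetaEnd_C {A : Type} [CommRing A] [Algebra ℂ A] (D : Derivation ℂ A A) (a : A)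
    (N : ℕ) : PowerSeries.coeff N (zetaEnd D (PowerSeries.C a)) =
      PowerSeries.coeff N zetaDivZ • (D^[N]) a := by
  rw [coeff_zetaEnd, Finset.sum_eq_single (N, 0)]
  · simp
  · rintro ⟨i, j⟩ h hne
    rw [Finset.HasAntidiagonal.mem_antidiagonal] at h
    have hj : j ≠ 0 := fun e => hne (by simp at h; ext <;> simp <;> omega)
    rw [PowerSeries.coeff_C, if_neg hj, iterate_map_zero, smul_zero]
  · intro h; exact absurd (by rw [Finset.HasAntidiagonal.mem_antidiagonal]; simp) h

/-- Since S is even, the sign between D_ξ and D_{x_i} is harmless. The operator thereby moves onto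
the variable x_i, and all variables of a block are treated alike. -/
theorem map_specialize_log (a : Fin m) {i : Fin n} (hi : k ≠ i) :
    PowerSeries.map (specialize k) (xiOps k (List.finRange m) (polarReg k a i)) =
      zetaEnd (eulerFrac i) (PowerSeries.C (polar k i)) := by
  rw [xiOps_single k _ (List.nodup_finRange m) fun b hb => eulerReg_polarReg_of_ne k hb hi,
    if_pos (List.mem_finRange a)]
  ext N
  rw [PowerSeries.coeff_map, coeff_zetaEnd_C, coeff_zetaEnd_C, specialize_smul,
    specialize_iterate_polarReg k a hi]
  rcases Nat.even_or_odd N with h | h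
  · rw [h.neg_one_pow, one_mul]
  · rw [coeff_eq_zero_of_even rescale_neg_zetaDivZ (Nat.not_even_iff_odd.2 h), zero_smul, zero_smul]

/-- The specialization of a factor, as a series in `z`. -/
def factorSeries (q r : ℕ) (Ht : ℕ → (n : ℕ) → MvPowerSeries (Fin n) ℂ) (g : ℕ)
    (K : Finset (Fin n)) (s : ℕ) : PowerSeries (Frac n) :=
  PowerSeries.map (algebraMap _ (Frac n)) (regSeries k K s (regularPart q r Ht g (K.card + s))) +
    if g = 0 ∧ K.card = 1 ∧ s = 1 then
      ∑ i ∈ K, zetaEnd (eulerFrac i) (PowerSeries.C (polar k i)) else 0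

theorem mixedDeriv_factor (q r : ℕ) (Ht : ℕ → (n : ℕ) → MvPowerSeries (Fin n) ℂ) (g : ℕ)
    {K : Finset (Fin n)} (hk : k ∉ K) {M : Finset (Fin m)} (hM : M.Nonempty) :
    (factor q r Ht k g K M).mixedDeriv k M =
      algebraMap _ (Reg n m k) (mixedEuler M (MvPowerSeries.rename (factorVars K M)
        (regularPart q r Ht g (K.card + M.card)))) +
      if g = 0 ∧ K.card = 1 ∧ M.card = 1 then ∑ i ∈ K, ∑ a ∈ M, polarReg k a i else 0 := by
  split_ifs with h
  · obtain ⟨-, hK, hM1⟩ := id h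
    obtain ⟨i, rfl⟩ := Finset.card_eq_one.1 hK
    obtain ⟨a, rfl⟩ := Finset.card_eq_one.1 hM1
    have hi : k ≠ i := by simpa using hk
    rw [← mixedDeriv_of_arg_one k hM]
    have hs : ({a} : Finset (Fin m)).sort (· ≤ ·) = [a] := Finset.sort_singleton _ _
    simp only [LogFun.mixedDeriv]
    rw [hs]
    simp only [List.foldr_nil, LogFun.deriv, Derivation.map_one_eq_zero, zero_mul, add_zero,
      Finset.sum_singleton]
    rw [← log_deriv k a hi]
    simp only [factor, if_pos h, Finset.prod_singleton]
    rfl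
  · rw [add_zero, ← mixedDeriv_of_arg_one k hM]
    congr 1
    simp only [factor, if_neg h]
    rfl

theorem map_specialize_factor (q r : ℕ) (Ht : ℕ → (n : ℕ) → MvPowerSeries (Fin n) ℂ) (g : ℕ)
    {K : Finset (Fin n)} (hk : k ∉ K) {M : Finset (Fin m)} (hM : M.Nonempty) :
    PowerSeries.map (specialize k) (xiOps k (List.finRange m)
      ((factor q r Ht k g K M).mixedDeriv k M)) = factorSeries k q r Ht g K M.card := by
  rw [mixedDeriv_factor k q r Ht g hk hM, xiOps_add, map_add, factorSeries]
  congr 1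
  · rw [xiOps_algebraMap, ← map_diag_foldr]
    ext N
    simp only [PowerSeries.coeff_map]
    exact specialize_algebraMap k _
  · split_ifs with h
    · obtain ⟨-, hK, hM1⟩ := h
      obtain ⟨i, rfl⟩ := Finset.card_eq_one.1 hK
      obtain ⟨a, rfl⟩ := Finset.card_eq_one.1 hM1
      have hi : k ≠ i := by simpa using hk
      simp only [Finset.sum_singleton]
      exact map_specialize_log k a hi
    · have := xiOps_sub k (List.finRange m) 0 0
      rw [sub_self, sub_self] at this
      rw [this, map_zero]

theorem eulerReg_mixedDeriv_factor (q r : ℕ) (Ht : ℕ → (n : ℕ) → MvPowerSeries (Fin n) ℂ) (g : ℕ)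
    {K : Finset (Fin n)} (hk : k ∉ K) {M : Finset (Fin m)} (hM : M.Nonempty) {a : Fin m}
    (ha : a ∉ M) : eulerReg k a ((factor q r Ht k g K M).mixedDeriv k M) = 0 := by
  rw [mixedDeriv_factor k q r Ht g hk hM, map_add, eulerReg_algebraMap,
    euler_mixedEuler_rename K ha, map_zero, zero_add]
  split_ifs with h
  · rw [map_sum]
    refine Finset.sum_eq_zero fun i hi => ?_
    rw [map_sum]
    exact Finset.sum_eq_zero fun b hb => eulerReg_polarReg_of_ne k (fun e => ha (by rwa [e]))
      fun e => hk (by rwa [e])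
  · exact map_zero _

theorem Qop_eq (d : ℕ) (G : Reg n m k) : Qop d k G = PowerSeries.coeff (2 * d)
    (PowerSeries.map (algebraMap ℂ (Frac n)) zetaDivZ⁻¹ *
      zetaEnd (eulerFrac k) (PowerSeries.map (specialize k) (xiOps k (List.finRange m) G))) := rfl

/-- Each ξ_a occurs in a single factor, so its operator acts on that factor alone, and
specialization is multiplicative. -/
theorem Qop_prod_factor (q r : ℕ) (Ht : ℕ → (n : ℕ) → MvPowerSeries (Fin n) ℂ) (d : ℕ) {l : ℕ}
    (γ : Fin l → ℕ) {K : Fin l → Finset (Fin n)} (hK : ∀ j, k ∉ K j) {M : Fin l → Finset (Fin m)}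
    (hM : ∀ j, (M j).Nonempty) (hd : ∀ i j, i ≠ j → Disjoint (M i) (M j)) :
    Qop d k (∏ j, (factor q r Ht k (γ j) (K j) (M j)).mixedDeriv k (M j)) =
      PowerSeries.coeff (2 * d) (PowerSeries.map (algebraMap ℂ (Frac n)) zetaDivZ⁻¹ *
        zetaEnd (eulerFrac k) (∏ j, factorSeries k q r Ht (γ j) (K j) (M j).card)) := by
  rw [Qop_eq, xiOps_prod, map_prod]
  · simp only [map_specialize_factor k q r Ht _ (hK _) (hM _)]
  · intro a i j hij
    by_cases ha : a ∈ M i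
    · exact Or.inr (eulerReg_mixedDeriv_factor k q r Ht _ (hK j) (hM j)
        (Finset.disjoint_left.1 (hd i j hij) ha))
    · exact Or.inl (eulerReg_mixedDeriv_factor k q r Ht _ (hK i) (hM i) ha)

end Specialize

/-! ### Sums over splittings as coefficients of an exponential -/

section Splittings
variable {B : Type} [CommRing B] [Algebra ℂ B]

theorem factorial_mul_smul {A : Type} [CommRing A] [Algebra ℂ A] (s : ℕ) (a : A) :
    (s.factorial : A) * ((s.factorial : ℂ)⁻¹ • a) = a := by
  have h : ((s.factorial : ℕ) : A) = algebraMap ℂ A (s.factorial : ℂ) := (map_natCast _ _).symm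
  rw [h, ← Algebra.smul_def, smul_smul, mul_inv_cancel₀, one_smul]
  exact_mod_cast s.factorial_ne_zero

/-- The generating series `∑_{s ≥ 1} t^s/s! ∑_g u^{g+s-1} φ(g,K,s)`. -/
def factorGen (α : Type) [DecidableEq α] (φ : ℕ → Finset α → ℕ → B) :
    PowerSeries (SetFun α (PowerSeries B)) :=
  PowerSeries.mk fun s => if s = 0 then 0 else (s.factorial : ℂ)⁻¹ •
    SetFun.of fun K => PowerSeries.X ^ (s - 1) * PowerSeries.mk fun g => φ g K s

theorem constantCoeff_factorGen (α : Type) [DecidableEq α] (φ : ℕ → Finset α → ℕ → B) :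
    PowerSeries.constantCoeff (factorGen α φ) = 0 := by
  rw [← PowerSeries.coeff_zero_eq_constantCoeff_apply, factorGen, PowerSeries.coeff_mk, if_pos rfl]

theorem coeff_prod_mk {l : ℕ} (f : Fin l → ℕ → B) {N G : ℕ} (h : N ≤ G) :
    PowerSeries.coeff N (∏ j, PowerSeries.mk (f j)) =
      ∑ γ ∈ (Finset.univ : Finset (Fin l → Fin (G + 1))).filter (fun γ => ∑ j, (γ j : ℕ) = N),
        ∏ j, f j (γ j) := by
  rw [PowerSeries.coeff_prod]
  simp only [PowerSeries.coeff_mk]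
  symm
  refine Finset.sum_nbij (fun γ => Finsupp.equivFunOnFinite.symm fun j => (γ j : ℕ)) ?_ ?_ ?_ ?_
  · intro γ hγ
    rw [Finset.mem_filter] at hγ
    rw [Finset.mem_finsuppAntidiag]
    exact ⟨by simpa using hγ.2, by simp⟩
  · intro γ _ γ' _ h
    funext j
    have := congrArg (fun x : Fin l →₀ ℕ => x j) h
    exact Fin.ext (by simpa using this)
  · intro κ hκ
    rw [Finset.mem_coe, Finset.mem_finsuppAntidiag] at hκ
    have hle : ∀ j, κ j < G + 1 := fun j => by
      have := Finset.single_le_sum (f := fun j => κ j) (fun _ _ => Nat.zero_le _)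
        (Finset.mem_univ j)
      rw [hκ.1] at this
      omega
    refine ⟨fun j => ⟨κ j, hle j⟩, ?_, ?_⟩
    · rw [Finset.mem_coe, Finset.mem_filter]
      exact ⟨Finset.mem_univ _, hκ.1⟩
    · ext j; simp
  · intro γ _
    simp

theorem sum_card_of_mem_splittings {α : Type} [Fintype α] {s : Finset α} {l : ℕ}
    {K : Fin l → Finset α} (hK : K ∈ splittings s l) : ∑ j, (K j).card = s.card := by
  classical
  rw [mem_splittings] at hK
  rw [← Finset.card_biUnion fun i _ j _ hij => hK.1 i j hij]
  congr 1
  ext x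
  simpa using (hK.2 x).symm

theorem sum_card_splitting {m l : ℕ} {M : Fin l → Finset (Fin m)}
    (hM : M ∈ splittings (Finset.univ : Finset (Fin m)) l) : ∑ j, (M j).card = m := by
  rw [sum_card_of_mem_splittings hM, Finset.card_univ, Fintype.card_fin]

open Classical in
-- As ∑ |M_j| = m, the exponents |M_j| - 1 of u add up to m - l. So the power of u records the genus
-- condition g = ∑ g_j + m - l + d.
theorem coeff_prod_factorGen (m d g l : ℕ) (hd : d ≤ g) {α : Type} [DecidableEq α]
    (φ : ℕ → Finset α → ℕ → B) (K : Fin l → Finset α) {M : Fin l → Finset (Fin m)}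
    (hM : M ∈ splittings (Finset.univ : Finset (Fin m)) l) (hM' : ∀ j, (M j).Nonempty) :
    PowerSeries.coeff (g - d) (∏ j, (PowerSeries.X ^ ((M j).card - 1) *
        PowerSeries.mk fun g => φ g (K j) (M j).card)) =
      ∑ γ ∈ (Finset.univ : Finset (Fin l → Fin (g + 1))).filter
          (fun γ => (∑ j, (γ j : ℕ)) + m + d = g + l), ∏ j, φ (γ j) (K j) (M j).card := by
  have hs : ∑ j, ((M j).card - 1) + l = m := by
    have h1 : ∑ j, ((M j).card - 1 + 1) = m :=
      (Finset.sum_congr rfl fun j _ => Nat.sub_add_cancel (hM' j).card_pos).trans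
        (sum_card_splitting hM)
    rw [Finset.sum_add_distrib] at h1
    simpa using h1
  rw [Finset.prod_mul_distrib, Finset.prod_pow_eq_pow_sum, PowerSeries.coeff_X_pow_mul']
  split_ifs with h
  · rw [coeff_prod_mk _ (show g - d - ∑ j, ((M j).card - 1) ≤ g by omega)]
    refine Finset.sum_congr (Finset.filter_congr fun γ _ => ?_) fun _ _ => rfl
    omega
  · refine (Finset.sum_eq_zero fun γ hγ => ?_).symm
    rw [Finset.mem_filter] at hγ
    omega

open Classical in
-- The exponential formula: 1/l! and the sum over K are a power in the convolution ring, and the sum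
-- over M depends on the cardinalities |M_j| only. If d > g, then l ≤ m makes the genus condition
-- unsolvable.
theorem sum_splittings_eq_coeff_expSeries {α : Type} [Fintype α] [DecidableEq α] (m d g : ℕ)
    (S : Finset α) (φ : ℕ → Finset α → ℕ → B) :
    ∑ l ∈ Finset.range (m + 1), ((l.factorial : ℂ)⁻¹) • ∑ K ∈ splittings S l,
        ∑ M ∈ (splittings (Finset.univ : Finset (Fin m)) l).filter (fun M => ∀ j, (M j).Nonempty),
          ∑ γ ∈ (Finset.univ : Finset (Fin l → Fin (g + 1))).filter
              (fun γ => (∑ j, (γ j : ℕ)) + m + d = g + l), ∏ j, φ (γ j) (K j) (M j).card =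
      if d ≤ g then (m.factorial : ℂ) • PowerSeries.coeff (g - d)
        ((PowerSeries.coeff m (expSeries (factorGen α φ))) S) else 0 := by
  split_ifs with hd
  · have hΦ : ∀ s (K : Finset α), ((s.factorial : SetFun α (PowerSeries B)) *
        PowerSeries.coeff s (factorGen α φ)) K =
        if s = 0 then 0 else PowerSeries.X ^ (s - 1) * PowerSeries.mk fun g => φ g K s := by
      intro s K
      rw [factorGen, PowerSeries.coeff_mk]
      split_ifs with hs
      · rw [mul_zero, SetFun.zero_apply]
      · rw [factorial_mul_smul, SetFun.of_apply]
    have hl : ∀ l, (m.factorial : ℂ) • PowerSeries.coeff (g - d)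
        ((PowerSeries.coeff m (factorGen α φ ^ l)) S) = ∑ K ∈ splittings S l,
        ∑ M ∈ (splittings (Finset.univ : Finset (Fin m)) l).filter (fun M => ∀ j, (M j).Nonempty),
          ∑ γ ∈ (Finset.univ : Finset (Fin l → Fin (g + 1))).filter
              (fun γ => (∑ j, (γ j : ℕ)) + m + d = g + l), ∏ j, φ (γ j) (K j) (M j).card := by
      intro l
      have h1 := sum_splittings_card (Finset.univ : Finset (Fin m)) l fun _ => factorGen α φ
      have h2 := congrArg (fun f : SetFun α (PowerSeries B) => PowerSeries.coeff (g - d) (f S)) h1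
      simp only [Finset.card_univ, Fintype.card_fin, Finset.prod_const, SetFun.sum_apply, map_sum,
        SetFun.prod_apply] at h2
      have h3 : ((m.factorial : SetFun α (PowerSeries B)) *
          PowerSeries.coeff m (factorGen α φ ^ l)) S =
          (m.factorial : ℂ) • ((PowerSeries.coeff m (factorGen α φ ^ l)) S) := by
        rw [Nat.cast_smul_eq_nsmul, ← nsmul_eq_mul]
        rfl
      rw [h3, PowerSeries.coeff_smul] at h2
      rw [← h2, Finset.sum_comm]
      refine Finset.sum_congr rfl fun K _ => ?_
      rw [Finset.sum_filter]
      refine Finset.sum_congr rfl fun M hM => ?_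
      simp only [hΦ]
      split_ifs with hM'
      · rw [← coeff_prod_factorGen m d g l hd φ K hM hM']
        congr 1
        exact Finset.prod_congr rfl fun j _ => if_neg (hM' j).card_ne_zero
      · push Not at hM'
        obtain ⟨j, hj⟩ := hM'
        rw [Finset.prod_eq_zero (Finset.mem_univ j), map_zero]
        rw [if_pos (by rw [hj, Finset.card_empty])]
    rw [expSeries, PowerSeries.coeff_mk]
    have h4 : ∀ c : ℂ, ∀ f : SetFun α (PowerSeries B), (c • f) S = c • f S := fun _ _ => rfl
    rw [SetFun.sum_apply, map_sum, Finset.smul_sum]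
    refine Finset.sum_congr rfl fun l _ => ?_
    rw [h4, PowerSeries.coeff_smul, smul_comm, hl]
  · refine Finset.sum_eq_zero fun l hl => ?_
    rw [Finset.sum_eq_zero, smul_zero]
    refine fun K _ => Finset.sum_eq_zero fun M hM => Finset.sum_eq_zero fun γ hγ => ?_
    rw [Finset.mem_filter] at hγ
    rw [Finset.mem_range] at hl
    omega

end Splittings

/-! ### Set functions with values in power series that have the right support -/

/-- The restriction of a set function to the subsets of `J`. -/
def restrictHom {ι R : Type} [DecidableEq ι] [CommRing R] (J : Finset ι) :
    SetFun ι R →+* SetFun ι R where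
  toFun f := SetFun.of fun K => if K ⊆ J then f K else 0
  map_one' := SetFun.ext fun K => by
    rw [SetFun.of_apply, SetFun.one_apply]
    split_ifs with h1 h2
    · rfl
    · rfl
    · rename_i h; exact absurd (h ▸ Finset.empty_subset J) h1
    · rfl
  map_zero' := SetFun.ext fun K => by simp [SetFun.zero_apply]
  map_add' f g := SetFun.ext fun K => by
    change (if K ⊆ J then f K + g K else 0) = (if K ⊆ J then f K else 0) + if K ⊆ J then g K else 0
    split_ifs <;> simp
  map_mul' f g := SetFun.ext fun K => by
    rw [SetFun.of_apply, SetFun.mul_apply, SetFun.mul_apply]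
    split_ifs with h
    · refine Finset.sum_congr rfl fun T hT => ?_
      have hTK := Finset.mem_powerset.1 hT
      change _ = (if T ⊆ J then f T else 0) * (if K \ T ⊆ J then g (K \ T) else 0)
      rw [if_pos (hTK.trans h),
        if_pos (Finset.sdiff_subset.trans h)]
    · refine (Finset.sum_eq_zero fun T hT => ?_).symm
      have hTK := Finset.mem_powerset.1 hT
      change (if T ⊆ J then f T else 0) * (if K \ T ⊆ J then g (K \ T) else 0) = 0
      by_cases h1 : T ⊆ J
      · rw [if_neg fun h2 : K \ T ⊆ J => h fun x hx => ?_, mul_zero]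
        by_cases hxT : x ∈ T
        · exact h1 hxT
        · exact h2 (Finset.mem_sdiff.2 ⟨hx, hxT⟩)
      · rw [if_neg h1, zero_mul]

/-- Restriction to the subsets of J is a ring homomorphism for the convolution product, and it
commutes with the exponential. -/
theorem coeff_expSeries_congr {ι R : Type} [DecidableEq ι] [CommRing R] [Algebra ℂ R]
    {Φ Ψ : PowerSeries (SetFun ι R)} {J : Finset ι}
    (h : ∀ s, ∀ K ⊆ J, (PowerSeries.coeff s Φ) K = (PowerSeries.coeff s Ψ) K) (l : ℕ) :
    (PowerSeries.coeff l (expSeries Φ)) J = (PowerSeries.coeff l (expSeries Ψ)) J := by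
  have h1 : PowerSeries.map (restrictHom J) Φ = PowerSeries.map (restrictHom J) Ψ := by
    ext1 s
    rw [PowerSeries.coeff_map, PowerSeries.coeff_map]
    refine SetFun.ext fun K => ?_
    change (if K ⊆ J then _ else _) = if K ⊆ J then _ else _
    split_ifs with hK
    · exact h s K hK
    · rfl
  have h2 : ∀ Φ : PowerSeries (SetFun ι R), (PowerSeries.coeff l (expSeries Φ)) J =
      (PowerSeries.coeff l (expSeries (PowerSeries.map (restrictHom J) Φ))) J := fun Φ => by
    rw [← map_expSeries, PowerSeries.coeff_map]
    exact (if_pos (le_refl J)).symm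
  rw [h2 Φ, h1, ← h2]

/-- Functions on a ring `B` that behave as the coefficients of power series in `n` variables. -/
structure CoeffFamily (n : ℕ) (B S : Type) [CommRing B] [Algebra ℂ B] [CommRing S]
    [Algebra ℂ S] where
  /-- The coefficients. -/
  cf : (Fin n →₀ ℕ) → B →ₗ[ℂ] S
  map_one : ∀ ν, cf ν 1 = if ν = 0 then 1 else 0
  map_mul : ∀ ν F G, cf ν (F * G) = ∑ p ∈ antidiagonal ν, cf p.1 F * cf p.2 G

namespace CoeffFamily
variable {n : ℕ} {B S : Type} [CommRing B] [Algebra ℂ B] [CommRing S] [Algebra ℂ S]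
  (c : CoeffFamily n B S) (k : Fin n)

/-- The exponents in a series that depends on the variables in `J` and on `x_k` only. -/
def Fits (J : Finset (Fin n)) (ν : Fin n →₀ ℕ) : Prop := k ∉ J ∧ ∀ i, i ≠ k → (1 ≤ ν i ↔ i ∈ J)

theorem Fits.sdiff {J T : Finset (Fin n)} {μ ν : Fin n →₀ ℕ} (hμ : Fits k T μ)
    (hν : Fits k (J \ T) ν) (hT : T ⊆ J) : Fits k J (μ + ν) := by
  refine ⟨fun h => hν.1 (Finset.mem_sdiff.2 ⟨h, hμ.1⟩), fun i hi => ?_⟩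
  have h1 := hμ.2 i hi
  have h2 := hν.2 i hi
  rw [Finset.mem_sdiff] at h2
  rw [Finsupp.add_apply]
  constructor
  · intro h
    rcases Nat.eq_zero_or_pos (μ i) with h0 | h0
    · exact (h2.1 (by omega)).1
    · exact hT (h1.1 h0)
  · intro h
    by_cases hiT : i ∈ T
    · have := h1.2 hiT; omega
    · have := h2.2 ⟨h, hiT⟩; omega

theorem map_algebraMap (ν : Fin n →₀ ℕ) (a : ℂ) :
    c.cf ν (algebraMap ℂ B a) = if ν = 0 then algebraMap ℂ S a else 0 := by
  rw [Algebra.algebraMap_eq_smul_one, map_smul, c.map_one, Algebra.algebraMap_eq_smul_one]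
  split_ifs
  · rfl
  · exact smul_zero _

/-- The set functions whose value at `J` depends on the variables in `J` and on `x_k` only. -/
def supported : Subalgebra ℂ (SetFun (Fin n) B) where
  carrier := {A | ∀ J ν, c.cf ν (A J) ≠ 0 → Fits k J ν}
  mul_mem' {A A'} hA hA' J ν h := by
    rw [SetFun.mul_apply, map_sum] at h
    obtain ⟨T, hT, h1⟩ := Finset.exists_ne_zero_of_sum_ne_zero h
    rw [c.map_mul] at h1
    obtain ⟨p, hp, h2⟩ := Finset.exists_ne_zero_of_sum_ne_zero h1
    rw [← Finset.HasAntidiagonal.mem_antidiagonal.1 hp]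
    exact (hA T p.1 (left_ne_zero_of_mul h2)).sdiff k (hA' _ p.2 (right_ne_zero_of_mul h2))
      (Finset.mem_powerset.1 hT)
  add_mem' {A A'} hA hA' J ν h := by
    rw [SetFun.add_apply, map_add] at h
    by_cases h1 : c.cf ν (A J) = 0
    · rw [h1, zero_add] at h
      exact hA' J ν h
    · exact hA J ν h1
  algebraMap_mem' a J ν h := by
    have h0 : (algebraMap ℂ (SetFun (Fin n) B) a) J = if J = ∅ then algebraMap ℂ B a else 0 := by
      rw [Algebra.algebraMap_eq_smul_one]
      change a • ((1 : SetFun (Fin n) B) J) = _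
      rw [SetFun.one_apply, Algebra.algebraMap_eq_smul_one]
      split_ifs <;> simp
    rw [h0] at h
    split_ifs at h with hJ
    · rw [c.map_algebraMap] at h
      split_ifs at h with hν
      · subst hJ hν
        exact ⟨by simp, by simp⟩
      · exact absurd rfl h
    · exact absurd (map_zero _) h

/-- The exponents `ν_i` for `i ∈ J` and `a` for `i = k`. -/
def exponents (ν : Fin n → ℕ) (J : Finset (Fin n)) (a : ℕ) : Fin n →₀ ℕ :=
  Finsupp.equivFunOnFinite.symm fun i => if i = k then a else if i ∈ J then ν i else 0

theorem exponents_apply (ν : Fin n → ℕ) (J : Finset (Fin n)) (a : ℕ) (i : Fin n) :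
    exponents k ν J a i = if i = k then a else if i ∈ J then ν i else 0 := rfl

/-- The coefficients with exponents `ν_i` for `i ∈ J`, as a series in the variable `x_k`. -/
def slice (ν : Fin n → ℕ) : c.supported k →+* SetFun (Fin n) (PowerSeries S) where
  toFun A := SetFun.of fun J => PowerSeries.mk fun a => c.cf (exponents k ν J a) (A.1 J)
  map_one' := SetFun.ext fun J => PowerSeries.ext fun a => by
    rw [SetFun.of_apply, PowerSeries.coeff_mk, SetFun.one_apply]
    change c.cf _ ((1 : SetFun (Fin n) B) J) = _
    rw [SetFun.one_apply]
    split_ifs with hJ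
    · rw [c.map_one, PowerSeries.coeff_one]
      refine if_congr ⟨fun h => ?_, fun h => ?_⟩ rfl rfl
      · have := congrArg (fun f : Fin n →₀ ℕ => f k) h
        simpa [exponents_apply] using this
      · ext i
        simp [exponents_apply, hJ, h]
    · simp
  map_zero' := SetFun.ext fun J => PowerSeries.ext fun a => by
    rw [SetFun.of_apply, PowerSeries.coeff_mk]
    exact map_zero _
  map_add' A A' := SetFun.ext fun J => PowerSeries.ext fun a => by
    rw [SetFun.of_apply, PowerSeries.coeff_mk, SetFun.add_apply, map_add, SetFun.of_apply,
      SetFun.of_apply, PowerSeries.coeff_mk, PowerSeries.coeff_mk]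
    exact map_add _ _ _
  map_mul' A A' := SetFun.ext fun J => PowerSeries.ext fun a => by
    rw [SetFun.of_apply, PowerSeries.coeff_mk, SetFun.mul_apply, map_sum]
    change c.cf _ ((A.1 * A'.1) J) = _
    rw [SetFun.mul_apply, map_sum]
    refine Finset.sum_congr rfl fun T hT => ?_
    have hTJ := Finset.mem_powerset.1 hT
    rw [c.map_mul, SetFun.of_apply, SetFun.of_apply, PowerSeries.coeff_mul]
    simp only [PowerSeries.coeff_mk]
    symm
    -- The supports decide how an exponent splits: that of x_i with i ≠ k belongs entirely to the
    -- factor whose set contains i. Only the exponent of x_k is shared, which is the product of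
    -- series in one variable.
    refine Finset.sum_of_injOn
      (fun p : ℕ × ℕ => (exponents k ν T p.1, exponents k ν (J \ T) p.2)) ?_ ?_ ?_ ?_
    · intro p _ p' _ h
      have h1 := congrArg (fun f : (Fin n →₀ ℕ) × (Fin n →₀ ℕ) => f.1 k) h
      have h2 := congrArg (fun f : (Fin n →₀ ℕ) × (Fin n →₀ ℕ) => f.2 k) h
      simp only [exponents_apply, if_true] at h1 h2
      exact Prod.ext h1 h2
    · intro p hp
      rw [Finset.mem_coe, Finset.HasAntidiagonal.mem_antidiagonal] at hp ⊢
      ext i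
      rw [Finsupp.add_apply, exponents_apply, exponents_apply, exponents_apply]
      by_cases hik : i = k
      · simpa [hik] using hp
      · by_cases hiT : i ∈ T
        · simp [hik, hiT, hTJ hiT]
        · simp [hik, hiT]
    · intro p hp hnot
      by_contra hne
      have h1 := A.2 T p.1 (left_ne_zero_of_mul hne)
      have h2 := A'.2 (J \ T) p.2 (right_ne_zero_of_mul hne)
      rw [Finset.HasAntidiagonal.mem_antidiagonal] at hp
      refine hnot ⟨(p.1 k, p.2 k), ?_, ?_⟩
      · rw [Finset.mem_coe, Finset.HasAntidiagonal.mem_antidiagonal]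
        have := congrArg (fun f : Fin n →₀ ℕ => f k) hp
        simpa [exponents_apply] using this
      · have hi : ∀ i, p.1 i = exponents k ν T (p.1 k) i ∧
            p.2 i = exponents k ν (J \ T) (p.2 k) i := fun i => by
          rw [exponents_apply, exponents_apply]
          by_cases hik : i = k
          · simp [hik]
          have h3 := h1.2 i hik
          have h4 := h2.2 i hik
          have h5 := congrArg (fun f : Fin n →₀ ℕ => f i) hp
          simp only [Finsupp.add_apply, exponents_apply, if_neg hik] at h5
          rw [Finset.mem_sdiff] at h4
          rw [if_neg hik, if_neg hik]
          by_cases hiT : i ∈ T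
          · have h6 : p.2 i = 0 := by
              by_contra h
              exact (h4.1 (by omega)).2 hiT
            rw [if_pos (hTJ hiT)] at h5
            simp [hiT, h6]
            omega
          · have h6 : p.1 i = 0 := by
              by_contra h
              exact hiT (h3.1 (by omega))
            rw [h6, zero_add] at h5
            simp [hiT, h6, h5]
        exact Prod.ext (Finsupp.ext fun i => ((hi i).1).symm) (Finsupp.ext fun i => ((hi i).2).symm)
    · intro p _
      rfl

theorem coeff_slice (ν : Fin n → ℕ) (A : c.supported k) (J : Finset (Fin n)) (a : ℕ) :
    PowerSeries.coeff a ((c.slice k ν A) J) = c.cf (exponents k ν J a) (A.1 J) := by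
  change PowerSeries.coeff a (PowerSeries.mk fun a => c.cf (exponents k ν J a) (A.1 J)) = _
  rw [PowerSeries.coeff_mk]

theorem exponents_self {J : Finset (Fin n)} {ν : Fin n →₀ ℕ} (h : Fits k J ν) :
    exponents k ν J (ν k) = ν := by
  ext i
  rw [exponents_apply]
  split_ifs with h1 h2
  · rw [h1]
  · rfl
  · have := (h.2 i h1).not.2 h2
    omega

/-- Extracting coefficients with fixed exponents away from x_k is a ring homomorphism on set
functions with the right support, so it commutes with the exponential. -/
theorem cf_expSeries {Φ : PowerSeries (SetFun (Fin n) B)}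
    (hΦ : ∀ s, PowerSeries.coeff s Φ ∈ c.supported k) (l : ℕ) (J : Finset (Fin n))
    (ν : Fin n →₀ ℕ) [Decidable (Fits k J ν)] {Ψ : PowerSeries (SetFun (Fin n) (PowerSeries S))}
    (hΨ : Fits k J ν → ∀ s a, ∀ K ⊆ J, c.cf (exponents k ν K a) ((PowerSeries.coeff s Φ) K) =
      PowerSeries.coeff a ((PowerSeries.coeff s Ψ) K)) :
    c.cf ν ((PowerSeries.coeff l (expSeries Φ)) J) = if Fits k J ν then
      PowerSeries.coeff (ν k) ((PowerSeries.coeff l (expSeries Ψ)) J) else 0 := by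
  set Φ' : PowerSeries (c.supported k) := PowerSeries.mk fun s => ⟨_, hΦ s⟩ with hΦ'
  have h1 : PowerSeries.map (c.supported k).val.toRingHom Φ' = Φ := by
    ext1 s
    rw [PowerSeries.coeff_map, hΦ', PowerSeries.coeff_mk]
    rfl
  have h2 : PowerSeries.coeff l (expSeries Φ) = (PowerSeries.coeff l (expSeries Φ')).1 := by
    rw [← h1, ← map_expSeries, PowerSeries.coeff_map]
    rfl
  split_ifs with h
  · rw [← coeff_expSeries_congr (Φ := PowerSeries.map (c.slice k ν) Φ') (Ψ := Ψ), ← map_expSeries,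
      PowerSeries.coeff_map]
    · rw [coeff_slice, exponents_self k h, h2]
    · intro s K hK
      ext a
      rw [← hΨ h s a K hK, PowerSeries.coeff_map, coeff_slice, hΦ', PowerSeries.coeff_mk]
  · by_contra hne
    rw [h2] at hne
    exact h ((PowerSeries.coeff l (expSeries Φ')).2 J ν hne)

end CoeffFamily

/-! ### The coefficients of the regular factors -/

namespace CoeffFamily
variable {n : ℕ}

/-- The coefficients of power series in `n` variables. -/
def base (n : ℕ) : CoeffFamily n (MvPowerSeries (Fin n) ℂ) ℂ where
  cf ν := MvPowerSeries.coeff ν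
  map_one ν := by classical rw [MvPowerSeries.coeff_one]
  map_mul ν F G := by classical rw [MvPowerSeries.coeff_mul]

/-- The coefficients of series in a further variable. -/
def powerSeries {B S : Type} [CommRing B] [Algebra ℂ B] [CommRing S] [Algebra ℂ S]
    (c : CoeffFamily n B S) : CoeffFamily n (PowerSeries B) (PowerSeries S) where
  cf ν :=
    { toFun := fun F => PowerSeries.mk fun N => c.cf ν (PowerSeries.coeff N F)
      map_add' := fun F G => by ext N; simp
      map_smul' := fun a F => by ext N; simp }
  map_one ν := by
    ext N
    change PowerSeries.coeff N (PowerSeries.mk fun N => c.cf ν (PowerSeries.coeff N 1)) = _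
    rw [PowerSeries.coeff_mk, PowerSeries.coeff_one]
    by_cases hN : N = 0
    · subst hN
      rw [if_pos rfl, c.map_one]
      split_ifs <;> simp
    · rw [if_neg hN, map_zero]
      split_ifs <;> simp [PowerSeries.coeff_one, hN]
  map_mul ν F G := by
    ext N
    change PowerSeries.coeff N (PowerSeries.mk fun N => c.cf ν (PowerSeries.coeff N (F * G))) = _
    rw [PowerSeries.coeff_mk, PowerSeries.coeff_mul, map_sum, map_sum]
    simp only [c.map_mul]
    rw [Finset.sum_comm]
    refine Finset.sum_congr rfl fun p _ => ?_
    rw [PowerSeries.coeff_mul]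
    refine Finset.sum_congr rfl fun s _ => ?_
    change _ = PowerSeries.coeff s.1 (PowerSeries.mk fun N => c.cf p.1 (PowerSeries.coeff N F)) *
      PowerSeries.coeff s.2 (PowerSeries.mk fun N => c.cf p.2 (PowerSeries.coeff N G))
    rw [PowerSeries.coeff_mk, PowerSeries.coeff_mk]

theorem coeff_powerSeries {B S : Type} [CommRing B] [Algebra ℂ B] [CommRing S] [Algebra ℂ S]
    (c : CoeffFamily n B S) (ν : Fin n →₀ ℕ) (F : PowerSeries B) (N : ℕ) :
    PowerSeries.coeff N (c.powerSeries.cf ν F) = c.cf ν (PowerSeries.coeff N F) := by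
  change PowerSeries.coeff N (PowerSeries.mk fun N => c.cf ν (PowerSeries.coeff N F)) = _
  rw [PowerSeries.coeff_mk]

theorem powerSeries_base_cf (ν : Fin n →₀ ℕ) (F : PowerSeries (MvPowerSeries (Fin n) ℂ)) :
    (base n).powerSeries.cf ν F = coeffAt ν F := rfl

end CoeffFamily

theorem map_univ_val_eq_sum {s : ℕ} {α : Type} (f : Fin s → α) :
    (Finset.univ : Finset (Fin s)).val.map f = ∑ i, ({f i} : Multiset α) := by
  rw [← Multiset.sum_map_singleton ((Finset.univ : Finset (Fin s)).val.map f), Multiset.map_map]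
  rfl

theorem sum_antidiagonalTuple_succ {A : Type} [AddCommMonoid A] (s a : ℕ)
    (F : (Fin (s + 1) → ℕ) → A) :
    ∑ lam ∈ Finset.Nat.antidiagonalTuple (s + 1) a, F lam = ∑ p ∈ antidiagonal a,
      ∑ lam ∈ Finset.Nat.antidiagonalTuple s p.2, F (Fin.cons p.1 lam) := by
  rw [Finset.sum_sigma']
  refine Finset.sum_nbij' (fun lam => ⟨(lam 0, ∑ i, lam (Fin.succ i)), Fin.tail lam⟩)
    (fun x => Fin.cons x.1.1 x.2) ?_ ?_ ?_ ?_ ?_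
  · intro lam h
    rw [Finset.Nat.mem_antidiagonalTuple, Fin.sum_univ_succ] at h
    rw [Finset.mem_sigma, Finset.HasAntidiagonal.mem_antidiagonal,
      Finset.Nat.mem_antidiagonalTuple]
    exact ⟨h, rfl⟩
  · rintro ⟨⟨i, j⟩, lam⟩ h
    rw [Finset.mem_sigma, Finset.HasAntidiagonal.mem_antidiagonal,
      Finset.Nat.mem_antidiagonalTuple] at h
    rw [Finset.Nat.mem_antidiagonalTuple, Fin.sum_univ_succ]
    simp only [Fin.cons_zero, Fin.cons_succ] at h ⊢
    rw [h.2, h.1]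
  · intro lam _
    exact Fin.cons_self_tail lam
  · rintro ⟨⟨i, j⟩, lam⟩ h
    rw [Finset.mem_sigma, Finset.Nat.mem_antidiagonalTuple] at h
    obtain ⟨-, h⟩ := h
    simp only at h
    subst h
    simp
  · intro lam _
    rw [Fin.cons_self_tail]

theorem insertions_eq_sum {R : Type} [CommRing R] (ω : ℕ → R) (c : Multiset ℕ → R) (s a : ℕ)
    (u : Multiset ℕ) : insertions ω c s a u = ∑ lam ∈ Finset.Nat.antidiagonalTuple s a,
      (∏ b, ω (lam b)) * c (u + (Finset.univ : Finset (Fin s)).val.map lam) := by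
  induction s generalizing a u with
  | zero =>
    rcases a with _ | a
    · rw [insertions, if_pos rfl]
      simp
    · rw [insertions, if_neg (by omega)]
      simp
  | succ s ih =>
    rw [insertions, sum_antidiagonalTuple_succ]
    refine Finset.sum_congr rfl fun p _ => ?_
    rw [ih, Finset.mul_sum]
    refine Finset.sum_congr rfl fun lam _ => ?_
    rw [Fin.prod_univ_succ, map_univ_val_eq_sum, map_univ_val_eq_sum, Fin.sum_univ_succ]
    simp only [Fin.cons_zero, Fin.cons_succ]
    rw [mul_assoc, ← add_assoc, add_comm u {p.1}, Multiset.singleton_add]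

/-! ### Coefficients of the exponential of the regular factors -/

section Regular
variable {n : ℕ}

open Classical in
theorem coeffAt_regSeries (k : Fin n) {K : Finset (Fin n)} (hk : k ∉ K) {s : ℕ}
    (H : MvPowerSeries (Fin (K.card + s)) ℂ) (ν : Fin n →₀ ℕ) :
    coeffAt ν (regSeries k K s H) = if ∀ i, i ∉ K → i ≠ k → ν i = 0 then
      ∑ lam ∈ Finset.Nat.antidiagonalTuple s (ν k),
        (∏ b, partWeight (lam b)) * PowerSeries.C (MvPowerSeries.coeff (tuple ν K lam) H)
      else 0 := by
  ext N
  rw [coeff_coeffAt, regSeries, PowerSeries.coeff_mk]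
  refine (coeff_rename_collapse k hk _ ν).trans ?_
  split_ifs
  · rw [map_sum]
    refine Finset.sum_congr rfl fun lam _ => ?_
    rw [PowerSeries.coeff_mul_C]
    change PowerSeries.coeff N (∏ b, partWeight (tuple ν K lam (Fin.natAdd K.card b))) * _ = _
    simp [tuple]
  · rw [map_zero]

open Classical in
-- The integer condition in `correlator` and the truncated subtraction in `genusFun`, guarded by its
-- inequality, describe the same exponent b.
theorem coeff_correlator (q r g : ℕ) (hn : 1 ≤ n) (κ : Fin n →₀ ℕ) :
    MvPowerSeries.coeff κ (correlator q r g n) =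
      if ∀ i, 1 ≤ κ i then PowerSeries.coeff g (genusNumbers q r (parts κ Finset.univ)) else 0 := by
  have : Nonempty (Fin n) := ⟨⟨0, hn⟩⟩
  change (if (∀ i, 1 ≤ κ i) ∧ 0 ≤ (2 * (g : ℤ) - 2 + n) * q + ∑ i, (κ i : ℤ) ∧
    ((q : ℤ) * r) ∣ (2 * (g : ℤ) - 2 + n) * q + ∑ i, (κ i : ℤ) then _ else _) = _
  by_cases hκ : ∀ i, 1 ≤ κ i
  · rw [if_pos hκ, genusNumbers, genusFun, PowerSeries.coeff_mk, card_parts, sum_parts,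
      Finset.card_univ, Fintype.card_fin,
      connected_disconnectedSeries q r κ Finset.univ Finset.univ_nonempty]
    by_cases hle : 2 * q ≤ n * q + ∑ i, κ i + 2 * q * g
    · obtain ⟨X, hX⟩ := Nat.exists_eq_add_of_le hle
      have hN : (2 * (g : ℤ) - 2 + n) * q + ∑ i, (κ i : ℤ) = (X : ℤ) := by
        have := congrArg (Nat.cast (R := ℤ)) hX
        push_cast at this
        linear_combination this
      rw [hN, hX, Nat.add_sub_cancel_left, ← Nat.cast_mul, ← Int.natCast_div, Int.toNat_natCast]
      refine if_congr ?_ rfl rfl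
      rw [Int.natCast_dvd_natCast]
      constructor
      · rintro ⟨-, -, h⟩; exact ⟨by omega, h⟩
      · rintro ⟨-, h⟩; exact ⟨hκ, by omega, h⟩
    · rw [if_neg, if_neg]
      · exact fun h => hle h.1
      · rintro ⟨-, h, -⟩
        apply hle
        zify
        linarith
  · rw [if_neg hκ, if_neg fun h => hκ h.1]

theorem parts_tuple (ν : Fin n →₀ ℕ) (K : Finset (Fin n)) {s : ℕ} (lam : Fin s → ℕ) :
    parts (tuple ν K lam) Finset.univ =
      parts ν K + (Finset.univ : Finset (Fin s)).val.map lam := by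
  have h1 : parts ν K = (Finset.univ : Finset (Fin K.card)).val.map
      fun i => ν (K.orderEmbOfFin rfl i) := by
    rw [parts]
    conv_lhs => rw [← Finset.map_orderEmbOfFin_univ K rfl]
    rw [Finset.map_val, Multiset.map_map]
    rfl
  rw [h1, parts, map_univ_val_eq_sum, map_univ_val_eq_sum, map_univ_val_eq_sum, Fin.sum_univ_add]
  simp [tuple]

/-- The generating series of the regular factors. -/
def regGen (q r : ℕ) (k : Fin n) :
    PowerSeries (SetFun (Fin n) (PowerSeries (PowerSeries (MvPowerSeries (Fin n) ℂ)))) :=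
  factorGen (Fin n) fun g K s =>
    if k ∈ K then 0 else regSeries k K s (correlator q r g (K.card + s))

theorem cf_regGen (q r : ℕ) (k : Fin n) {s : ℕ} (hs : s ≠ 0) {K : Finset (Fin n)} (hk : k ∉ K)
    (ν : Fin n →₀ ℕ) (N : ℕ) :
    PowerSeries.coeff N ((CoeffFamily.base n).powerSeries.powerSeries.cf ν
      ((PowerSeries.coeff s (regGen q r k)) K)) = (s.factorial : ℂ)⁻¹ •
        if s - 1 ≤ N then coeffAt ν (regSeries k K s (correlator q r (N - (s - 1)) (K.card + s)))
        else 0 := by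
  rw [CoeffFamily.coeff_powerSeries, CoeffFamily.powerSeries_base_cf, regGen, factorGen,
    PowerSeries.coeff_mk, if_neg hs]
  change coeffAt ν (PowerSeries.coeff N ((s.factorial : ℂ)⁻¹ • (PowerSeries.X ^ (s - 1) *
    PowerSeries.mk _))) = _
  rw [PowerSeries.coeff_smul, PowerSeries.coeff_X_pow_mul', ← CoeffFamily.powerSeries_base_cf,
    map_smul]
  split_ifs with h
  · rw [PowerSeries.coeff_mk]
    rfl
  · rw [map_zero]

theorem regGen_mem_supported (q r : ℕ) (k : Fin n) (s : ℕ) :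
    PowerSeries.coeff s (regGen q r k) ∈ (CoeffFamily.base n).powerSeries.powerSeries.supported k := by
  classical
  intro K ν h
  by_cases hs : s = 0
  · refine absurd ?_ h
    rw [regGen, factorGen, PowerSeries.coeff_mk, if_pos hs, SetFun.zero_apply, map_zero]
  by_cases hk : k ∈ K
  · refine absurd ?_ h
    rw [regGen, factorGen, PowerSeries.coeff_mk, if_neg hs]
    change (CoeffFamily.base n).powerSeries.powerSeries.cf ν ((s.factorial : ℂ)⁻¹ •
      (PowerSeries.X ^ (s - 1) * PowerSeries.mk fun g => if k ∈ K then 0 else _)) = 0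
    simp only [if_pos hk]
    rw [map_smul, show (PowerSeries.mk fun _ => 0 :
      PowerSeries (PowerSeries (MvPowerSeries (Fin n) ℂ))) = 0 from rfl, mul_zero, map_zero,
      smul_zero]
  obtain ⟨N, hN⟩ : ∃ N, PowerSeries.coeff N ((CoeffFamily.base n).powerSeries.powerSeries.cf ν
      ((PowerSeries.coeff s (regGen q r k)) K)) ≠ 0 := by
    by_contra! h0
    exact h (PowerSeries.ext fun N => by rw [h0, map_zero])
  rw [cf_regGen q r k hs hk] at hN
  have h1 := right_ne_zero_of_smul hN
  split_ifs at h1 with hsN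
  · rw [coeffAt_regSeries k hk] at h1
    split_ifs at h1 with hsupp
    · obtain ⟨lam, -, h2⟩ := Finset.exists_ne_zero_of_sum_ne_zero h1
      have h3 := right_ne_zero_of_mul h2
      rw [coeff_correlator q r _ (by omega)] at h3
      split_ifs at h3 with h4
      · refine ⟨hk, fun i hi => ⟨fun h => ?_, fun h => ?_⟩⟩
        · by_contra hiK
          rw [hsupp i hiK hi] at h
          omega
        · obtain ⟨a, rfl⟩ : i ∈ Set.range (K.orderEmbOfFin rfl) := by
            rw [Finset.range_orderEmbOfFin]; exact h
          simpa [tuple] using h4 (Fin.castAdd s a)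
      · exact absurd (map_zero _) h3
    · exact absurd rfl h1
  · exact absurd rfl h1

theorem partWeight_zero : partWeight 0 = 0 := by simp [partWeight]

open Classical in
/-- The coefficients of the exponential of the regular factors. -/
theorem cf_expSeries_regGen (q r : ℕ) (k : Fin n) (l : ℕ) (J : Finset (Fin n)) (ν : Fin n →₀ ℕ) :
    (CoeffFamily.base n).powerSeries.powerSeries.cf ν
      ((PowerSeries.coeff l (expSeries (regGen q r k))) J) = if CoeffFamily.Fits k J ν then
        insertionExp liftedWeight PowerSeries.X (liftedFun (genusNumbers q r)) ν l J (ν k)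
        else 0 := by
  rw [CoeffFamily.cf_expSeries _ k (regGen_mem_supported q r k) l J ν
    (Ψ := insertionSeries liftedWeight PowerSeries.X (liftedFun (genusNumbers q r)) ν)]
  · rfl
  intro hfit s a K hKJ
  by_cases hs : s = 0
  · rw [regGen, factorGen, PowerSeries.coeff_mk, if_pos hs, insertionSeries, PowerSeries.coeff_mk,
      if_pos hs, SetFun.zero_apply, SetFun.zero_apply, map_zero, map_zero]
  have hk : k ∉ K := fun h => hfit.1 (hKJ h)
  have hne : ∀ i ∈ K, i ≠ k := fun i hi e => hk (e ▸ hi)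
  have hparts : parts (CoeffFamily.exponents k ν K a) K = parts ν K := by
    refine Multiset.map_congr rfl fun i hi => ?_
    rw [CoeffFamily.exponents_apply, if_neg (hne i hi), if_pos (show i ∈ K from hi)]
  rw [coeff_insertionSeries _ _ _ _ hs]
  ext1 N
  rw [cf_regGen q r k hs hk, PowerSeries.coeff_X_pow_mul', PowerSeries.coeff_smul]
  split_ifs with hN
  · congr 1
    rw [coeffAt_regSeries k hk, if_pos fun i hiK hik => by
      rw [CoeffFamily.exponents_apply, if_neg hik, if_neg hiK], insertions_eq_sum, map_sum,
      CoeffFamily.exponents_apply, if_pos rfl]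
    refine Finset.sum_congr rfl fun lam _ => ?_
    have h1 : ∏ b, liftedWeight (lam b) = PowerSeries.C (∏ b, partWeight (lam b)) := by
      rw [map_prod]; rfl
    rw [h1, PowerSeries.coeff_C_mul, liftedFun, PowerSeries.coeff_map, ← hparts, ← parts_tuple,
      coeff_correlator q r _ (by omega)]
    split_ifs with h2
    · rfl
    -- The correlator has no monomials with a zero exponent, whereas `insertions` allows a part 0;
    -- the latter has weight zero.
    · obtain ⟨b, hb⟩ : ∃ b, lam b = 0 := by
        by_contra! h3
        refine h2 fun i => ?_
        refine Fin.addCases (fun i => ?_) (fun i => ?_) i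
        · have hi := K.orderEmbOfFin_mem rfl i
          simp only [tuple, Finsupp.equivFunOnFinite_symm_apply_apply, Fin.append_left]
          rw [CoeffFamily.exponents_apply, if_neg (hne _ hi), if_pos hi]
          exact (hfit.2 _ (hne _ hi)).2 (hKJ hi)
        · simpa [tuple] using Nat.one_le_iff_ne_zero.2 (h3 i)
      rw [Finset.prod_eq_zero (Finset.mem_univ b) (by rw [hb, partWeight_zero]), zero_mul, zero_mul]
  · rw [smul_zero]

end Regular

/-! ### The right-hand side of the resummed equation as a sum over subsets -/

section Assembly
variable {n : ℕ}

/-- The coefficient of `z^{2d}` of `S(z)⁻¹ F(z)`. -/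
def lead (n d : ℕ) : PowerSeries (Frac n) →ₗ[ℂ] Frac n where
  toFun F := PowerSeries.coeff (2 * d) (PowerSeries.map (algebraMap ℂ (Frac n)) zetaDivZ⁻¹ * F)
  map_add' F G := by rw [mul_add, map_add]
  map_smul' c F := by rw [mul_smul_comm, PowerSeries.coeff_smul, RingHom.id_apply]

theorem lead_apply (d : ℕ) (F : PowerSeries (Frac n)) : lead n d F =
    PowerSeries.coeff (2 * d) (PowerSeries.map (algebraMap ℂ (Frac n)) zetaDivZ⁻¹ * F) := rfl

/-- The pairs `(m,d)` with `m ≥ 1` and `m + 2d = r + 1`. -/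
def orderPairs (r : ℕ) : Finset (ℕ × ℕ) :=
  (Finset.range (r + 2) ×ˢ Finset.range (r + 2)).filter
    fun p => 1 ≤ p.1 ∧ p.1 + 2 * p.2 = r + 1

/-- The sums over l, K, M and the genera become one coefficient of an exponential; the m! of the
exponential formula cancels the prefactor 1/m!. -/
theorem resummedRHS_eq (q r : ℕ) (Ht : ℕ → (n : ℕ) → MvPowerSeries (Fin n) ℂ) (g n : ℕ) :
    resummedRHS q r Ht g n = ∑ p ∈ orderPairs r, ∑ k : Fin n,
      lead n p.2 (zetaEnd (eulerFrac k) (if p.2 ≤ g then PowerSeries.coeff (g - p.2)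
        ((PowerSeries.coeff p.1 (expSeries (factorGen (Fin n) fun γ K s =>
          factorSeries k q r Ht γ K s))) (Finset.univ.erase k)) else 0)) := by
  classical
  rw [resummedRHS]
  refine Finset.sum_congr rfl fun p _ => ?_
  rw [Finset.smul_sum]
  refine Finset.sum_congr rfl fun k _ => ?_
  have h := sum_splittings_eq_coeff_expSeries p.1 p.2 g (Finset.univ.erase k)
    fun γ K s => factorSeries k q r Ht γ K s
  have h2 : (if p.2 ≤ g then PowerSeries.coeff (g - p.2)
        ((PowerSeries.coeff p.1 (expSeries (factorGen (Fin n) fun γ K s =>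
          factorSeries k q r Ht γ K s))) (Finset.univ.erase k)) else 0) =
      (p.1.factorial : ℂ)⁻¹ • if p.2 ≤ g then (p.1.factorial : ℂ) • PowerSeries.coeff (g - p.2)
        ((PowerSeries.coeff p.1 (expSeries (factorGen (Fin n) fun γ K s =>
          factorSeries k q r Ht γ K s))) (Finset.univ.erase k)) else 0 := by
    split_ifs
    · rw [smul_smul, inv_mul_cancel₀ (by exact_mod_cast p.1.factorial_ne_zero), one_smul]
    · rw [smul_zero]
  rw [h2, ← h, map_smul, map_smul, map_sum, map_sum]
  congr 1
  refine Finset.sum_congr rfl fun l _ => ?_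
  rw [map_smul, map_smul, map_sum, map_sum]
  congr 1
  refine Finset.sum_congr rfl fun K hK => ?_
  rw [map_sum, map_sum]
  refine Finset.sum_congr rfl fun M hM => ?_
  rw [map_sum, map_sum]
  refine Finset.sum_congr rfl fun γ _ => ?_
  rw [Finset.mem_filter, mem_splittings] at hM
  rw [mem_splittings] at hK
  rw [Qop_prod_factor k q r Ht p.2 (fun j => (γ j : ℕ)) (fun j hj => ?_) hM.2 hM.1.1]
  · rfl
  · have := (hK.2 k).2 ⟨j, hj⟩
    simp at this

/-- The set function of the polar parts. -/
def polarFun (k : Fin n) : SetFun (Fin n) (PowerSeries (PowerSeries (Frac n))) :=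
  SetFun.of fun K => if K.card = 1 then
    ∑ i ∈ K, PowerSeries.C (zetaEnd (eulerFrac i) (PowerSeries.C (polar k i))) else 0

/-- The generating series of the polar parts. -/
def polarSeries (k : Fin n) :
    PowerSeries (SetFun (Fin n) (PowerSeries (PowerSeries (Frac n)))) :=
  PowerSeries.X * PowerSeries.C (polarFun k)

theorem coeff_expSeries_X_mul_C {R : Type} [CommRing R] [Algebra ℂ R] (a : R) (b : ℕ) :
    PowerSeries.coeff b (expSeries (PowerSeries.X * PowerSeries.C a)) =
      (b.factorial : ℂ)⁻¹ • a ^ b := by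
  rw [expSeries, PowerSeries.coeff_mk, Finset.sum_eq_single b]
  · rw [mul_pow, ← map_pow, PowerSeries.coeff_mul_C, PowerSeries.coeff_X_pow_self, one_mul]
  · intro j _ hj
    rw [mul_pow, ← map_pow, PowerSeries.coeff_mul_C, PowerSeries.coeff_X_pow, if_neg (Ne.symm hj),
      zero_mul, smul_zero]
  · intro h; simp at h

theorem coeff_expSeries_polarFun (k : Fin n) (b : ℕ) (T : Finset (Fin n)) :
    (PowerSeries.coeff b (expSeries (polarSeries k))) T =
      if T.card = b then
        PowerSeries.C (∏ i ∈ T, zetaEnd (eulerFrac i) (PowerSeries.C (polar k i))) else 0 := by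
  rw [polarSeries, coeff_expSeries_X_mul_C]
  change (b.factorial : ℂ)⁻¹ • ((polarFun k ^ b) T) = _
  rw [SetFun.pow_apply_singletons _ (fun S hS => if_neg hS)]
  split_ifs with h
  · rw [← mul_smul_comm, factorial_mul_smul, map_prod]
    refine Finset.prod_congr rfl fun i _ => ?_
    change (if ({i} : Finset (Fin n)).card = 1 then ∑ i ∈ {i},
      PowerSeries.C (zetaEnd (eulerFrac i) (PowerSeries.C (polar k i))) else 0) = _
    rw [if_pos (Finset.card_singleton i), Finset.sum_singleton]
  · exact smul_zero _

/-- The coefficient of `t^l u^N` of the exponential of the regular factors. -/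
def regExp (q r : ℕ) (k : Fin n) (l N : ℕ) (J : Finset (Fin n)) :
    PowerSeries (MvPowerSeries (Fin n) ℂ) :=
  PowerSeries.coeff N ((PowerSeries.coeff l (expSeries (regGen q r k))) J)

theorem regularPart_correlator (q r g N : ℕ) :
    regularPart q r (fun g n => correlator q r g n) g N = correlator q r g N := by
  rw [regularPart, ite_self]

/-- A factor is a regular series plus, in the case (0,2), a polar part, and the exponential of a sum
is a product. The polar exponential attaches one ξ to each x_i, i ∈ T; the other m - |T| of the ξ
enter regular factors. -/
theorem coeff_expSeries_factorSeries (q r : ℕ) (k : Fin n) (m N : ℕ) :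
    PowerSeries.coeff N ((PowerSeries.coeff m (expSeries (factorGen (Fin n) fun γ K s =>
        factorSeries k q r (fun g n => correlator q r g n) γ K s))) (Finset.univ.erase k)) =
      ∑ T ∈ (Finset.univ.erase k).powerset, if T.card ≤ m then
        (∏ i ∈ T, zetaEnd (eulerFrac i) (PowerSeries.C (polar k i))) *
          PowerSeries.map (algebraMap _ (Frac n))
            (regExp q r k (m - T.card) N (Finset.univ.erase k \ T)) else 0 := by
  set φ := SetFun.map (ι := Fin n) (PowerSeries.map (PowerSeries.map
    (algebraMap (MvPowerSeries (Fin n) ℂ) (Frac n)))) with hφ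
  have h0 : PowerSeries.constantCoeff (PowerSeries.map φ (regGen q r k)) = 0 := by
    rw [← PowerSeries.coeff_zero_eq_constantCoeff_apply, PowerSeries.coeff_map,
      PowerSeries.coeff_zero_eq_constantCoeff_apply, regGen, constantCoeff_factorGen, map_zero]
  rw [coeff_expSeries_congr (Ψ := polarSeries k +
    PowerSeries.map φ (regGen q r k)), expSeries_add (by simp [polarSeries]) h0, PowerSeries.coeff_mul,
    SetFun.sum_apply, map_sum]
  · simp only [SetFun.mul_apply, map_sum, coeff_expSeries_polarFun]
    rw [Finset.sum_comm]
    refine Finset.sum_congr rfl fun T _ => ?_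
    split_ifs with hT
    · rw [Finset.sum_eq_single (T.card, m - T.card)]
      · rw [if_pos rfl, PowerSeries.coeff_C_mul, ← map_expSeries, PowerSeries.coeff_map, hφ,
          SetFun.map_apply, PowerSeries.coeff_map]
        rfl
      · rintro ⟨a, b⟩ hab hne
        rw [Finset.HasAntidiagonal.mem_antidiagonal] at hab
        rw [if_neg, zero_mul, map_zero]
        rintro rfl
        apply hne
        simp only at hab
        ext <;> simp <;> omega
      · intro h
        rw [Finset.HasAntidiagonal.mem_antidiagonal] at h
        exact absurd (Nat.add_sub_cancel' hT) h
    · refine Finset.sum_eq_zero fun p hp => ?_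
      rw [Finset.HasAntidiagonal.mem_antidiagonal] at hp
      rw [if_neg (by omega), zero_mul, map_zero]
  · intro s K hK
    have hk : k ∉ K := fun h => by simpa using hK h
    rw [map_add, SetFun.add_apply, PowerSeries.coeff_map, polarSeries, hφ, SetFun.map_apply, regGen, factorGen,
      factorGen, PowerSeries.coeff_mk, PowerSeries.coeff_mk, PowerSeries.coeff_mul_C,
      PowerSeries.coeff_X]
    by_cases hs : s = 0
    · subst hs
      simp [SetFun.zero_apply]
    rw [if_neg hs, if_neg hs]
    change (s.factorial : ℂ)⁻¹ • (PowerSeries.X ^ (s - 1) * PowerSeries.mk fun g =>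
      factorSeries k q r (fun g n => correlator q r g n) g K s) = _ + PowerSeries.map
        (PowerSeries.map (algebraMap (MvPowerSeries (Fin n) ℂ) (Frac n))) ((s.factorial : ℂ)⁻¹ •
          (PowerSeries.X ^ (s - 1) * PowerSeries.mk fun g => if k ∈ K then 0 else
            regSeries k K s (correlator q r g (K.card + s))))
    rw [map_inv_natCast_smul _ ℂ ℂ, map_mul, map_pow, PowerSeries.map_X]
    have h1 : (PowerSeries.mk fun g => factorSeries k q r (fun g n => correlator q r g n) g K s) =
        PowerSeries.map (PowerSeries.map (algebraMap (MvPowerSeries (Fin n) ℂ) (Frac n)))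
          (PowerSeries.mk fun g => if k ∈ K then 0 else
            regSeries k K s (correlator q r g (K.card + s))) +
          if s = 1 then polarFun k K else 0 := by
      ext1 g
      rw [map_add, PowerSeries.coeff_map, PowerSeries.coeff_mk, PowerSeries.coeff_mk, if_neg hk,
        factorSeries, regularPart_correlator]
      congr 1
      by_cases hs1 : s = 1
      · rw [if_pos hs1]
        change _ = PowerSeries.coeff g (if K.card = 1 then
          ∑ i ∈ K, PowerSeries.C (zetaEnd (eulerFrac i) (PowerSeries.C (polar k i))) else 0)
        by_cases hK1 : K.card = 1
        · rw [if_pos hK1, ← map_sum, PowerSeries.coeff_C]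
          simp [hs1, hK1]
        · rw [if_neg hK1, if_neg (by tauto), map_zero]
      · rw [if_neg hs1, if_neg (by tauto), map_zero]
    rw [h1, mul_add, smul_add, add_comm]
    congr 1
    by_cases hs1 : s = 1
    · subst hs1
      simp
    · rw [if_neg hs1, if_neg hs1, mul_zero, smul_zero, zero_mul, SetFun.zero_apply]

/-- The sum over `k ∈ I` of the terms whose polar factors have the variables `x_i`,
`i ∈ I ∖ {k}`. -/
def blockTerm (q r l N : ℕ) (I : Finset (Fin n)) : PowerSeries (Frac n) :=
  ∑ k ∈ I, zetaEnd (eulerFrac k)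
    ((∏ i ∈ I.erase k, zetaEnd (eulerFrac i) (PowerSeries.C (polar k i))) *
      PowerSeries.map (algebraMap _ (Frac n)) (regExp q r k l N (Finset.univ \ I)))

/-- With I = T ∪ {k}, the distinguished index becomes one element of I among equals, and the sum
over k ∈ I can be carried out first. -/
theorem sum_powerset_erase {A : Type} [AddCommMonoid A] (F : Fin n → Finset (Fin n) → A) :
    ∑ k, ∑ T ∈ (Finset.univ.erase k).powerset, F k (insert k T) =
      ∑ I ∈ (Finset.univ : Finset (Fin n)).powerset, ∑ k ∈ I, F k I := by
  rw [Finset.sum_sigma', Finset.sum_sigma']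
  refine Finset.sum_nbij' (fun x => ⟨insert x.1 x.2, x.1⟩) (fun x => ⟨x.2, x.1.erase x.2⟩)
    ?_ ?_ ?_ ?_ ?_
  · rintro ⟨k, T⟩ _; simp
  · rintro ⟨I, k⟩ h
    simp only [Finset.mem_sigma, Finset.mem_univ, true_and, Finset.mem_powerset] at h ⊢
    exact Finset.erase_subset_erase k (Finset.subset_univ I)
  · rintro ⟨k, T⟩ h
    simp only [Finset.mem_sigma, Finset.mem_univ, true_and, Finset.mem_powerset] at h
    have hk : k ∉ T := fun hkT => by simpa using h hkT
    simp [Finset.erase_insert hk]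
  · rintro ⟨I, k⟩ h
    simp only [Finset.mem_sigma] at h
    simp [Finset.insert_erase h.2]
  · rintro ⟨k, T⟩ _; rfl

theorem resummedRHS_correlator (q r g : ℕ) :
    resummedRHS q r (fun g n => correlator q r g n) g n = ∑ p ∈ orderPairs r,
      ∑ I ∈ (Finset.univ : Finset (Fin n)).powerset,
        if p.2 ≤ g ∧ I.card ≤ p.1 + 1 then
          lead n p.2 (blockTerm q r (p.1 + 1 - I.card) (g - p.2) I) else 0 := by
  rw [resummedRHS_eq]
  refine Finset.sum_congr rfl fun p _ => ?_
  set F : Fin n → Finset (Fin n) → Frac n := fun k I => if p.2 ≤ g ∧ I.card ≤ p.1 + 1 then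
    lead n p.2 (zetaEnd (eulerFrac k)
      ((∏ i ∈ I.erase k, zetaEnd (eulerFrac i) (PowerSeries.C (polar k i))) *
        PowerSeries.map (algebraMap _ (Frac n))
          (regExp q r k (p.1 + 1 - I.card) (g - p.2) (Finset.univ \ I)))) else 0 with hF
  trans ∑ k, ∑ T ∈ (Finset.univ.erase k).powerset, F k (insert k T)
  · refine Finset.sum_congr rfl fun k _ => ?_
    by_cases hd : p.2 ≤ g
    · rw [if_pos hd, coeff_expSeries_factorSeries, map_sum, map_sum]
      refine Finset.sum_congr rfl fun T hT => ?_
      have hk : k ∉ T := fun hkT => by simpa using Finset.mem_powerset.1 hT hkT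
      simp only [hF]
      rw [Finset.card_insert_of_notMem hk, Finset.erase_insert hk]
      by_cases hc : T.card ≤ p.1
      · rw [if_pos hc, if_pos ⟨hd, by omega⟩, Nat.add_sub_add_right]
        have hs : Finset.univ.erase k \ T = Finset.univ \ insert k T := by
          ext i
          simp
        rw [hs]
      · rw [if_neg hc, if_neg (by omega), map_zero, map_zero]
    · rw [if_neg hd, map_zero, map_zero]
      refine (Finset.sum_eq_zero fun T _ => ?_).symm
      simp only [hF]
      rw [if_neg fun h => hd h.1]
  · rw [sum_powerset_erase]
    refine Finset.sum_congr rfl fun I _ => ?_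
    simp only [hF, blockTerm]
    split_ifs
    · rw [map_sum]
    · exact Finset.sum_const_zero

end Assembly

/-! ### The coefficients of the right-hand side -/

section InsertionExp
variable {n : ℕ} {R : Type} [CommRing R] [Algebra ℂ R]

theorem insertionExp_congr (ω : ℕ → R) (θ : R) (c : Multiset ℕ → R) {ν ν' : Fin n → ℕ}
    {J : Finset (Fin n)} (h : ∀ j ∈ J, ν j = ν' j) (l a : ℕ) :
    insertionExp ω θ c ν l J a = insertionExp ω θ c ν' l J a := by
  rw [insertionExp, insertionExp]
  congr 1
  refine coeff_expSeries_congr (fun s K hK => ?_) l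
  have : parts ν K = parts ν' K := Multiset.map_congr rfl fun i hi => h i (hK hi)
  by_cases hs : s = 0
  · rw [hs, insertionSeries, insertionSeries, PowerSeries.coeff_mk, PowerSeries.coeff_mk]
    rfl
  · ext a
    rw [coeff_insertionSeries _ _ _ _ hs, coeff_insertionSeries _ _ _ _ hs, this]

theorem coeff_zero_expSeries {Φ : PowerSeries R} : PowerSeries.coeff 0 (expSeries Φ) = 1 := by
  rw [expSeries, PowerSeries.coeff_mk]
  simp

theorem expSeries_zero : expSeries (0 : PowerSeries R) = 1 := by
  ext l
  rw [expSeries, PowerSeries.coeff_mk, Finset.sum_eq_single 0]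
  · simp
  · intro j _ hj
    rw [zero_pow hj, map_zero, smul_zero]
  · intro h; simp at h

theorem insertionExp_zero_left (ω : ℕ → R) (θ : R) (c : Multiset ℕ → R) (ν : Fin n → ℕ)
    (J : Finset (Fin n)) (a : ℕ) :
    insertionExp ω θ c ν 0 J a = if J = ∅ ∧ a = 0 then 1 else 0 := by
  rw [insertionExp, coeff_zero_expSeries, SetFun.one_apply]
  by_cases hJ : J = ∅
  · rw [if_pos hJ, PowerSeries.coeff_one]
    simp [hJ]
  · rw [if_neg hJ, map_zero, if_neg fun h => hJ h.1]

theorem insertionExp_zero_right {ω : ℕ → R} (hω : ω 0 = 0) (θ : R) (c : Multiset ℕ → R)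
    (ν : Fin n → ℕ) {l : ℕ} (hl : l ≠ 0) (J : Finset (Fin n)) :
    insertionExp ω θ c ν l J 0 = 0 := by
  have h1 : PowerSeries.map (SetFun.map (PowerSeries.constantCoeff (R := R)))
      (insertionSeries ω θ c ν) = 0 := by
    ext1 s
    rw [PowerSeries.coeff_map, map_zero]
    refine SetFun.ext fun K => ?_
    rw [SetFun.map_apply, SetFun.zero_apply]
    by_cases hs : s = 0
    · rw [hs, insertionSeries, PowerSeries.coeff_mk, if_pos rfl, SetFun.zero_apply, map_zero]
    · rw [← PowerSeries.coeff_zero_eq_constantCoeff_apply, coeff_insertionSeries _ _ _ _ hs]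
      obtain ⟨s, rfl⟩ := Nat.exists_eq_succ_of_ne_zero hs
      have : insertions ω c (s + 1) 0 (parts ν K) = 0 := by
        rw [insertions]
        refine Finset.sum_eq_zero fun p hp => ?_
        rw [Finset.HasAntidiagonal.mem_antidiagonal] at hp
        rw [show p.1 = 0 by omega, hω, zero_mul]
      rw [this, smul_zero, mul_zero]
  rw [insertionExp, PowerSeries.coeff_zero_eq_constantCoeff_apply, ← SetFun.map_apply,
    ← PowerSeries.coeff_map, map_expSeries, h1, expSeries_zero, PowerSeries.coeff_one, if_neg hl,
    SetFun.zero_apply]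

end InsertionExp

/-! ### Cancellation of the poles in the block terms -/

section BlockTerm
variable {n : ℕ}

open Classical in
theorem coeffAt_regExp (q r : ℕ) (k : Fin n) (l N : ℕ) (J : Finset (Fin n)) (ν : Fin n →₀ ℕ) :
    coeffAt ν (regExp q r k l N J) = if CoeffFamily.Fits k J ν then
      PowerSeries.coeff N (insertionExp liftedWeight PowerSeries.X (liftedFun (genusNumbers q r))
        ν l J (ν k)) else 0 := by
  have := congrArg (PowerSeries.coeff N) (cf_expSeries_regGen q r k l J ν)
  rw [CoeffFamily.coeff_powerSeries, CoeffFamily.powerSeries_base_cf] at this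
  rw [regExp, this]
  split_ifs
  · rfl
  · exact map_zero _

/-- The polar function of x_i and x_k is killed by D_j for every other j ∈ I, and the regular factor
by D_i for i ∈ I∖{k}. So all operators can be pulled out as one product over I that does not depend
on k. -/
theorem blockTerm_eq (q r l N : ℕ) (I : Finset (Fin n)) :
    blockTerm q r l N I = zetaEnds (eulerFrac (n := n)) eulerFrac_comm I
      (∑ k ∈ I, PowerSeries.C (∏ i ∈ I.erase k, polar k i) *
        PowerSeries.map (algebraMap _ (Frac n)) (regExp q r k l N (Finset.univ \ I))) := by
  classical
  rw [blockTerm, map_sum]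
  refine Finset.sum_congr rfl fun k hk => ?_
  have hz := fun F => zetaEnds_insert (eulerFrac (n := n)) eulerFrac_comm
    (Finset.notMem_erase k I) F
  rw [Finset.insert_erase hk] at hz
  rw [hz, map_prod, zetaEnds_prod_mul]
  · intro i hi j hj hij
    exact kills_C (eulerFrac_polar_of_ne k hij (Finset.ne_of_mem_erase hi)
      (Finset.ne_of_mem_erase hj).symm)
  · intro i hi M
    rw [PowerSeries.coeff_map, eulerFrac_algebraMap]
    rw [show euler i (PowerSeries.coeff M (regExp q r k l N (Finset.univ \ I))) = 0 from ?_,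
      map_zero]
    ext ν
    rw [coeff_euler, map_zero, ← coeff_coeffAt, coeffAt_regExp]
    split_ifs with h
    · have h1 := (h.2 i (Finset.ne_of_mem_erase hi)).not.2 (by simp [Finset.mem_of_mem_erase hi])
      rw [show ν i = 0 by omega, Nat.cast_zero, zero_mul]
    · rw [map_zero, mul_zero]

/-- The coefficients of the exponential of the insertion series. -/
def insertionCoeff (q r l N M : ℕ) (J : Finset (Fin n)) (a : ℕ) (ν : Fin n → ℕ) : ℂ :=
  PowerSeries.coeff M (PowerSeries.coeff N (insertionExp liftedWeight PowerSeries.X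
    (liftedFun (genusNumbers q r)) ν l J a))

/-- The value of a block term with `l ≥ 1`. -/
def blockValue (q r l N : ℕ) (I : Finset (Fin n)) : PowerSeries (MvPowerSeries (Fin n) ℂ) :=
  zetaEnds (euler (σ := Fin n)) euler_comm I (PowerSeries.mk fun M =>
    blockSeries (Finset.univ \ I) (insertionCoeff q r l N M (Finset.univ \ I)) I)

theorem liftedWeight_zero' : liftedWeight 0 = 0 := by rw [liftedWeight, partWeight_zero, map_zero]

/-- At least one ξ enters a regular factor, so the series multiplying the polar functions has only
positive powers of x_k. Then `sum_blockSeries_polar` applies and the sum over k has no poles. -/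
theorem blockTerm_of_ne_zero (q r : ℕ) {l : ℕ} (hl : l ≠ 0) (N : ℕ) {I : Finset (Fin n)}
    (hI : I.Nonempty) : blockTerm q r l N I =
      PowerSeries.map (algebraMap _ (Frac n)) (blockValue q r l N I) := by
  classical
  rw [blockTerm_eq, blockValue, ← zetaEnds_eulerFrac_map]
  congr 1
  ext M
  rw [PowerSeries.coeff_map, PowerSeries.coeff_mk, map_sum, ← sum_blockSeries_polar _ hI
    Finset.disjoint_sdiff]
  · refine Finset.sum_congr rfl fun k hk => ?_
    rw [PowerSeries.coeff_C_mul, mul_comm, PowerSeries.coeff_map]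
    congr 2
    ext ν
    rw [← coeff_coeffAt, coeffAt_regExp, coeff_blockSeries, Finset.sum_singleton]
    have hkJ : k ∉ Finset.univ \ I := by simp [hk]
    -- The exponent 0 of x_k does not occur in a block series; on the other side it would need l ≥ 1
    -- inserted parts of total size 0.
    rcases Nat.eq_zero_or_pos (ν k) with h0 | h0
    · rw [if_neg (c := ∀ i, 1 ≤ ν i ↔ i ∈ Finset.univ \ I ∪ {k})]
      · rw [h0, insertionExp_zero_right liftedWeight_zero' _ _ _ hl, map_zero, ite_self, map_zero]
      · intro h
        have := (h k).2 (by simp)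
        omega
    · have hiff : CoeffFamily.Fits k (Finset.univ \ I) ν ↔
          ∀ i, 1 ≤ ν i ↔ i ∈ Finset.univ \ I ∪ {k} := by
        constructor
        · intro h i
          by_cases hik : i = k
          · subst hik; simp; omega
          · rw [h.2 i hik]; simp [hik]
        · intro h
          refine ⟨hkJ, fun i hik => ?_⟩
          rw [h i]; simp [hik]
      simp only [hiff]
      split_ifs
      · rfl
      · exact map_zero _
  · intro a ν ν' h
    rw [insertionCoeff, insertionExp_congr _ _ _ h, insertionCoeff]

open Classical in
theorem coeffAt_blockValue (q r l N : ℕ) (I : Finset (Fin n)) (ν : Fin n →₀ ℕ) :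
    coeffAt ν (blockValue q r l N I) = if ∀ i, 1 ≤ ν i then
      (∏ i ∈ I, PowerSeries.rescale (ν i : ℂ) zetaDivZ) *
        PowerSeries.coeff N (insertionExp liftedWeight PowerSeries.X
          (liftedFun (genusNumbers q r)) ν l (Finset.univ \ I) (∑ i ∈ I, ν i)) else 0 := by
  have h1 : coeffAt ν (PowerSeries.mk fun M => blockSeries (Finset.univ \ I)
      (insertionCoeff q r l N M (Finset.univ \ I)) I) = if ∀ i, 1 ≤ ν i then
        PowerSeries.coeff N (insertionExp liftedWeight PowerSeries.X
          (liftedFun (genusNumbers q r)) ν l (Finset.univ \ I) (∑ i ∈ I, ν i)) else 0 := by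
    ext M
    rw [coeff_coeffAt, PowerSeries.coeff_mk, coeff_blockSeries]
    simp only [Finset.sdiff_union_self_eq_union, Finset.mem_union, Finset.mem_univ, true_or, iff_true]
    split_ifs
    · rfl
    · exact (map_zero _).symm
  rw [blockValue, coeffAt_zetaEnds, h1]
  split_ifs
  · rfl
  · exact mul_zero _

/-- Without regular factors the series multiplying the polar functions is 1 and the interpolation
sum is a sign, by `sum_prod_polar`. This term has no counterpart in the cut-and-join equation and is
the origin of the correction. -/
theorem blockTerm_zero (q r N : ℕ) {I : Finset (Fin n)} (hI : I.Nonempty) :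
    blockTerm q r 0 N I = if I = Finset.univ ∧ N = 0 then
      PowerSeries.C ((-1) ^ (I.card - 1)) else 0 := by
  have h1 : ∀ k, regExp q r k 0 N (Finset.univ \ I) = if I = Finset.univ ∧ N = 0 then 1 else 0 := by
    intro k
    rw [regExp, coeff_zero_expSeries, SetFun.one_apply]
    by_cases h : I = Finset.univ
    · rw [if_pos (by simp [h]), PowerSeries.coeff_one]
      simp [h]
    · rw [if_neg, map_zero, if_neg (by tauto)]
      intro h2
      exact h (Finset.univ_subset_iff.1 (Finset.sdiff_eq_empty_iff_subset.1 h2))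
  rw [blockTerm_eq]
  simp only [h1]
  split_ifs with h
  · have h2 : ∑ k ∈ I, PowerSeries.C (∏ i ∈ I.erase k, polar k i) *
        PowerSeries.map (algebraMap (MvPowerSeries (Fin n) ℂ) (Frac n)) 1 =
        ((-1 : ℂ) ^ (I.card - 1)) • (1 : PowerSeries (Frac n)) := by
      rw [map_one]
      simp only [mul_one]
      rw [← map_sum, sum_prod_polar I hI]
      rcases neg_one_pow_eq_or ℂ (I.card - 1) with h3 | h3
      · have h4 : (-1 : Frac n) ^ (I.card - 1) = 1 := by
          have := congrArg (algebraMap ℂ (Frac n)) h3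
          simpa using this
        rw [h3, h4, one_smul, map_one]
      · have h4 : (-1 : Frac n) ^ (I.card - 1) = -1 := by
          have := congrArg (algebraMap ℂ (Frac n)) h3
          simpa using this
        rw [h3, h4, neg_one_smul, map_neg, map_one]
    have h5 : PowerSeries.C ((-1 : Frac n) ^ (I.card - 1)) =
        ((-1 : ℂ) ^ (I.card - 1)) • (1 : PowerSeries (Frac n)) := by
      rw [← h2, map_one]
      simp only [mul_one]
      rw [← map_sum, sum_prod_polar I hI]
    rw [h2, map_smul, zetaEnds_one, h5]
  · simp

theorem blockTerm_empty (q r l N : ℕ) : blockTerm (n := n) q r l N ∅ = 0 := by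
  rw [blockTerm, Finset.sum_empty]

end BlockTerm

/-! ### The resummed equation for the correlators, and existence -/

section Total
variable {n : ℕ}

theorem map_algebraMap_map (W : PowerSeries ℂ) :
    PowerSeries.map (algebraMap ℂ (Frac n)) W =
      PowerSeries.map (algebraMap (MvPowerSeries (Fin n) ℂ) (Frac n))
        (PowerSeries.map (algebraMap ℂ (MvPowerSeries (Fin n) ℂ)) W) := by
  ext N
  rw [PowerSeries.coeff_map, PowerSeries.coeff_map, PowerSeries.coeff_map,
    ← IsScalarTower.algebraMap_apply]

theorem coeffAt_map_mul (W : PowerSeries ℂ) (V : PowerSeries (MvPowerSeries (Fin n) ℂ))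
    (ν : Fin n →₀ ℕ) :
    coeffAt ν (PowerSeries.map (algebraMap ℂ (MvPowerSeries (Fin n) ℂ)) W * V) =
      W * coeffAt ν V := by
  ext N
  rw [coeff_coeffAt, PowerSeries.coeff_mul, PowerSeries.coeff_mul, map_sum]
  refine Finset.sum_congr rfl fun p _ => ?_
  rw [PowerSeries.coeff_map, ← Algebra.smul_def, MvPowerSeries.coeff_smul, coeff_coeffAt]

/-- The contribution of the terms with `l ≥ 1`. -/
def mainTerm (q r g : ℕ) (p : ℕ × ℕ) (I : Finset (Fin n)) : MvPowerSeries (Fin n) ℂ :=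
  if p.2 ≤ g ∧ I.card ≤ p.1 ∧ I ≠ ∅ then PowerSeries.coeff (2 * p.2)
    (PowerSeries.map (algebraMap ℂ (MvPowerSeries (Fin n) ℂ)) zetaDivZ⁻¹ *
      blockValue q r (p.1 + 1 - I.card) (g - p.2) I) else 0

/-- The contribution of the terms with `l = 0`. -/
def constTerm (g : ℕ) (p : ℕ × ℕ) (I : Finset (Fin n)) : ℂ :=
  if p.2 = g ∧ I.card = p.1 + 1 ∧ I = Finset.univ then
    (-1) ^ p.1 * PowerSeries.coeff (2 * p.2) zetaDivZ⁻¹ else 0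

theorem lead_blockTerm (q r g : ℕ) (p : ℕ × ℕ) (I : Finset (Fin n)) :
    (if p.2 ≤ g ∧ I.card ≤ p.1 + 1 then
      lead n p.2 (blockTerm q r (p.1 + 1 - I.card) (g - p.2) I) else 0) =
      algebraMap _ (Frac n) (mainTerm q r g p I + MvPowerSeries.C (constTerm g p I)) := by
  rw [mainTerm, constTerm]
  by_cases hI : I = ∅
  · subst hI
    rw [blockTerm_empty, map_zero, ite_self, if_neg (by simp), if_neg (by simp)]
    simp
  have hne := Finset.nonempty_iff_ne_empty.2 hI
  rcases Nat.lt_trichotomy I.card (p.1 + 1) with h | h | h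
  · rw [if_neg (c := p.2 = g ∧ _) (by omega), map_zero, add_zero]
    by_cases hg : p.2 ≤ g
    · rw [if_pos ⟨hg, h.le⟩, if_pos ⟨hg, by omega, hI⟩, blockTerm_of_ne_zero q r (by omega) _ hne,
        lead_apply, map_algebraMap_map, ← map_mul, PowerSeries.coeff_map]
    · rw [if_neg fun h => hg h.1, if_neg fun h => hg h.1, map_zero]
  · rw [if_neg (c := p.2 ≤ g ∧ _ ∧ _) (by omega), zero_add, h, Nat.sub_self,
      blockTerm_zero q r _ hne]
    by_cases hg : p.2 = g ∧ I = Finset.univ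
    · rw [if_pos ⟨hg.1.le, le_refl _⟩, if_pos ⟨hg.2, by omega⟩, if_pos ⟨hg.1, rfl, hg.2⟩, h,
        lead_apply, PowerSeries.coeff_mul_C, PowerSeries.coeff_map, Nat.add_sub_cancel, map_mul,
        map_mul, mul_comm]
      congr 1
      · simp
    · rw [if_neg (c := p.2 = g ∧ _) (by tauto), map_zero, map_zero]
      split_ifs with h1 h2
      · exact absurd ⟨by omega, h2.1⟩ hg
      · exact map_zero _
      · rfl
  · rw [if_neg (by omega), if_neg (by omega), if_neg (by omega)]
    simp

theorem coeff_mainTerm (q r g : ℕ) (p : ℕ × ℕ) (I : Finset (Fin n)) (ν : Fin n →₀ ℕ)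
    (hν : ∀ i, 1 ≤ ν i) : MvPowerSeries.coeff ν (mainTerm q r g p I) =
      if p.2 ≤ g ∧ I.card ≤ p.1 ∧ I ≠ ∅ then
        PowerSeries.coeff g (PowerSeries.X ^ p.2 * coeffMul (2 * p.2) (joinFactor ν I)
          (insertionExp liftedWeight PowerSeries.X (liftedFun (genusNumbers q r)) ν
            (p.1 + 1 - I.card) (Finset.univ \ I) (∑ i ∈ I, ν i))) else 0 := by
  rw [mainTerm]
  split_ifs with h
  · rw [← coeff_coeffAt, coeffAt_map_mul, coeffAt_blockValue, if_pos hν,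
      PowerSeries.coeff_X_pow_mul', if_pos h.1, coeff_coeffMul, joinFactor, mul_assoc]
  · exact map_zero _

theorem coeff_mainTerm_eq_zero (q r g : ℕ) (p : ℕ × ℕ) (I : Finset (Fin n)) (ν : Fin n →₀ ℕ)
    (hν : ¬ ∀ i, 1 ≤ ν i) : MvPowerSeries.coeff ν (mainTerm q r g p I) = 0 := by
  rw [mainTerm]
  split_ifs with h
  · rw [← coeff_coeffAt, coeffAt_map_mul, coeffAt_blockValue, if_neg hν, mul_zero, map_zero]
  · exact map_zero _

/-- The indices match through l = m + 1 - |I|: one element of I is the variable x_k, and the other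
|I| - 1 use up one ξ each. Thus m + 2d = r + 1 turns into |I| + l + 2d = r + 2. -/
theorem sum_mainTerm (q r g : ℕ) (ν : Fin n →₀ ℕ) (hν : ∀ i, 1 ≤ ν i) :
    ∑ p ∈ orderPairs r, ∑ I ∈ (Finset.univ : Finset (Fin n)).powerset,
      MvPowerSeries.coeff ν (mainTerm q r g p I) =
        PowerSeries.coeff g (genusJoin r (genusNumbers q r) ν Finset.univ) := by
  rw [Finset.sum_comm, genusJoin, map_sum]
  refine Finset.sum_congr rfl fun I _ => ?_
  by_cases hI : I = ∅
  · rw [if_pos hI, map_zero]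
    refine Finset.sum_eq_zero fun p _ => ?_
    rw [coeff_mainTerm q r g p I ν hν, if_neg fun h => h.2.2 hI]
  obtain ⟨i, hi⟩ := Finset.nonempty_iff_ne_empty.2 hI
  have hc : 1 ≤ I.card := Finset.card_pos.2 ⟨i, hi⟩
  have hsum : 1 ≤ ∑ i ∈ I, ν i := (hν i).trans
    (Finset.single_le_sum (f := fun i => ν i) (fun _ _ => Nat.zero_le _) hi)
  rw [if_neg hI, map_sum]
  simp only [map_sum]
  rw [← Finset.sum_product']
  set T : ℕ → ℕ → ℂ := fun l d => PowerSeries.coeff g (PowerSeries.X ^ d *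
    coeffMul (2 * d) (joinFactor ν I) (insertionExp liftedWeight PowerSeries.X
      (liftedFun (genusNumbers q r)) ν l (Finset.univ \ I) (∑ i ∈ I, ν i))) with hT
  -- The sum by genus formally contains l = 0, but the joined parts have positive total size and
  -- cannot vanish without an inserted part.
  have hT0 : ∀ d, T 0 d = 0 := fun d => by
    simp only [hT]
    rw [insertionExp_zero_left, if_neg (by omega), map_zero, mul_zero, map_zero]
  have hTg : ∀ l d, ¬ d ≤ g → T l d = 0 := fun l d hd => by
    simp only [hT]
    rw [PowerSeries.coeff_X_pow_mul', if_neg hd]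
  have h1 : ∀ p : ℕ × ℕ, MvPowerSeries.coeff ν (mainTerm q r g p I) =
      if I.card ≤ p.1 then T (p.1 + 1 - I.card) p.2 else 0 := fun p => by
    rw [coeff_mainTerm q r g p I ν hν]
    by_cases hd : p.2 ≤ g
    · exact if_congr (by tauto) rfl rfl
    · rw [if_neg fun h => hd h.1, hTg _ _ hd, ite_self]
  have h2 : ∀ p : ℕ × ℕ, PowerSeries.coeff g (if I.card + p.1 + 2 * p.2 = r + 2 then
      PowerSeries.X ^ p.2 * coeffMul (2 * p.2) (joinFactor ν I)
        (insertionExp liftedWeight PowerSeries.X (liftedFun (genusNumbers q r)) ν p.1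
          (Finset.univ \ I) (∑ i ∈ I, ν i)) else 0) =
      if I.card + p.1 + 2 * p.2 = r + 2 ∧ 1 ≤ p.1 then T p.1 p.2 else 0 := fun p => by
    rcases Nat.eq_zero_or_pos p.1 with h0 | h0
    · rw [if_neg (c := _ ∧ 1 ≤ p.1) (by omega)]
      split_ifs
      · exact (congrArg (fun l => T l p.2) h0).trans (hT0 _)
      · exact map_zero _
    · by_cases hp : I.card + p.1 + 2 * p.2 = r + 2
      · rw [if_pos hp, if_pos ⟨hp, h0⟩]
      · rw [if_neg hp, if_neg fun h => hp h.1, map_zero]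
  simp only [h1, h2]
  rw [← Finset.sum_filter, ← Finset.sum_filter]
  refine Finset.sum_nbij' (fun p => (p.1 + 1 - I.card, p.2)) (fun p => (p.1 + I.card - 1, p.2))
    ?_ ?_ ?_ ?_ ?_
  · rintro ⟨m, d⟩ h
    simp only [orderPairs, Finset.mem_filter, Finset.mem_product, Finset.mem_range] at h ⊢
    omega
  · rintro ⟨l, d⟩ h
    simp only [orderPairs, Finset.mem_filter, Finset.mem_product, Finset.mem_range] at h ⊢
    omega
  · rintro ⟨m, d⟩ h
    simp only [orderPairs, Finset.mem_filter, Finset.mem_product, Finset.mem_range] at h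
    exact Prod.ext (by simp only; omega) rfl
  · rintro ⟨l, d⟩ h
    simp only [Finset.mem_filter, Finset.mem_product, Finset.mem_range] at h
    exact Prod.ext (by simp only; omega) rfl
  · rintro ⟨m, d⟩ _; rfl

/-- The constant by which the modified correlators differ from the correlators, divided by
`r!`. -/
def shift (r g n : ℕ) : ℂ :=
  if 2 ≤ n ∧ 2 * g + n = r + 2 then (-1) ^ (n - 1) * PowerSeries.coeff (2 * g) zetaDivZ⁻¹ else 0

/-- Only I = [n], m = n - 1 and d = g contribute. The requirement m ≥ 1 excludes n = 1, and m + 2d =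
r + 1 becomes 2g + n = r + 2. -/
theorem sum_constTerm (r g : ℕ) (hn : 1 ≤ n) :
    ∑ p ∈ orderPairs r, ∑ I ∈ (Finset.univ : Finset (Fin n)).powerset, constTerm g p I =
      shift r g n := by
  have h1 : ∀ p : ℕ × ℕ, ∑ I ∈ (Finset.univ : Finset (Fin n)).powerset, constTerm g p I =
      if p = (n - 1, g) then (-1) ^ (n - 1) * PowerSeries.coeff (2 * g) zetaDivZ⁻¹ else 0 := by
    rintro ⟨m, d⟩
    rw [Finset.sum_eq_single Finset.univ]
    · rw [constTerm, Finset.card_univ, Fintype.card_fin]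
      by_cases h : m = n - 1 ∧ d = g
      · obtain ⟨rfl, rfl⟩ := h
        rw [if_pos ⟨rfl, by simp only; omega, rfl⟩, if_pos rfl]
      · rw [if_neg, if_neg]
        · intro h2
          exact h ⟨congrArg Prod.fst h2, congrArg Prod.snd h2⟩
        · rintro ⟨h2, h3, -⟩
          simp only at h2 h3
          exact h ⟨by omega, h2⟩
    · intro I _ hI
      rw [constTerm, if_neg fun h => hI h.2.2]
    · intro h; simp at h
  rw [Finset.sum_congr rfl fun p _ => h1 p, Finset.sum_ite_eq', shift]
  refine if_congr ?_ rfl rfl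
  simp only [orderPairs, Finset.mem_filter, Finset.mem_product, Finset.mem_range]
  omega

theorem coeff_Bop (q r g : ℕ) (f : MvPowerSeries (Fin n) ℂ) (ν : Fin n →₀ ℕ) :
    MvPowerSeries.coeff ν ((1 / (r.factorial : ℂ)) • Bop q r g n f) =
      (1 / (r.factorial : ℂ)) * ((1 / (r : ℂ)) * ((2 * (g : ℂ) - 2 + n) +
        (1 / (q : ℂ)) * ∑ i, (ν i : ℂ))) * MvPowerSeries.coeff ν f := by
  rw [Bop]
  simp only [MvPowerSeries.coeff_smul, map_add, map_sum, coeff_euler]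
  rw [← Finset.sum_mul]
  ring

/-- The resummed equation for the correlators. -/
theorem resummedRHS_correlator_eq (q r : ℕ) (hq : 1 ≤ q) (hr : 1 ≤ r) (g : ℕ) (hn : 1 ≤ n) :
    resummedRHS q r (fun g n => correlator q r g n) g n = algebraMap _ (Frac n)
      ((1 / (r.factorial : ℂ)) • Bop q r g n (correlator q r g n) +
        MvPowerSeries.C (shift r g n)) := by
  rw [resummedRHS_correlator]
  simp only [lead_blockTerm]
  rw [Finset.sum_congr rfl fun p _ => (map_sum (algebraMap (MvPowerSeries (Fin n) ℂ) (Frac n))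
    (fun I => mainTerm q r g p I + MvPowerSeries.C (constTerm g p I)) _).symm, ← map_sum]
  congr 1
  simp only [Finset.sum_add_distrib]
  congr 1
  · ext ν
    rw [map_sum, coeff_Bop, coeff_correlator q r g hn]
    simp only [map_sum]
    split_ifs with hν
    -- The eigenvalue of B_{g,n} on x^ν is the number b of completed cycles, the factor that ∂_β
    -- produces.
    · have h1 := coeff_genusJoin q r hq hr ν hν g
      rw [sum_mainTerm q r g ν hν]
      have hr0 : (r.factorial : ℂ) ≠ 0 := by exact_mod_cast r.factorial_ne_zero
      have hr1 : (r : ℂ) ≠ 0 := by exact_mod_cast (by omega : r ≠ 0)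
      have hq1 : (q : ℂ) ≠ 0 := by exact_mod_cast (by omega : q ≠ 0)
      push_cast at h1
      rw [← mul_right_inj' hr0, h1]
      field_simp
      ring
    · rw [mul_zero]
      exact Finset.sum_eq_zero fun p _ => Finset.sum_eq_zero fun I _ =>
        coeff_mainTerm_eq_zero q r g p I ν hν
  · rw [← sum_constTerm r g hn, map_sum]
    simp only [map_sum]

/-- The right-hand side does not change if constants are added to the correlators. -/
theorem resummedRHS_congr (q r : ℕ) {Ht Ht' : ℕ → (n : ℕ) → MvPowerSeries (Fin n) ℂ}
    (h : ∀ γ N, ∃ c : ℂ, regularPart q r Ht γ N = regularPart q r Ht' γ N + MvPowerSeries.C c)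
    (g n : ℕ) : resummedRHS q r Ht g n = resummedRHS q r Ht' g n := by
  classical
  rw [resummedRHS, resummedRHS]
  refine Finset.sum_congr rfl fun p _ => congrArg _ (Finset.sum_congr rfl fun k _ =>
    Finset.sum_congr rfl fun l _ => congrArg _ (Finset.sum_congr rfl fun K hK =>
      Finset.sum_congr rfl fun M hM => Finset.sum_congr rfl fun γ _ => congrArg _
        (Finset.prod_congr rfl fun j _ => ?_)))
  rw [Finset.mem_filter] at hM
  rw [mem_splittings] at hK
  have hk : k ∉ K j := fun hj => by simpa using (hK.2 k).2 ⟨j, hj⟩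
  obtain ⟨c, hc⟩ := h (γ j) ((K j).card + (M j).card)
  -- The logarithm does not depend on the family, and the constant is killed by the derivatives in
  -- the ξ_a, a ∈ M_j.
  rw [mixedDeriv_factor k q r Ht _ hk (hM.2 j), mixedDeriv_factor k q r Ht' _ hk (hM.2 j), hc,
    map_add, mixedEuler_add, mixedEuler_rename_C (K j) (hM.2 j), add_zero]

/-- The modified correlators. -/
def modified (q r g n : ℕ) : MvPowerSeries (Fin n) ℂ :=
  correlator q r g n + MvPowerSeries.C ((r.factorial : ℂ) * shift r g n)

theorem isModified_modified (q r : ℕ) (hq : 1 ≤ q) (hr : 1 ≤ r) :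
    IsModified q r (modified q r) := by
  classical
  intro g n hn hgn
  rw [resummedRHS_congr q r (Ht' := fun g n => correlator q r g n),
    resummedRHS_correlator_eq q r hq hr g hn]
  · congr 1
    ext ν
    rw [map_add, coeff_Bop, coeff_Bop, modified, map_add, mul_add, MvPowerSeries.coeff_C,
      MvPowerSeries.coeff_C]
    congr 1
    split_ifs with hν
    · subst hν
      rw [shift]
      split_ifs with hs
      · have hr0 : (r.factorial : ℂ) ≠ 0 := by exact_mod_cast r.factorial_ne_zero
        have hr1 : (r : ℂ) ≠ 0 := by exact_mod_cast (by omega : r ≠ 0)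
        -- Hence B_{g,n} acts on constants as the identity, and the left-hand side contributes
        -- exactly the shift after division by r!.
        have h2 : (2 * (g : ℂ) - 2 + n) = r := by
          have := congrArg (Nat.cast (R := ℂ)) hs.2
          push_cast at this
          linear_combination this
        rw [h2]
        simp only [Finsupp.coe_zero, Pi.zero_apply, Nat.cast_zero, Finset.sum_const_zero, mul_zero,
          add_zero]
        field_simp
      · simp
    · rw [mul_zero]
  · intro γ N
    rw [regularPart_correlator, regularPart]
    split_ifs
    · exact ⟨_, rfl⟩
    · exact ⟨0, by simp⟩

end Total

/-! ### Uniqueness of the modified correlators -/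

section Uniqueness
variable {n m : ℕ}

/-- The power series whose coefficients of total degree `< D` vanish. -/
def orderGE (σ : Type) (D : ℕ) : Submodule ℂ (MvPowerSeries σ ℂ) where
  carrier := {f | ∀ η : σ →₀ ℕ, η.degree < D → MvPowerSeries.coeff η f = 0}
  zero_mem' := fun _ _ => map_zero _
  add_mem' := fun {f g} hf hg η hη => by rw [map_add, hf η hη, hg η hη, add_zero]
  smul_mem' := fun c f hf η hη => by rw [MvPowerSeries.coeff_smul, hf η hη, mul_zero]

theorem mul_mem_orderGE {σ : Type} {D E : ℕ} {f g : MvPowerSeries σ ℂ} (hf : f ∈ orderGE σ D)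
    (hg : g ∈ orderGE σ E) : f * g ∈ orderGE σ (D + E) := by
  classical
  intro η hη
  rw [MvPowerSeries.coeff_mul]
  refine Finset.sum_eq_zero fun p hp => ?_
  rw [Finset.HasAntidiagonal.mem_antidiagonal] at hp
  rw [← hp, map_add] at hη
  rcases lt_or_ge p.1.degree D with h | h
  · rw [hf _ h, zero_mul]
  · rw [hg _ (by omega), mul_zero]

theorem mem_orderGE_zero {σ : Type} (f : MvPowerSeries σ ℂ) : f ∈ orderGE σ 0 :=
  fun _ h => absurd h (Nat.not_lt_zero _)

theorem euler_mem_orderGE {σ : Type} (v : σ) {D : ℕ} {f : MvPowerSeries σ ℂ}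
    (hf : f ∈ orderGE σ D) : euler v f ∈ orderGE σ D := fun η hη => by
  rw [coeff_euler, hf η hη, mul_zero]

theorem rename_mem_orderGE {σ τ : Type} (e : σ → τ) [Filter.TendstoCofinite e] {D : ℕ}
    {f : MvPowerSeries σ ℂ} (hf : f ∈ orderGE σ D) : MvPowerSeries.rename e f ∈ orderGE τ D := by
  intro η hη
  rw [MvPowerSeries.coeff_rename]
  refine Finset.sum_eq_zero fun x hx => hf x ?_
  have hx' : Finsupp.mapDomain e x = η := by simpa using hx
  rwa [← hx', Finsupp.degree_mapDomain] at hη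

theorem mixedEuler_sub (M : Finset (Fin m)) (f g : Series n m) :
    mixedEuler M (f - g) = mixedEuler M f - mixedEuler M g := by
  rw [eq_sub_iff_add_eq, ← mixedEuler_add, sub_add_cancel]

theorem mixedEuler_mem_orderGE (M : Finset (Fin m)) {D : ℕ} {f : Series n m}
    (hf : f ∈ orderGE _ D) : mixedEuler M f ∈ orderGE _ D := fun η hη => by
  rw [mixedEuler, coeff_foldr_euler, hf η hη, mul_zero]

theorem mixedEuler_mem_orderGE_one {M : Finset (Fin m)} (hM : M.Nonempty) (f : Series n m) :
    mixedEuler M f ∈ orderGE _ 1 := fun η hη => by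
  haveI : NeZero M.card := ⟨hM.card_ne_zero⟩
  rw [mixedEuler, coeff_foldr_euler, prod_map_sort,
    (Finsupp.degree_eq_zero_iff η).1 (by omega),
    Finset.prod_eq_zero (Finset.mem_univ (0 : Fin M.card)) (by simp), zero_mul]

theorem coeff_zetaEnd_mem_orderGE {σ : Type} (v : σ) {D : ℕ}
    {F : PowerSeries (MvPowerSeries σ ℂ)} (hF : ∀ N, PowerSeries.coeff N F ∈ orderGE σ D) (N : ℕ) :
    PowerSeries.coeff N (zetaEnd (euler v) F) ∈ orderGE σ D := by
  rw [coeff_zetaEnd]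
  refine Submodule.sum_mem _ fun p _ => Submodule.smul_mem _ _ ?_
  generalize p.1 = j
  induction j with
  | zero => exact hF _
  | succ j ih => rw [Function.iterate_succ_apply']; exact euler_mem_orderGE v ih

/-- The fractions that are power series whose coefficients of total degree `< D` vanish. -/
def orderGEFrac (n D : ℕ) : Submodule ℂ (Frac n) :=
  (orderGE (Fin n) D).map (IsScalarTower.toAlgHom ℂ (MvPowerSeries (Fin n) ℂ) (Frac n)).toLinearMap

theorem algebraMap_mem_orderGEFrac {D : ℕ} {f : MvPowerSeries (Fin n) ℂ} :
    algebraMap _ (Frac n) f ∈ orderGEFrac n D ↔ f ∈ orderGE _ D := by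
  refine ⟨fun ⟨g, hg, h⟩ => ?_, fun h => ⟨f, h, rfl⟩⟩
  rwa [← IsFractionRing.injective (MvPowerSeries (Fin n) ℂ) (Frac n) h]

theorem Qop_sub (d : ℕ) (k : Fin n) (G G' : Reg n m k) :
    Qop d k (G - G') = Qop d k G - Qop d k G' := by
  rw [Qop_eq, Qop_eq, Qop_eq, xiOps_sub, map_sub, map_sub, mul_sub, map_sub]

/-- The derivations v ∂/∂v preserve monomials, and the specialization only renames variables, so
nothing lowers the total degree. -/
theorem Qop_algebraMap_mem (d : ℕ) (k : Fin n) {D : ℕ} {Z : Series n m} (hZ : Z ∈ orderGE _ D) :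
    Qop d k (algebraMap _ (Reg n m k) Z) ∈ orderGEFrac n D := by
  have h1 : ∀ L : List (Fin m), ∀ N, PowerSeries.coeff N
      (L.foldr (fun a F => zetaEnd (euler (Sum.inr a)) F) (PowerSeries.C Z)) ∈ orderGE _ D := by
    intro L
    induction L with
    | nil =>
      intro N
      rw [List.foldr_nil, PowerSeries.coeff_C]
      split_ifs
      exacts [hZ, Submodule.zero_mem _]
    | cons a L ih => exact coeff_zetaEnd_mem_orderGE _ ih
  set F := (List.finRange m).foldr (fun a F => zetaEnd (euler (Sum.inr a)) F)
    (PowerSeries.C Z) with hF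
  have h2 : PowerSeries.map (specialize k) (xiOps k (List.finRange m)
      (algebraMap _ (Reg n m k) Z)) = PowerSeries.map (algebraMap _ (Frac n))
        (PowerSeries.map (diag (m := m) k).toRingHom F) := by
    rw [xiOps_algebraMap]
    ext N
    simp only [PowerSeries.coeff_map]
    exact specialize_algebraMap k _
  rw [Qop_eq, h2, ← map_zetaEnd _ (algebraMap_complex_smul _)
      (fun f => (eulerFrac_algebraMap k f).symm) _, map_algebraMap_map, ← map_mul,
    PowerSeries.coeff_map, algebraMap_mem_orderGEFrac, PowerSeries.coeff_mul]
  refine Submodule.sum_mem _ fun p _ => ?_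
  rw [PowerSeries.coeff_map, ← Algebra.smul_def]
  refine Submodule.smul_mem _ _ (coeff_zetaEnd_mem_orderGE _ (fun N => ?_) _)
  rw [PowerSeries.coeff_map]
  exact rename_mem_orderGE _ (h1 _ N)

/-- In the splittings of the resummed equation, a factor is of lower order than the left-hand
side, or all the other factors are `H_{0,1}`. -/
theorem splitting_dichotomy {r g p d l : ℕ} {k : Fin n} {K : Fin l → Finset (Fin n)}
    {M : Fin l → Finset (Fin p)} {γ : Fin l → ℕ} (hp : p + 2 * d = r + 1) (hr : 1 ≤ r)
    (hK : K ∈ splittings (Finset.univ.erase k) l) (hM : M ∈ splittings Finset.univ l)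
    (hne : ∀ j, (M j).Nonempty) (hγ : (∑ j, γ j) + p + d = g + l) (j : Fin l) :
    2 * γ j + ((K j).card + (M j).card) < 2 * g + n ∨
      (2 * γ j + ((K j).card + (M j).card) = 2 * g + n ∧ 2 ≤ l ∧
        ∀ i, i ≠ j → K i = ∅ ∧ 2 * γ i + ((K i).card + (M i).card) = 1) := by
  have hKs := sum_card_of_mem_splittings hK
  have hMs := sum_card_splitting hM
  have hn : 1 ≤ n := k.pos
  have hl : 1 ≤ l := j.pos
  rw [Finset.card_erase_of_mem (Finset.mem_univ k), Finset.card_univ, Fintype.card_fin] at hKs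
  set f : Fin l → ℕ := fun i => 2 * γ i + ((K i).card + (M i).card) with hf
  have hM1 : ∀ i, 1 ≤ (M i).card := fun i => Finset.card_pos.2 (hne i)
  have hf1 : ∀ i, 1 ≤ f i := fun i => by
    have := hM1 i
    simp only [hf]
    omega
  have hlp : l ≤ p := by
    have := Finset.card_nsmul_le_sum Finset.univ (fun i => (M i).card) 1 fun i _ => hM1 i
    rw [hMs] at this
    simpa using this
  -- By the genus condition this is 2g + n - 1 + 2l - p - 2d. The other l - 1 factors contribute at
  -- least 1 each, so f j ≤ 2g + n - (p - l) - 2d. Equality forces d = 0 and l = p = r + 1 ≥ 2, and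
  -- every other factor has f i = 1.
  have hsum : ∑ i, f i = 2 * ∑ i, γ i + (n - 1 + p) := by
    simp only [hf]
    rw [Finset.sum_add_distrib, Finset.sum_add_distrib, hKs, hMs, Finset.mul_sum]
  have hge : ∀ s : Finset (Fin l), s.card ≤ ∑ i ∈ s, f i := fun s => by
    have := Finset.card_nsmul_le_sum s f 1 fun i _ => hf1 i
    simpa using this
  have e1 := Finset.add_sum_erase Finset.univ f (Finset.mem_univ j)
  have e2 := hge (Finset.univ.erase j)
  rw [Finset.card_erase_of_mem (Finset.mem_univ j), Finset.card_univ, Fintype.card_fin] at e2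
  by_cases h : f j < 2 * g + n
  · exact Or.inl h
  · refine Or.inr ⟨by change f j = _; omega, by omega, fun i hi => ?_⟩
    have hi' : i ∈ Finset.univ.erase j := by simp [hi]
    have e3 := Finset.add_sum_erase _ f hi'
    have e4 := hge ((Finset.univ.erase j).erase i)
    rw [Finset.card_erase_of_mem hi', Finset.card_erase_of_mem (Finset.mem_univ j),
      Finset.card_univ, Fintype.card_fin] at e4
    have h1 : f i = 1 := by
      have := hf1 i
      omega
    have h2 := hM1 i
    refine ⟨Finset.card_eq_zero.1 ?_, h1⟩
    simp only [hf] at h1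
    omega

/-- If all factors are of lower order, the two terms agree. Otherwise one factor differs by a series
of order D, from which the logarithms cancel, and at least one more factor is a derivative of
H_{0,1}, which has no constant term. The product therefore has order D + 1. -/
theorem Qop_sub_mem (q r : ℕ) {Ht Ht' : ℕ → (n : ℕ) → MvPowerSeries (Fin n) ℂ} (hr : 1 ≤ r)
    {g p d l D : ℕ} {k : Fin n} {K : Fin l → Finset (Fin n)}
    {M : Fin l → Finset (Fin p)} {γ : Fin l → ℕ}
    (hlt : ∀ γ s, 1 ≤ s → 2 * γ + s < 2 * g + n →
      regularPart q r Ht γ s = regularPart q r Ht' γ s)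
    (htop : ∀ γ s, 1 ≤ s → 2 * γ + s = 2 * g + n →
      regularPart q r Ht γ s - regularPart q r Ht' γ s ∈ orderGE _ D)
    (hgn : 2 < 2 * g + n) (hp : p + 2 * d = r + 1)
    (hK : K ∈ splittings (Finset.univ.erase k) l) (hM : M ∈ splittings Finset.univ l)
    (hne : ∀ j, (M j).Nonempty) (hγ : (∑ j, γ j) + p + d = g + l) :
    Qop d k (∏ j, (factor q r Ht k (γ j) (K j) (M j)).mixedDeriv k (M j)) -
      Qop d k (∏ j, (factor q r Ht' k (γ j) (K j) (M j)).mixedDeriv k (M j)) ∈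
        orderGEFrac n (D + 1) := by
  have hdich := splitting_dichotomy hp hr hK hM hne hγ
  have hk : ∀ j, k ∉ K j := fun j hj => by
    simpa using ((mem_splittings.1 hK).2 k).2 ⟨j, hj⟩
  have hs : ∀ j, 1 ≤ (K j).card + (M j).card := fun j => by
    have := Finset.card_pos.2 (hne j)
    omega
  have heq : ∀ j, 2 * γ j + ((K j).card + (M j).card) < 2 * g + n →
      (factor q r Ht k (γ j) (K j) (M j)).mixedDeriv k (M j) =
        (factor q r Ht' k (γ j) (K j) (M j)).mixedDeriv k (M j) := fun j hj => by
    rw [mixedDeriv_factor k q r Ht _ (hk j) (hne j), mixedDeriv_factor k q r Ht' _ (hk j) (hne j),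
      hlt _ _ (hs j) hj]
  by_cases hall : ∀ j, 2 * γ j + ((K j).card + (M j).card) < 2 * g + n
  · rw [Finset.prod_congr rfl fun j _ => heq j (hall j), sub_self]
    exact Submodule.zero_mem _
  push Not at hall
  obtain ⟨j, hj⟩ := hall
  obtain ⟨hj1, hl, hj2⟩ := (hdich j).resolve_left (by omega)
  set V : Fin l → Series n p := fun i => mixedEuler (M i)
    (MvPowerSeries.rename (factorVars (K i) (M i))
      (regularPart q r Ht' (γ i) ((K i).card + (M i).card))) with hV
  have hfac : ∀ i, i ≠ j → (factor q r Ht' k (γ i) (K i) (M i)).mixedDeriv k (M i) =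
      algebraMap _ (Reg n p k) (V i) := fun i hi => by
    rw [mixedDeriv_factor k q r Ht' _ (hk i) (hne i), if_neg, add_zero]
    rintro ⟨-, h, -⟩
    rw [(hj2 i hi).1] at h
    simp at h
  have hother : ∀ i, i ≠ j → (factor q r Ht k (γ i) (K i) (M i)).mixedDeriv k (M i) =
      algebraMap _ (Reg n p k) (V i) := fun i hi => by
    rw [← hfac i hi]
    exact heq i (by rw [(hj2 i hi).2]; omega)
  rw [← Qop_sub, ← Finset.mul_prod_erase _ _ (Finset.mem_univ j),
    ← Finset.mul_prod_erase _ _ (Finset.mem_univ j),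
    Finset.prod_congr rfl fun i hi => hother i (Finset.ne_of_mem_erase hi),
    Finset.prod_congr rfl fun i hi => hfac i (Finset.ne_of_mem_erase hi), ← map_prod, ← sub_mul,
    mixedDeriv_factor k q r Ht _ (hk j) (hne j), mixedDeriv_factor k q r Ht' _ (hk j) (hne j),
    add_sub_add_right_eq_sub, ← map_sub, ← map_mul]
  refine Qop_algebraMap_mem _ _ (mul_mem_orderGE ?_ ?_)
  · rw [← mixedEuler_sub, ← map_sub]
    exact mixedEuler_mem_orderGE _ (rename_mem_orderGE _ (htop _ _ (hs j) hj1))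
  · obtain ⟨i, hi⟩ : ∃ i, i ≠ j := by
      have : Nontrivial (Fin l) := Fin.nontrivial_iff_two_le.2 hl
      exact exists_ne j
    rw [← Finset.mul_prod_erase _ _ (Finset.mem_erase.2 ⟨hi, Finset.mem_univ i⟩)]
    exact mul_mem_orderGE (mixedEuler_mem_orderGE_one (hne i) _) (mem_orderGE_zero _)

theorem resummedRHS_sub_mem (q r : ℕ) {Ht Ht' : ℕ → (n : ℕ) → MvPowerSeries (Fin n) ℂ}
    (hr : 1 ≤ r) {g D : ℕ} (hgn : 2 < 2 * g + n)
    (hlt : ∀ γ s, 1 ≤ s → 2 * γ + s < 2 * g + n →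
      regularPart q r Ht γ s = regularPart q r Ht' γ s)
    (htop : ∀ γ s, 1 ≤ s → 2 * γ + s = 2 * g + n →
      regularPart q r Ht γ s - regularPart q r Ht' γ s ∈ orderGE _ D) :
    resummedRHS q r Ht g n - resummedRHS q r Ht' g n ∈ orderGEFrac n (D + 1) := by
  classical
  rw [resummedRHS, resummedRHS, ← Finset.sum_sub_distrib]
  refine Submodule.sum_mem _ fun p hp => ?_
  rw [← smul_sub, ← Finset.sum_sub_distrib]
  refine Submodule.smul_mem _ _ (Submodule.sum_mem _ fun k _ => ?_)
  rw [← Finset.sum_sub_distrib]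
  refine Submodule.sum_mem _ fun l _ => ?_
  rw [← smul_sub, ← Finset.sum_sub_distrib]
  refine Submodule.smul_mem _ _ (Submodule.sum_mem _ fun K hK => ?_)
  rw [← Finset.sum_sub_distrib]
  refine Submodule.sum_mem _ fun M hM => ?_
  rw [← Finset.sum_sub_distrib]
  refine Submodule.sum_mem _ fun γ hγ => ?_
  rw [Finset.mem_filter] at hp hM hγ
  exact Qop_sub_mem q r hr (γ := fun j => (γ j : ℕ)) hlt htop hgn hp.2.2 hK hM.1 hM.2 hγ.2

/-- In the stable range 2g - 2 + n > 0 the eigenvalue of B_{g,n}/r! is a positive real number, so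
B_{g,n} is injective and can be inverted degree by degree. -/
theorem eigenvalue_ne_zero {q r : ℕ} (hr : 1 ≤ r) {g : ℕ} (hgn : 2 < 2 * g + n) (ν : Fin n →₀ ℕ) :
    (1 / (r.factorial : ℂ)) * ((1 / (r : ℂ)) * ((2 * (g : ℂ) - 2 + n) +
        (1 / (q : ℂ)) * ∑ i, (ν i : ℂ))) ≠ 0 := by
  have h1 : (0 : ℝ) < 2 * (g : ℝ) - 2 + n := by
    have : ((2 : ℕ) : ℝ) < ((2 * g + n : ℕ) : ℝ) := by exact_mod_cast hgn
    push_cast at this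
    linarith
  have h2 : (0 : ℝ) < (1 / (r.factorial : ℝ)) * ((1 / (r : ℝ)) * ((2 * (g : ℝ) - 2 + n) +
      (1 / (q : ℝ)) * ∑ i, (ν i : ℝ))) := by
    have hr' : (0 : ℝ) < r := by exact_mod_cast hr
    have hr'' : (0 : ℝ) < r.factorial := by exact_mod_cast r.factorial_pos
    positivity
  have h3 := Complex.ofReal_ne_zero.2 h2.ne'
  push_cast at h3
  exact h3

theorem IsModified.unique {q r : ℕ} (hr : 1 ≤ r)
    {Ht Ht' : ℕ → (n : ℕ) → MvPowerSeries (Fin n) ℂ} (h : IsModified q r Ht)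
    (h' : IsModified q r Ht') {g : ℕ} (hn : 1 ≤ n) (hgn : 2 < 2 * g + n) : Ht g n = Ht' g n := by
  suffices H : ∀ N g n, 1 ≤ n → 2 * g + n = N →
      regularPart q r Ht g n = regularPart q r Ht' g n by
    simpa only [regularPart, if_pos hgn] using H _ g n hn rfl
  intro N
  induction N using Nat.strong_induction_on with
  | _ N ihN =>
  -- A series of order at least D for all D vanishes. The inner induction treats all (g, n) with the
  -- same 2g + n at once, which spares determining the type of the factor of top order.
  suffices H : ∀ D g n, 1 ≤ n → 2 * g + n = N →
      regularPart q r Ht g n - regularPart q r Ht' g n ∈ orderGE _ D by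
    intro g n hn hN
    rw [← sub_eq_zero]
    ext η
    exact H (η.degree + 1) g n hn hN η (Nat.lt_succ_self _)
  intro D
  induction D with
  | zero => exact fun g n _ _ => mem_orderGE_zero _
  | succ D ihD =>
    intro g n hn hN
    by_cases hgn : 2 < 2 * g + n
    · have h1 := resummedRHS_sub_mem q r hr hgn (D := D)
        (fun γ s hs hlt => ihN _ (hN ▸ hlt) γ s hs rfl)
        (fun γ s hs he => ihD γ s hs (he.trans hN))
      rw [← h g n hn hgn, ← h' g n hn hgn, ← map_sub, algebraMap_mem_orderGEFrac] at h1
      intro η hη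
      have h2 := h1 η hη
      rw [map_sub, coeff_Bop, coeff_Bop, ← mul_sub] at h2
      rw [regularPart, regularPart, if_pos hgn, if_pos hgn, map_sub]
      exact (mul_eq_zero.1 h2).resolve_left (eigenvalue_ne_zero hr hgn η)
    · rw [regularPart, regularPart, if_neg hgn, if_neg hgn, sub_self]
      exact Submodule.zero_mem _

end Uniqueness

/-! ### The expansion of `z/ζ(z)` by Bernoulli numbers -/

/-- With E = e^{z/2}: z/(E - E⁻¹) = z E/(E² - 1) = z/(E - 1) - z/(E² - 1), and both terms are
Bernoulli generating series, at z/2 and at z. -/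
theorem zetaDivZ_inv_eq : zetaDivZ⁻¹ =
    PowerSeries.C 2 * PowerSeries.rescale (1 / 2 : ℂ) (bernoulliPowerSeries ℂ) -
      bernoulliPowerSeries ℂ := by
  set E := PowerSeries.rescale (1 / 2 : ℂ) (PowerSeries.exp ℂ) with hE
  set E' := PowerSeries.rescale (-1 / 2 : ℂ) (PowerSeries.exp ℂ) with hE'
  set b := PowerSeries.rescale (1 / 2 : ℂ) (bernoulliPowerSeries ℂ) with hb
  set B := bernoulliPowerSeries ℂ
  have h1 : E * E' = 1 := by
    rw [hE, hE', PowerSeries.exp_mul_exp_eq_exp_add]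
    norm_num
  have h2 : E * E = PowerSeries.exp ℂ := by
    rw [hE, PowerSeries.exp_mul_exp_eq_exp_add]
    norm_num
  have h3 : B * (E * E - 1) = PowerSeries.X := by
    rw [h2]; exact bernoulliPowerSeries_mul_exp_sub_one ℂ
  have h4 : PowerSeries.C (2 : ℂ) * (b * (E - 1)) = PowerSeries.X := by
    have := congrArg (PowerSeries.rescale (1 / 2 : ℂ)) (bernoulliPowerSeries_mul_exp_sub_one ℂ)
    rw [map_mul, map_sub, map_one, PowerSeries.rescale_X] at this
    rw [hb, hE, this, ← mul_assoc, ← map_mul]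
    norm_num
  have hX : (PowerSeries.X : PowerSeries ℂ) ≠ 0 := PowerSeries.X_ne_zero
  have h5 : (PowerSeries.C 2 * b - B) * zetaDivZ = 1 := by
    refine mul_left_cancel₀ hX ?_
    have h6 : PowerSeries.X * zetaDivZ = E - E' := zeta_eq_X_mul.symm
    linear_combination (PowerSeries.C 2 * b - B) * h6 + E' * (E + 1) * h4 - E' * h3 +
      (PowerSeries.X + (PowerSeries.C 2 * b - B) * (-E)) * h1
  have h7 := congrArg (· * zetaDivZ⁻¹) h5
  simp only [mul_assoc, zetaDivZ_mul_inv, mul_one, one_mul] at h7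
  exact h7.symm

theorem coeff_zetaDivZ_inv (g : ℕ) : PowerSeries.coeff (2 * g) zetaDivZ⁻¹ =
    ((2 : ℂ) ^ (1 - 2 * (g : ℤ)) - 1) * ((bernoulli (2 * g) : ℚ) : ℂ) / ((2 * g).factorial : ℂ) := by
  rw [zetaDivZ_inv_eq, map_sub, PowerSeries.coeff_C_mul, PowerSeries.coeff_rescale,
    bernoulliPowerSeries, PowerSeries.coeff_mk, zpow_sub₀ two_ne_zero, zpow_one,
    show (2 * (g : ℤ)) = ((2 * g : ℕ) : ℤ) by push_cast; rfl, zpow_natCast, eq_ratCast]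
  push_cast
  rw [div_pow, one_pow]
  ring

theorem modified_eq_correlator {r g n : ℕ} (q : ℕ) (h : 2 * g + n ≠ r + 2 ∨ n = 1) :
    modified q r g n = correlator q r g n := by
  rw [modified, shift, if_neg (by omega), mul_zero, map_zero, add_zero]

theorem modified_eq_add_C {r g n : ℕ} (q : ℕ) (h : 2 * g + n = r + 2) (hn : 2 ≤ n) :
    modified q r g n = correlator q r g n +
      MvPowerSeries.C ((-1 : ℂ) ^ (n + 1) * (r.factorial : ℂ) *
        (((2 : ℂ) ^ (1 - 2 * (g : ℤ)) - 1) * ((bernoulli (2 * g) : ℚ) : ℂ) /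
          ((2 * g).factorial : ℂ))) := by
  obtain ⟨n, rfl⟩ := Nat.exists_eq_add_of_le' (show 1 ≤ n by omega)
  rw [modified, shift, if_pos ⟨hn, h⟩, coeff_zetaDivZ_inv, Nat.add_sub_cancel]
  congr 2
  ring

end

end SpinHurwitz

theorem proposition3p4 (q r : ℕ) (hq : 1 ≤ q) (hr : 1 ≤ r) :
    (∃ Ht : ℕ → (n : ℕ) → MvPowerSeries (Fin n) ℂ, SpinHurwitz.IsModified q r Ht) ∧
    ∀ Ht : ℕ → (n : ℕ) → MvPowerSeries (Fin n) ℂ, SpinHurwitz.IsModified q r Ht →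
      ∀ g n : ℕ, 1 ≤ n → 2 < 2 * g + n →
        ((2 * g + n ≠ r + 2 ∨ n = 1) → Ht g n = SpinHurwitz.correlator q r g n) ∧
        ((2 * g + n = r + 2 ∧ 2 ≤ n) →
          Ht g n = SpinHurwitz.correlator q r g n +
            MvPowerSeries.C ((-1 : ℂ) ^ (n + 1) * (r.factorial : ℂ) *
              (((2 : ℂ) ^ (1 - 2 * (g : ℤ)) - 1) * ((bernoulli (2 * g) : ℚ) : ℂ) /
                ((2 * g).factorial : ℂ)))) := by
  refine ⟨⟨_, SpinHurwitz.isModified_modified q r hq hr⟩, fun Ht hHt g n hn hgn => ?_⟩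
  rw [hHt.unique hr (SpinHurwitz.isModified_modified q r hq hr) hn hgn]
  exact ⟨SpinHurwitz.modified_eq_correlator q, fun h => SpinHurwitz.modified_eq_add_C q h.1 h.2⟩
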